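/- **Setting.** Let $\mathbb R^2_+=\{(x,y): y\ge 0\}$, let $\Omega\subseteq\mathbb R^2_+$ be relatively open, and for a weight $w$ let $L^2_w(E)$ be the measurable $g$ with $\int_E w|g|^2\,dX<\infty$, and $W^{1,2}_{w,\mathrm{loc}}(E)$ the functions $g$ which together with their weak gradient belong to $L^2_w(K)$ for all compact $K\subseteq E$. A pair $\psi:\Omega\to[0,\infty)$, $I:\Omega\to\{0,1\}$ is a *variational solution* in $\Omega$ with constant $C_V$ if $\psi\in W^{1,2}_{1/y,\mathrm{loc}}(\Omega)\cap C^0(\Omega)\cap C^2(\Omega\cap\{\psi>0\})$, $\psi=0$ on $\Omega\cap\{y=0\}$, $\frac1y|\nabla\psi|\le C_V$ a.e. in $\Omega$, $I$ is Borel, $\chi_{\{\psi>0\}}\le I$ a.e. in $\Omega$, and for every $\eta=(\eta_1,\eta_2)\in C^1_c(\Omega,\mathbb R^2)$ with $\eta_2=0$ on $\{y=0\}$, $$\int_\Omega\Big(\tfrac1y|\nabla\psi|^2+yI\Big)\operatorname{div}\eta-\tfrac2y\nabla\psi\cdot D\eta\,\nabla\psi-\eta_2\Big(\tfrac1{y^2}|\nabla\psi|^2-I\Big)\,dX=0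 .$$ Let $X_0=(x_0,y_0)\in\Omega\cap\partial\{\psi>0\}$ with $y_0>0$. For $r>0$ let $\psi_r(X)=\psi(X_0+rX)/r$, defined where $X_0+rX\in\Omega$. Let $w\equiv 1/y_0$, the limit as $r\to0$ of the rescaled weight $1/(y_0+ry)$. Given $r_n>0$ with $r_n\to0$, put $\psi_n=\psi_{r_n}$; a function $\psi_0\in W^{1,2}_{w,\mathrm{loc}}(\mathbb R^2)$ is the *blow-up limit* of $\psi$ at $X_0$ along $(r_n)$ if $\psi_n\to\psi_0$ weakly in $W^{1,2}_{w,\mathrm{loc}}(\mathbb R^2)$, that is, $\psi_n\rightharpoonup\psi_0$ and $\nabla\psi_n\rightharpoonup\nabla\psi_0$ weakly in $L^2_w(K)$ for every compact $K\subset\mathbb R^2$. **Proposition.** Let $(\psi,I)$ be a variational solution in $\Omega$ (for example $\Omega=B_1(X_0)\cap\mathbb R^2_+$) and let $X_0=(x_0,y_0)\in\Omega\cap\partial\{\psi>0\}$ with $y_0>0$. Every sequence $r_n\to0^+$ has a subsequence along which $\psi$ has a blow-up limit at $X_0$. Moreover, whenever $\psi_0$ is the blow-up limit along a sequence $r_n\to0^+$,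 the following hold. 1. $\psi_n\to\psi_0$ strongly in $W^{1,2}_{w,\mathrm{loc}}(\mathbb R^2)$, that is, $\int_K\frac1{y_0}\big(|\psi_n-\psi_0|^2+|\nabla\psi_n-\nabla\psi_0|^2\big)\,dX\to0$ for every compact $K\subset\mathbb R^2$. 2. $\psi_0$ has a continuous representative, and this representative (again denoted $\psi_0$) satisfies $\psi_0(sX)=s\,\psi_0(X)$ for all $X\in\mathbb R^2$ and $s>0$. 3. If $\psi_0\not\equiv0$, then there is a unit vector $\nu$ such that either $\psi_0(X)=y_0\,(X\cdot\nu)_+$ for all $X$, or $\psi_0(X)=A\,|X\cdot\nu|$ for all $X$, with some constant $A>0$. -/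

import Mathlib

open Set Filter Topology MeasureTheory
open scoped ContDiff

noncomputable section

namespace AxiFlow

/-- The plane with its Euclidean norm; for `X = (x, y)` we have `x = X 0` and `y = X 1`. -/
abbrev Plane : Type := EuclideanSpace ℝ (Fin 2)

/-- The closed upper half-plane `{(x, y) : y ≥ 0}`. -/
def upperHalf : Set Plane := {X | 0 ≤ X 1}

/-- `Ω` is an open subset of the closed upper half-plane (in the relative topology), so it may
contain a part of the axis `y = 0`. -/
def IsOpenInUpperHalf (Ω : Set Plane) : Prop := ∃ U : Set Plane, IsOpen U ∧ Ω = U ∩ upperHalf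

/-- `G` is the weak gradient of `g` in (the interior of) `E`: both are locally integrable and
`∫ g ∂ᵢφ = - ∫ Gᵢ φ` for all smooth `φ` with compact support in the interior of `E`. -/
def IsWeakGrad (E : Set Plane) (g : Plane → ℝ) (G : Plane → Plane) : Prop :=
  LocallyIntegrableOn g (interior E) ∧ LocallyIntegrableOn G (interior E) ∧
  ∀ φ : Plane → ℝ, ContDiff ℝ ∞ φ → HasCompactSupport φ → tsupport φ ⊆ interior E →
    ∀ i : Fin 2,
      ∫ X, g X * fderiv ℝ φ X (EuclideanSpace.single i 1) = - ∫ X, G X i * φ X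

open Classical in
/-- The weak gradient `∇g` in `E`, unique up to null sets of the interior of `E`
(and `0` if there is none). -/
def wgrad (E : Set Plane) (g : Plane → ℝ) : Plane → Plane :=
  if h : ∃ G, IsWeakGrad E g G then h.choose else 0

theorem isWeakGrad_wgrad {E : Set Plane} {g : Plane → ℝ} (h : ∃ G, IsWeakGrad E g G) :
    IsWeakGrad E g (wgrad E g) := by
  unfold wgrad
  rw [dif_pos h]
  exact h.choose_spec

/-- The weighted space `L²_w(E)`: measurable functions on `E` with `∫_E w |g|² < ∞`. -/
def MemL2 {F : Type*} [NormedAddCommGroup F] (w : Plane → ℝ) (E : Set Plane) (g : Plane → F) :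
    Prop :=
  AEStronglyMeasurable g (volume.restrict E) ∧
    ∫⁻ X in E, ENNReal.ofReal (w X) * ‖g X‖ₑ ^ 2 < ⊤

/-- The local weighted Sobolev space `W^{1,2}_{w,loc}(E)`: the weak gradient exists, and `g` and
`∇g` are in `L²_w(K)` for all compact `K ⊆ E`. -/
def MemW12Loc (w : Plane → ℝ) (E : Set Plane) (g : Plane → ℝ) : Prop :=
  (∃ G, IsWeakGrad E g G) ∧
    ∀ K : Set Plane, IsCompact K → K ⊆ E → MemL2 w K g ∧ MemL2 w K (wgrad E g)

/-- The weight `1 / y`. -/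
def axialWeight (X : Plane) : ℝ := 1 / X 1

/-- The divergence of a vector field in the plane. -/
def divergence (η : Plane → Plane) (X : Plane) : ℝ :=
  ∑ i : Fin 2, fderiv ℝ η X (EuclideanSpace.single i 1) i

/-- Admissible domain variations: fields in `C¹_c(Ω, ℝ²)` with `η₂ = 0` on `{y = 0}`. As `Ω` is
relatively open in the closed half-plane, such fields are the restrictions of `C¹_c` fields on the
plane whose support meets the closed half-plane only inside `Ω`. -/
def IsAdmissibleField (Ω : Set Plane) (η : Plane → Plane) : Prop :=
  ContDiff ℝ 1 η ∧ HasCompactSupport η ∧ tsupport η ∩ upperHalf ⊆ Ω ∧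
    ∀ X : Plane, X 1 = 0 → η X 1 = 0

/-- The first (inner) variation in direction `η` of
`J(ψ, I) = ∫_Ω (|∇ψ / y|² + I) y dX`. -/
def innerVariation (Ω : Set Plane) (ψ I : Plane → ℝ) (η : Plane → Plane) : ℝ :=
  ∫ X in Ω,
    ((1 / X 1) * ‖wgrad Ω ψ X‖ ^ 2 + X 1 * I X) * divergence η X
      - (2 / X 1) * inner ℝ (wgrad Ω ψ X) (fderiv ℝ η X (wgrad Ω ψ X))
      - η X 1 * ((1 / X 1 ^ 2) * ‖wgrad Ω ψ X‖ ^ 2 - I X)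

/-- `(ψ, I)` is a variational solution in `Ω` with constant `C`. Only the values of `ψ` and `I`
on `Ω` matter. -/
structure IsVariationalSolution (C : ℝ) (Ω : Set Plane) (ψ I : Plane → ℝ) : Prop where
  isOpen_domain : IsOpenInUpperHalf Ω
  memW12Loc : MemW12Loc axialWeight Ω ψ
  indicator_values : ∀ X ∈ Ω, I X = 0 ∨ I X = 1
  continuousOn : ContinuousOn ψ Ω
  contDiffOn : ContDiffOn ℝ 2 ψ {X | X ∈ Ω ∧ 0 < ψ X}
  nonneg : ∀ X ∈ Ω, 0 ≤ ψ X
  zero_on_axis : ∀ X ∈ Ω, X 1 = 0 → ψ X = 0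
  gradient_bound : ∀ᵐ X ∂(volume.restrict Ω), (1 / X 1) * ‖wgrad Ω ψ X‖ ≤ C
  measurable_indicator : Measurable (fun X : Ω => I X)
  positivity_le : ∀ᵐ X ∂(volume.restrict Ω), indicator {Z | 0 < ψ Z} (fun _ => (1 : ℝ)) X ≤ I X
  stationary : ∀ η : Plane → Plane, IsAdmissibleField Ω η → innerVariation Ω ψ I η = 0

/-- The free boundary `Ω ∩ ∂{ψ > 0}`. -/
def freeBoundary (Ω : Set Plane) (ψ : Plane → ℝ) : Set Plane :=
  Ω ∩ frontier {X | X ∈ Ω ∧ 0 < ψ X}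

/-- The non-degenerate free boundary points: those with `y₀ > 0`. -/
def nonDegeneratePoints (Ω : Set Plane) (ψ : Plane → ℝ) : Set Plane :=
  {X₀ | X₀ ∈ freeBoundary Ω ψ ∧ 0 < X₀ 1}

/-- The rescaling `X ↦ ψ(X₀ + r X) / r` at a non-degenerate point (growth exponent one). -/
def rescale (ψ : Plane → ℝ) (X₀ : Plane) (r : ℝ) (X : Plane) : ℝ := ψ (X₀ + r • X) / r

/-- The domain of the rescaling: all `X` with `X₀ + r X ∈ Ω`. -/
def rescaledDomain (Ω : Set Plane) (X₀ : Plane) (r : ℝ) : Set Plane := {X | X₀ + r • X ∈ Ω}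

/-- The weight of the blow-up limit at `X₀ = (x₀, y₀)`, `y₀ > 0`. Under `X ↦ X₀ + r X` the weight
`1 / y` turns into `1 / (y₀ + r y)`, which tends to the constant `1 / y₀` uniformly on compact
sets as `r → 0`; so this weight determines the space `W^{1,2}_{w,loc}(ℝ²)` and its topology. -/
def blowUpWeight (X₀ : Plane) : Plane → ℝ := fun _ => 1 / X₀ 1

/-- Weak convergence `gₙ ⇀ g₀` in `W^{1,2}_{w,loc}(ℝ²)`, where `gₙ` is defined on `U n`, and each
compact set is contained in `U n` for large `n`: the functions and their weak gradients converge
weakly in `L²_w(K)` for all compact `K`. -/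
def WeakConvLoc (w : Plane → ℝ) (U : ℕ → Set Plane) (g : ℕ → Plane → ℝ) (g₀ : Plane → ℝ) : Prop :=
  ∀ K : Set Plane, IsCompact K →
    (∀ᶠ n in atTop, K ⊆ U n) ∧
    (∀ h : Plane → ℝ, MemL2 w K h →
      Tendsto (fun n => ∫ X in K, w X * (g n X * h X)) atTop
        (𝓝 (∫ X in K, w X * (g₀ X * h X)))) ∧
    (∀ H : Plane → Plane, MemL2 w K H →
      Tendsto (fun n => ∫ X in K, w X * inner ℝ (wgrad (U n) (g n) X) (H X)) atTop
        (𝓝 (∫ X in K, w X * inner ℝ (wgrad univ g₀ X) (H X))))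

/-- Strong convergence `gₙ → g₀` in `W^{1,2}_{w,loc}(ℝ²)`: the functions and their weak gradients
converge in the norm of `L²_w(K)` for all compact `K`. -/
def StrongConvLoc (w : Plane → ℝ) (U : ℕ → Set Plane) (g : ℕ → Plane → ℝ) (g₀ : Plane → ℝ) :
    Prop :=
  ∀ K : Set Plane, IsCompact K →
    (∀ᶠ n in atTop, K ⊆ U n) ∧
    Tendsto (fun n => ∫⁻ X in K, ENNReal.ofReal (w X) * ‖g n X - g₀ X‖ₑ ^ 2) atTop (𝓝 0) ∧
    Tendsto (fun n => ∫⁻ X in K, ENNReal.ofReal (w X) *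
      ‖wgrad (U n) (g n) X - wgrad univ g₀ X‖ₑ ^ 2) atTop (𝓝 0)

/-- `ψ₀` is the blow-up limit of `ψ` at the non-degenerate point `X₀` along the sequence `rₙ → 0⁺`:
the rescalings converge to `ψ₀` weakly in `W^{1,2}_{w,loc}(ℝ²)`. -/
def IsBlowUpLimit (Ω : Set Plane) (ψ : Plane → ℝ) (X₀ : Plane) (r : ℕ → ℝ) (ψ₀ : Plane → ℝ) :
    Prop :=
  (∀ n, 0 < r n) ∧ Tendsto r atTop (𝓝 0) ∧
    MemW12Loc (blowUpWeight X₀) univ ψ₀ ∧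
    WeakConvLoc (blowUpWeight X₀) (fun n => rescaledDomain Ω X₀ (r n))
      (fun n => rescale ψ X₀ (r n)) ψ₀

end AxiFlow

end

/-!
Write `a = 1 / (y₀ + r y)` for the weight at scale `r`. Near a non-degenerate point `ψ` is Lipschitz,
because its gradient is bounded where it is positive, and stationarity with respect to variations
supported in `{ψ > 0}` gives the equation `div (a ∇ψ) = 0` there
(`IsVariationalSolution.exists_statPair`). Hence every sequence of rescalings has a subsequence that
converges locally uniformly, with weak convergence of the gradients. Testing the equation with
`(u - ε)₊ ζ` yields an energy identity for both the rescalings and the limit, and comparing them shows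
that the gradients converge strongly (`BlowUpSeq.tendsto_gradient`).

Homogeneity is a monotonicity formula in integrated form. Stationarity along the radial field
`χ(|X|²) X / (|X|² + ε)`, together with the energy identity, bounds the integral of
`(∇u · X - u)² / (|X|² + ε)²` uniformly in `ε`: the logarithmically divergent terms cancel. So the
homogeneity defect is square integrable against `|X|⁻⁴` (`StatPair.integrableOn_homDefect`), its
integral over shrinking balls tends to zero, and by scaling blow-up limits satisfy `∇φ · X = φ`
(`BlowUpSeq.homDefect_eq_zero`), which means homogeneity of degree one.

In the plane, Euler's equation and harmonicity force all second derivatives of `φ` to vanish where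
`φ > 0`. Thus `φ` is linear near its positive points, then linear on half-planes, which leaves
`φ = A (X · ν)₊ + B (X · ν)₋` with `A > 0` and `B ≥ 0` (`exists_two_plane`).

The slopes are found by passing to the limit in the domain variation; the densities `Jₙ` converge
only weakly, a priori. Fields parallel to `ν` show that on the side `X · ν < 0` their weak limit is
the constant `m = 1 - (A² - B²) / y₀²` (`BlowUpSeq.tendsto_density_lower`). If `B > 0`, the densities
tend to one there, so that `A = B` (`BlowUpSeq.slopes_eq`). If `B = 0`, the gradient of the limit
vanishes on that side, and then stationarity holds asymptotically even along fields that depend on `n`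
and are bounded in `W^{1,2}` only (`BlowUpSeq.tendsto_density_divergence`). Inserting `ζ ∇Wₙ`, where
`Wₙ - c ΔWₙ` is close to `ζ (Jₙ - m)` (`exists_elliptic_corrector`), shows that `Jₙ` converges
strongly. So `m` takes one of the values `0` and `1` of the densities, and `A > 0` leaves `m = 0`,
that is `A = y₀` (`BlowUpSeq.slope_eq_of_one_phase`).

Finally, a weak blow-up limit agrees with every pointwise limit of a subsequence of the Lipschitz
rescalings, so all these conclusions hold along the whole sequence (`ae_eq_of_weakConvLoc`).
-/

open scoped NNReal

namespace AxiFlow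

/-! ### Lipschitz test functions and integration by parts -/

/-- The standard unit vectors of the plane. -/
noncomputable abbrev stdVec (i : Fin 2) : Plane := EuclideanSpace.single i (1 : ℝ)

/-- Lipschitz functions with compact support, the class of test functions used below. -/
def LipTest (h : Plane → ℝ) : Prop := (∃ K : ℝ≥0, LipschitzWith K h) ∧ HasCompactSupport h

theorem LipTest.of_contDiff {h : Plane → ℝ} (h₁ : ContDiff ℝ 1 h) (h₂ : HasCompactSupport h) :
    LipTest h :=
  ⟨h₁.lipschitzWith_of_hasCompactSupport h₂ one_ne_zero, h₂⟩

theorem LipTest.continuous {h : Plane → ℝ} (hh : LipTest h) : Continuous h :=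
  hh.1.choose_spec.continuous

theorem LipTest.ae_differentiableAt {h : Plane → ℝ} (hh : LipTest h) :
    ∀ᵐ X, DifferentiableAt ℝ h X := hh.1.choose_spec.ae_differentiableAt

theorem LipTest.bounded {h : Plane → ℝ} (hh : LipTest h) : ∃ M, 0 ≤ M ∧ ∀ X, |h X| ≤ M := by
  obtain ⟨M, hM⟩ := hh.2.exists_bound_of_continuous hh.continuous
  exact ⟨M, (norm_nonneg _).trans (hM 0), hM⟩

theorem LipTest.exists_ball {h : Plane → ℝ} (hh : LipTest h) :
    ∃ R, 0 < R ∧ ∀ X, R ≤ ‖X‖ → h X = 0 := by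
  obtain ⟨R, hR, hsub⟩ := hh.2.isCompact.isBounded.subset_ball_lt 0 0
  refine ⟨R, hR, fun X hX => ?_⟩
  by_contra hne
  have := hsub (subset_tsupport h hne)
  simp at this
  linarith

/-- The product of a Lipschitz function and a compactly supported Lipschitz function. -/
theorem LipTest.mul_left {h : Plane → ℝ} (hh : LipTest h) {f : Plane → ℝ} {K : ℝ≥0}
    (hf : LipschitzWith K f) : LipTest (fun X => f X * h X) := by
  obtain ⟨⟨D, hD⟩, hc⟩ := id hh
  obtain ⟨M, hM0, hM⟩ := hh.bounded
  obtain ⟨R, hR0, hR⟩ := hh.exists_ball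
  have hfR : ∀ X : Plane, ‖X‖ ≤ R → |f X| ≤ |f 0| + K * R := by
    intro X hX
    have h1 := hf.dist_le_mul X 0
    rw [Real.dist_eq, dist_zero_right] at h1
    have h2 : (K : ℝ) * ‖X‖ ≤ K * R := mul_le_mul_of_nonneg_left hX K.2
    have := abs_sub_abs_le_abs_sub (f X) (f 0)
    linarith
  set N : ℝ := |f 0| + K * R with hN
  have hN0 : 0 ≤ N := by positivity
  -- the estimate with one point in the ball that contains the support
  have key : ∀ X Y : Plane, ‖X‖ ≤ R →
      |f X * h X - f Y * h Y| ≤ (N * D + K * M) * dist X Y := by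
    intro X Y hX
    have e : f X * h X - f Y * h Y = f X * (h X - h Y) + (f X - f Y) * h Y := by ring
    have h1 := hD.dist_le_mul X Y
    have h2 := hf.dist_le_mul X Y
    rw [Real.dist_eq] at h1 h2
    rw [e]
    refine (abs_add_le _ _).trans ?_
    rw [abs_mul, abs_mul]
    have h3 : |f X| * |h X - h Y| ≤ N * (D * dist X Y) :=
      mul_le_mul (hfR X hX) h1 (abs_nonneg _) hN0
    have h4 : |f X - f Y| * |h Y| ≤ K * dist X Y * M :=
      mul_le_mul h2 (hM Y) (abs_nonneg _) (by positivity)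
    nlinarith
  refine ⟨⟨⟨N * D + K * M, by positivity⟩, LipschitzWith.of_dist_le_mul fun X Y => ?_⟩,
    hc.mul_left⟩
  rw [Real.dist_eq]
  change _ ≤ (N * D + K * M) * dist X Y
  rcases le_total ‖X‖ R with hX | hX
  · exact key X Y hX
  rcases le_total ‖Y‖ R with hY | hY
  · rw [abs_sub_comm, dist_comm]; exact key Y X hY
  · rw [hR X hX, hR Y hY]; simp; positivity

theorem LipTest.mul {h k : Plane → ℝ} (hh : LipTest h) (hk : LipTest k) :
    LipTest (fun X => h X * k X) := hk.mul_left hh.1.choose_spec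

/-- Integration by parts for Lipschitz functions. -/
theorem integral_fderiv_mul_eq {f g : Plane → ℝ} {K : ℝ≥0} (hf : LipschitzWith K f)
    (hg : LipTest g) (v : Plane) :
    ∫ X, fderiv ℝ f X v * g X = - ∫ X, f X * fderiv ℝ g X v := by
  obtain ⟨⟨D, hD⟩, hc⟩ := hg
  have h1 := hf.integral_lineDeriv_mul_eq (μ := (volume : Measure Plane)) hD hc v
  have h2 : ∫ X, fderiv ℝ f X v * g X = ∫ X, lineDeriv ℝ f X v * g X := by
    refine integral_congr_ae ?_
    filter_upwards [hf.ae_differentiableAt] with X hX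
    rw [hX.lineDeriv_eq_fderiv]
  rw [h2, h1, ← integral_neg]
  refine integral_congr_ae ?_
  filter_upwards [hD.ae_differentiableAt] with X hX
  rw [hX.lineDeriv_eq_fderiv]
  simp; ring

theorem integral_fderiv_eq_zero {g : Plane → ℝ} (hg : LipTest g) (v : Plane) :
    ∫ X, fderiv ℝ g X v = 0 := by
  have := integral_fderiv_mul_eq (f := fun _ => (1 : ℝ)) (LipschitzWith.const 1) hg v
  simpa using this

theorem norm_gradient_le {f : Plane → ℝ} {K : ℝ≥0} (hf : LipschitzWith K f) (X : Plane) :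
    ‖gradient f X‖ ≤ K := by
  rw [gradient, LinearIsometryEquiv.norm_map]
  exact norm_fderiv_le_of_lipschitz ℝ hf

theorem abs_fderiv_le {f : Plane → ℝ} {K : ℝ≥0} (hf : LipschitzWith K f) (X v : Plane) :
    |fderiv ℝ f X v| ≤ K * ‖v‖ :=
  ((fderiv ℝ f X).le_opNorm v).trans
    (mul_le_mul_of_nonneg_right (norm_fderiv_le_of_lipschitz ℝ hf) (norm_nonneg _))

theorem measurable_gradient (f : Plane → ℝ) : Measurable (gradient f) :=
  (InnerProductSpace.toDual ℝ Plane).symm.continuous.measurable.comp (measurable_fderiv ℝ f)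

theorem measurable_fderiv_apply (f : Plane → ℝ) (v : Plane) :
    Measurable fun X => fderiv ℝ f X v := measurable_fderiv_apply_const ℝ f v

theorem gradient_apply (f : Plane → ℝ) (X : Plane) (i : Fin 2) :
    gradient f X i = fderiv ℝ f X (stdVec i) := by
  rw [← inner_gradient_left, EuclideanSpace.inner_single_right]; simp

theorem inner_eq_sum (V W : Plane) : inner ℝ V W = V 0 * W 0 + V 1 * W 1 := by
  rw [PiLp.inner_apply]; simp [Fin.sum_univ_two]; ring

theorem norm_sq_eq (V : Plane) : ‖V‖ ^ 2 = V 0 ^ 2 + V 1 ^ 2 := by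
  rw [← real_inner_self_eq_norm_sq, inner_eq_sum]; ring

theorem fderiv_eq_sum (f : Plane → ℝ) (X v : Plane) :
    fderiv ℝ f X v = fderiv ℝ f X (stdVec 0) * v 0 + fderiv ℝ f X (stdVec 1) * v 1 := by
  rw [← inner_gradient_left, inner_eq_sum, gradient_apply, gradient_apply]

/-- A bounded measurable function that vanishes outside a bounded set is integrable. -/
theorem integrable_of_bound {F : Type*} [NormedAddCommGroup F] {f : Plane → F} {M R : ℝ}
    (hf : AEStronglyMeasurable f) (hM : ∀ᵐ X, ‖f X‖ ≤ M) (hR : ∀ X, R ≤ ‖X‖ → f X = 0) :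
    Integrable f := by
  have h1 : IntegrableOn f (Metric.ball 0 R) :=
    Measure.integrableOn_of_bounded measure_ball_lt_top.ne hf (ae_restrict_of_ae hM)
  refine (integrableOn_iff_integrable_of_support_subset fun X hX => ?_).1 h1
  by_contra h
  simp at h
  exact hX (hR X h)

theorem LipTest.integrable {h : Plane → ℝ} (hh : LipTest h) : Integrable h :=
  hh.continuous.integrable_of_hasCompactSupport hh.2

theorem LipTest.fderiv_eq_zero {h : Plane → ℝ} (hh : LipTest h) :
    ∃ R, 0 < R ∧ (∀ X, R ≤ ‖X‖ → h X = 0) ∧ ∀ X, R ≤ ‖X‖ → fderiv ℝ h X = 0 := by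
  obtain ⟨R, hR, hsub⟩ := hh.2.isCompact.isBounded.subset_ball_lt 0 0
  have : ∀ X : Plane, R ≤ ‖X‖ → X ∉ tsupport h := fun X hX hmem => by
    have := hsub hmem
    simp at this
    linarith
  exact ⟨R, hR, fun X hX => image_eq_zero_of_notMem_tsupport (this X hX), fun X hX =>
    image_eq_zero_of_notMem_tsupport fun h => this X hX (tsupport_fderiv_subset ℝ h)⟩

theorem LipTest.abs_fderiv_bounded {h : Plane → ℝ} (hh : LipTest h) (v : Plane) :
    ∃ M, 0 ≤ M ∧ ∀ X, |fderiv ℝ h X v| ≤ M := by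
  obtain ⟨⟨K, hK⟩, -⟩ := hh
  exact ⟨K * ‖v‖, by positivity, fun X => abs_fderiv_le hK X v⟩

/-- Hyperplanes are null sets. -/
theorem ae_inner_ne_zero {ν : Plane} (hν : ν ≠ 0) : ∀ᵐ X : Plane, inner ℝ X ν ≠ 0 := by
  have h := Measure.addHaar_submodule (volume : Measure Plane)
    (LinearMap.ker (innerSL ℝ ν).toLinearMap) (fun h => by
      have : ν ∈ LinearMap.ker (innerSL ℝ ν).toLinearMap := by rw [h]; trivial
      simp at this
      exact hν this)
  rw [ae_iff]
  refine measure_mono_null (fun X hX => ?_) h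
  simp only [mem_ofPred_eq, not_not] at hX
  simpa [real_inner_comm ν X] using hX

/-! ### Weak gradients and affine changes of variables -/

theorem isWeakGrad_gradient {u : Plane → ℝ} {K : ℝ≥0} (hu : LipschitzWith K u) (E : Set Plane) :
    IsWeakGrad E u (gradient u) := by
  refine ⟨hu.continuous.locallyIntegrable.locallyIntegrableOn _, ?_, ?_⟩
  · refine LocallyIntegrable.locallyIntegrableOn ?_ _
    refine (memLp_top_of_bound (measurable_gradient u).aestronglyMeasurable K
      (ae_of_all _ (norm_gradient_le hu))).locallyIntegrable le_top
  · rintro φ hφ hc - i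
    have h := integral_fderiv_mul_eq hu (LipTest.of_contDiff (hφ.of_le (by simp)) hc) (stdVec i)
    simp only [gradient_apply]
    rw [h, neg_neg]

/-- A weak gradient is determined on open sets where the function agrees with a Lipschitz
function. -/
theorem IsWeakGrad.ae_eq_gradient {E U : Set Plane} {g u : Plane → ℝ} {G : Plane → Plane}
    (hG : IsWeakGrad E g G) (hU : IsOpen U) (hUE : U ⊆ interior E) {K : ℝ≥0}
    (hu : LipschitzWith K u) (hgu : EqOn g u U) :
    ∀ᵐ X, X ∈ U → G X = gradient u X := by
  have hcomp : ∀ i : Fin 2, ∀ᵐ X, X ∈ U → G X i - gradient u X i = 0 := by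
    intro i
    have hGi : LocallyIntegrableOn (fun X => G X i) U := by
      intro X hX
      obtain ⟨s, hs, hi⟩ := (hG.2.1.mono_set hUE) X hX
      exact ⟨s, hs, (EuclideanSpace.proj (𝕜 := ℝ) i : Plane →L[ℝ] ℝ).integrable_comp hi⟩
    have hui : LocallyIntegrableOn (fun X => gradient u X i) U := by
      intro X hX
      obtain ⟨s, hs, hi⟩ := ((isWeakGrad_gradient hu E).2.1.mono_set hUE) X hX
      exact ⟨s, hs, (EuclideanSpace.proj (𝕜 := ℝ) i : Plane →L[ℝ] ℝ).integrable_comp hi⟩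
    refine hU.ae_eq_zero_of_integral_contDiff_smul_eq_zero (hGi.sub hui) fun φ hφ hc hs => ?_
    have h1 := hG.2.2 φ hφ hc (hs.trans hUE) i
    have h2 := (isWeakGrad_gradient hu E).2.2 φ hφ hc (hs.trans hUE) i
    have h3 : ∫ X, g X * fderiv ℝ φ X (stdVec i) = ∫ X, u X * fderiv ℝ φ X (stdVec i) := by
      congr 1
      ext X
      by_cases hX : X ∈ U
      · rw [hgu hX]
      · have : fderiv ℝ φ X = 0 := image_eq_zero_of_notMem_tsupport fun h =>
          hX (hs (tsupport_fderiv_subset ℝ h))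
        simp [this]
    have hint : ∀ {f : Plane → ℝ}, LocallyIntegrableOn f U → Integrable fun X => f X * φ X := by
      intro f hf
      have h4 : IntegrableOn f (tsupport φ) := hf.integrableOn_compact_subset hs hc
      have h5 : IntegrableOn (fun X => φ X * f X) (tsupport φ) :=
        h4.continuousOn_mul hφ.continuous.continuousOn hc
      rw [integrableOn_iff_integrable_of_support_subset] at h5
      · simpa only [mul_comm] using h5
      · intro X hX
        by_contra hX'
        exact hX (by simp [image_eq_zero_of_notMem_tsupport hX'])
    simp only [smul_eq_mul, mul_sub]
    rw [integral_sub (by simpa only [mul_comm] using hint hGi)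
      (by simpa only [mul_comm] using hint hui)]
    simp only [mul_comm (φ _)]
    linarith
  filter_upwards [hcomp 0, hcomp 1] with X h0 h1 hX
  ext i
  fin_cases i
  · exact sub_eq_zero.1 (h0 hX)
  · exact sub_eq_zero.1 (h1 hX)

/-- Where a function is continuously differentiable, its weak gradient is the classical one. -/
theorem IsWeakGrad.ae_eq_gradient_of_contDiffOn {E V : Set Plane} {g : Plane → ℝ}
    {G : Plane → Plane} (hG : IsWeakGrad E g G) (hV : IsOpen V) (hVE : V ⊆ interior E)
    (hg : ContDiffOn ℝ 1 g V) : ∀ᵐ X, X ∈ V → G X = gradient g X := by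
  rw [ae_iff]
  refine measure_null_of_locally_null _ fun X hX => ?_
  simp only [mem_ofPred_eq, Classical.not_imp] at hX
  have hc : ContDiffAt ℝ 1 g X := hg.contDiffAt (hV.mem_nhds hX.1)
  obtain ⟨K, t, ht, hlip⟩ := hc.exists_lipschitzOnWith
  obtain ⟨u, hu, hgu⟩ := hlip.extend_real
  have hU : interior (t ∩ V) ∈ 𝓝 X :=
    interior_mem_nhds.2 (inter_mem ht (hV.mem_nhds hX.1))
  have hUt : interior (t ∩ V) ⊆ t ∩ V := interior_subset
  refine ⟨_, inter_mem (mem_nhdsWithin_of_mem_nhds hU) self_mem_nhdsWithin, ?_⟩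
  have h1 := hG.ae_eq_gradient isOpen_interior
    ((hUt.trans inter_subset_right).trans hVE) hu (fun Z hZ => hgu (hUt hZ).1)
  rw [ae_iff] at h1
  refine measure_mono_null (fun Z hZ => ?_) h1
  obtain ⟨hZU, hZV⟩ := hZ
  simp only [mem_ofPred_eq, Classical.not_imp] at hZV ⊢
  refine ⟨hZU, fun h => hZV.2 ?_⟩
  have he : g =ᶠ[𝓝 Z] u := by
    filter_upwards [isOpen_interior.mem_nhds hZU] with Y hY using hgu (hUt hY).1
  rw [h, he.gradient_eq]

/-- Change of variables `X ↦ X₀ + r X`. -/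
theorem integral_comp_affine {F : Type*} [NormedAddCommGroup F] [NormedSpace ℝ F]
    (f : Plane → F) (X₀ : Plane) {r : ℝ} (hr : 0 < r) :
    ∫ X, f (X₀ + r • X) = (r ^ 2)⁻¹ • ∫ X, f X := by
  have h := Measure.integral_comp_smul (volume : Measure Plane) (fun X => f (X₀ + X)) r
  rw [h, integral_add_left_eq_self]
  simp [abs_of_pos hr]

/-- The homeomorphism `X ↦ X₀ + r X`. -/
noncomputable def affineHomeo (X₀ : Plane) {r : ℝ} (hr : r ≠ 0) : Plane ≃ₜ Plane :=
  (Homeomorph.smulOfNeZero r hr).trans (Homeomorph.addLeft X₀)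

@[simp] theorem affineHomeo_apply (X₀ : Plane) {r : ℝ} (hr : r ≠ 0) (X : Plane) :
    affineHomeo X₀ hr X = X₀ + r • X := rfl

@[simp] theorem affineHomeo_symm_apply (X₀ : Plane) {r : ℝ} (hr : r ≠ 0) (X : Plane) :
    (affineHomeo X₀ hr).symm X = r⁻¹ • (X - X₀) := by
  rw [Homeomorph.symm_apply_eq]; simp [smul_smul, hr]

theorem integrable_comp_affine {F : Type*} [NormedAddCommGroup F] {f : Plane → F}
    (X₀ : Plane) {r : ℝ} (hr : 0 < r) :
    Integrable (fun X => f (X₀ + r • X)) ↔ Integrable f := by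
  rw [integrable_comp_smul_iff (volume : Measure Plane) (fun X => f (X₀ + X)) hr.ne']
  exact ⟨fun h => by simpa using h.comp_add_left (-X₀), fun h => h.comp_add_left X₀⟩

theorem locallyIntegrableOn_comp_affine {F : Type*} [NormedAddCommGroup F] {f : Plane → F}
    {U : Set Plane} (hU : IsOpen U) (hf : LocallyIntegrableOn f U) (X₀ : Plane) {r : ℝ}
    (hr : 0 < r) :
    LocallyIntegrableOn (fun X => f (X₀ + r • X)) {X | X₀ + r • X ∈ U} := by
  have hcont : Continuous fun X : Plane => X₀ + r • X := by fun_prop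
  have hU' : IsOpen {X : Plane | X₀ + r • X ∈ U} := hU.preimage hcont
  rw [locallyIntegrableOn_iff hU'.isLocallyClosed]
  rw [locallyIntegrableOn_iff hU.isLocallyClosed] at hf
  intro k hk hkc
  have h1 : IntegrableOn f ((fun X => X₀ + r • X) '' k) :=
    hf _ (by rintro _ ⟨X, hX, rfl⟩; exact hk hX) (hkc.image hcont)
  have hm : MeasurableSet ((fun X => X₀ + r • X) '' k) := (hkc.image hcont).measurableSet
  rw [← integrable_indicator_iff hm, ← integrable_comp_affine X₀ hr] at h1
  rw [← integrable_indicator_iff hkc.measurableSet]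
  refine h1.congr (ae_of_all _ fun X => ?_)
  have hinj : Function.Injective fun X : Plane => X₀ + r • X := (affineHomeo X₀ hr.ne').injective
  by_cases hX : X ∈ k
  · simp only [indicator_of_mem hX, indicator_of_mem (mem_image_of_mem _ hX)]
  · have hX' : X₀ + r • X ∉ (fun X => X₀ + r • X) '' k := by
      rintro ⟨Z, hZ, hZX⟩
      exact hX (hinj hZX ▸ hZ)
    simp only [indicator_of_notMem hX, indicator_of_notMem hX']

theorem interior_rescaledDomain (E : Set Plane) (X₀ : Plane) {r : ℝ} (hr : r ≠ 0) :
    interior (rescaledDomain E X₀ r) = {X | X₀ + r • X ∈ interior E} :=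
  ((affineHomeo X₀ hr).preimage_interior E).symm

theorem fderiv_comp_affine (φ : Plane → ℝ) (X₀ : Plane) (r : ℝ) (X v : Plane) :
    fderiv ℝ (fun Z => φ (X₀ + r • Z)) X v = r * fderiv ℝ φ (X₀ + r • X) v := by
  have h := fderiv_comp_smul (𝕜 := ℝ) (f := fun Z => φ (X₀ + Z)) (x := X) r
  rw [h, fderiv_comp_add_left]
  simp

/-- Weak gradients under rescaling. -/
theorem IsWeakGrad.rescale {E : Set Plane} {g : Plane → ℝ} {G : Plane → Plane}
    (hG : IsWeakGrad E g G) (X₀ : Plane) {r : ℝ} (hr : 0 < r) :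
    IsWeakGrad (rescaledDomain E X₀ r) (rescale g X₀ r) (fun X => G (X₀ + r • X)) := by
  refine ⟨?_, ?_, ?_⟩
  · rw [interior_rescaledDomain _ _ hr.ne']
    have h := locallyIntegrableOn_comp_affine isOpen_interior hG.1 X₀ hr
    intro X hX
    obtain ⟨s, hs, hi⟩ := h X hX
    exact ⟨s, hs, hi.div_const r⟩
  · rw [interior_rescaledDomain _ _ hr.ne']
    exact locallyIntegrableOn_comp_affine isOpen_interior hG.2.1 X₀ hr
  · intro φ hφ hc hs i
    rw [interior_rescaledDomain _ _ hr.ne'] at hs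
    have hr' : r⁻¹ ≠ 0 := inv_ne_zero hr.ne'
    set Φ : Plane → ℝ := fun Z => φ ((-(r⁻¹ • X₀)) + r⁻¹ • Z) with hΦ
    have hΦφ : ∀ X, Φ (X₀ + r • X) = φ X := by
      intro X
      simp only [hΦ]
      congr 1
      rw [smul_add, smul_smul, inv_mul_cancel₀ hr.ne']
      simp
    have hΦφ' : ∀ X, fderiv ℝ Φ (X₀ + r • X) (stdVec i) = r⁻¹ * fderiv ℝ φ X (stdVec i) := by
      intro X
      have h := fderiv_comp_affine Φ X₀ r X (stdVec i)
      simp only [hΦφ] at h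
      rw [h, inv_mul_cancel_left₀ hr.ne']
    have hΦ1 : ContDiff ℝ ∞ Φ := hφ.comp (by fun_prop)
    have hcomp : Φ = φ ∘ (affineHomeo X₀ hr.ne').symm := by
      ext Z
      simp only [hΦ, Function.comp, affineHomeo_symm_apply, smul_sub]
      congr 1; abel
    have hΦ2 : HasCompactSupport Φ := by
      rw [hcomp]; exact hc.comp_homeomorph _
    have hΦ3 : tsupport Φ ⊆ interior E := by
      rw [hcomp, tsupport_comp_eq_preimage]
      intro Z hZ
      have := hs hZ
      simpa [smul_smul, hr.ne'] using this
    have h := hG.2.2 Φ hΦ1 hΦ2 hΦ3 i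
    have e1 := integral_comp_affine (fun X => g X * fderiv ℝ Φ X (stdVec i)) X₀ hr
    have e2 := integral_comp_affine (fun X => G X i * Φ X) X₀ hr
    simp only [hΦφ, hΦφ'] at e1 e2
    rw [e2, smul_eq_mul, ← mul_neg, ← h, ← smul_eq_mul, ← e1]
    congr 1; ext X
    simp [AxiFlow.rescale]; ring

/-! ### The equation in the positivity set -/

/-- The height `y₀ + r y` of the point `X₀ + r X` over the axis. -/
def height (y₀ r : ℝ) (X : Plane) : ℝ := y₀ + r * X 1

theorem contDiff_height (y₀ r : ℝ) {n : ℕ∞ω} : ContDiff ℝ n (height y₀ r) := by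
  unfold height; fun_prop

theorem continuous_height (y₀ r : ℝ) : Continuous (height y₀ r) :=
  (contDiff_height y₀ r (n := 0)).continuous

theorem fderiv_height (y₀ r : ℝ) (X v : Plane) : fderiv ℝ (height y₀ r) X v = r * v 1 := by
  have h : HasFDerivAt (height y₀ r) (r • (EuclideanSpace.proj (𝕜 := ℝ) 1 : Plane →L[ℝ] ℝ)) X :=
    ((EuclideanSpace.proj (𝕜 := ℝ) 1 : Plane →L[ℝ] ℝ).hasFDerivAt.const_mul r).const_add y₀
  rw [h.fderiv]; simp

/-- A smooth cut-off function between a compact set and an open neighbourhood. -/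
theorem exists_cutoff {K D : Set Plane} (hK : IsCompact K) (hD : IsOpen D) (hKD : K ⊆ D) :
    ∃ χ : Plane → ℝ, ContDiff ℝ ∞ χ ∧ HasCompactSupport χ ∧ tsupport χ ⊆ D ∧
      (∀ X, χ X ∈ Icc (0 : ℝ) 1) ∧ ∀ᶠ X in 𝓝ˢ K, χ X = 1 := by
  obtain ⟨K', hK', hKK', hK'D⟩ := exists_compact_between hK hD hKD
  obtain ⟨f, hf1, hf0, hf⟩ := exists_contMDiffMap_one_nhds_of_subset_interior
    (modelWithCornersSelf ℝ Plane) (n := ⊤) hK.isClosed hKK'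
  have hsupp : Function.support f ⊆ K' := fun X hX => by
    by_contra h
    exact hX (hf0 X h)
  have ht : tsupport f ⊆ K' := closure_minimal hsupp hK'.isClosed
  exact ⟨f, f.contMDiff.contDiff, hK'.of_isClosed_subset (isClosed_tsupport f) ht, ht.trans hK'D,
    hf, hf1⟩

theorem fderiv_eq_zero_of_notMem_tsupport {f : Plane → ℝ} {X : Plane} (h : X ∉ tsupport f) :
    fderiv ℝ f X = 0 :=
  image_eq_zero_of_notMem_tsupport fun h' => h (tsupport_fderiv_subset ℝ h')

theorem contDiff_of_contDiffOn_of_tsupport {f : Plane → ℝ} {D : Set Plane} {n : ℕ∞ω}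
    (hD : IsOpen D) (hf : ContDiffOn ℝ n f D) (hs : tsupport f ⊆ D) : ContDiff ℝ n f := by
  rw [contDiff_iff_contDiffAt]
  intro X
  by_cases hX : X ∈ tsupport f
  · exact hf.contDiffAt (hD.mem_nhds (hs hX))
  · exact contDiffAt_const.congr_of_eventuallyEq (notMem_tsupport_iff_eventuallyEq.1 hX)

theorem LipTest.mul_contDiffOn {h m : Plane → ℝ} {D : Set Plane} (hh : LipTest h)
    (hD : IsOpen D) (hs : tsupport h ⊆ D) (hm : ContDiffOn ℝ 1 m D) :
    LipTest (fun X => h X * m X) := by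
  obtain ⟨χ, hχ, hχc, hχs, -, hχ1⟩ := exists_cutoff hh.2 hD hs
  have h1 : LipTest (fun X => χ X * m X) := by
    have hsub : tsupport (fun X => χ X * m X) ⊆ tsupport χ := tsupport_mul_subset_left
    exact .of_contDiff (contDiff_of_contDiffOn_of_tsupport hD
      ((hχ.of_le (by simp)).contDiffOn.mul hm) (hsub.trans hχs)) hχc.mul_right
  have h2 := hh.mul h1
  convert h2 using 2 with X
  by_cases hX : X ∈ tsupport h
  · rw [hχ1.self_of_nhdsSet X hX, one_mul]
  · simp [image_eq_zero_of_notMem_tsupport hX]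

/-- The divergence theorem for the product of a test function and a function that is continuously
differentiable near its support. -/
theorem integral_fderiv_mul_contDiffOn {h m : Plane → ℝ} {D : Set Plane} (hh : LipTest h)
    (hD : IsOpen D) (hs : tsupport h ⊆ D) (hm : ContDiffOn ℝ 1 m D) (v : Plane) :
    Integrable (fun X => h X * fderiv ℝ m X v + m X * fderiv ℝ h X v) ∧
      ∫ X, (h X * fderiv ℝ m X v + m X * fderiv ℝ h X v) = 0 := by
  have hL := hh.mul_contDiffOn hD hs hm
  have hae : (fun X => fderiv ℝ (fun X => h X * m X) X v) =ᵐ[volume]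
      fun X => h X * fderiv ℝ m X v + m X * fderiv ℝ h X v := by
    filter_upwards [hh.ae_differentiableAt] with X hX
    by_cases hXs : X ∈ tsupport h
    · have hmX : DifferentiableAt ℝ m X :=
        (hm.contDiffAt (hD.mem_nhds (hs hXs))).differentiableAt one_ne_zero
      rw [fderiv_fun_mul hX hmX]
      simp
    · have : X ∉ tsupport (fun X => h X * m X) := fun h' => hXs (tsupport_mul_subset_left h')
      rw [fderiv_eq_zero_of_notMem_tsupport this, fderiv_eq_zero_of_notMem_tsupport hXs,
        image_eq_zero_of_notMem_tsupport hXs]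
      simp
  constructor
  · refine Integrable.congr ?_ hae
    obtain ⟨R, hR, -, hR2⟩ := hL.fderiv_eq_zero
    obtain ⟨M, -, hM⟩ := hL.abs_fderiv_bounded v
    exact integrable_of_bound (R := R) (measurable_fderiv_apply _ v).aestronglyMeasurable
      (ae_of_all _ hM) (fun X hX => by rw [hR2 X hX]; rfl)
  · rw [← integral_congr_ae hae, integral_fderiv_eq_zero hL]

/-- The integrand of the inner variation at scale `r`: with the weight `1 / (y₀ + r y)`, in the
direction of the field `η`. -/
noncomputable def variationIntegrand (y₀ r : ℝ) (u J : Plane → ℝ) (η : Plane → Plane) (X : Plane) : ℝ :=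
  ((1 / height y₀ r X) * ‖gradient u X‖ ^ 2 + height y₀ r X * J X) * divergence η X
    - (2 / height y₀ r X) * inner ℝ (gradient u X) (fderiv ℝ η X (gradient u X))
    - r * η X 1 * ((1 / height y₀ r X ^ 2) * ‖gradient u X‖ ^ 2 - J X)

theorem divergence_eq (η : Plane → Plane) (X : Plane) :
    divergence η X = fderiv ℝ η X (stdVec 0) 0 + fderiv ℝ η X (stdVec 1) 1 := by
  simp [divergence, Fin.sum_univ_two]

theorem fderiv_smul_const_apply {θ : Plane → ℝ} {X : Plane} (hθ : DifferentiableAt ℝ θ X)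
    (V v : Plane) : fderiv ℝ (fun Z => θ Z • V) X v = fderiv ℝ θ X v • V := by
  rw [fderiv_smul_const hθ]; rfl

theorem ContDiffOn.fderiv_apply_open {u : Plane → ℝ} {D : Set Plane} (hD : IsOpen D)
    (hu : ContDiffOn ℝ 2 u D) (v : Plane) : ContDiffOn ℝ 1 (fun X => fderiv ℝ u X v) D :=
  (hu.fderiv_of_isOpen hD (m := 1) (by norm_num)).clm_apply contDiffOn_const

theorem integral_linear_comb {f g h k : Plane → ℝ} (hf : Integrable f) (hg : Integrable g)
    (hh : Integrable h) (hk : Integrable k) :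
    ∫ X, (f X - 2 * g X - 2 * h X + 2 * k X)
      = (∫ X, f X) - 2 * (∫ X, g X) - 2 * (∫ X, h X) + 2 * ∫ X, k X := by
  have h1 : Integrable fun X => f X - 2 * g X := hf.sub (hg.const_mul 2)
  have h2 : Integrable fun X => f X - 2 * g X - 2 * h X := h1.sub (hh.const_mul 2)
  rw [integral_add h2 (hk.const_mul 2), integral_sub h1 (hh.const_mul 2),
    integral_sub hf (hg.const_mul 2), integral_const_mul, integral_const_mul, integral_const_mul]

/-- In the set where `u` is positive, stationarity with respect to domain variations implies the
equation `div (a ∇u) = 0`, where `a = 1 / (y₀ + r y)`. -/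
theorem divergence_form_of_stationary {y₀ r : ℝ} {u : Plane → ℝ} {D : Set Plane} (hD : IsOpen D)
    (hb : ∀ X ∈ D, 0 < height y₀ r X) (hu : ContDiffOn ℝ 2 u D)
    (hstat : ∀ η : Plane → Plane, ContDiff ℝ 1 η → HasCompactSupport η → tsupport η ⊆ D →
      ∫ X, variationIntegrand y₀ r u (fun _ => 1) η X = 0) :
    ∀ X ∈ D, ∑ k : Fin 2,
      fderiv ℝ (fun Z => (1 / height y₀ r Z) * fderiv ℝ u Z (stdVec k)) X (stdVec k) = 0 := by
  set a : Plane → ℝ := fun Z => 1 / height y₀ r Z with ha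
  set p : Fin 2 → Plane → ℝ := fun k Z => fderiv ℝ u Z (stdVec k) with hp
  set q : Plane → ℝ := fun X => ∑ k : Fin 2, fderiv ℝ (fun Z => a Z * p k Z) X (stdVec k) with hq
  have haC : ContDiffOn ℝ 1 a D :=
    contDiffOn_const.div (contDiff_height y₀ r).contDiffOn fun X hX => (hb X hX).ne'
  have hpC : ∀ k, ContDiffOn ℝ 1 (p k) D := fun k => ContDiffOn.fderiv_apply_open hD hu _
  have had : ∀ X ∈ D, DifferentiableAt ℝ a X := fun X hX =>
    (haC.contDiffAt (hD.mem_nhds hX)).differentiableAt one_ne_zero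
  have hpd : ∀ k, ∀ X ∈ D, DifferentiableAt ℝ (p k) X := fun k X hX =>
    ((hpC k).contDiffAt (hD.mem_nhds hX)).differentiableAt one_ne_zero
  have hafd : ∀ X ∈ D, ∀ v : Plane, fderiv ℝ a X v = - (r * v 1) * a X ^ 2 := by
    intro X hX v
    have h1 : HasFDerivAt (height y₀ r) (fderiv ℝ (height y₀ r) X) X :=
      ((contDiff_height y₀ r (n := 1)).differentiable one_ne_zero X).hasFDerivAt
    have h2 := (hasDerivAt_inv (hb X hX).ne').comp_hasFDerivAt X h1
    have h3 : a = (fun y => y⁻¹) ∘ height y₀ r := by ext Z; simp [ha]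
    rw [h3, h2.fderiv]
    simp [fderiv_height]
    ring
  -- symmetry of second derivatives
  have hsymm : ∀ X ∈ D, fderiv ℝ (p 0) X (stdVec 1) = fderiv ℝ (p 1) X (stdVec 0) := by
    intro X hX
    have hc : ContDiffAt ℝ 2 u X := hu.contDiffAt (hD.mem_nhds hX)
    have hs := hc.isSymmSndFDerivAt (by simp)
    have hd : DifferentiableAt ℝ (fderiv ℝ u) X :=
      ((hc.fderiv_right (m := 1) (by norm_num)).differentiableAt one_ne_zero)
    have e : ∀ v w : Plane, fderiv ℝ (fun Z => fderiv ℝ u Z v) X w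
        = fderiv ℝ (fderiv ℝ u) X w v := by
      intro v w
      rw [fderiv_clm_apply hd (differentiableAt_const _)]
      simp
    simp only [hp]
    rw [e, e]
    exact hs _ _
  have hqc : ContinuousOn q D := by
    have h : ∀ k, ContinuousOn (fun X => fderiv ℝ (fun Z => a Z * p k Z) X (stdVec k)) D :=
      fun k => ((haC.mul (hpC k)).continuousOn_fderiv_of_isOpen hD le_rfl).clm_apply
        continuousOn_const
    simp only [hq, Fin.sum_univ_two]
    exact (h 0).add (h 1)
  have hqX : ∀ X ∈ D, q X = fderiv ℝ a X (stdVec 0) * p 0 X + a X * fderiv ℝ (p 0) X (stdVec 0)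
      + (fderiv ℝ a X (stdVec 1) * p 1 X + a X * fderiv ℝ (p 1) X (stdVec 1)) := by
    intro X hX
    simp only [hq, Fin.sum_univ_two]
    rw [fderiv_fun_mul (had X hX) (hpd 0 X hX), fderiv_fun_mul (had X hX) (hpd 1 X hX)]
    simp; ring
  -- the product `∂ⱼu q` vanishes for each `j`
  have hpq : ∀ j, ∀ X ∈ D, p j X * q X = 0 := by
    intro j
    have hcont : ContinuousOn (fun X => p j X * q X) D := (hpC j).continuousOn.mul hqc
    have hae := hD.ae_eq_zero_of_integral_contDiff_smul_eq_zero (μ := (volume : Measure Plane))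
      (hcont.locallyIntegrableOn hD.measurableSet) (fun θ hθ hθc hθs => ?_)
    · intro X hX
      by_contra hne
      have hopen : IsOpen (D ∩ (fun X => p j X * q X) ⁻¹' {0}ᶜ) :=
        hcont.isOpen_inter_preimage hD isOpen_compl_singleton
      have hpos := hopen.measure_pos (volume : Measure Plane) ⟨X, hX, hne⟩
      refine hpos.ne' (measure_mono_null (fun Z hZ => ?_) (ae_iff.1 hae))
      simp only [mem_ofPred_eq, Classical.not_imp]
      exact ⟨hZ.1, hZ.2⟩
    · have hθ1 : ContDiff ℝ 1 θ := hθ.of_le (by simp)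
      have hθL : LipTest θ := .of_contDiff hθ1 hθc
      have hθd : ∀ X, DifferentiableAt ℝ θ X := fun X => hθ1.differentiable one_ne_zero X
      have hη := hstat (fun X => θ X • stdVec j) (hθ1.smul contDiff_const) hθc.smul_right
        ((closure_mono (Function.support_smul_subset_left _ _)).trans hθs)
      have hbC : ContDiffOn ℝ 1 (height y₀ r) D := (contDiff_height y₀ r).contDiffOn
      obtain ⟨i0, e0⟩ := integral_fderiv_mul_contDiffOn hθL hD hθs
        (m := fun X => a X * (p 0 X * p 0 X + p 1 X * p 1 X) + height y₀ r X)
        ((haC.mul (((hpC 0).mul (hpC 0)).add ((hpC 1).mul (hpC 1)))).add hbC) (stdVec j)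
      obtain ⟨i1, e1⟩ := integral_fderiv_mul_contDiffOn hθL hD hθs
        (m := fun X => (a X * p 0 X) * p j X) ((haC.mul (hpC 0)).mul (hpC j)) (stdVec 0)
      obtain ⟨i2, e2⟩ := integral_fderiv_mul_contDiffOn hθL hD hθs
        (m := fun X => (a X * p 1 X) * p j X) ((haC.mul (hpC 1)).mul (hpC j)) (stdVec 1)
      have i3 : Integrable fun X => θ X * (p j X * q X) := by
        have := (hcont.locallyIntegrableOn (μ := volume)
          hD.measurableSet).integrableOn_compact_subset hθs hθc
        have h5 := this.continuousOn_mul hθ.continuous.continuousOn hθc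
        rwa [integrableOn_iff_integrable_of_support_subset] at h5
        intro X hX
        by_contra hX'
        exact hX (by simp [image_eq_zero_of_notMem_tsupport hX'])
      -- the conservation law behind stationarity: for `η = θ eⱼ` the integrand is a divergence, up
      -- to the term `2 θ ∂ⱼu q`
      have key : ∀ X, variationIntegrand y₀ r u (fun _ => 1) (fun X => θ X • stdVec j) X
          = (θ X * fderiv ℝ (fun X => a X * (p 0 X * p 0 X + p 1 X * p 1 X) + height y₀ r X) X
              (stdVec j) + (a X * (p 0 X * p 0 X + p 1 X * p 1 X) + height y₀ r X)
              * fderiv ℝ θ X (stdVec j))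
            - 2 * (θ X * fderiv ℝ (fun X => (a X * p 0 X) * p j X) X (stdVec 0)
              + (a X * p 0 X) * p j X * fderiv ℝ θ X (stdVec 0))
            - 2 * (θ X * fderiv ℝ (fun X => (a X * p 1 X) * p j X) X (stdVec 1)
              + (a X * p 1 X) * p j X * fderiv ℝ θ X (stdVec 1))
            + 2 * (θ X * (p j X * q X)) := by
        intro X
        have hθe : ∀ v, fderiv ℝ (fun X => θ X • stdVec j) X v = fderiv ℝ θ X v • stdVec j :=
          fun v => fderiv_smul_const_apply (hθd X) _ v
        by_cases hX : X ∈ tsupport θ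
        · have hXD := hθs hX
          have d0 : DifferentiableAt ℝ (fun X => p 0 X * p 0 X + p 1 X * p 1 X) X :=
            ((hpd 0 X hXD).mul (hpd 0 X hXD)).add ((hpd 1 X hXD).mul (hpd 1 X hXD))
          have dh : DifferentiableAt ℝ (height y₀ r) X :=
            (contDiff_height y₀ r (n := 1)).differentiable one_ne_zero X
          have dA : DifferentiableAt ℝ
              (fun X => a X * (p 0 X * p 0 X + p 1 X * p 1 X)) X := (had X hXD).mul d0
          have dB : ∀ k, DifferentiableAt ℝ (fun X => a X * p k X) X :=
            fun k => (had X hXD).mul (hpd k X hXD)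
          have dC : ∀ k, DifferentiableAt ℝ (fun X => p k X * p k X) X :=
            fun k => (hpd k X hXD).mul (hpd k X hXD)
          rw [fderiv_fun_add dA dh, fderiv_fun_mul (had X hXD) d0,
            fderiv_fun_add (dC 0) (dC 1),
            fderiv_fun_mul (hpd 0 X hXD) (hpd 0 X hXD), fderiv_fun_mul (hpd 1 X hXD) (hpd 1 X hXD),
            fderiv_fun_mul (dB 0) (hpd j X hXD),
            fderiv_fun_mul (dB 1) (hpd j X hXD),
            fderiv_fun_mul (had X hXD) (hpd 0 X hXD), fderiv_fun_mul (had X hXD) (hpd 1 X hXD),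
            hqX X hXD]
          have hs := hsymm X hXD
          have hbX := hb X hXD
          have hab : a X = 1 / height y₀ r X := rfl
          have hab2 : 1 / height y₀ r X ^ 2 = a X ^ 2 := by rw [hab]; ring
          have hab3 : 2 / height y₀ r X = 2 * a X := by rw [hab]; ring
          have hga : ∀ i, gradient u X i = p i X := fun i => gradient_apply u X i
          unfold variationIntegrand
          rw [divergence_eq, norm_sq_eq, inner_eq_sum, hab2, hab3, ← hab, hθe, hθe, hθe,
            fderiv_eq_sum θ X (gradient u X)]
          simp only [hga]
          simp only [add_apply, smul_apply, smul_eq_mul,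
            fderiv_height, hafd X hXD, PiLp.smul_apply]
          fin_cases j
          · simp
            rw [hs]
            ring
          · simp
            rw [← hs]
            ring
        · have h1 : fderiv ℝ θ X = 0 := fderiv_eq_zero_of_notMem_tsupport hX
          have h2 : θ X = 0 := image_eq_zero_of_notMem_tsupport hX
          unfold variationIntegrand
          rw [divergence_eq, hθe, hθe, hθe, h1]
          simp [h2]
      simp only [key] at hη
      rw [integral_linear_comb i0 i1 i2 i3, e0, e1, e2] at hη
      simp only [smul_eq_mul]
      linarith
  -- if `q X ≠ 0`, then `∇u = 0` near `X` because all products `∂ⱼu q` vanish; but then `q X = 0`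
  intro X hX
  by_contra hne
  change q X ≠ 0 at hne
  have hev : ∀ᶠ Z in 𝓝 X, Z ∈ D ∧ q Z ≠ 0 :=
    (hD.eventually_mem hX).and
      ((hqc.continuousAt (hD.mem_nhds hX)).eventually_ne hne)
  have hz : ∀ k, (fun Z => a Z * p k Z) =ᶠ[𝓝 X] fun _ => 0 := by
    intro k
    filter_upwards [hev] with Z hZ
    rw [(mul_eq_zero.1 (hpq k Z hZ.1)).resolve_right hZ.2, mul_zero]
  apply hne
  simp only [hq]
  refine Finset.sum_eq_zero fun k _ => ?_
  rw [(hz k).fderiv_eq]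
  simp

/-- The weak form of the equation `div (a ∇u) = 0`, for Lipschitz test functions. -/
theorem integral_inner_gradient_eq_zero {y₀ r : ℝ} {u : Plane → ℝ} {D : Set Plane} (hD : IsOpen D)
    (hb : ∀ X ∈ D, 0 < height y₀ r X) (hu : ContDiffOn ℝ 2 u D)
    (heq : ∀ X ∈ D, ∑ k : Fin 2,
      fderiv ℝ (fun Z => (1 / height y₀ r Z) * fderiv ℝ u Z (stdVec k)) X (stdVec k) = 0)
    {h : Plane → ℝ} (hh : LipTest h) (hs : tsupport h ⊆ D) :
    ∫ X, (1 / height y₀ r X) * inner ℝ (gradient u X) (gradient h X) = 0 := by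
  have haC : ContDiffOn ℝ 1 (fun Z => 1 / height y₀ r Z) D :=
    contDiffOn_const.div (contDiff_height y₀ r).contDiffOn fun X hX => (hb X hX).ne'
  have hm := fun k => integral_fderiv_mul_contDiffOn hh hD hs
    (haC.mul (ContDiffOn.fderiv_apply_open hD hu (stdVec k))) (stdVec k)
  have hsum := integral_add (hm 0).1 (hm 1).1
  rw [(hm 0).2, (hm 1).2, add_zero] at hsum
  rw [← hsum]
  congr 1
  ext X
  rw [inner_eq_sum]
  simp only [gradient_apply]
  by_cases hX : X ∈ tsupport h
  · have := heq X (hs hX)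
    rw [Fin.sum_univ_two] at this
    linear_combination - (h X) * this
  · rw [fderiv_eq_zero_of_notMem_tsupport hX, image_eq_zero_of_notMem_tsupport hX]
    simp

/-! ### Lipschitz bound and stationary pairs -/

/-- A nonnegative function on `[0, 1]` whose derivative is at most `M` where it is positive
grows by at most `M`. -/
theorem le_add_of_deriv_le_of_pos {f : ℝ → ℝ} {M : ℝ} (hM : 0 ≤ M)
    (hf : ContinuousOn f (Icc 0 1)) (h0 : ∀ t ∈ Icc (0 : ℝ) 1, 0 ≤ f t)
    (hd : ∀ t ∈ Icc (0 : ℝ) 1, 0 < f t → DifferentiableAt ℝ f t ∧ deriv f t ≤ M) :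
    f 1 ≤ f 0 + M := by
  have main : ∀ t₀ ∈ Ico (0 : ℝ) 1, (∀ t ∈ Ioo t₀ 1, 0 < f t) → f 1 ≤ f t₀ + M := by
    intro t₀ ht₀ hpos
    have hsub : Icc t₀ 1 ⊆ Icc 0 1 := Icc_subset_Icc_left ht₀.1
    have hsub' : Ioo t₀ 1 ⊆ Icc 0 1 := Ioo_subset_Icc_self.trans hsub
    obtain ⟨c, hc, hcd⟩ := exists_deriv_eq_slope f ht₀.2 (hf.mono hsub)
      (fun t ht => (hd t (hsub' ht) (hpos t ht)).1.differentiableWithinAt)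
    have h1 := (hd c (hsub' hc) (hpos c hc)).2
    have h2 : 0 < 1 - t₀ := by linarith [ht₀.2]
    rw [hcd, div_le_iff₀ h2] at h1
    nlinarith [ht₀.1]
  -- after the last zero of `f`, the mean value theorem applies
  by_cases hZ : (Icc (0 : ℝ) 1 ∩ f ⁻¹' {0}).Nonempty
  · have hcomp : IsCompact (Icc (0 : ℝ) 1 ∩ f ⁻¹' {0}) :=
      isCompact_Icc.of_isClosed_subset
        (hf.preimage_isClosed_of_isClosed isClosed_Icc isClosed_singleton) inter_subset_left
    obtain ⟨t₀, ⟨ht₀, hft₀⟩, hgr⟩ := hcomp.exists_isGreatest hZ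
    have hft₀' : f t₀ = 0 := hft₀
    rcases ht₀.2.eq_or_lt with rfl | hlt
    · rw [hft₀']
      linarith [h0 0 (by simp)]
    · have := main t₀ ⟨ht₀.1, hlt⟩ fun t ht => by
        have htI : t ∈ Icc (0 : ℝ) 1 := ⟨ht₀.1.trans ht.1.le, ht.2.le⟩
        refine lt_of_le_of_ne (h0 t htI) fun h => ?_
        exact absurd (hgr ⟨htI, h.symm⟩) (not_le.2 ht.1)
      linarith [h0 0 (by simp)]
  · refine main 0 (by simp) fun t ht => lt_of_le_of_ne (h0 t (Ioo_subset_Icc_self ht)) fun h => ?_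
    exact hZ ⟨t, Ioo_subset_Icc_self ht, h.symm⟩

/-- A nonnegative continuous function on a convex set is Lipschitz if its gradient is bounded where
the function is positive. -/
theorem lipschitzOnWith_of_pos {f : Plane → ℝ} {B : Set Plane} (hB : Convex ℝ B) {L : ℝ≥0}
    (hf : ContinuousOn f B) (h0 : ∀ X ∈ B, 0 ≤ f X)
    (hd : ∀ X ∈ B, 0 < f X → DifferentiableAt ℝ f X ∧ ‖fderiv ℝ f X‖ ≤ L) :
    LipschitzOnWith L f B := by
  have key : ∀ X ∈ B, ∀ Z ∈ B, f Z ≤ f X + L * dist X Z := by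
    intro X hX Z hZ
    have hmem : ∀ t ∈ Icc (0 : ℝ) 1, X + t • (Z - X) ∈ B := fun t ht =>
      hB.add_smul_sub_mem hX hZ ht
    have h := le_add_of_deriv_le_of_pos (f := fun t : ℝ => f (X + t • (Z - X)))
      (M := L * dist X Z) (by positivity)
      (hf.comp (by fun_prop) hmem) (fun t ht => h0 _ (hmem t ht)) (fun t ht hpos => ?_)
    · simpa using h
    · obtain ⟨h1, h2⟩ := hd _ (hmem t ht) hpos
      have h3 : HasDerivAt (fun t : ℝ => X + t • (Z - X)) (Z - X) t := by
        simpa using ((hasDerivAt_id t).smul_const (Z - X)).const_add X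
      have h4 := h1.hasFDerivAt.comp_hasDerivAt t h3
      refine ⟨h4.differentiableAt, ?_⟩
      have h5 : deriv (fun t : ℝ => f (X + t • (Z - X))) t
        = fderiv ℝ f (X + t • (Z - X)) (Z - X) := h4.deriv
      rw [h5, dist_comm, dist_eq_norm]
      exact (le_abs_self _).trans (((fderiv ℝ f _).le_opNorm _).trans
        (mul_le_mul_of_nonneg_right h2 (norm_nonneg _)))
  refine LipschitzOnWith.of_dist_le_mul fun X hX Z hZ => ?_
  rw [Real.dist_eq, abs_le]
  have h1 := key X hX Z hZ
  have h2 := key Z hZ X hX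
  rw [dist_comm Z X] at h2
  constructor <;> linarith

/-- A variational solution near a free boundary point, in coordinates that move the point to the
origin and at scale `r`. The function `u` is globally Lipschitz, but the properties that come from
the variational solution are required in the ball of radius `ρ` only. The weight is the inverse of
`height y₀ r`, which `small` keeps between `y₀ / 2` and `3 y₀ / 2` in that ball; `weak` is the
equation `div (a ∇u) = 0`, with `a` the weight, in `{u > 0}`; and `J` is the density `I`. -/
structure StatPair (y₀ : ℝ) (L : ℝ≥0) (ρ r : ℝ) (u J : Plane → ℝ) : Prop where
  pos : 0 < y₀
  radius_pos : 0 < ρ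
  scale_pos : 0 < r
  small : r * ρ ≤ y₀ / 2
  lip : LipschitzWith L u
  zero : u 0 = 0
  nonneg : ∀ X ∈ Metric.ball (0 : Plane) ρ, 0 ≤ u X
  weak : ∀ h, LipTest h → tsupport h ⊆ {X | X ∈ Metric.ball (0 : Plane) ρ ∧ 0 < u X} →
    ∫ X, (1 / height y₀ r X) * inner ℝ (gradient u X) (gradient h X) = 0
  measurable : Measurable J
  values : ∀ X, J X = 0 ∨ J X = 1
  one : ∀ᵐ X, X ∈ Metric.ball (0 : Plane) ρ → 0 < u X → J X = 1
  stationary : ∀ η : Plane → Plane, ContDiff ℝ 1 η → HasCompactSupport η →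
    tsupport η ⊆ Metric.ball 0 ρ → ∫ X, variationIntegrand y₀ r u J η X = 0

theorem abs_coord_le (X : Plane) (i : Fin 2) : |X i| ≤ ‖X‖ := PiLp.norm_apply_le X i

theorem StatPair.height_mem {y₀ : ℝ} {L : ℝ≥0} {ρ r : ℝ} {u J : Plane → ℝ}
    (h : StatPair y₀ L ρ r u J) {X : Plane} (hX : ‖X‖ ≤ ρ) :
    y₀ / 2 ≤ height y₀ r X ∧ height y₀ r X ≤ 3 * y₀ / 2 := by
  have h1 : |r * X 1| ≤ y₀ / 2 := by
    rw [abs_mul, abs_of_pos h.scale_pos]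
    exact (mul_le_mul_of_nonneg_left ((abs_coord_le X 1).trans hX) h.scale_pos.le).trans h.small
  have := abs_le.1 h1
  unfold height
  constructor <;> linarith

theorem variationIntegrand_eq_zero {y₀ r : ℝ} {u J : Plane → ℝ} {η : Plane → Plane} {X : Plane}
    (hX : X ∉ tsupport η) : variationIntegrand y₀ r u J η X = 0 := by
  have h1 : fderiv ℝ η X = 0 :=
    image_eq_zero_of_notMem_tsupport fun h' => hX (tsupport_fderiv_subset ℝ h')
  have h2 : η X = 0 := image_eq_zero_of_notMem_tsupport hX
  unfold variationIntegrand
  rw [divergence_eq, h1, h2]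
  simp

/-- Near a non-degenerate free boundary point, `ψ` is Lipschitz: the gradient bound holds almost
everywhere, hence everywhere in the open set `{ψ > 0}` by continuity, and `ψ ≥ 0` vanishes
elsewhere. Translating the point to the origin and extending `ψ` gives a stationary pair at scale
`1`. -/
theorem IsVariationalSolution.exists_statPair {C : ℝ} {Ω : Set Plane} {ψ I : Plane → ℝ}
    (hψ : IsVariationalSolution C Ω ψ I) {X₀ : Plane} (hX₀ : X₀ ∈ nonDegeneratePoints Ω ψ) :
    ∃ (L : ℝ≥0) (ρ : ℝ) (u J : Plane → ℝ), StatPair (X₀ 1) L ρ 1 u J ∧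
      Metric.ball X₀ ρ ⊆ interior Ω ∧ ∀ X ∈ Metric.ball (0 : Plane) ρ, ψ (X₀ + X) = u X := by
  obtain ⟨⟨hX₀Ω, hfr⟩, hy⟩ := hX₀
  obtain ⟨U, hU, hΩU⟩ := hψ.isOpen_domain
  have hy' : IsOpen {X : Plane | 0 < X 1} := isOpen_lt continuous_const (by fun_prop)
  have hint : X₀ ∈ interior Ω := by
    rw [mem_interior]
    refine ⟨U ∩ {X : Plane | 0 < X 1}, ?_, hU.inter hy', ?_, hy⟩
    · rw [hΩU]; exact inter_subset_inter_right _ fun X (hX : 0 < X 1) => hX.le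
    · rw [hΩU] at hX₀Ω; exact hX₀Ω.1
  obtain ⟨ρ₁, hρ₁, hball₁⟩ := Metric.isOpen_iff.1 isOpen_interior X₀ hint
  set ρ := min ρ₁ (X₀ 1 / 2) with hρ
  have hρpos : 0 < ρ := lt_min hρ₁ (by linarith)
  have hball : Metric.ball X₀ ρ ⊆ interior Ω :=
    (Metric.ball_subset_ball (min_le_left _ _)).trans hball₁
  have hballΩ : Metric.ball X₀ ρ ⊆ Ω := hball.trans interior_subset
  have hyball : ∀ X ∈ Metric.ball X₀ ρ, 0 < X 1 ∧ X 1 ≤ 2 * X₀ 1 := by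
    intro X hX
    have h1 := abs_coord_le (X - X₀) 1
    rw [← dist_eq_norm] at h1
    have h2 : |X 1 - X₀ 1| < X₀ 1 / 2 :=
      h1.trans_lt ((Metric.mem_ball.1 hX).trans_le (min_le_right _ _))
    have := abs_lt.1 h2
    constructor <;> linarith
  set D : Set Plane := Metric.ball X₀ ρ ∩ {X | 0 < ψ X} with hD
  have hcont : ContinuousOn ψ (Metric.ball X₀ ρ) := hψ.continuousOn.mono hballΩ
  have hDo : IsOpen D := hcont.isOpen_inter_preimage Metric.isOpen_ball isOpen_Ioi
  have hDC : ContDiffOn ℝ 2 ψ D := hψ.contDiffOn.mono fun X hX => ⟨hballΩ hX.1, hX.2⟩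
  have hψ0 : ψ X₀ = 0 := by
    refine le_antisymm (not_lt.1 fun h => ?_) (hψ.nonneg X₀ hX₀Ω)
    have h1 : X₀ ∈ interior {X | X ∈ Ω ∧ 0 < ψ X} :=
      mem_interior.2 ⟨D, fun X hX => ⟨hballΩ hX.1, hX.2⟩, hDo, Metric.mem_ball_self hρpos, h⟩
    exact hfr.2 h1
  have hW := isWeakGrad_wgrad hψ.memW12Loc.1
  set L : ℝ≥0 := ⟨|C| * (2 * X₀ 1), by positivity⟩ with hL
  -- the gradient bound on `{ψ > 0}`, where the weak gradient is the classical one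
  have hgradD : ∀ X ∈ D, ‖fderiv ℝ ψ X‖ ≤ L := by
    have hae : ∀ᵐ X, X ∈ D → ‖fderiv ℝ ψ X‖ ≤ L := by
      have h1 := hW.ae_eq_gradient_of_contDiffOn hDo (inter_subset_left.trans hball)
        (hDC.of_le (by norm_num))
      have h2 := hψ.gradient_bound
      have hΩm : MeasurableSet Ω := by
        rw [hΩU]
        exact hU.measurableSet.inter
          (isClosed_le continuous_const (by fun_prop) : IsClosed upperHalf).measurableSet
      rw [ae_restrict_iff' hΩm] at h2
      filter_upwards [h1, h2] with X h1 h2 hX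
      have h3 := h2 (hballΩ hX.1)
      rw [h1 hX, gradient, LinearIsometryEquiv.norm_map] at h3
      obtain ⟨h4, h5⟩ := hyball X hX.1
      rw [one_div, inv_mul_le_iff₀ h4] at h3
      change _ ≤ |C| * (2 * X₀ 1)
      calc _ ≤ X 1 * C := h3
        _ ≤ X 1 * |C| := mul_le_mul_of_nonneg_left (le_abs_self C) h4.le
        _ ≤ _ := by nlinarith [abs_nonneg C]
    intro X hX
    by_contra hlt
    have hopen : IsOpen (D ∩ (fun X => ‖fderiv ℝ ψ X‖) ⁻¹' Ioi (L : ℝ)) :=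
      (hDC.continuousOn_fderiv_of_isOpen hDo (by norm_num)).norm.isOpen_inter_preimage hDo
        isOpen_Ioi
    refine (hopen.measure_pos (volume : Measure Plane) ⟨X, hX, not_le.1 hlt⟩).ne'
      (measure_mono_null (fun Z hZ => ?_) (ae_iff.1 hae))
    simp only [mem_ofPred_eq, Classical.not_imp]
    exact ⟨hZ.1, not_le.2 hZ.2⟩
  have hlip : LipschitzOnWith L ψ (Metric.ball X₀ ρ) :=
    lipschitzOnWith_of_pos (convex_ball _ _) hcont (fun X hX => hψ.nonneg X (hballΩ hX))
      fun X hX hpos => ⟨(hDC.contDiffAt (hDo.mem_nhds ⟨hX, hpos⟩)).differentiableAt two_ne_zero,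
        hgradD X ⟨hX, hpos⟩⟩
  obtain ⟨w, hw, hwψ⟩ := hlip.extend_real
  set u : Plane → ℝ := fun X => w (X₀ + X) with hu
  have hmem : ∀ X : Plane, X₀ + X ∈ Metric.ball X₀ ρ ↔ X ∈ Metric.ball (0 : Plane) ρ := by
    intro X; simp
  have huψ : ∀ X ∈ Metric.ball (0 : Plane) ρ, ψ (X₀ + X) = u X := fun X hX =>
    hwψ ((hmem X).2 hX)
  have hulip : LipschitzWith L u := by
    have h1 := hw.comp (isometry_add_left X₀).lipschitz
    rwa [mul_one] at h1
  -- the gradient of `u` is the translated weak gradient of `ψ`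
  have hgrad : ∀ᵐ X, X ∈ Metric.ball (0 : Plane) ρ → wgrad Ω ψ (X₀ + X) = gradient u X := by
    have h1 := hW.ae_eq_gradient Metric.isOpen_ball hball hw hwψ
    have h2 := (measurePreserving_add_left (volume : Measure Plane) X₀).quasiMeasurePreserving.ae h1
    filter_upwards [h2] with X hX hXB
    rw [hX ((hmem X).2 hXB)]
    simp only [gradient, hu]
    rw [fderiv_comp_add_left]
  -- the density `J` is `I`, translated and set to zero outside the ball
  set S : Set Plane := Metric.ball X₀ ρ ∩ (Subtype.val '' {Z : Ω | I Z = 1}) with hS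
  have hΩm : MeasurableSet Ω := by
    rw [hΩU]
    exact hU.measurableSet.inter
      (isClosed_le continuous_const (by fun_prop) : IsClosed upperHalf).measurableSet
  have hSm : MeasurableSet S := measurableSet_ball.inter
    (hΩm.subtype_image (hψ.measurable_indicator (measurableSet_singleton 1)))
  set J : Plane → ℝ := indicator ((fun X => X₀ + X) ⁻¹' S) (fun _ => 1) with hJ
  have hJI : ∀ X ∈ Metric.ball (0 : Plane) ρ, J X = I (X₀ + X) := by
    intro X hX
    have hXΩ := hballΩ ((hmem X).2 hX)
    rcases hψ.indicator_values _ hXΩ with h | h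
    · rw [h, hJ, indicator_of_notMem]
      rintro ⟨-, Z, hZ, hZX⟩
      have : I Z = 1 := hZ
      rw [hZX, h] at this
      exact zero_ne_one this
    · rw [h, hJ, indicator_of_mem]
      exact ⟨(hmem X).2 hX, ⟨_, hXΩ⟩, h, rfl⟩
  have hJone : ∀ᵐ X, X ∈ Metric.ball (0 : Plane) ρ → 0 < u X → J X = 1 := by
    have h1 := (ae_restrict_iff' hΩm).1 hψ.positivity_le
    have h2 := (measurePreserving_add_left (volume : Measure Plane) X₀).quasiMeasurePreserving.ae h1
    filter_upwards [h2] with X hX hXB hpos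
    have hXΩ := hballΩ ((hmem X).2 hXB)
    have h3 := hX hXΩ
    rw [indicator_of_mem (by rw [mem_ofPred_eq, huψ X hXB]; exact hpos)] at h3
    rw [hJI X hXB]
    rcases hψ.indicator_values _ hXΩ with h | h
    · rw [h] at h3; norm_num at h3
    · exact h
  have hstat : ∀ η : Plane → Plane, ContDiff ℝ 1 η → HasCompactSupport η →
      tsupport η ⊆ Metric.ball 0 ρ → ∫ X, variationIntegrand (X₀ 1) 1 u J η X = 0 := by
    intro η hη hηc hηs
    set η' : Plane → Plane := fun Z => η (-X₀ + Z) with hη'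
    have hts : tsupport η' = (fun Z => -X₀ + Z) ⁻¹' tsupport η :=
      tsupport_comp_eq_preimage η (Homeomorph.addLeft (-X₀))
    have htsB : tsupport η' ⊆ Metric.ball X₀ ρ := by
      rw [hts]
      intro Z hZ
      have := hηs hZ
      rw [← hmem] at this
      simpa using this
    have hadm : IsAdmissibleField Ω η' := by
      refine ⟨hη.comp (by fun_prop), hηc.comp_homeomorph (Homeomorph.addLeft (-X₀)),
        inter_subset_left.trans (htsB.trans hballΩ), fun X hX => ?_⟩
      have : X ∉ tsupport η' := fun h => by
        have := (hyball X (htsB h)).1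
        rw [hX] at this
        exact lt_irrefl _ this
      rw [image_eq_zero_of_notMem_tsupport this]; rfl
    have h1 := hψ.stationary η' hadm
    have hfd : ∀ X, fderiv ℝ η' (X₀ + X) = fderiv ℝ η X := by
      intro X
      simp only [hη']
      rw [fderiv_comp_add_left]
      simp
    have hηX : ∀ X, η' (X₀ + X) = η X := by
      intro X; simp [hη']
    unfold innerVariation at h1
    rw [setIntegral_eq_integral_of_forall_compl_eq_zero, ← integral_add_left_eq_self _ X₀] at h1
    · rw [← h1]
      refine integral_congr_ae ?_
      filter_upwards [hgrad] with X hX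
      by_cases hXs : X ∈ tsupport η
      · have hXB := hηs hXs
        unfold variationIntegrand
        rw [hX hXB, ← hJI X hXB]
        simp only [divergence, hfd, height, hηX]
        simp
      · rw [variationIntegrand_eq_zero hXs]
        simp [divergence, hfd, hηX, image_eq_zero_of_notMem_tsupport hXs,
          image_eq_zero_of_notMem_tsupport fun h' => hXs (tsupport_fderiv_subset ℝ h')]
    · intro X hX
      have hXs : X ∉ tsupport η' := fun h => hX (hballΩ (htsB h))
      simp [divergence, image_eq_zero_of_notMem_tsupport hXs,
          image_eq_zero_of_notMem_tsupport fun h' => hXs (tsupport_fderiv_subset ℝ h')]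
  refine ⟨L, ρ, u, J, ⟨hy, hρpos, one_pos, by rw [one_mul]; exact min_le_right _ _, hulip, ?_, ?_,
    ?_, ?_, ?_, hJone, hstat⟩, hball, huψ⟩
  · rw [← huψ 0 (Metric.mem_ball_self hρpos), add_zero, hψ0]
  · intro X hX
    rw [← huψ X hX]
    exact hψ.nonneg _ (hballΩ ((hmem X).2 hX))
  · intro h hh hs
    set D' : Set Plane := {X | X ∈ Metric.ball (0 : Plane) ρ ∧ 0 < u X} with hD'
    have hD'o : IsOpen D' :=
      Metric.isOpen_ball.inter (isOpen_lt continuous_const hulip.continuous)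
    have hb : ∀ X ∈ D', 0 < height (X₀ 1) 1 X := by
      intro X hX
      have := (hyball _ ((hmem X).2 hX.1)).1
      simpa [height] using this
    have huC : ContDiffOn ℝ 2 u D' := by
      have h1 : ContDiffOn ℝ 2 (fun X => ψ (X₀ + X)) D' :=
        hDC.comp (by fun_prop) fun X hX => ⟨(hmem X).2 hX.1, by
          rw [mem_ofPred_eq, huψ X hX.1]; exact hX.2⟩
      exact h1.congr fun X hX => (huψ X hX.1).symm
    refine integral_inner_gradient_eq_zero hD'o hb huC
      (divergence_form_of_stationary hD'o hb huC fun η hη hηc hηs => ?_) hh hs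
    rw [← hstat η hη hηc (hηs.trans fun X hX => hX.1)]
    refine integral_congr_ae ?_
    filter_upwards [hJone] with X hX
    by_cases hXs : X ∈ tsupport η
    · have := hηs hXs
      unfold variationIntegrand
      rw [hX this.1 this.2]
    · rw [variationIntegrand_eq_zero hXs, variationIntegrand_eq_zero hXs]
  · exact measurable_const.indicator (measurable_const_add X₀ hSm)
  · intro X
    by_cases hX : X ∈ (fun X => X₀ + X) ⁻¹' S
    · right; rw [hJ, indicator_of_mem hX]
    · left; rw [hJ, indicator_of_notMem hX]

theorem ae_comp_smul {P : Plane → Prop} {s : ℝ} (hs : s ≠ 0) (h : ∀ᵐ X, P X) :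
    ∀ᵐ X, P (s • X) := by
  rw [ae_iff] at h ⊢
  have := Measure.addHaar_preimage_smul (volume : Measure Plane) hs {X | ¬ P X}
  rw [h, mul_zero] at this
  exact this

theorem fderiv_dilate {F : Type*} [NormedAddCommGroup F] [NormedSpace ℝ F] (η : Plane → F)
    {s : ℝ} (hs : s ≠ 0) (X : Plane) :
    fderiv ℝ (fun Z => η (s⁻¹ • Z)) (s • X) = s⁻¹ • fderiv ℝ η X := by
  rw [fderiv_comp_smul s⁻¹, smul_smul, inv_mul_cancel₀ hs, one_smul]

theorem gradient_dilate (u : Plane → ℝ) {s : ℝ} (hs : s ≠ 0) (X : Plane) :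
    gradient (fun Z => u (s • Z) / s) X = gradient u (s • X) := by
  have h : (fun Z => u (s • Z) / s) = fun Z => s⁻¹ • u (s • Z) := by
    ext Z; simp [div_eq_inv_mul]
  have h2 : fderiv ℝ (fun Z => s⁻¹ • u (s • Z)) X = fderiv ℝ u (s • X) := by
    change fderiv ℝ (s⁻¹ • fun Z => u (s • Z)) X = _
    rw [fderiv_const_smul_field, Pi.smul_apply, fderiv_comp_smul s, smul_smul, inv_mul_cancel₀ hs, one_smul]
  rw [h, gradient, gradient, h2]

theorem lipschitzWith_dilate {u : Plane → ℝ} {L : ℝ≥0} (hu : LipschitzWith L u) {s : ℝ}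
    (hs : 0 < s) : LipschitzWith L fun X => u (s • X) / s := by
  refine LipschitzWith.of_dist_le_mul fun X Z => ?_
  have h := hu.dist_le_mul (s • X) (s • Z)
  rw [dist_smul₀, Real.norm_of_nonneg hs.le, Real.dist_eq] at h
  rw [Real.dist_eq, ← sub_div, abs_div, abs_of_pos hs, div_le_iff₀ hs]
  linarith

theorem tsupport_dilate {F : Type*} [Zero F] (η : Plane → F) {s : ℝ} (hs : s ≠ 0) :
    tsupport (fun Z => η (s⁻¹ • Z)) = (fun Z => s⁻¹ • Z) ⁻¹' tsupport η :=
  tsupport_comp_eq_preimage η (Homeomorph.smulOfNeZero s⁻¹ (inv_ne_zero hs))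

theorem smul_mem_ball_iff {s ρ : ℝ} (hs : 0 < s) (X : Plane) :
    s • X ∈ Metric.ball (0 : Plane) ρ ↔ X ∈ Metric.ball (0 : Plane) (ρ / s) := by
  rw [mem_ball_zero_iff, mem_ball_zero_iff, norm_smul, Real.norm_of_nonneg hs.le, lt_div_iff₀ hs,
    mul_comm]

/-- Blowing up: the class of pairs is invariant under `u ↦ u (s X) / s`, `J ↦ J (s X)`. -/
theorem StatPair.dilate {y₀ : ℝ} {L : ℝ≥0} {ρ r : ℝ} {u J : Plane → ℝ}
    (h : StatPair y₀ L ρ r u J) {s : ℝ} (hs : 0 < s) :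
    StatPair y₀ L (ρ / s) (r * s) (fun X => u (s • X) / s) (fun X => J (s • X)) := by
  have hheight : ∀ X, height y₀ r (s • X) = height y₀ (r * s) X := by
    intro X; simp [height]; ring
  have hball := fun X => smul_mem_ball_iff (ρ := ρ) hs X
  refine ⟨h.pos, div_pos h.radius_pos hs, mul_pos h.scale_pos hs, ?_, lipschitzWith_dilate h.lip hs,
    by simp [h.zero], fun X hX => div_nonneg (h.nonneg _ ((hball X).2 hX)) hs.le, ?_,
    h.measurable.comp (measurable_const_smul s), fun X => h.values _, ?_, ?_⟩
  · have := h.small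
    field_simp
    linarith
  · intro f hf hfs
    set f' : Plane → ℝ := fun Z => f (s⁻¹ • Z) with hf'
    have hfL : LipTest f' := by
      obtain ⟨⟨K, hK⟩, hc⟩ := hf
      exact ⟨⟨_, hK.comp (lipschitzWith_smul s⁻¹)⟩,
        hc.comp_homeomorph (Homeomorph.smulOfNeZero s⁻¹ (inv_ne_zero hs.ne'))⟩
    have h1 := h.weak f' hfL ?_
    · have h2 := integral_comp_affine
        (fun Z => (1 / height y₀ r Z) * inner ℝ (gradient u Z) (gradient f' Z)) 0 hs
      rw [h1, smul_zero] at h2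
      have h3 : ∀ X, gradient f' (s • X) = s⁻¹ • gradient f X := by
        intro X
        simp only [gradient, hf']
        rw [fderiv_dilate f hs.ne', map_smul]
      simp only [zero_add, h3, hheight, inner_smul_right] at h2
      have h4 : ∀ X, 1 / height y₀ (r * s) X * (s⁻¹ * inner ℝ (gradient u (s • X)) (gradient f X))
          = s⁻¹ * (1 / height y₀ (r * s) X * inner ℝ (gradient (fun X => u (s • X) / s) X)
            (gradient f X)) := by
        intro X
        rw [gradient_dilate u hs.ne']; ring
      simp only [h4] at h2
      rw [integral_const_mul] at h2
      exact (mul_eq_zero.1 h2).resolve_left (inv_ne_zero hs.ne')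
    · rw [tsupport_dilate f hs.ne']
      intro Z hZ
      obtain ⟨h1, h2⟩ := hfs hZ
      rw [← hball, smul_inv_smul₀ hs.ne'] at h1
      rw [smul_inv_smul₀ hs.ne'] at h2
      exact ⟨h1, by simpa [hs] using h2⟩
  · filter_upwards [ae_comp_smul hs.ne' h.one] with X hX hXB hpos
    exact hX ((hball X).2 hXB) (by simpa [hs] using hpos)
  · intro η hη hηc hηs
    set η' : Plane → Plane := fun Z => η (s⁻¹ • Z) with hη'
    have h1 := h.stationary η' (hη.comp (by fun_prop))
      (hηc.comp_homeomorph (Homeomorph.smulOfNeZero s⁻¹ (inv_ne_zero hs.ne'))) ?_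
    · have h2 := integral_comp_affine (variationIntegrand y₀ r u J η') 0 hs
      rw [h1, smul_zero] at h2
      have h3 : ∀ X, fderiv ℝ η' (s • X) = s⁻¹ • fderiv ℝ η X := fun X => fderiv_dilate η hs.ne' X
      have h3' : ∀ X, η' (s • X) = η X := fun X => by
        simp only [hη']; rw [inv_smul_smul₀ hs.ne']
      have h4 : ∀ X, variationIntegrand y₀ r u J η' ((0 : Plane) + s • X)
          = s⁻¹ * variationIntegrand y₀ (r * s) (fun X => u (s • X) / s) (fun X => J (s • X))
            η X := by
        intro X
        unfold variationIntegrand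
        rw [zero_add, divergence_eq, divergence_eq, h3, h3', gradient_dilate u hs.ne', hheight]
        have hss : s⁻¹ * s = 1 := inv_mul_cancel₀ hs.ne'
        simp only [smul_apply, PiLp.smul_apply, inner_smul_right, smul_eq_mul]
        linear_combination (r * (η X).ofLp 1 *
          (1 / height y₀ (r * s) X ^ 2 * ‖gradient u (s • X)‖ ^ 2 - J (s • X))) * hss
      simp only [h4] at h2
      rw [integral_const_mul] at h2
      exact (mul_eq_zero.1 h2).resolve_left (inv_ne_zero hs.ne')
    · rw [tsupport_dilate η hs.ne']
      intro Z hZ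
      have h1 := hηs hZ
      rwa [← hball, smul_inv_smul₀ hs.ne'] at h1

/-! ### The energy identity -/

/-- At a minimum the gradient vanishes. -/
theorem gradient_eq_zero_of_isLocalMin {w : Plane → ℝ} {X : Plane} (h : IsLocalMin w X) :
    gradient w X = 0 := by
  rw [gradient, h.fderiv_eq_zero, map_zero]

theorem gradient_fun_mul {f g : Plane → ℝ} {X : Plane} (hf : DifferentiableAt ℝ f X)
    (hg : DifferentiableAt ℝ g X) :
    gradient (fun Z => f Z * g Z) X = f X • gradient g X + g X • gradient f X := by
  simp only [gradient]
  rw [fderiv_fun_mul hf hg, map_add, map_smul, map_smul]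

theorem LipTest.norm_gradient_bounded {h : Plane → ℝ} (hh : LipTest h) :
    ∃ M, 0 ≤ M ∧ ∀ X, ‖gradient h X‖ ≤ M := by
  obtain ⟨⟨K, hK⟩, -⟩ := hh
  exact ⟨K, K.2, norm_gradient_le hK⟩

theorem gradient_eq_zero_of_notMem_tsupport {f : Plane → ℝ} {X : Plane} (h : X ∉ tsupport f) :
    gradient f X = 0 := by
  rw [gradient, fderiv_eq_zero_of_notMem_tsupport h, map_zero]

/-- The energy identity `∫ a |∇w|² ζ = - ∫ a w ∇w · ∇ζ` for a nonnegative function `w` which is a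
weak solution of `div (a ∇w) = 0` in the set where it is positive. It is obtained by testing with
`(w - ε)₊ ζ`. -/
theorem energy_identity {w a : Plane → ℝ} {L : ℝ≥0} {ρ M : ℝ} (hw : LipschitzWith L w)
    (ha : Measurable a) (haM : ∀ X, ‖X‖ < ρ → |a X| ≤ M)
    (h0 : ∀ X ∈ Metric.ball (0 : Plane) ρ, 0 ≤ w X)
    (hweak : ∀ h, LipTest h → tsupport h ⊆ {X | X ∈ Metric.ball (0 : Plane) ρ ∧ 0 < w X} →
      ∫ X, a X * inner ℝ (gradient w X) (gradient h X) = 0)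
    {ζ : Plane → ℝ} (hζ : LipTest ζ) (hζs : tsupport ζ ⊆ Metric.ball 0 ρ) :
    ∫ X, a X * (‖gradient w X‖ ^ 2 * ζ X + w X * inner ℝ (gradient w X) (gradient ζ X)) = 0 := by
  have htr : ∀ ε : ℝ, LipschitzWith L fun X => max (w X - ε) 0 := fun ε => by
    have h1 : LipschitzWith L fun X => w X - ε := by
      simpa using hw.sub (LipschitzWith.const ε)
    simpa using h1.max_const 0
  set ε : ℕ → ℝ := fun n => 1 / ((n : ℝ) + 1) with hε
  have hεpos : ∀ n, 0 < ε n := fun n => by positivity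
  have hεlim : Tendsto ε atTop (𝓝 0) := tendsto_one_div_add_atTop_nhds_zero_nat
  -- the integrand of the equation tested with `(w - εₙ)₊ ζ`
  set F : ℕ → Plane → ℝ := fun n X => a X * (indicator {Z | ε n < w Z} (fun _ => (1 : ℝ)) X *
    ‖gradient w X‖ ^ 2 * ζ X + max (w X - ε n) 0 * inner ℝ (gradient w X) (gradient ζ X)) with hF
  have hFzero : ∀ n, ∫ X, F n X = 0 := by
    intro n
    have hL : LipTest fun X => max (w X - ε n) 0 * ζ X := hζ.mul_left (htr (ε n))
    rw [← hweak _ hL]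
    · refine integral_congr_ae ?_
      filter_upwards [hw.ae_differentiableAt, (htr (ε n)).ae_differentiableAt,
        hζ.ae_differentiableAt] with X hX1 hX2 hX3
      rw [gradient_fun_mul hX2 hX3]
      have hg : gradient (fun X => max (w X - ε n) 0) X
          = indicator {Z | ε n < w Z} (fun _ => (1 : ℝ)) X • gradient w X := by
        by_cases hX : ε n < w X
        · rw [indicator_of_mem (by exact hX), one_smul]
          have h1 : (fun X => max (w X - ε n) 0) =ᶠ[𝓝 X] fun X => w X - ε n := by
            filter_upwards [hw.continuous.continuousAt.eventually_mem (Ioi_mem_nhds hX)] with Z hZ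
            have : ε n < w Z := hZ
            exact max_eq_left (by linarith)
          rw [h1.gradient_eq, gradient, gradient, fderiv_sub_const]
        · rw [indicator_of_notMem (by exact hX), zero_smul]
          refine gradient_eq_zero_of_isLocalMin (Eventually.of_forall fun Z => ?_)
          change max (w X - ε n) 0 ≤ max (w Z - ε n) 0
          rw [max_eq_right (by linarith [not_lt.1 hX])]
          exact le_max_right _ _
      rw [hg, inner_add_right, inner_smul_right, inner_smul_right, inner_smul_right,
        real_inner_self_eq_norm_sq]
      simp only [hF]
      ring
    · have hcl : IsClosed {X | ε n ≤ w X} := isClosed_le continuous_const hw.continuous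
      have h1 : tsupport (fun X => max (w X - ε n) 0 * ζ X) ⊆ {X | ε n ≤ w X} := by
        refine closure_minimal (fun X hX => ?_) hcl
        by_contra h
        refine hX ?_
        have h' : w X < ε n := not_le.1 h
        simp only
        rw [max_eq_right (by linarith), zero_mul]
      intro X hX
      exact ⟨hζs (tsupport_mul_subset_right hX), (hεpos n).trans_le (h1 hX)⟩
  obtain ⟨N, hN0, hN⟩ := hζ.bounded
  obtain ⟨N', hN'0, hN'⟩ := hζ.norm_gradient_bounded
  -- an integrable bound
  set B : Plane → ℝ := indicator (Metric.ball 0 ρ) fun _ =>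
    |M| * ((L : ℝ) ^ 2 * N + (|w 0| + L * ρ) * (L * N')) with hB
  have hBint : Integrable B :=
    (integrable_indicator_iff measurableSet_ball).2 (integrableOn_const measure_ball_lt_top.ne)
  have hgm := measurable_gradient w
  have hgζ := measurable_gradient ζ
  have hlim : Tendsto (fun n => ∫ X, F n X) atTop (𝓝 (∫ X, a X *
      (‖gradient w X‖ ^ 2 * ζ X + w X * inner ℝ (gradient w X) (gradient ζ X)))) := by
    refine tendsto_integral_of_dominated_convergence B (fun n => ?_) hBint (fun n => ?_) ?_
    · refine Measurable.aestronglyMeasurable (ha.mul ?_)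
      have hm : MeasurableSet {Z | ε n < w Z} :=
        measurableSet_lt measurable_const hw.continuous.measurable
      exact (((measurable_const.indicator hm).mul (hgm.norm.pow_const 2)).mul
        hζ.continuous.measurable).add ((htr (ε n)).continuous.measurable.mul
          (hgm.inner hgζ))
    · refine ae_of_all _ fun X => ?_
      by_cases hX : X ∈ Metric.ball (0 : Plane) ρ
      · have hX' : ‖X‖ < ρ := by simpa using hX
        have hρ0 : 0 ≤ ρ := (norm_nonneg X).trans hX'.le
        simp only [hF, hB, indicator_of_mem hX]
        rw [norm_mul]
        refine mul_le_mul ((haM X hX').trans (le_abs_self M)) ?_ (norm_nonneg _) (abs_nonneg _)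
        refine (norm_add_le _ _).trans (add_le_add ?_ ?_)
        · rw [norm_mul, norm_mul]
          have h1 : ‖indicator {Z | ε n < w Z} (fun _ => (1 : ℝ)) X‖ ≤ 1 := by
            refine (norm_indicator_le_norm_self _ _).trans (by simp)
          have h2 : ‖‖gradient w X‖ ^ 2‖ ≤ (L : ℝ) ^ 2 := by
            rw [norm_pow, norm_norm]
            exact pow_le_pow_left₀ (norm_nonneg _) (norm_gradient_le hw X) 2
          calc _ ≤ 1 * (L : ℝ) ^ 2 * N := by
                gcongr
                exact hN X
            _ = _ := by ring
        · rw [norm_mul]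
          refine mul_le_mul ?_ ?_ (norm_nonneg _) (by positivity)
          · rw [Real.norm_of_nonneg (le_max_right _ _)]
            refine max_le ?_ (by positivity)
            have h1 := hw.dist_le_mul X 0
            rw [Real.dist_eq, dist_zero_right] at h1
            have h2 : (L : ℝ) * ‖X‖ ≤ L * ρ := mul_le_mul_of_nonneg_left hX'.le L.2
            have h3 := le_abs_self (w X - w 0)
            have h4 := le_abs_self (w 0)
            linarith [hεpos n]
          · refine (norm_inner_le_norm _ _).trans ?_
            exact mul_le_mul (norm_gradient_le hw X) (hN' X) (norm_nonneg _) L.2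
      · have hXs : X ∉ tsupport ζ := fun h => hX (hζs h)
        simp only [hF, hB, indicator_of_notMem hX]
        rw [gradient_eq_zero_of_notMem_tsupport hXs, image_eq_zero_of_notMem_tsupport hXs]
        simp
    · refine ae_of_all _ fun X => ?_
      by_cases hX : X ∈ Metric.ball (0 : Plane) ρ
      · rcases (h0 X hX).eq_or_lt with hw0 | hpos
        -- `w` has a local minimum at `X`, so its gradient vanishes there
        · have hg : gradient w X = 0 := by
            refine gradient_eq_zero_of_isLocalMin ?_
            filter_upwards [Metric.isOpen_ball.mem_nhds hX] with Z hZ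
            rw [← hw0]; exact h0 Z hZ
          simp only [hF, hg]
          simp
        · simp only [hF]
          refine Tendsto.const_mul _ (Tendsto.add ?_ (Tendsto.mul_const _ ?_))
          · refine tendsto_const_nhds.congr' ?_
            filter_upwards [hεlim.eventually_mem (Iio_mem_nhds hpos)] with n hn
            rw [indicator_of_mem (by exact hn), one_mul]
          · have h1 : Tendsto (fun n => max (w X - ε n) 0) atTop (𝓝 (max (w X - 0) 0)) :=
              (tendsto_const_nhds.sub hεlim).max tendsto_const_nhds
            rwa [sub_zero, max_eq_left hpos.le] at h1
      · have hXs : X ∉ tsupport ζ := fun h => hX (hζs h)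
        simp only [hF]
        rw [gradient_eq_zero_of_notMem_tsupport hXs, image_eq_zero_of_notMem_tsupport hXs]
        simp
  simp only [hFzero] at hlim
  exact tendsto_nhds_unique hlim tendsto_const_nhds

/-! ### The monotonicity identity -/

/-- Measurable functions that are bounded in the ball of radius `R`. -/
def BddOnBall (R : ℝ) (f : Plane → ℝ) : Prop :=
  Measurable f ∧ ∃ M, 0 ≤ M ∧ ∀ X, ‖X‖ < R → |f X| ≤ M

namespace BddOnBall

variable {R : ℝ} {f g : Plane → ℝ}

theorem add (hf : BddOnBall R f) (hg : BddOnBall R g) : BddOnBall R fun X => f X + g X := by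
  obtain ⟨hf, M, hM0, hM⟩ := hf
  obtain ⟨hg, N, hN0, hN⟩ := hg
  exact ⟨hf.add hg, M + N, by positivity, fun X hX =>
    (abs_add_le _ _).trans (add_le_add (hM X hX) (hN X hX))⟩

theorem mul (hf : BddOnBall R f) (hg : BddOnBall R g) : BddOnBall R fun X => f X * g X := by
  obtain ⟨hf, M, hM0, hM⟩ := hf
  obtain ⟨hg, N, hN0, hN⟩ := hg
  refine ⟨hf.mul hg, M * N, by positivity, fun X hX => ?_⟩
  rw [abs_mul]
  exact mul_le_mul (hM X hX) (hN X hX) (abs_nonneg _) hM0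

theorem neg (hf : BddOnBall R f) : BddOnBall R fun X => -f X := by
  obtain ⟨hf, M, hM0, hM⟩ := hf
  exact ⟨hf.neg, M, hM0, fun X hX => by rw [abs_neg]; exact hM X hX⟩

theorem sub (hf : BddOnBall R f) (hg : BddOnBall R g) : BddOnBall R fun X => f X - g X := by
  simpa only [sub_eq_add_neg] using hf.add hg.neg

theorem const (c : ℝ) : BddOnBall R fun _ => c :=
  ⟨measurable_const, |c|, abs_nonneg c, fun _ _ => le_rfl⟩

theorem pow (hf : BddOnBall R f) (n : ℕ) : BddOnBall R fun X => f X ^ n := by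
  obtain ⟨hf, M, hM0, hM⟩ := hf
  refine ⟨hf.pow_const n, M ^ n, by positivity, fun X hX => ?_⟩
  rw [abs_pow]
  exact pow_le_pow_left₀ (abs_nonneg _) (hM X hX) n

theorem of_continuous (hf : Continuous f) : BddOnBall R f := by
  obtain ⟨M, hM⟩ := (isCompact_closedBall (0 : Plane) R).exists_bound_of_continuousOn
    hf.continuousOn
  refine ⟨hf.measurable, |M|, abs_nonneg M, fun X hX => ?_⟩
  exact (hM X (by simpa using hX.le)).trans (le_abs_self M)

theorem integrable {M : Type*} [NormedAddCommGroup M] (hf : BddOnBall R f)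
    (h0 : ∀ X, R ≤ ‖X‖ → f X = 0) : Integrable f := by
  obtain ⟨hf, M, hM0, hM⟩ := hf
  refine integrable_of_bound (M := M) hf.aestronglyMeasurable (ae_of_all _ fun X => ?_) h0
  rcases lt_or_ge ‖X‖ R with h | h
  · exact hM X h
  · rw [h0 X h]; simpa using hM0

theorem of_abs_le {M : ℝ} (hf : Measurable f) (hM : ∀ X, |f X| ≤ M) : BddOnBall R f :=
  ⟨hf, |M|, abs_nonneg M, fun X _ => (hM X).trans (le_abs_self M)⟩

end BddOnBall

variable {y₀ : ℝ} {L : ℝ≥0} {ρ r : ℝ} {u J : Plane → ℝ}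

namespace StatPair

theorem bdd_weight (h : StatPair y₀ L ρ r u J) {R : ℝ} (hR : R ≤ ρ) :
    BddOnBall R fun X => 1 / height y₀ r X := by
  refine ⟨measurable_const.div (continuous_height y₀ r).measurable, 2 / y₀,
    (div_pos two_pos h.pos).le, fun X hX => ?_⟩
  have h1 := (h.height_mem (hX.le.trans hR)).1
  have h2 : 0 < y₀ / 2 := half_pos h.pos
  rw [abs_of_pos (one_div_pos.2 (h2.trans_le h1))]
  calc 1 / height y₀ r X ≤ 1 / (y₀ / 2) := one_div_le_one_div_of_le h2 h1
    _ = 2 / y₀ := by rw [one_div_div]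

theorem abs_density_le (h : StatPair y₀ L ρ r u J) (X : Plane) : |J X| ≤ 1 := by
  rcases h.values X with h | h <;> rw [h] <;> simp

theorem bdd_density (h : StatPair y₀ L ρ r u J) (R : ℝ) : BddOnBall R J :=
  .of_abs_le h.measurable h.abs_density_le

theorem abs_le (h : StatPair y₀ L ρ r u J) (X : Plane) : |u X| ≤ L * ‖X‖ := by
  have := h.lip.dist_le_mul X 0
  rwa [h.zero, Real.dist_eq, sub_zero, dist_zero_right] at this

end StatPair

theorem bdd_norm_gradient {w : Plane → ℝ} (hw : LipschitzWith L w) (R : ℝ) :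
    BddOnBall R fun X => ‖gradient w X‖ :=
  .of_abs_le (measurable_gradient w).norm fun X => by
    rw [abs_norm]; exact norm_gradient_le hw X

theorem bdd_fderiv {w : Plane → ℝ} (hw : LipschitzWith L w) (R : ℝ) (v : Plane) :
    BddOnBall R fun X => fderiv ℝ w X v :=
  .of_abs_le (measurable_fderiv_apply w v) (abs_fderiv_le hw · v)

theorem bdd_gradient_self {w : Plane → ℝ} (hw : LipschitzWith L w) (R : ℝ) :
    BddOnBall R fun X => inner ℝ (gradient w X) X := by
  have h1 : ∀ i : Fin 2, BddOnBall R fun X => fderiv ℝ w X (stdVec i) * X i := fun i =>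
    (bdd_fderiv hw R _).mul (.of_continuous (by fun_prop))
  have := (h1 0).add (h1 1)
  refine ⟨(measurable_gradient w).inner measurable_id, ?_⟩
  obtain ⟨-, M, hM0, hM⟩ := this
  refine ⟨M, hM0, fun X hX => ?_⟩
  change |inner ℝ (gradient w X) X| ≤ M
  rw [inner_gradient_left, fderiv_eq_sum]
  exact hM X hX

/-- A radial profile `k 0`, as a function of `t = |X|²`, together with its derivatives `k 1`, `k 2`
and `k 3` for `t ≥ 0`; all of them vanish for `t ≥ 3`. -/
structure RadialProfile (k : Fin 4 → ℝ → ℝ) : Prop where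
  deriv0 : ∀ t, 0 ≤ t → HasDerivAt (k 0) (k 1 t) t
  deriv1 : ∀ t, 0 ≤ t → HasDerivAt (k 1) (k 2 t) t
  deriv2 : ∀ t, 0 ≤ t → HasDerivAt (k 2) (k 3 t) t
  contDiff : ∀ j, ContDiff ℝ 1 fun X : Plane => k j (‖X‖ ^ 2)
  zero : ∀ j t, 3 ≤ t → k j t = 0

theorem fderiv_radial {f : ℝ → ℝ} {f' : ℝ} {X : Plane} (hf : HasDerivAt f f' (‖X‖ ^ 2))
    (v : Plane) : fderiv ℝ (fun Z : Plane => f (‖Z‖ ^ 2)) X v = 2 * f' * inner ℝ X v := by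
  have h := hf.comp_hasFDerivAt X (hasStrictFDerivAt_norm_sq X).hasFDerivAt
  have h2 : fderiv ℝ (fun Z : Plane => f (‖Z‖ ^ 2)) X = f' • (2 • innerSL ℝ X) := h.fderiv
  rw [h2]
  simp
  ring

theorem hasCompactSupport_of_norm {F : Type*} [Zero F] {f : Plane → F} {R : ℝ}
    (h : ∀ X, R ≤ ‖X‖ → f X = 0) : HasCompactSupport f :=
  HasCompactSupport.intro (isCompact_closedBall (0 : Plane) R) fun X hX => h X (by
    rw [Metric.mem_closedBall, dist_zero_right, not_le] at hX
    exact hX.le)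

theorem tsupport_subset_of_norm {F : Type*} [Zero F] {f : Plane → F} {R : ℝ}
    (h : ∀ X, R ≤ ‖X‖ → f X = 0) : tsupport f ⊆ Metric.closedBall 0 R :=
  closure_minimal (fun X hX => by
    by_contra hX'
    rw [Metric.mem_closedBall, dist_zero_right, not_le] at hX'
    exact hX (h X hX'.le)) Metric.isClosed_closedBall

/-- The deviation `∇u · X - u` from homogeneity of degree one. -/
noncomputable def homDefect (u : Plane → ℝ) (X : Plane) : ℝ := inner ℝ (gradient u X) X - u X

theorem RadialProfile.zero_of_norm {k : Fin 4 → ℝ → ℝ} (hk : RadialProfile k) (j : Fin 4)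
    {X : Plane} (hX : 9 / 5 ≤ ‖X‖) : k j (‖X‖ ^ 2) = 0 :=
  hk.zero j _ (by nlinarith)

/-- The coefficients of the profile and its derivatives in the remainder of the monotonicity
identity. -/
noncomputable def monotonicityCoeff (y₀ r : ℝ) (u J : Plane → ℝ) : Fin 4 → Plane → ℝ :=
  ![fun X => -2 * height y₀ r X * J X + r * X 1 *
      ((1 / height y₀ r X) ^ 2 * ‖gradient u X‖ ^ 2 - J X),
    fun X => -16 * (1 / height y₀ r X) * u X ^ 2
      + 6 * r * X 1 * (1 / height y₀ r X) ^ 2 * u X ^ 2 - 2 * height y₀ r X * J X * ‖X‖ ^ 2,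
    fun X => -20 * (1 / height y₀ r X) * u X ^ 2 * ‖X‖ ^ 2
      + 2 * r * X 1 * (1 / height y₀ r X) ^ 2 * u X ^ 2 * ‖X‖ ^ 2,
    fun X => -4 * (1 / height y₀ r X) * u X ^ 2 * (‖X‖ ^ 2) ^ 2]

/-- The remainder terms in the monotonicity identity, linear in the profile. -/
noncomputable def monotonicityRemainder (y₀ r : ℝ) (u J : Plane → ℝ) (k : Fin 4 → ℝ → ℝ)
    (X : Plane) : ℝ := ∑ j, monotonicityCoeff y₀ r u J j X * k j (‖X‖ ^ 2)

theorem monotonicityRemainder_eq (y₀ r : ℝ) (u J : Plane → ℝ) (k : Fin 4 → ℝ → ℝ) (X : Plane) :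
    monotonicityRemainder y₀ r u J k X =
      (-2 * height y₀ r X * J X + r * X 1 *
        ((1 / height y₀ r X) ^ 2 * ‖gradient u X‖ ^ 2 - J X)) * k 0 (‖X‖ ^ 2)
      + (-16 * (1 / height y₀ r X) * u X ^ 2
        + 6 * r * X 1 * (1 / height y₀ r X) ^ 2 * u X ^ 2 - 2 * height y₀ r X * J X * ‖X‖ ^ 2)
        * k 1 (‖X‖ ^ 2)
      + (-20 * (1 / height y₀ r X) * u X ^ 2 * ‖X‖ ^ 2
        + 2 * r * X 1 * (1 / height y₀ r X) ^ 2 * u X ^ 2 * ‖X‖ ^ 2) * k 2 (‖X‖ ^ 2)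
      + (-4 * (1 / height y₀ r X) * u X ^ 2 * (‖X‖ ^ 2) ^ 2) * k 3 (‖X‖ ^ 2) := by
  rw [monotonicityRemainder, Fin.sum_univ_four]
  rfl

theorem StatPair.bdd_monotonicityCoeff (h : StatPair y₀ L ρ r u J) (hρ : 2 ≤ ρ) (j : Fin 4) :
    BddOnBall 2 (monotonicityCoeff y₀ r u J j) := by
  have Ba := h.bdd_weight hρ
  have BG := (bdd_norm_gradient h.lip 2).pow 2
  have Bb : BddOnBall 2 (height y₀ r) := .of_continuous (continuous_height y₀ r)
  have Bt : BddOnBall 2 fun X : Plane => ‖X‖ ^ 2 := .of_continuous (by fun_prop)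
  have BJ := h.bdd_density 2
  have Bu := (BddOnBall.of_continuous (R := 2) h.lip.continuous).pow 2
  have By : BddOnBall 2 fun X : Plane => X 1 := .of_continuous (by fun_prop)
  have Bc : ∀ c : ℝ, BddOnBall 2 fun _ : Plane => c := fun c => .const c
  fin_cases j
  · exact (((Bc (-2)).mul Bb).mul BJ).add
      (((Bc r).mul By).mul (((Ba.pow 2).mul BG).sub BJ))
  · exact ((((Bc (-16)).mul Ba).mul Bu).add ((((Bc (6 * r)).mul By).mul (Ba.pow 2)).mul Bu)).sub
      ((((Bc 2).mul Bb).mul BJ).mul Bt)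
  · exact ((((Bc (-20)).mul Ba).mul Bu).mul Bt).add
      (((((Bc (2 * r)).mul By).mul (Ba.pow 2)).mul Bu).mul Bt)
  · exact (((Bc (-4)).mul Ba).mul Bu).mul (Bt.pow 2)

/-- Stationarity with respect to the radial field `k₀(|X|²) X`, combined with the energy identity
for the cut-off `2 |X|² k₁(|X|²)` and an integration by parts of `u ∇u`. The combination completes
the square: it expresses a weighted integral of the squared homogeneity defect by terms without
derivatives of `u`, apart from one with the factor `r`. -/
theorem StatPair.monotonicity_identity (h : StatPair y₀ L ρ r u J) (hρ : 2 ≤ ρ)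
    {k : Fin 4 → ℝ → ℝ} (hk : RadialProfile k) :
    Integrable (fun X => 4 * (1 / height y₀ r X) * (- k 1 (‖X‖ ^ 2)) * homDefect u X ^ 2) ∧
    Integrable (monotonicityRemainder y₀ r u J k) ∧
    ∫ X, 4 * (1 / height y₀ r X) * (- k 1 (‖X‖ ^ 2)) * homDefect u X ^ 2
      = ∫ X, monotonicityRemainder y₀ r u J k X := by
  have hkX : ∀ (j) (X : Plane), 9 / 5 ≤ ‖X‖ → k j (‖X‖ ^ 2) = 0 := fun j X hX =>
    hk.zero_of_norm j hX
  have hsq : ∀ X : Plane, 0 ≤ ‖X‖ ^ 2 := fun X => sq_nonneg _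
  have hball : Metric.closedBall (0 : Plane) (9 / 5) ⊆ Metric.ball 0 ρ :=
    Metric.closedBall_subset_ball (by linarith)
  -- the integrands of stationarity for `k₀ X`, of the energy identity for `2 t k₁`, and of the
  -- divergence of `½ a u² c X`, where `c = 12 k₁ + 4 t k₂` is chosen so that the mixed terms
  -- `u ∇u · X` add up to the one in the square of the defect
  set a : Plane → ℝ := fun X => 1 / height y₀ r X with ha
  set S : Plane → ℝ := fun X => inner ℝ (gradient u X) X with hS
  set G : Plane → ℝ := fun X => ‖gradient u X‖ ^ 2 with hG
  set b : Plane → ℝ := height y₀ r with hb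
  set t : Plane → ℝ := fun X => ‖X‖ ^ 2 with ht
  set E1 : Plane → ℝ := fun X => (a X * G X + b X * J X) * (2 * k 0 (t X) + 2 * k 1 (t X) * t X)
    - 2 * a X * (k 0 (t X) * G X + 2 * k 1 (t X) * S X ^ 2)
    - r * (k 0 (t X) * X 1) * (a X ^ 2 * G X - J X) with hE1
  set E2 : Plane → ℝ := fun X => a X * (G X * (2 * k 1 (t X) * t X)
    + u X * (4 * (k 1 (t X) + k 2 (t X) * t X) * S X)) with hE2
  set E3 : Plane → ℝ := fun X => a X * (u X * S X * (12 * k 1 (t X) + 4 * k 2 (t X) * t X))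
    + u X ^ 2 / 2 * (a X * (2 * (12 * k 1 (t X) + 4 * k 2 (t X) * t X)
      + 2 * t X * (16 * k 2 (t X) + 4 * k 3 (t X) * t X))
      - r * X 1 * a X ^ 2 * (12 * k 1 (t X) + 4 * k 2 (t X) * t X)) with hE3
  have Ba : BddOnBall 2 a := h.bdd_weight hρ
  have BS : BddOnBall 2 S := bdd_gradient_self h.lip 2
  have BG : BddOnBall 2 G := (bdd_norm_gradient h.lip 2).pow 2
  have Bb : BddOnBall 2 b := .of_continuous (continuous_height y₀ r)
  have Bt : BddOnBall 2 t := .of_continuous (by fun_prop)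
  have BJ : BddOnBall 2 J := h.bdd_density 2
  have Bu : BddOnBall 2 u := .of_continuous h.lip.continuous
  have Bk : ∀ j, BddOnBall 2 fun X => k j (t X) := fun j => .of_continuous (hk.contDiff j).continuous
  have By : BddOnBall 2 fun X : Plane => X 1 := .of_continuous (by fun_prop)
  have Bc : ∀ c : ℝ, BddOnBall 2 fun _ : Plane => c := fun c => .const c
  have hk2 : ∀ (j) (X : Plane), 2 ≤ ‖X‖ → k j (t X) = 0 := fun j X hX => hkX j X (by linarith)
  have I1 : Integrable E1 := by
    refine BddOnBall.integrable (M := ℝ) (R := 2) ?_ fun X hX => ?_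
    · exact ((((Ba.mul BG).add (Bb.mul BJ)).mul (((Bc 2).mul (Bk 0)).add
        (((Bc 2).mul (Bk 1)).mul Bt))).sub (((Bc 2).mul Ba).mul (((Bk 0).mul BG).add
        (((Bc 2).mul (Bk 1)).mul (BS.pow 2))))).sub
        (((Bc r).mul ((Bk 0).mul By)).mul (((Ba.pow 2).mul BG).sub BJ))
    · simp only [hE1, hk2 _ X hX]; ring
  have I2 : Integrable E2 := by
    refine BddOnBall.integrable (M := ℝ) (R := 2) ?_ fun X hX => ?_
    · exact Ba.mul ((BG.mul (((Bc 2).mul (Bk 1)).mul Bt)).add (Bu.mul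
        (((Bc 4).mul ((Bk 1).add ((Bk 2).mul Bt))).mul BS)))
    · simp only [hE2, hk2 _ X hX]; ring
  -- the integrals vanish
  have Z1 : ∫ X, E1 X = 0 := by
    set η : Plane → Plane := fun X => k 0 (t X) • X with hη
    have hη0 : ∀ X : Plane, 9 / 5 ≤ ‖X‖ → η X = 0 := fun X hX => by
      simp only [hη, ht]; rw [hkX 0 X hX, zero_smul]
    have hηC : ContDiff ℝ 1 η := (hk.contDiff 0).smul contDiff_id
    have hfd : ∀ X v, fderiv ℝ η X v = k 0 (t X) • v + (2 * k 1 (t X) * inner ℝ X v) • X := by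
      intro X v
      have h1 : DifferentiableAt ℝ (fun X : Plane => k 0 (t X)) X :=
        (hk.contDiff 0).differentiable one_ne_zero X
      simp only [hη]
      rw [fderiv_fun_smul h1 differentiableAt_fun_id]
      simp only [fderiv_fun_id, add_apply, smul_apply, ContinuousLinearMap.smulRight_apply,
        ContinuousLinearMap.id_apply, ht]
      rw [fderiv_radial (hk.deriv0 _ (hsq X))]
    rw [← h.stationary η hηC (hasCompactSupport_of_norm hη0)
      ((tsupport_subset_of_norm hη0).trans hball)]
    congr 1
    ext X
    unfold variationIntegrand
    rw [divergence_eq, hfd, hfd, hfd]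
    simp only [hE1, ha, hS, hG, ht, hη, inner_add_right, inner_smul_right,
      real_inner_self_eq_norm_sq, PiLp.add_apply, PiLp.smul_apply, smul_eq_mul,
      real_inner_comm (gradient u X) X]
    simp only [norm_sq_eq X, EuclideanSpace.inner_single_right, PiLp.single_apply]
    simp
    ring
  have Z2 : ∫ X, E2 X = 0 := by
    set ζ : Plane → ℝ := fun X => 2 * k 1 (t X) * t X with hζ
    have hζ0 : ∀ X : Plane, 9 / 5 ≤ ‖X‖ → ζ X = 0 := fun X hX => by
      simp only [hζ, ht]; rw [hkX 1 X hX]; ring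
    have hζC : ContDiff ℝ 1 ζ :=
      (contDiff_const.mul (hk.contDiff 1)).mul (contDiff_norm_sq ℝ)
    have hζL : LipTest ζ := .of_contDiff hζC (hasCompactSupport_of_norm hζ0)
    obtain ⟨am, A, -, hA⟩ := h.bdd_weight le_rfl
    have := energy_identity h.lip am hA h.nonneg h.weak hζL
      ((tsupport_subset_of_norm hζ0).trans hball)
    rw [← this]
    congr 1
    ext X
    have h1 : fderiv ℝ ζ X (gradient u X)
        = 2 * (2 * (k 1 (t X) + k 2 (t X) * t X)) * inner ℝ X (gradient u X) := by
      refine fderiv_radial (f := fun s => 2 * k 1 s * s) ?_ _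
      have := ((hk.deriv1 _ (hsq X)).const_mul 2).mul (hasDerivAt_id (‖X‖ ^ 2))
      refine HasDerivAt.congr_deriv (f := fun s => 2 * k 1 s * s) this ?_
      simp only [ht, id]; ring
    rw [real_inner_comm, inner_gradient_left, h1, real_inner_comm]
    simp only [hE2, ha, hS, hG, hζ]
    ring
  have Z3 : Integrable E3 ∧ ∫ X, E3 X = 0 := by
    set c : Plane → ℝ := fun X => 12 * k 1 (t X) + 4 * k 2 (t X) * t X with hc
    have hc0 : ∀ X : Plane, 9 / 5 ≤ ‖X‖ → c X = 0 := fun X hX => by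
      simp only [hc, ht]; rw [hkX 1 X hX, hkX 2 X hX]; ring
    have hcC : ContDiff ℝ 1 c := (contDiff_const.mul (hk.contDiff 1)).add
      ((contDiff_const.mul (hk.contDiff 2)).mul (contDiff_norm_sq ℝ))
    have hcfd : ∀ X v, fderiv ℝ c X v
        = 2 * (16 * k 2 (t X) + 4 * k 3 (t X) * t X) * inner ℝ X v := by
      intro X v
      refine fderiv_radial (f := fun s => 12 * k 1 s + 4 * k 2 s * s) ?_ _
      have := ((hk.deriv1 _ (hsq X)).const_mul 12).add
        (((hk.deriv2 _ (hsq X)).const_mul 4).mul (hasDerivAt_id (‖X‖ ^ 2)))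
      refine HasDerivAt.congr_deriv (f := fun s => 12 * k 1 s + 4 * k 2 s * s) this ?_
      simp only [ht, id]; ring
    have hcoord : ∀ i : Fin 2, ContDiff ℝ 1 fun X : Plane => X i := fun i => by fun_prop
    have hcoordfd : ∀ (i : Fin 2) (X v : Plane), fderiv ℝ (fun X : Plane => X i) X v = v i := by
      intro i X v
      have h1 : HasFDerivAt (fun X : Plane => X i)
        (EuclideanSpace.proj (𝕜 := ℝ) i : Plane →L[ℝ] ℝ) X :=
        (EuclideanSpace.proj (𝕜 := ℝ) i : Plane →L[ℝ] ℝ).hasFDerivAt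
      rw [h1.fderiv]; rfl
    have hκ : ∀ i : Fin 2, LipTest fun X : Plane => X i * c X := fun i =>
      .of_contDiff ((hcoord i).mul hcC) (hasCompactSupport_of_norm fun X hX => by
        rw [hc0 X hX, mul_zero])
    have hκ0 : ∀ i : Fin 2, ∀ X : Plane, 9 / 5 ≤ ‖X‖ → u X * (u X * (X i * c X)) = 0 :=
      fun i X hX => by rw [hc0 X hX]; ring
    have haC : ContDiffOn ℝ 1 a (Metric.ball 0 ρ) :=
      contDiffOn_const.div (contDiff_height y₀ r).contDiffOn fun X hX => by
        have h1 := (h.height_mem (mem_ball_zero_iff.1 hX).le).1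
        have := h.pos
        exact ne_of_gt (by linarith)
    have hmain := fun i : Fin 2 => integral_fderiv_mul_contDiffOn
      (((hκ i).mul_left h.lip).mul_left h.lip) Metric.isOpen_ball
      ((tsupport_subset_of_norm (hκ0 i)).trans hball) haC (stdVec i)
    have hint := (hmain 0).1.add (hmain 1).1
    have hsum := integral_add (hmain 0).1 (hmain 1).1
    rw [(hmain 0).2, (hmain 1).2, add_zero] at hsum
    have hae : (fun X => E3 X) =ᵐ[volume] fun X => (1 / 2 : ℝ) * (
        (u X * (u X * (X 0 * c X)) * fderiv ℝ a X (stdVec 0)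
          + a X * fderiv ℝ (fun X => u X * (u X * (X 0 * c X))) X (stdVec 0))
        + (u X * (u X * (X 1 * c X)) * fderiv ℝ a X (stdVec 1)
          + a X * fderiv ℝ (fun X => u X * (u X * (X 1 * c X))) X (stdVec 1))) := by
      filter_upwards [h.lip.ae_differentiableAt] with X hX
      have hcd : DifferentiableAt ℝ c X := hcC.differentiable one_ne_zero X
      have hxd : ∀ i : Fin 2, DifferentiableAt ℝ (fun X : Plane => X i) X := fun i =>
        (hcoord i).differentiable one_ne_zero X
      have hxc : ∀ i : Fin 2, DifferentiableAt ℝ (fun X : Plane => X i * c X) X := fun i =>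
        (hxd i).mul hcd
      have huxc : ∀ i : Fin 2, DifferentiableAt ℝ (fun X : Plane => u X * (X i * c X)) X :=
        fun i => hX.mul (hxc i)
      have hfd : ∀ i : Fin 2, fderiv ℝ (fun X => u X * (u X * (X i * c X))) X (stdVec i)
          = 2 * u X * fderiv ℝ u X (stdVec i) * (X i * c X) + u X ^ 2 * (c X
            + X i * (2 * (16 * k 2 (t X) + 4 * k 3 (t X) * t X) * X i)) := by
        intro i
        rw [fderiv_fun_mul hX (huxc i), fderiv_fun_mul hX (hxc i), fderiv_fun_mul (hxd i) hcd]
        simp only [add_apply, smul_apply, smul_eq_mul, hcoordfd, hcfd]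
        rw [EuclideanSpace.inner_single_right]
        simp
        ring
      rw [hfd, hfd]
      by_cases hXρ : X ∈ Metric.ball (0 : Plane) ρ
      · have hbne : height y₀ r X ≠ 0 := by
          have h1 := (h.height_mem (mem_ball_zero_iff.1 hXρ).le).1
          have := h.pos
          exact ne_of_gt (by linarith)
        have hafd : ∀ v : Plane, fderiv ℝ a X v = - (r * v 1) * a X ^ 2 := by
          intro v
          have h1 : HasFDerivAt (height y₀ r) (fderiv ℝ (height y₀ r) X) X :=
            ((contDiff_height y₀ r (n := 1)).differentiable one_ne_zero X).hasFDerivAt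
          have h2 := (hasDerivAt_inv hbne).comp_hasFDerivAt X h1
          have h3 : a = (fun y => y⁻¹) ∘ height y₀ r := by ext Z; simp [ha, hb]
          rw [h3, h2.fderiv]
          simp [fderiv_height]
          ring
        rw [hafd, hafd]
        simp only [hE3, hS, inner_eq_sum (gradient u X) X, gradient_apply]
        have hteq : t X = X 0 ^ 2 + X 1 ^ 2 := norm_sq_eq X
        have hcX : c X = 12 * k 1 (t X) + 4 * k 2 (t X) * t X := rfl
        rw [← hcX]
        simp
        linear_combination (u X ^ 2 * a X * (16 * k 2 (t X) + 4 * k 3 (t X) * t X)) * hteq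
      · have hX9 : 9 / 5 ≤ ‖X‖ := by
          rw [mem_ball_zero_iff, not_lt] at hXρ
          linarith
        have e1 : k 1 (t X) = 0 := hkX 1 X hX9
        have e2 : k 2 (t X) = 0 := hkX 2 X hX9
        have e3 : k 3 (t X) = 0 := hkX 3 X hX9
        simp only [hE3, hc0 X hX9, e1, e2, e3]
        ring
    refine ⟨(hint.const_mul (1 / 2)).congr hae.symm, ?_⟩
    rw [integral_congr_ae hae, integral_const_mul, hsum, mul_zero]
  -- pointwise, the weighted square of the defect is `E1 - E2 + E3` plus the remainder
  have hpt : ∀ X, 4 * (1 / height y₀ r X) * (- k 1 (‖X‖ ^ 2)) * homDefect u X ^ 2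
      = E1 X - E2 X + E3 X + monotonicityRemainder y₀ r u J k X := by
    intro X
    simp only [hE1, hE2, hE3, monotonicityRemainder_eq, homDefect]
    change 4 * a X * (- k 1 (t X)) * (S X - u X) ^ 2 = _
    simp only [hG, hb, ht, ha]
    ring
  have hRem : Integrable (monotonicityRemainder y₀ r u J k) := by
    have hj : ∀ j, Integrable fun X => monotonicityCoeff y₀ r u J j X * k j (‖X‖ ^ 2) := fun j =>
      ((h.bdd_monotonicityCoeff hρ j).mul (Bk j)).integrable (M := ℝ) fun X hX => by
        have e := hk2 j X hX
        simp only [ht] at e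
        rw [e, mul_zero]
    exact integrable_finsetSum _ fun j _ => hj j
  have hInt := ((I1.sub I2).add Z3.1).add hRem
  refine ⟨hInt.congr (ae_of_all _ fun X => (hpt X).symm), hRem, ?_⟩
  rw [integral_congr_ae (ae_of_all _ hpt)]
  have s1 : Integrable fun X => E1 X - E2 X := I1.sub I2
  have s2 : Integrable fun X => E1 X - E2 X + E3 X := s1.add Z3.1
  rw [integral_add s2 hRem, integral_add s1 Z3.1, integral_sub I1 I2, Z1, Z2, Z3.2]
  simp

/-! ### The truncated profile and the remainder -/

/-- A smooth cut-off function of one variable, `1` for `t ≤ 1` and `0` for `t ≥ 2`. -/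
noncomputable def cutoffProfile (t : ℝ) : ℝ := Real.smoothTransition (2 - t)

theorem contDiff_cutoffProfile : ContDiff ℝ ∞ cutoffProfile :=
  Real.smoothTransition.contDiff.comp (by fun_prop)

theorem cutoffProfile_one {t : ℝ} (ht : t ≤ 1) : cutoffProfile t = 1 :=
  Real.smoothTransition.one_of_one_le (by linarith)

theorem cutoffProfile_zero {t : ℝ} (ht : 2 ≤ t) : cutoffProfile t = 0 :=
  Real.smoothTransition.zero_of_nonpos (by linarith)

theorem contDiff_iteratedDeriv_cutoffProfile (j : ℕ) :
    ContDiff ℝ ∞ (iteratedDeriv j cutoffProfile) := by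
  rw [iteratedDeriv_eq_iterate]
  exact contDiff_cutoffProfile.iterate_deriv j

theorem hasDerivAt_iteratedDeriv_cutoffProfile (j : ℕ) (t : ℝ) :
    HasDerivAt (iteratedDeriv j cutoffProfile) (iteratedDeriv (j + 1) cutoffProfile t) t := by
  rw [iteratedDeriv_succ]
  exact ((contDiff_iteratedDeriv_cutoffProfile j).differentiable (by simp) t).hasDerivAt

theorem iteratedDeriv_cutoffProfile_of_lt {j : ℕ} (hj : j ≠ 0) {t : ℝ} (ht : t < 1) :
    iteratedDeriv j cutoffProfile t = 0 := by
  have h : cutoffProfile =ᶠ[𝓝 t] fun _ => 1 := by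
    filter_upwards [Iio_mem_nhds ht] with s hs using cutoffProfile_one (le_of_lt hs)
  rw [h.iteratedDeriv_eq, iteratedDeriv_const]
  simp [hj]

theorem iteratedDeriv_cutoffProfile_of_gt (j : ℕ) {t : ℝ} (ht : 2 < t) :
    iteratedDeriv j cutoffProfile t = 0 := by
  have h : cutoffProfile =ᶠ[𝓝 t] fun _ => 0 := by
    filter_upwards [Ioi_mem_nhds ht] with s hs using cutoffProfile_zero (le_of_lt hs)
  rw [h.iteratedDeriv_eq, iteratedDeriv_const]
  simp

theorem exists_bound_iteratedDeriv_cutoffProfile :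
    ∃ B, 0 ≤ B ∧ ∀ j < 4, ∀ t, 1 ≤ t → |iteratedDeriv j cutoffProfile t| ≤ B := by
  have h : ∀ j : ℕ, ∃ B, ∀ t, 1 ≤ t → |iteratedDeriv j cutoffProfile t| ≤ B := by
    intro j
    obtain ⟨B, hB⟩ := (isCompact_Icc (a := (1 : ℝ)) (b := 2)).exists_bound_of_continuousOn
      (contDiff_iteratedDeriv_cutoffProfile j).continuous.continuousOn
    refine ⟨|B|, fun t ht => ?_⟩
    rcases le_or_gt t 2 with h2 | h2
    · exact (hB t ⟨ht, h2⟩).trans (le_abs_self B)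
    · rw [iteratedDeriv_cutoffProfile_of_gt j h2]; simp
  choose B hB using h
  refine ⟨∑ j ∈ Finset.range 4, |B j|, by positivity, fun j hj t ht => (hB j t ht).trans
    ((le_abs_self _).trans (Finset.single_le_sum (f := fun j => |B j|)
      (fun _ _ => abs_nonneg _) (Finset.mem_range.2 hj)))⟩

/-- The profile `χ(t) / (t + ε)`, with `χ` the cut-off function, and its first three derivatives. It
regularizes the profile `1 / t` of the monotonicity formula. -/
noncomputable def truncatedProfile (ε : ℝ) : Fin 4 → ℝ → ℝ :=
  ![fun t => iteratedDeriv 0 cutoffProfile t * (t + ε)⁻¹,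
    fun t => iteratedDeriv 1 cutoffProfile t * (t + ε)⁻¹
      - iteratedDeriv 0 cutoffProfile t * (t + ε)⁻¹ ^ 2,
    fun t => iteratedDeriv 2 cutoffProfile t * (t + ε)⁻¹
      - 2 * (iteratedDeriv 1 cutoffProfile t * (t + ε)⁻¹ ^ 2)
      + 2 * (iteratedDeriv 0 cutoffProfile t * (t + ε)⁻¹ ^ 3),
    fun t => iteratedDeriv 3 cutoffProfile t * (t + ε)⁻¹
      - 3 * (iteratedDeriv 2 cutoffProfile t * (t + ε)⁻¹ ^ 2)
      + 6 * (iteratedDeriv 1 cutoffProfile t * (t + ε)⁻¹ ^ 3)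
      - 6 * (iteratedDeriv 0 cutoffProfile t * (t + ε)⁻¹ ^ 4)]

theorem radialProfile_truncatedProfile {ε : ℝ} (hε : 0 < ε) :
    RadialProfile (truncatedProfile ε) := by
  have hd : ∀ (j m : ℕ) (t : ℝ), 0 ≤ t →
      HasDerivAt (fun t => iteratedDeriv j cutoffProfile t * (t + ε)⁻¹ ^ (m + 1))
        (iteratedDeriv (j + 1) cutoffProfile t * (t + ε)⁻¹ ^ (m + 1)
          - (m + 1) * (iteratedDeriv j cutoffProfile t * (t + ε)⁻¹ ^ (m + 2))) t := by
    intro j m t ht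
    have hs : t + ε ≠ 0 := by positivity
    have h1 : HasDerivAt (fun t => (t + ε)⁻¹ ^ (m + 1))
        (((m + 1 : ℕ) : ℝ) * (t + ε)⁻¹ ^ m * (-1 / (t + ε) ^ 2)) t :=
      (((hasDerivAt_id t).add_const ε).fun_inv hs).fun_pow (m + 1)
    refine ((hasDerivAt_iteratedDeriv_cutoffProfile j t).mul h1).congr_deriv ?_
    have h2 : -1 / (t + ε) ^ 2 = - (t + ε)⁻¹ ^ 2 := by rw [inv_pow, neg_div, one_div]
    rw [h2]
    push_cast
    ring
  have hd0 : ∀ (j : ℕ) (t : ℝ), 0 ≤ t →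
      HasDerivAt (fun t => iteratedDeriv j cutoffProfile t * (t + ε)⁻¹)
        (iteratedDeriv (j + 1) cutoffProfile t * (t + ε)⁻¹
          - iteratedDeriv j cutoffProfile t * (t + ε)⁻¹ ^ 2) t := by
    intro j t ht
    have := hd j 0 t ht
    simp only [zero_add, pow_one, Nat.cast_zero, one_mul] at this
    exact this
  refine ⟨hd0 0, fun t ht => ?_, fun t ht => ?_, fun j => ?_, fun j t ht => ?_⟩
  · refine ((hd0 1 t ht).sub (hd 0 1 t ht)).congr_deriv ?_
    simp only [truncatedProfile, Matrix.cons_val]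
    push_cast
    ring
  · refine (((hd0 2 t ht).sub ((hd 1 1 t ht).const_mul 2)).add
      ((hd 0 2 t ht).const_mul 2)).congr_deriv ?_
    simp only [truncatedProfile, Matrix.cons_val]
    push_cast
    ring
  · have h1 : ∀ i : ℕ, ContDiff ℝ 1 fun X : Plane => iteratedDeriv i cutoffProfile (‖X‖ ^ 2) :=
      fun i => ((contDiff_iteratedDeriv_cutoffProfile i).of_le (by simp)).comp (contDiff_norm_sq ℝ)
    have h2 : ContDiff ℝ 1 fun X : Plane => (‖X‖ ^ 2 + ε)⁻¹ :=
      ((contDiff_norm_sq ℝ).add contDiff_const).inv fun X => by positivity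
    fin_cases j
    · exact (h1 0).mul h2
    · exact ((h1 1).mul h2).sub ((h1 0).mul (h2.pow 2))
    · exact (((h1 2).mul h2).sub (contDiff_const.mul ((h1 1).mul (h2.pow 2)))).add
        (contDiff_const.mul ((h1 0).mul (h2.pow 3)))
    · exact ((((h1 3).mul h2).sub (contDiff_const.mul ((h1 2).mul (h2.pow 2)))).add
        (contDiff_const.mul ((h1 1).mul (h2.pow 3)))).sub
        (contDiff_const.mul ((h1 0).mul (h2.pow 4)))
  · have h1 := fun i => iteratedDeriv_cutoffProfile_of_gt i (t := t) (by linarith)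
    fin_cases j <;>
      simp only [truncatedProfile, Fin.zero_eta, Fin.mk_one, Fin.reduceFinMk, Matrix.cons_val, h1] <;>
      ring

/-- Outside the unit ball the profile and its derivatives are bounded uniformly in `ε`. -/
theorem exists_bound_truncatedProfile :
    ∃ B, 0 ≤ B ∧ ∀ ε, 0 < ε → ∀ j t, 1 ≤ t → |truncatedProfile ε j t| ≤ B := by
  obtain ⟨B, hB0, hB⟩ := exists_bound_iteratedDeriv_cutoffProfile
  refine ⟨16 * B, by positivity, fun ε hε j t ht => ?_⟩
  have hm0 : 0 ≤ (t + ε)⁻¹ := by positivity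
  have hm1 : (t + ε)⁻¹ ≤ 1 := inv_le_one_of_one_le₀ (by linarith)
  have key : ∀ i < 4, ∀ m : ℕ, |iteratedDeriv i cutoffProfile t * (t + ε)⁻¹ ^ m| ≤ B := by
    intro i hi m
    rw [abs_mul, abs_of_nonneg (pow_nonneg hm0 m)]
    calc _ ≤ B * 1 := mul_le_mul (hB i hi t ht) (pow_le_one₀ hm0 hm1) (pow_nonneg hm0 m) hB0
      _ = B := mul_one B
  have key1 : ∀ i < 4, |iteratedDeriv i cutoffProfile t * (t + ε)⁻¹| ≤ B := fun i hi => by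
    simpa using key i hi 1
  fin_cases j
  · have a0 := abs_le.1 (key1 0 (by norm_num))
    simp only [truncatedProfile, Fin.zero_eta, Matrix.cons_val]
    rw [abs_le]; constructor <;> linarith
  · have a0 := abs_le.1 (key1 1 (by norm_num))
    have a1 := abs_le.1 (key 0 (by norm_num) 2)
    simp only [truncatedProfile, Fin.mk_one, Matrix.cons_val]
    rw [abs_le]; constructor <;> linarith
  · have a0 := abs_le.1 (key1 2 (by norm_num))
    have a1 := abs_le.1 (key 1 (by norm_num) 2)
    have a2 := abs_le.1 (key 0 (by norm_num) 3)
    simp only [truncatedProfile, Fin.reduceFinMk, Matrix.cons_val]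
    rw [abs_le]; constructor <;> linarith
  · have a0 := abs_le.1 (key1 3 (by norm_num))
    have a1 := abs_le.1 (key 2 (by norm_num) 2)
    have a2 := abs_le.1 (key 1 (by norm_num) 3)
    have a3 := abs_le.1 (key 0 (by norm_num) 4)
    simp only [truncatedProfile, Fin.reduceFinMk, Matrix.cons_val]
    rw [abs_le]; constructor <;> linarith

theorem truncatedProfile_of_lt {ε t : ℝ} (ht : t < 1) :
    truncatedProfile ε 0 t = (t + ε)⁻¹ ∧ truncatedProfile ε 1 t = -(t + ε)⁻¹ ^ 2 ∧
    truncatedProfile ε 2 t = 2 * (t + ε)⁻¹ ^ 3 ∧ truncatedProfile ε 3 t = -6 * (t + ε)⁻¹ ^ 4 := by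
  have h0 : iteratedDeriv 0 cutoffProfile t = 1 := by
    rw [iteratedDeriv_zero, cutoffProfile_one ht.le]
  have h1 := iteratedDeriv_cutoffProfile_of_lt one_ne_zero ht
  have h2 := iteratedDeriv_cutoffProfile_of_lt two_ne_zero ht
  have h3 := iteratedDeriv_cutoffProfile_of_lt three_ne_zero ht
  simp only [truncatedProfile, Matrix.cons_val, h0, h1, h2, h3]
  refine ⟨by ring, by ring, by ring, by ring⟩

/-- The integral of this kernel over the plane does not depend on `ε`, by scaling. -/
theorem integrable_approxKernel (ε : ℝ) (hε : 0 < ε) :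
    Integrable (fun X : Plane => ε / (‖X‖ ^ 2 + ε) ^ 2) ∧
      ∫ X : Plane, ε / (‖X‖ ^ 2 + ε) ^ 2 = ∫ X : Plane, 1 / (‖X‖ ^ 2 + 1) ^ 2 := by
  have h1 : Integrable fun X : Plane => 1 / (‖X‖ ^ 2 + 1) ^ 2 := by
    have h := integrable_rpow_neg_one_add_norm_sq (E := Plane) (μ := volume) (r := 4)
      (by simp; norm_num)
    refine h.congr (ae_of_all _ fun X => ?_)
    simp only
    rw [show (-4 / 2 : ℝ) = ((-2 : ℤ) : ℝ) by norm_num, Real.rpow_intCast, zpow_neg, one_div,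
      add_comm]
    norm_cast
  have hs : 0 < √ε := Real.sqrt_pos.2 hε
  have hs2 : √ε ^ 2 = ε := Real.sq_sqrt hε.le
  have hpt : ∀ X : Plane, ε / (‖(0 : Plane) + √ε • X‖ ^ 2 + ε) ^ 2
      = ε⁻¹ * (1 / (‖X‖ ^ 2 + 1) ^ 2) := by
    intro X
    rw [zero_add, norm_smul, Real.norm_of_nonneg hs.le, mul_pow, hs2]
    have : ‖X‖ ^ 2 + 1 ≠ 0 := by positivity
    have h2 : ε * ‖X‖ ^ 2 + ε ≠ 0 := by positivity
    field_simp
  constructor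
  · rw [← integrable_comp_affine (0 : Plane) hs]
    exact (h1.const_mul ε⁻¹).congr (ae_of_all _ fun X => (hpt X).symm)
  · have h := integral_comp_affine (fun X : Plane => ε / (‖X‖ ^ 2 + ε) ^ 2) (0 : Plane) hs
    simp only [hpt] at h
    rw [integral_const_mul, hs2, smul_eq_mul] at h
    exact (mul_left_cancel₀ (inv_ne_zero hε.ne') h).symm

theorem integrableOn_inv_norm : IntegrableOn (fun X : Plane => 1 / ‖X‖) (Metric.ball 0 1) := by
  rw [integrableOn_fun_norm_addHaar (volume : Measure Plane) (f := fun y => 1 / y)]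
  refine (integrableOn_const (C := (1 : ℝ)) (s := Ioo (0 : ℝ) 1) (by simp)).congr_fun
    (fun y hy => ?_) measurableSet_Ioo
  have : y ≠ 0 := ne_of_gt hy.1
  simp [this]

/-- The remainder of the monotonicity identity in the unit ball, with `s = |X|² + ε`, `U = u²` and
`G = |∇u|²`. The terms of the non-integrable order `|X|⁻²` cancel up to a factor `ε`, and all other
terms carry a factor `r x`. -/
theorem remainder_expansion {b J r x a G U t ε s : ℝ} (hs : s = t + ε) (hs0 : s ≠ 0) :
    (-2 * b * J + r * x * (a ^ 2 * G - J)) * s⁻¹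
      + (-16 * a * U + 6 * r * x * a ^ 2 * U - 2 * b * J * t) * -s⁻¹ ^ 2
      + (-20 * a * U * t + 2 * r * x * a ^ 2 * U * t) * (2 * s⁻¹ ^ 3)
      + (-4 * a * U * t ^ 2) * (-6 * s⁻¹ ^ 4)
    = -2 * b * J * (ε * s⁻¹ ^ 2) + r * x * (a ^ 2 * G - J) * s⁻¹
      + r * x * a ^ 2 * U * ((-6 * s + 4 * t) * s⁻¹ ^ 3)
      + a * U * (8 * ε * (2 * s - 3 * t) * s⁻¹ ^ 4) := by
  obtain rfl : ε = s - t := by linarith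
  field_simp
  ring

/-- The bound for the right-hand side of `remainder_expansion`, for `U ≤ L² |X|²`, `G ≤ L²` and a
weight bounded by `α`. -/
theorem abs_remainder_le {b J r x a G U n ε s y₀ α L : ℝ} (hs : s = n ^ 2 + ε) (hn : 0 < n)
    (hε : 0 < ε) (hr : 0 < r) (hb : 0 < b) (hby : b ≤ 3 * y₀ / 2) (ha : 0 ≤ a) (haα : a ≤ α)
    (hJ : |J| ≤ 1) (hx : |x| ≤ n) (hG0 : 0 ≤ G) (hG : G ≤ L ^ 2) (hU0 : 0 ≤ U)
    (hU : U ≤ L ^ 2 * n ^ 2) :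
    |-2 * b * J * (ε * s⁻¹ ^ 2) + r * x * (a ^ 2 * G - J) * s⁻¹
      + r * x * a ^ 2 * U * ((-6 * s + 4 * n ^ 2) * s⁻¹ ^ 3)
      + a * U * (8 * ε * (2 * s - 3 * n ^ 2) * s⁻¹ ^ 4)|
    ≤ (3 * y₀ + r * (α ^ 2 * L ^ 2 + 1) + 6 * r * α ^ 2 * L ^ 2 + 16 * α * L ^ 2)
      * (ε * s⁻¹ ^ 2 + 1 / n) := by
  have hspos : 0 < s := by rw [hs]; positivity
  have hα : 0 ≤ α := ha.trans haα
  have hns : n ^ 2 ≤ s := by rw [hs]; linarith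
  have q0 : 0 ≤ s⁻¹ := by positivity
  have hnn : n * s⁻¹ ≤ 1 / n := by
    rw [← div_eq_mul_inv, div_le_div_iff₀ hspos hn]; nlinarith
  have hn2 : n ^ 2 * s⁻¹ ≤ 1 := by rw [← div_eq_mul_inv, div_le_one hspos]; exact hns
  have hεs : 0 ≤ ε * s⁻¹ ^ 2 := by positivity
  have T1 : |-2 * b * J * (ε * s⁻¹ ^ 2)| ≤ 3 * y₀ * (ε * s⁻¹ ^ 2) := by
    rw [abs_mul, abs_of_nonneg hεs, abs_mul, abs_mul, abs_of_pos hb]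
    refine mul_le_mul_of_nonneg_right ?_ hεs
    have : |(-2 : ℝ)| = 2 := by norm_num
    rw [this]
    nlinarith [abs_nonneg J]
  have T2 : |r * x * (a ^ 2 * G - J) * s⁻¹| ≤ r * (α ^ 2 * L ^ 2 + 1) * (1 / n) := by
    have h1 : |a ^ 2 * G - J| ≤ α ^ 2 * L ^ 2 + 1 := by
      refine (abs_sub _ _).trans (add_le_add ?_ hJ)
      rw [abs_of_nonneg (by positivity)]
      gcongr
    rw [abs_mul, abs_mul, abs_mul, abs_of_pos hr, abs_of_nonneg q0]
    calc r * |x| * |a ^ 2 * G - J| * s⁻¹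
        ≤ r * n * (α ^ 2 * L ^ 2 + 1) * s⁻¹ := by gcongr
      _ = r * (α ^ 2 * L ^ 2 + 1) * (n * s⁻¹) := by ring
      _ ≤ _ := by gcongr
  have T3 : |r * x * a ^ 2 * U * ((-6 * s + 4 * n ^ 2) * s⁻¹ ^ 3)|
      ≤ 6 * r * α ^ 2 * L ^ 2 * (1 / n) := by
    have h1 : |(-6 * s + 4 * n ^ 2) * s⁻¹ ^ 3| ≤ 6 * s⁻¹ ^ 2 := by
      rw [abs_mul, abs_of_nonneg (by positivity : 0 ≤ s⁻¹ ^ 3)]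
      calc _ ≤ (6 * s) * s⁻¹ ^ 3 := by
            refine mul_le_mul_of_nonneg_right ?_ (by positivity)
            rw [_root_.abs_le]; constructor <;> nlinarith
        _ = 6 * s⁻¹ ^ 2 := by field_simp
    rw [abs_mul, abs_mul, abs_mul, abs_mul, abs_of_pos hr, abs_of_nonneg (sq_nonneg a),
      abs_of_nonneg hU0]
    calc r * |x| * a ^ 2 * U * |(-6 * s + 4 * n ^ 2) * s⁻¹ ^ 3|
        ≤ r * n * α ^ 2 * (L ^ 2 * n ^ 2) * (6 * s⁻¹ ^ 2) := by gcongr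
      _ = 6 * r * α ^ 2 * L ^ 2 * (n ^ 2 * s⁻¹) * (n * s⁻¹) := by ring
      _ ≤ 6 * r * α ^ 2 * L ^ 2 * 1 * (1 / n) := by gcongr
      _ = _ := by ring
  have T4 : |a * U * (8 * ε * (2 * s - 3 * n ^ 2) * s⁻¹ ^ 4)|
      ≤ 16 * α * L ^ 2 * (ε * s⁻¹ ^ 2) := by
    have h1 : |8 * ε * (2 * s - 3 * n ^ 2) * s⁻¹ ^ 4| ≤ 16 * ε * s⁻¹ ^ 3 := by
      rw [abs_mul, abs_of_nonneg (by positivity : 0 ≤ s⁻¹ ^ 4), abs_mul,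
        abs_of_nonneg (by positivity : 0 ≤ 8 * ε)]
      have h2 : |2 * s - 3 * n ^ 2| ≤ 2 * s := by
        rw [_root_.abs_le]; constructor <;> nlinarith
      calc _ ≤ 8 * ε * (2 * s) * s⁻¹ ^ 4 := by gcongr
        _ = _ := by field_simp; norm_num
    rw [abs_mul, abs_mul, abs_of_nonneg ha, abs_of_nonneg hU0]
    calc a * U * |8 * ε * (2 * s - 3 * n ^ 2) * s⁻¹ ^ 4|
        ≤ α * (L ^ 2 * n ^ 2) * (16 * ε * s⁻¹ ^ 3) := by gcongr
      _ = 16 * α * L ^ 2 * (ε * s⁻¹ ^ 2) * (n ^ 2 * s⁻¹) := by ring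
      _ ≤ 16 * α * L ^ 2 * (ε * s⁻¹ ^ 2) * 1 := by gcongr
      _ = _ := by ring
  refine (abs_add_le _ _).trans ((add_le_add ((abs_add_le _ _).trans (add_le_add
    ((abs_add_le _ _).trans (add_le_add T1 T2)) T3)) T4).trans ?_)
  have w2 : 0 ≤ 1 / n := by positivity
  have hy : 0 ≤ y₀ := by linarith
  have c1 : 0 ≤ (3 * y₀ + 16 * α * L ^ 2) * (1 / n) := by positivity
  have c2 : 0 ≤ (r * (α ^ 2 * L ^ 2 + 1) + 6 * r * α ^ 2 * L ^ 2) * (ε * s⁻¹ ^ 2) := by positivity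
  linarith

variable {y₀ : ℝ} {L : ℝ≥0} {ρ r : ℝ} {u J : Plane → ℝ}

/-- Near the origin the remainder of the monotonicity identity is bounded by an integrable
function, up to a term of fixed integral. -/
theorem StatPair.remainder_le (h : StatPair y₀ L ρ r u J) (hρ : 2 ≤ ρ) :
    ∃ C, 0 ≤ C ∧ ∀ ε, 0 < ε → ∀ X : Plane, X ≠ 0 → ‖X‖ < 1 →
      |monotonicityRemainder y₀ r u J (truncatedProfile ε) X|
        ≤ C * (ε / (‖X‖ ^ 2 + ε) ^ 2 + 1 / ‖X‖) := by
  have hy := h.pos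
  have hr := h.scale_pos
  refine ⟨3 * y₀ + r * ((2 / y₀) ^ 2 * L ^ 2 + 1) + 6 * r * (2 / y₀) ^ 2 * L ^ 2
    + 16 * (2 / y₀) * L ^ 2, by positivity, fun ε hε X hX0 hX => ?_⟩
  have hnpos : 0 < ‖X‖ := norm_pos_iff.2 hX0
  have ht : ‖X‖ ^ 2 < 1 := by nlinarith
  obtain ⟨e0, e1, e2, e3⟩ := truncatedProfile_of_lt (ε := ε) ht
  obtain ⟨hb1, hb2⟩ := h.height_mem (X := X) (by linarith)
  have hbpos : 0 < height y₀ r X := by linarith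
  have hu2 : u X ^ 2 ≤ (L : ℝ) ^ 2 * ‖X‖ ^ 2 := by
    rw [← sq_abs, ← mul_pow]
    exact pow_le_pow_left₀ (abs_nonneg _) (h.abs_le X) 2
  rw [monotonicityRemainder_eq, e0, e1, e2, e3, remainder_expansion rfl (by positivity),
    show ε / (‖X‖ ^ 2 + ε) ^ 2 = ε * (‖X‖ ^ 2 + ε)⁻¹ ^ 2 by rw [inv_pow, div_eq_mul_inv]]
  refine abs_remainder_le rfl hnpos hε hr hbpos hb2 (by positivity) ?_ (h.abs_density_le X)
    (abs_coord_le X 1) (sq_nonneg _)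
    (pow_le_pow_left₀ (norm_nonneg _) (norm_gradient_le h.lip X) 2) (sq_nonneg _) hu2
  rw [div_le_div_iff₀ hbpos hy]
  linarith

/-! ### Integrability of the homogeneity defect -/

variable {y₀ : ℝ} {L : ℝ≥0} {ρ r : ℝ} {u J : Plane → ℝ}

/-- A bound for the regularized integral of the homogeneity defect that is uniform in `ε`. -/
theorem StatPair.exists_integral_homDefect_le (h : StatPair y₀ L ρ r u J) (hρ : 2 ≤ ρ) :
    ∃ C, ∀ ε, 0 < ε → ∫ X in Metric.ball (0 : Plane) 1,
      homDefect u X ^ 2 / (‖X‖ ^ 2 + ε) ^ 2 ≤ C := by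
  have hy := h.pos
  obtain ⟨C, hC0, hC⟩ := h.remainder_le hρ
  obtain ⟨B, hB0, hB⟩ := exists_bound_truncatedProfile
  have hM := fun j => (h.bdd_monotonicityCoeff hρ j).2
  choose M hM0 hM using hM
  have BE : BddOnBall 2 fun X => 4 * (1 / height y₀ r X) * homDefect u X ^ 2 :=
    ((BddOnBall.const 4).mul (h.bdd_weight hρ)).mul
      (((bdd_gradient_self h.lip 2).sub (.of_continuous h.lip.continuous)).pow 2)
  obtain ⟨-, N, hN0, hN⟩ := BE
  set D := Metric.ball (0 : Plane) 1 with hD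
  set I1 := ∫ X in D, 1 / ‖X‖
  set I0 := ∫ X : Plane, 1 / (‖X‖ ^ 2 + 1) ^ 2
  set V := volume.real (Metric.ball (0 : Plane) 2)
  refine ⟨3 * y₀ / 8 * (C * (I0 + I1) + (∑ j, M j * B + N * B) * V), fun ε hε => ?_⟩
  have hk := radialProfile_truncatedProfile hε
  obtain ⟨hF, hR, hFR⟩ := h.monotonicity_identity hρ hk
  set k := truncatedProfile ε with hkdef
  set F : Plane → ℝ := fun X => 4 * (1 / height y₀ r X) * (- k 1 (‖X‖ ^ 2)) * homDefect u X ^ 2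
    with hFdef
  set R := monotonicityRemainder y₀ r u J k with hRdef
  obtain ⟨hK, hKI⟩ := integrable_approxKernel ε hε
  have hDm : MeasurableSet D := Metric.isOpen_ball.measurableSet
  have hmeas : Measurable (homDefect u) :=
    ((measurable_gradient u).inner measurable_id).sub h.lip.continuous.measurable
  -- on the unit ball the left-hand side controls the defect
  have h1 : ∫ X in D, homDefect u X ^ 2 / (‖X‖ ^ 2 + ε) ^ 2 ≤ 3 * y₀ / 8 * ∫ X in D, F X := by
    rw [← integral_const_mul]
    have hpt : ∀ X ∈ D, homDefect u X ^ 2 / (‖X‖ ^ 2 + ε) ^ 2 ≤ 3 * y₀ / 8 * F X := by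
      intro X hX
      have hX1 : ‖X‖ < 1 := by simpa [hD] using hX
      obtain ⟨hb1, hb2⟩ := h.height_mem (X := X) (by linarith)
      have hb : 0 < height y₀ r X := by linarith
      obtain ⟨-, e1, -, -⟩ := truncatedProfile_of_lt (ε := ε) (t := ‖X‖ ^ 2)
        (by nlinarith [norm_nonneg X])
      rw [hFdef]
      simp only [hkdef, e1]
      rw [neg_neg, inv_pow, div_eq_mul_inv]
      have q : 0 ≤ ((‖X‖ ^ 2 + ε) ^ 2)⁻¹ * homDefect u X ^ 2 := by positivity
      have e : 1 ≤ 3 * y₀ / 8 * (4 * (1 / height y₀ r X)) := by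
        rw [show 3 * y₀ / 8 * (4 * (1 / height y₀ r X)) = (3 * y₀ / 2) / height y₀ r X by
          field_simp; norm_num, one_le_div hb]
        exact hb2
      calc _ = 1 * (((‖X‖ ^ 2 + ε) ^ 2)⁻¹ * homDefect u X ^ 2) := by ring
        _ ≤ _ := mul_le_mul_of_nonneg_right e q
        _ = _ := by ring
    refine integral_mono_of_nonneg (ae_of_all _ fun X => by positivity)
      ((hF.const_mul _).integrableOn) ?_
    filter_upwards [ae_restrict_mem hDm] with X hX using hpt X hX
  refine h1.trans (mul_le_mul_of_nonneg_left ?_ (by positivity))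
  have e1 := integral_add_compl hDm hF
  have e2 := integral_add_compl hDm hR
  -- inside the unit ball the remainder is controlled by an integrable function, outside of it both
  -- sides of the identity are bounded uniformly in `ε`
  have h2 : ∫ X in D, F X = (∫ X in D, R X) + ∫ X in Dᶜ, (R X - F X) := by
    rw [integral_sub hR.integrableOn hF.integrableOn]
    linarith
  rw [h2]
  refine add_le_add ?_ ?_
  · have hI : IntegrableOn (fun X => C * (ε / (‖X‖ ^ 2 + ε) ^ 2 + 1 / ‖X‖)) D :=
      (hK.integrableOn.add integrableOn_inv_norm).const_mul C
    calc ∫ X in D, R X ≤ ∫ X in D, C * (ε / (‖X‖ ^ 2 + ε) ^ 2 + 1 / ‖X‖) := by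
          refine integral_mono_ae hR.integrableOn hI ?_
          have h0 : ∀ᵐ X : Plane ∂(volume.restrict D), X ≠ 0 :=
            ae_restrict_of_ae (Measure.ae_ne volume 0)
          filter_upwards [ae_restrict_mem hDm, h0] with X hX hX0
          exact (le_abs_self _).trans (hC ε hε X hX0 (by simpa [hD] using hX))
      _ = C * ((∫ X in D, ε / (‖X‖ ^ 2 + ε) ^ 2) + I1) := by
          rw [integral_const_mul, integral_add hK.integrableOn integrableOn_inv_norm]
      _ ≤ C * (I0 + I1) := by
          rw [show I0 = ∫ X : Plane, ε / (‖X‖ ^ 2 + ε) ^ 2 from hKI.symm]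
          gcongr
          · exact ae_of_all _ fun X => by positivity
          · exact Measure.restrict_le_self
  · have hS : ∫ X in Dᶜ, (R X - F X) = ∫ X in Dᶜ ∩ Metric.ball 0 2, (R X - F X) := by
      rw [setIntegral_eq_of_subset_of_forall_sdiff_eq_zero hDm.compl inter_subset_left]
      rintro X ⟨hX, hX2⟩
      have hX3 : 2 ≤ ‖X‖ := by
        by_contra hlt
        exact hX2 ⟨hX, by simpa using hlt⟩
      have hz : ∀ j, k j (‖X‖ ^ 2) = 0 := fun j => hk.zero j _ (by nlinarith)
      rw [hFdef, hRdef, monotonicityRemainder_eq]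
      simp [hz]
    rw [hS]
    refine (Real.le_norm_self _).trans ?_
    have hfin : volume (Dᶜ ∩ Metric.ball (0 : Plane) 2) < ⊤ :=
      (measure_mono inter_subset_right).trans_lt measure_ball_lt_top
    refine (norm_setIntegral_le_of_norm_le_const (C := ∑ j, M j * B + N * B) hfin
      fun X hX => ?_).trans ?_
    · have hX1 : 1 ≤ ‖X‖ := by simpa [hD] using hX.1
      have hX2 : ‖X‖ < 2 := by simpa using hX.2
      have hkB : ∀ j, |k j (‖X‖ ^ 2)| ≤ B := fun j => hB ε hε j _ (by nlinarith)
      refine (abs_sub _ _).trans (add_le_add ?_ ?_)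
      · rw [hRdef, monotonicityRemainder]
        refine (Finset.abs_sum_le_sum_abs _ _).trans (Finset.sum_le_sum fun j _ => ?_)
        rw [abs_mul]
        exact mul_le_mul (hM j X hX2) (hkB j) (abs_nonneg _) (hM0 j)
      · rw [hFdef]
        simp only
        rw [show 4 * (1 / height y₀ r X) * -k 1 (‖X‖ ^ 2) * homDefect u X ^ 2
          = (4 * (1 / height y₀ r X) * homDefect u X ^ 2) * -k 1 (‖X‖ ^ 2) by ring, abs_mul, abs_neg]
        exact mul_le_mul (hN X hX2) (hkB 1) (abs_nonneg _) hN0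
    · refine mul_le_mul_of_nonneg_left ?_ ?_
      · exact measureReal_mono inter_subset_right measure_ball_lt_top.ne
      · exact add_nonneg (Finset.sum_nonneg fun j _ => mul_nonneg (hM0 j) hB0) (mul_nonneg hN0 hB0)

theorem measurable_homDefect (h : LipschitzWith L u) : Measurable (homDefect u) :=
  ((measurable_gradient u).inner measurable_id).sub h.continuous.measurable

theorem StatPair.integrableOn_homDefect_unit (h : StatPair y₀ L ρ r u J) (hρ : 2 ≤ ρ) :
    IntegrableOn (fun X => homDefect u X ^ 2 / ‖X‖ ^ 4) (Metric.ball 0 1) := by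
  obtain ⟨C, hC⟩ := h.exists_integral_homDefect_le hρ
  have hmeas := measurable_homDefect h.lip
  have hm : ∀ ε : ℝ, Measurable fun X : Plane => homDefect u X ^ 2 / (‖X‖ ^ 2 + ε) ^ 2 :=
    fun ε => (hmeas.pow_const 2).div (by fun_prop)
  have hbdd : BddOnBall 2 (homDefect u) :=
    (bdd_gradient_self h.lip 2).sub (.of_continuous h.lip.continuous)
  obtain ⟨-, N, hN0, hN⟩ := hbdd
  have hint : ∀ ε, 0 < ε → IntegrableOn (fun X : Plane => homDefect u X ^ 2 / (‖X‖ ^ 2 + ε) ^ 2)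
      (Metric.ball 0 1) := by
    intro ε hε
    refine Measure.integrableOn_of_bounded (M := N ^ 2 / ε ^ 2) measure_ball_lt_top.ne
      (hm ε).aestronglyMeasurable ?_
    filter_upwards [ae_restrict_mem Metric.isOpen_ball.measurableSet] with X hX
    have hX1 : ‖X‖ < 1 := by simpa using hX
    rw [Real.norm_of_nonneg (by positivity), ← sq_abs]
    have := hN X (by linarith)
    gcongr
    nlinarith [norm_nonneg X]
  refine ⟨((hmeas.pow_const 2).div (by fun_prop)).aestronglyMeasurable, ?_⟩
  rw [hasFiniteIntegral_iff_ofReal (ae_of_all _ fun X => by positivity)]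
  -- Fatou with `ε = 1 / (n + 1)`
  set e : ℕ → ℝ := fun n => 1 / ((n : ℝ) + 1) with he
  have he0 : ∀ n, 0 < e n := fun n => by positivity
  have hlim : ∀ᵐ X : Plane ∂(volume.restrict (Metric.ball 0 1)),
      ENNReal.ofReal (homDefect u X ^ 2 / ‖X‖ ^ 4)
        = liminf (fun n => ENNReal.ofReal (homDefect u X ^ 2 / (‖X‖ ^ 2 + e n) ^ 2)) atTop := by
    filter_upwards [ae_restrict_of_ae (Measure.ae_ne volume 0)] with X hX
    have hX' : (‖X‖ ^ 2 + 0) ^ 2 ≠ 0 := by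
      have := norm_pos_iff.2 hX
      positivity
    have ht : Tendsto (fun n => homDefect u X ^ 2 / (‖X‖ ^ 2 + e n) ^ 2) atTop
        (𝓝 (homDefect u X ^ 2 / (‖X‖ ^ 2 + 0) ^ 2)) :=
      tendsto_const_nhds.div ((tendsto_const_nhds.add
        tendsto_one_div_add_atTop_nhds_zero_nat).pow 2) hX'
    have := (ENNReal.tendsto_ofReal ht).liminf_eq
    rw [this, add_zero, ← pow_mul]
  rw [lintegral_congr_ae hlim]
  refine (lintegral_liminf_le fun n => (hm (e n)).ennreal_ofReal).trans_lt ?_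
  refine lt_of_le_of_lt (b := ENNReal.ofReal C) ?_ ENNReal.ofReal_lt_top
  refine liminf_le_of_le (by isBoundedDefault) fun b hb => ?_
  obtain ⟨n, hn⟩ := hb.exists
  refine hn.trans ?_
  rw [← ofReal_integral_eq_lintegral_ofReal (hint _ (he0 n)) (ae_of_all _ fun X => by positivity)]
  exact ENNReal.ofReal_le_ofReal (hC _ (he0 n))

theorem homDefect_dilate (u : Plane → ℝ) {s : ℝ} (hs : 0 < s) (X : Plane) :
    homDefect (fun Z => u (s • Z) / s) X = homDefect u (s • X) / s := by
  rw [homDefect, homDefect, gradient_dilate u hs.ne', real_inner_smul_right]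
  field_simp

theorem indicator_ball_homDefect_dilate (u : Plane → ℝ) {s : ℝ} (hs : 0 < s) (R : ℝ) (X : Plane) :
    indicator (Metric.ball (0 : Plane) R)
        (fun X => homDefect (fun Z => u (s • Z) / s) X ^ 2 / ‖X‖ ^ 4) X
      = s ^ 2 * indicator (Metric.ball (0 : Plane) (s * R))
        (fun X => homDefect u X ^ 2 / ‖X‖ ^ 4) (0 + s • X) := by
  have hiff : X ∈ Metric.ball (0 : Plane) R ↔ 0 + s • X ∈ Metric.ball (0 : Plane) (s * R) := by
    rw [zero_add, smul_mem_ball_iff hs, mul_div_cancel_left₀ _ hs.ne']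
  by_cases hX : X ∈ Metric.ball (0 : Plane) R
  · rw [indicator_of_mem hX, indicator_of_mem (hiff.1 hX), homDefect_dilate u hs, zero_add,
      norm_smul, Real.norm_of_nonneg hs.le]
    rcases eq_or_ne ‖X‖ 0 with h0 | h0
    · simp [h0]
    · field_simp
  · rw [indicator_of_notMem hX, indicator_of_notMem (fun h => hX (hiff.2 h)), mul_zero]

/-- The homogeneity defect is square integrable against `|X|⁻⁴` near the free boundary point. -/
theorem StatPair.integrableOn_homDefect (h : StatPair y₀ L ρ r u J) :
    IntegrableOn (fun X => homDefect u X ^ 2 / ‖X‖ ^ 4) (Metric.ball 0 (ρ / 2)) := by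
  have hs : 0 < ρ / 2 := half_pos h.radius_pos
  have h1 := (h.dilate hs).integrableOn_homDefect_unit
    (by rw [le_div_iff₀ hs]; linarith)
  rw [← integrable_indicator_iff Metric.isOpen_ball.measurableSet] at h1 ⊢
  have h2 := h1.const_mul (((ρ / 2) ^ 2)⁻¹)
  rw [← integrable_comp_affine (0 : Plane) hs]
  refine h2.congr (ae_of_all _ fun X => ?_)
  simp only
  rw [indicator_ball_homDefect_dilate u hs, mul_one, ← mul_assoc,
    inv_mul_cancel₀ (pow_ne_zero 2 hs.ne'), one_mul]

/-- Consequence of the monotonicity identity: blow-ups become homogeneous of degree one. -/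
theorem StatPair.tendsto_homDefect_dilate (h : StatPair y₀ L ρ r u J) {s : ℕ → ℝ}
    (hs : ∀ n, 0 < s n) (hs0 : Tendsto s atTop (𝓝 0)) (R : ℝ) :
    Tendsto (fun n => ∫ X in Metric.ball (0 : Plane) R,
      homDefect (fun Z => u (s n • Z) / s n) X ^ 2) atTop (𝓝 0) := by
  have hI := h.integrableOn_homDefect
  have hmb : ∀ c : ℝ, MeasurableSet (Metric.ball (0 : Plane) c) :=
    fun c => Metric.isOpen_ball.measurableSet
  set f := fun X : Plane => homDefect u X ^ 2 / ‖X‖ ^ 4 with hf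
  have hev : ∀ᶠ n in atTop, s n * R < ρ / 2 := by
    have : Tendsto (fun n => s n * R) atTop (𝓝 (0 * R)) := hs0.mul_const R
    rw [zero_mul] at this
    exact this.eventually_lt_const (half_pos h.radius_pos)
  have hvol : Tendsto ((volume.restrict (Metric.ball (0 : Plane) (ρ / 2))) ∘
      fun n => Metric.ball (0 : Plane) (s n * R)) atTop (𝓝 0) := by
    have h1 : ∀ n, volume (Metric.ball (0 : Plane) (s n * R))
        = ENNReal.ofReal (s n ^ 2) * volume (Metric.ball (0 : Plane) R) := by
      intro n
      rw [Measure.addHaar_ball_mul_of_pos volume _ (hs n)]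
      simp
    have h2 : Tendsto (fun n => ENNReal.ofReal (s n ^ 2) * volume (Metric.ball (0 : Plane) R))
        atTop (𝓝 (ENNReal.ofReal (0 ^ 2) * volume (Metric.ball (0 : Plane) R))) :=
      ENNReal.Tendsto.mul_const (ENNReal.tendsto_ofReal (hs0.pow 2))
        (Or.inr measure_ball_lt_top.ne)
    rw [zero_pow two_ne_zero, ENNReal.ofReal_zero, zero_mul] at h2
    refine tendsto_of_tendsto_of_tendsto_of_le_of_le tendsto_const_nhds h2
      (fun _ => zero_le) fun n => ?_
    rw [← h1 n]
    exact Measure.restrict_apply_le _ _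
  have h0 := (Integrable.tendsto_setIntegral_nhds_zero hI hvol).const_mul (R ^ 4)
  rw [mul_zero] at h0
  refine squeeze_zero' (Eventually.of_forall fun n => integral_nonneg fun X => sq_nonneg _) ?_ h0
  -- on the ball of radius `R` use `|X|⁴ ≤ R⁴` and rescale; the defect on a shrinking ball tends to
  -- zero by absolute continuity of the integral
  filter_upwards [hev] with n hn
  have hsub : Metric.ball (0 : Plane) (s n * R) ⊆ Metric.ball 0 (ρ / 2) :=
    Metric.ball_subset_ball hn.le
  have hIn : Integrable (indicator (Metric.ball (0 : Plane) (s n * R)) f) :=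
    (integrable_indicator_iff (hmb _)).2 (hI.mono_set hsub)
  have hIn2 : Integrable fun X => indicator (Metric.ball (0 : Plane) R)
      (fun X => homDefect (fun Z => u (s n • Z) / s n) X ^ 2 / ‖X‖ ^ 4) X := by
    simp only [indicator_ball_homDefect_dilate u (hs n)]
    exact ((integrable_comp_affine (0 : Plane) (hs n)).2 hIn).const_mul _
  have hval : ∫ X in Metric.ball (0 : Plane) R,
      homDefect (fun Z => u (s n • Z) / s n) X ^ 2 / ‖X‖ ^ 4
      = ∫ X in Metric.ball (0 : Plane) (s n * R), f X := by
    rw [← integral_indicator (hmb _)]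
    simp only [indicator_ball_homDefect_dilate u (hs n)]
    rw [integral_const_mul, integral_comp_affine (indicator (Metric.ball (0 : Plane) (s n * R)) f)
      (0 : Plane) (hs n), integral_indicator (hmb _), smul_eq_mul, ← mul_assoc,
      mul_inv_cancel₀ (pow_ne_zero 2 (hs n).ne'), one_mul]
  rw [Measure.restrict_restrict (hmb _), inter_eq_left.2 hsub, ← hval, ← integral_const_mul]
  refine integral_mono_of_nonneg (ae_of_all _ fun X => sq_nonneg _)
    (((integrable_indicator_iff (hmb _)).1 hIn2).const_mul _) ?_
  filter_upwards [ae_restrict_mem (hmb R), ae_restrict_of_ae (Measure.ae_ne volume 0)] with X hX hX0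
  have hX1 : ‖X‖ < R := by simpa using hX
  have hX2 : 0 < ‖X‖ := norm_pos_iff.2 hX0
  have : homDefect (fun Z => u (s n • Z) / s n) X ^ 2 = ‖X‖ ^ 4 *
    (homDefect (fun Z => u (s n • Z) / s n) X ^ 2 / ‖X‖ ^ 4) := by field_simp
  rw [this]
  simp only [mul_div_cancel_left₀ _ (pow_ne_zero 4 hX2.ne')]
  gcongr

/-! ### Weak convergence of gradients -/

theorem lipschitzWith_of_tendsto {u : ℕ → Plane → ℝ} {φ : Plane → ℝ} {L : ℝ≥0}
    (hu : ∀ n, LipschitzWith L (u n)) (hlim : ∀ X, Tendsto (fun n => u n X) atTop (𝓝 (φ X))) :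
    LipschitzWith L φ := by
  refine LipschitzWith.of_dist_le_mul fun X Z => ?_
  exact le_of_tendsto ((hlim X).dist (hlim Z))
    (Eventually.of_forall fun n => (hu n).dist_le_mul X Z)

/-- A pointwise form of the Arzelà–Ascoli theorem. -/
theorem exists_subseq_tendsto_of_lipschitz {u : ℕ → Plane → ℝ} {L : ℝ≥0}
    (hu : ∀ n, LipschitzWith L (u n)) (h0 : ∀ n, u n 0 = 0) :
    ∃ k : ℕ → ℕ, StrictMono k ∧ ∃ φ : Plane → ℝ,
      ∀ X, Tendsto (fun n => u (k n) X) atTop (𝓝 (φ X)) := by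
  -- pointwise convergence on a dense sequence by compactness of a product of intervals
  set d := TopologicalSpace.denseSeq Plane with hd
  have hK : IsCompact (Set.pi univ fun i : ℕ => Icc (-(L * ‖d i‖)) (L * ‖d i‖) : Set (ℕ → ℝ)) :=
    isCompact_univ_pi fun i => isCompact_Icc
  obtain ⟨f, -, k, hk, hf⟩ := hK.tendsto_subseq (x := fun n i => u n (d i)) (fun n i _ => by
    have := (hu n).dist_le_mul (d i) 0
    rw [h0 n, Real.dist_eq, sub_zero, dist_zero_right] at this
    exact abs_le.1 this)
  refine ⟨k, hk, ?_⟩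
  have hlim : ∀ X, ∃ c, Tendsto (fun n => u (k n) X) atTop (𝓝 c) := by
    intro X
    refine cauchySeq_tendsto_of_complete (Metric.cauchySeq_iff'.2 fun ε hε => ?_)
    have hδ : 0 < ε / (4 * (L + 1)) := by positivity
    obtain ⟨i, hi⟩ := (TopologicalSpace.denseRange_denseSeq Plane).exists_dist_lt X hδ
    have hcau := (tendsto_pi_nhds.1 hf i).cauchySeq
    obtain ⟨N, hN⟩ := Metric.cauchySeq_iff'.1 hcau (ε / 2) (half_pos hε)
    refine ⟨N, fun n hn => ?_⟩
    have h1 := hN n hn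
    simp only [Function.comp] at h1
    have hb : ∀ m, dist (u m X) (u m (d i)) ≤ ε / 4 := fun m => by
      refine ((hu m).dist_le_mul X (d i)).trans ?_
      calc (L : ℝ) * dist X (d i) ≤ (L + 1) * (ε / (4 * (L + 1))) := by
            gcongr
            linarith
        _ = ε / 4 := by field_simp
    have t1 := dist_triangle4 (u (k n) X) (u (k n) (d i)) (u (k N) (d i)) (u (k N) X)
    have h2 := hb (k n)
    have h3 := hb (k N)
    rw [dist_comm] at h3
    linarith
  choose φ hφ using hlim
  exact ⟨φ, hφ⟩

section WeakConvergence

variable {u : ℕ → Plane → ℝ} {φ : Plane → ℝ} {L : ℝ≥0}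

theorem integrable_fderiv_mul {w h : Plane → ℝ} (hw : LipschitzWith L w) (hh : Integrable h)
    (v : Plane) : Integrable fun X => fderiv ℝ w X v * h X :=
  hh.bdd_mul (c := L * ‖v‖) (measurable_fderiv_apply w v).aestronglyMeasurable
    (ae_of_all _ fun X => abs_fderiv_le hw X v)

theorem abs_integral_fderiv_mul_le {w h : Plane → ℝ} (hw : LipschitzWith L w) (hh : Integrable h)
    (v : Plane) : |∫ X, fderiv ℝ w X v * h X| ≤ L * ‖v‖ * ∫ X, |h X| := by
  rw [← integral_const_mul]
  refine (abs_integral_le_integral_abs).trans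
    (integral_mono (integrable_fderiv_mul hw hh v).abs (hh.abs.const_mul _) fun X => ?_)
  simp only [abs_mul]
  exact mul_le_mul_of_nonneg_right (abs_fderiv_le hw X v) (abs_nonneg _)

/-- Pointwise convergence of uniformly Lipschitz functions implies that their derivatives converge
weakly. -/
theorem tendsto_integral_fderiv_mul_const (hu : ∀ n, LipschitzWith L (u n))
    (hlim : ∀ X, Tendsto (fun n => u n X) atTop (𝓝 (φ X))) {h : Plane → ℝ} (hh : Integrable h)
    (v : Plane) :
    Tendsto (fun n => ∫ X, fderiv ℝ (u n) X v * h X) atTop (𝓝 (∫ X, fderiv ℝ φ X v * h X)) := by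
  have hφ := lipschitzWith_of_tendsto hu hlim
  rw [Metric.tendsto_atTop]
  intro ε hε
  set c : ℝ := L * ‖v‖ with hc
  have hc0 : 0 ≤ c := by positivity
  have hδ : 0 < ε / (4 * (c + 1)) := by positivity
  obtain ⟨g, hgc, hgs, hg⟩ := MemLp.exist_eLpNorm_sub_le (p := 1) (by simp) le_rfl
    (memLp_one_iff_integrable.2 hh) hδ
  have hgt : LipTest g := .of_contDiff (hgs.of_le (by simp)) hgc
  have hgi : Integrable g := hgt.integrable
  have hd : Integrable (h - g) := hh.sub hgi
  have hnorm : ∫ X, |(h - g) X| ≤ ε / (4 * (c + 1)) := by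
    have h1 := integral_norm_eq_lintegral_enorm hd.1
    rw [← eLpNorm_one_eq_lintegral_enorm] at h1
    simp only [Real.norm_eq_abs] at h1
    rw [h1]
    exact ENNReal.toReal_le_of_le_ofReal hδ.le hg
  have hsmooth : Tendsto (fun n => ∫ X, fderiv ℝ (u n) X v * g X) atTop
      (𝓝 (∫ X, fderiv ℝ φ X v * g X)) := by
    simp only [integral_fderiv_mul_eq (hu _) hgt, integral_fderiv_mul_eq hφ hgt]
    refine Tendsto.neg ?_
    have hdg : Continuous fun X => fderiv ℝ g X v :=
      (hgs.continuous_fderiv (by simp)).clm_apply continuous_const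
    have hdc : HasCompactSupport fun X => fderiv ℝ g X v := hgc.fderiv_apply (𝕜 := ℝ) v
    obtain ⟨K, hK⟩ : ∃ K, ∀ n X, |u n X| ≤ K + L * ‖X‖ := by
      obtain ⟨K, hK⟩ := (hlim 0).abs.bddAbove_range
      refine ⟨K, fun n X => ?_⟩
      have h1 := (hu n).dist_le_mul X 0
      rw [dist_zero_right, Real.dist_eq] at h1
      have h2 : |u n 0| ≤ K := hK ⟨n, rfl⟩
      have h3 := abs_sub_abs_le_abs_sub (u n X) (u n 0)
      linarith
    refine tendsto_integral_of_dominated_convergence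
      (fun X => (K + L * ‖X‖) * |fderiv ℝ g X v|) (fun n => ?_) ?_ (fun n => ?_) ?_
    · exact ((hu n).continuous.mul hdg).aestronglyMeasurable
    · refine Continuous.integrable_of_hasCompactSupport (by fun_prop) ?_
      exact (hdc.comp_left (g := abs) abs_zero).mul_left
    · refine ae_of_all _ fun X => ?_
      rw [Real.norm_eq_abs, abs_mul]
      exact mul_le_mul_of_nonneg_right (hK n X) (abs_nonneg _)
    · exact ae_of_all _ fun X => (hlim X).mul_const _
  obtain ⟨N, hN⟩ := Metric.tendsto_atTop.1 hsmooth (ε / 2) (half_pos hε)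
  refine ⟨N, fun n hn => ?_⟩
  have hsplit : ∀ w : Plane → ℝ, LipschitzWith L w →
      |(∫ X, fderiv ℝ w X v * h X) - ∫ X, fderiv ℝ w X v * g X| ≤ ε / 4 := by
    intro w hw
    rw [← integral_sub (integrable_fderiv_mul hw hh v) (integrable_fderiv_mul hw hgi v)]
    have : ∀ X, fderiv ℝ w X v * h X - fderiv ℝ w X v * g X = fderiv ℝ w X v * (h - g) X :=
      fun X => by simp [mul_sub]
    simp only [this]
    refine (abs_integral_fderiv_mul_le hw hd v).trans ?_
    calc _ ≤ c * (ε / (4 * (c + 1))) := mul_le_mul_of_nonneg_left hnorm hc0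
      _ ≤ (c + 1) * (ε / (4 * (c + 1))) := by gcongr; linarith
      _ = ε / 4 := by field_simp
  have a1 := abs_lt.1 (by simpa [Real.dist_eq] using hN n hn)
  have a2 := abs_le.1 (hsplit _ (hu n))
  have a3 := abs_le.1 (hsplit _ hφ)
  rw [Real.dist_eq, abs_lt]
  constructor <;> linarith [a1.1, a1.2, a2.1, a2.2, a3.1, a3.2]

theorem tendsto_integral_fderiv_mul (hu : ∀ n, LipschitzWith L (u n))
    (hlim : ∀ X, Tendsto (fun n => u n X) atTop (𝓝 (φ X))) {f : ℕ → Plane → ℝ} {f₀ g : Plane → ℝ}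
    (hf : ∀ n, AEStronglyMeasurable (f n)) (hg : Integrable g)
    (hb : ∀ᶠ n in atTop, ∀ X, |f n X| ≤ g X)
    (hff : ∀ X, Tendsto (fun n => f n X) atTop (𝓝 (f₀ X))) (v : Plane) :
    Tendsto (fun n => ∫ X, fderiv ℝ (u n) X v * f n X) atTop
      (𝓝 (∫ X, fderiv ℝ φ X v * f₀ X)) := by
  have hf₀m : AEStronglyMeasurable f₀ :=
    aestronglyMeasurable_of_tendsto_ae atTop hf (ae_of_all _ hff)
  have hf₀b : ∀ X, |f₀ X| ≤ g X := fun X =>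
    le_of_tendsto (hff X).abs (hb.mono fun n hn => hn X)
  have hf₀ : Integrable f₀ := hg.mono' hf₀m (ae_of_all _ hf₀b)
  have h1 := tendsto_integral_fderiv_mul_const hu hlim hf₀ v
  have h2 : Tendsto (fun n => ∫ X, |f n X - f₀ X|) atTop (𝓝 0) := by
    have : Tendsto (fun n => ∫ X, |f n X - f₀ X|) atTop (𝓝 (∫ X : Plane, (0 : ℝ))) := by
      refine tendsto_integral_filter_of_dominated_convergence (fun X => g X + g X)
        (Eventually.of_forall fun n => ((hf n).sub hf₀m).norm) ?_ (hg.add hg) ?_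
      · filter_upwards [hb] with n hn
        refine ae_of_all _ fun X => ?_
        rw [Real.norm_eq_abs, abs_abs]
        exact (abs_sub _ _).trans (add_le_add (hn X) (hf₀b X))
      · refine ae_of_all _ fun X => ?_
        have := ((hff X).sub_const (f₀ X)).abs
        simpa using this
    simpa using this
  have h3 : Tendsto (fun n => ∫ X, fderiv ℝ (u n) X v * (f n X - f₀ X)) atTop (𝓝 0) := by
    have h4 := h2.const_mul (L * ‖v‖)
    rw [mul_zero] at h4
    refine squeeze_zero_norm' ?_ h4
    filter_upwards [hb] with n hn
    exact abs_integral_fderiv_mul_le (hu n) ((hg.mono' (hf n) (ae_of_all _ hn)).sub hf₀) v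
  have h5 := h1.add h3
  rw [add_zero] at h5
  refine h5.congr' ?_
  filter_upwards [hb] with n hn
  have hfn : Integrable (f n) := hg.mono' (hf n) (ae_of_all _ hn)
  rw [← integral_add (integrable_fderiv_mul (hu n) hf₀ v)
    (integrable_fderiv_mul (h := fun X => f n X - f₀ X) (hu n) (hfn.sub hf₀) v)]
  refine integral_congr_ae (ae_of_all _ fun X => ?_)
  simp only
  ring

/-- The product of weakly converging gradients and dominated, pointwise converging fields. -/
theorem tendsto_integral_inner_gradient (hu : ∀ n, LipschitzWith L (u n))
    (hlim : ∀ X, Tendsto (fun n => u n X) atTop (𝓝 (φ X))) {H : ℕ → Plane → Plane}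
    {H₀ : Plane → Plane} {g : Plane → ℝ}
    (hH : ∀ n, AEStronglyMeasurable (H n)) (hg : Integrable g)
    (hb : ∀ᶠ n in atTop, ∀ X, ‖H n X‖ ≤ g X)
    (hHH : ∀ X, Tendsto (fun n => H n X) atTop (𝓝 (H₀ X))) :
    Tendsto (fun n => ∫ X, inner ℝ (gradient (u n) X) (H n X)) atTop
      (𝓝 (∫ X, inner ℝ (gradient φ X) (H₀ X))) := by
  have hφ := lipschitzWith_of_tendsto hu hlim
  have hproj : ∀ i : Fin 2, Continuous fun V : Plane => V i := fun i => by fun_prop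
  have hHi : ∀ i n, AEStronglyMeasurable fun X => H n X i := fun i n =>
    (hproj i).comp_aestronglyMeasurable (hH n)
  have hbi : ∀ i, ∀ᶠ n in atTop, ∀ X, |H n X i| ≤ g X := fun i =>
    hb.mono fun n hn X => (abs_coord_le _ i).trans (hn X)
  have hlimi : ∀ i X, Tendsto (fun n => H n X i) atTop (𝓝 (H₀ X i)) := fun i X =>
    ((hproj i).tendsto _).comp (hHH X)
  have h := fun i => tendsto_integral_fderiv_mul hu hlim (hHi i) hg (hbi i) (hlimi i) (stdVec i)
  have hsum := (h 0).add (h 1)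
  have hf₀m : ∀ i, Integrable fun X => H₀ X i := fun i =>
    hg.mono' (aestronglyMeasurable_of_tendsto_ae atTop (hHi i) (ae_of_all _ (hlimi i)))
      (ae_of_all _ fun X => le_of_tendsto (hlimi i X).abs ((hbi i).mono fun n hn => hn X))
  rw [← integral_add (integrable_fderiv_mul hφ (hf₀m 0) _)
    (integrable_fderiv_mul hφ (hf₀m 1) _)] at hsum
  simp only [inner_eq_sum, gradient_apply]
  refine hsum.congr' ?_
  filter_upwards [hbi 0, hbi 1] with n h0 h1
  rw [← integral_add
    (integrable_fderiv_mul (hu n) (hg.mono' (hHi 0 n) (ae_of_all _ h0)) _)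
    (integrable_fderiv_mul (hu n) (hg.mono' (hHi 1 n) (ae_of_all _ h1)) _)]

end WeakConvergence

/-! ### Blow-up sequences: strong convergence and homogeneity -/

/-- A sequence of stationary pairs on exhausting balls with the coefficients approaching a
constant, whose functions converge pointwise to `φ` and become homogeneous in the limit. -/
structure BlowUpSeq (y₀ : ℝ) (L : ℝ≥0) (ρ r : ℕ → ℝ) (u J : ℕ → Plane → ℝ) (φ : Plane → ℝ) :
    Prop where
  pair : ∀ n, StatPair y₀ L (ρ n) (r n) (u n) (J n)
  radius : Tendsto ρ atTop atTop
  scale : Tendsto r atTop (𝓝 0)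
  lim : ∀ X, Tendsto (fun n => u n X) atTop (𝓝 (φ X))
  defect : ∀ R, Tendsto (fun n => ∫ X in Metric.ball (0 : Plane) R, homDefect (u n) X ^ 2) atTop
    (𝓝 0)

/-- A blow-up with a pointwise limit is a blow-up sequence. -/
theorem BlowUpSeq.of_dilate {y₀ ρ : ℝ} {L : ℝ≥0} {u J φ : Plane → ℝ} (h : StatPair y₀ L ρ 1 u J)
    {s : ℕ → ℝ} (hs : ∀ n, 0 < s n) (hs0 : Tendsto s atTop (𝓝 0))
    (hlim : ∀ X, Tendsto (fun n => u (s n • X) / s n) atTop (𝓝 (φ X))) :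
    BlowUpSeq y₀ L (fun n => ρ / s n) (fun n => 1 * s n) (fun n X => u (s n • X) / s n)
      (fun n X => J (s n • X)) φ := by
  refine ⟨fun n => h.dilate (hs n), ?_, by simpa using hs0, hlim,
    h.tendsto_homDefect_dilate hs hs0⟩
  have h1 : Tendsto s atTop (𝓝[>] 0) :=
    tendsto_nhdsWithin_iff.2 ⟨hs0, Eventually.of_forall hs⟩
  simpa [div_eq_mul_inv] using
    Tendsto.const_mul_atTop h.radius_pos (tendsto_inv_nhdsGT_zero.comp h1)

namespace BlowUpSeq

variable {y₀ : ℝ} {L : ℝ≥0} {ρ r : ℕ → ℝ} {u J : ℕ → Plane → ℝ} {φ : Plane → ℝ}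

theorem comp (h : BlowUpSeq y₀ L ρ r u J φ) {k : ℕ → ℕ} (hk : Tendsto k atTop atTop) :
    BlowUpSeq y₀ L (ρ ∘ k) (r ∘ k) (u ∘ k) (J ∘ k) φ :=
  ⟨fun n => h.pair (k n), h.radius.comp hk, h.scale.comp hk, fun X => (h.lim X).comp hk,
    fun R => (h.defect R).comp hk⟩

theorem pos (h : BlowUpSeq y₀ L ρ r u J φ) : 0 < y₀ := (h.pair 0).pos

theorem lipschitz (h : BlowUpSeq y₀ L ρ r u J φ) : LipschitzWith L φ :=
  lipschitzWith_of_tendsto (fun n => (h.pair n).lip) h.lim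

theorem zero (h : BlowUpSeq y₀ L ρ r u J φ) : φ 0 = 0 := by
  refine tendsto_nhds_unique (h.lim 0) ?_
  simp only [(h.pair _).zero, tendsto_const_nhds]

theorem eventually_lt_radius (h : BlowUpSeq y₀ L ρ r u J φ) (R : ℝ) : ∀ᶠ n in atTop, R < ρ n :=
  h.radius.eventually_gt_atTop R

theorem nonneg (h : BlowUpSeq y₀ L ρ r u J φ) (X : Plane) : 0 ≤ φ X := by
  refine ge_of_tendsto (h.lim X) ?_
  filter_upwards [h.eventually_lt_radius ‖X‖] with n hn
  exact (h.pair n).nonneg X (by simpa using hn)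

theorem abs_le (h : BlowUpSeq y₀ L ρ r u J φ) (n : ℕ) (X : Plane) : |u n X| ≤ L * ‖X‖ :=
  (h.pair n).abs_le X

theorem tendsto_height (h : BlowUpSeq y₀ L ρ r u J φ) (X : Plane) :
    Tendsto (fun n => height y₀ (r n) X) atTop (𝓝 y₀) := by
  have := (h.scale.mul_const (X 1)).const_add y₀
  simpa [height] using this

theorem tendsto_weight (h : BlowUpSeq y₀ L ρ r u J φ) (X : Plane) :
    Tendsto (fun n => 1 / height y₀ (r n) X) atTop (𝓝 (1 / y₀)) :=
  tendsto_const_nhds.div (h.tendsto_height X) h.pos.ne'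

theorem eventually_weight_mem (h : BlowUpSeq y₀ L ρ r u J φ) (R : ℝ) :
    ∀ᶠ n in atTop, ∀ X : Plane, ‖X‖ ≤ R →
      2 / (3 * y₀) ≤ 1 / height y₀ (r n) X ∧ 1 / height y₀ (r n) X ≤ 2 / y₀ := by
  filter_upwards [h.eventually_lt_radius R] with n hn X hX
  have hy := h.pos
  obtain ⟨h1, h2⟩ := (h.pair n).height_mem (hX.trans hn.le)
  have hb : 0 < height y₀ (r n) X := by linarith
  constructor
  · rw [div_le_div_iff₀ (by positivity) hb]; linarith
  · rw [div_le_div_iff₀ hb hy]; linarith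

theorem measurable_weight (n : ℕ) : Measurable fun X => 1 / height y₀ (r n) X :=
  measurable_const.div (continuous_height y₀ (r n)).measurable

/-- Positivity of the limit on a compact set passes to the sequence, by equicontinuity. -/
theorem eventually_pos (h : BlowUpSeq y₀ L ρ r u J φ) {K : Set Plane} (hK : IsCompact K)
    (hpos : ∀ X ∈ K, 0 < φ X) : ∀ᶠ n in atTop, ∀ X ∈ K, 0 < u n X := by
  refine hK.induction_on (p := fun s => ∀ᶠ n in atTop, ∀ X ∈ s, 0 < u n X)
    (by simp) (fun s t hst ht => ht.mono fun n hn X hX => hn X (hst hX))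
    (fun s t hs ht => ?_) fun X hX => ?_
  · filter_upwards [hs, ht] with n h1 h2 X hX
    exact hX.elim (h1 X) (h2 X)
  · have hc := hpos X hX
    have hδ : 0 < φ X / (2 * (L + 1)) := by positivity
    refine ⟨Metric.ball X (φ X / (2 * (L + 1))),
      mem_nhdsWithin_of_mem_nhds (Metric.ball_mem_nhds X hδ), ?_⟩
    filter_upwards [(h.lim X).eventually_const_lt (half_lt_self hc)] with n hn Z hZ
    have h1 := (h.pair n).lip.dist_le_mul Z X
    have h2 : (L : ℝ) * dist Z X ≤ φ X / 2 := by
      calc (L : ℝ) * dist Z X ≤ (L + 1) * (φ X / (2 * (L + 1))) := by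
            gcongr
            · linarith
            · exact (Metric.mem_ball.1 hZ).le
        _ = φ X / 2 := by field_simp
    rw [Real.dist_eq] at h1
    have h3 := (_root_.abs_le.1 h1).1
    linarith

/-- The limit is weakly harmonic where it is positive. -/
theorem weak (h : BlowUpSeq y₀ L ρ r u J φ) {g : Plane → ℝ} (hg : LipTest g)
    (hs : tsupport g ⊆ {X | 0 < φ X}) : ∫ X, inner ℝ (gradient φ X) (gradient g X) = 0 := by
  obtain ⟨R, hR, hg0, hgR⟩ := hg.fderiv_eq_zero
  obtain ⟨M, hM0, hM⟩ := hg.norm_gradient_bounded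
  have hgradR : ∀ X : Plane, R ≤ ‖X‖ → gradient g X = 0 := fun X hX => by
    rw [gradient, hgR X hX, map_zero]
  have hy := h.pos
  have ht := tendsto_integral_inner_gradient (fun n => (h.pair n).lip) h.lim
    (H := fun n X => (1 / height y₀ (r n) X) • gradient g X)
    (H₀ := fun X => (1 / y₀) • gradient g X)
    (g := indicator (Metric.ball 0 R) fun _ => 2 / y₀ * M)
    (fun n => ((measurable_weight n).smul (measurable_gradient g)).aestronglyMeasurable)
    ((integrable_indicator_iff Metric.isOpen_ball.measurableSet).2
      (integrableOn_const measure_ball_lt_top.ne)) ?_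
    (fun X => (h.tendsto_weight X).smul_const _)
  · have hz : ∀ᶠ n in atTop, ∫ X, inner ℝ (gradient (u n) X)
        ((1 / height y₀ (r n) X) • gradient g X) = 0 := by
      filter_upwards [h.eventually_pos hg.2 hs, h.eventually_lt_radius R] with n hn hρ
      have := (h.pair n).weak g hg (fun X hX => ⟨?_, hn X hX⟩)
      · simpa only [real_inner_smul_right] using this
      · have h1 : tsupport g ⊆ Metric.closedBall 0 R := by
          refine closure_minimal (fun Z hZ => ?_) Metric.isClosed_closedBall
          by_contra hlt
          rw [mem_closedBall_zero_iff, not_le] at hlt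
          exact hZ (hg0 Z hlt.le)
        have := mem_closedBall_zero_iff.1 (h1 hX)
        rw [mem_ball_zero_iff]; linarith
    have h0 := tendsto_nhds_unique ht (tendsto_const_nhds.congr' (hz.mono fun n hn => hn.symm))
    simp only [real_inner_smul_right] at h0
    rw [integral_const_mul] at h0
    exact (mul_eq_zero.1 h0).resolve_left (by positivity)
  · filter_upwards [h.eventually_weight_mem R] with n hn X
    rcases lt_or_ge ‖X‖ R with hX | hX
    · rw [indicator_of_mem (by simpa using hX), norm_smul]
      have hw := hn X hX.le
      have hw0 : 0 ≤ 1 / height y₀ (r n) X := le_trans (by positivity) hw.1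
      rw [Real.norm_of_nonneg hw0]
      exact mul_le_mul hw.2 (hM X) (norm_nonneg _) (by positivity)
    · rw [hgradR X hX, smul_zero, norm_zero]
      exact indicator_nonneg (fun _ _ => by positivity) _

/-- The energy identity for the limit, with constant weight. -/
theorem energy (h : BlowUpSeq y₀ L ρ r u J φ) {ζ : Plane → ℝ} (hζ : LipTest ζ) :
    ∫ X, (‖gradient φ X‖ ^ 2 * ζ X + φ X * inner ℝ (gradient φ X) (gradient ζ X)) = 0 := by
  obtain ⟨R, -, hsub⟩ := hζ.2.isCompact.isBounded.subset_ball_lt 0 0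
  have := energy_identity (a := fun _ => 1) (ρ := R) (M := 1) h.lipschitz measurable_const
    (fun _ _ => by simp) (fun X _ => h.nonneg X)
    (fun g hg hs => by simpa using h.weak hg fun X hX => (hs hX).2) hζ hsub
  simpa using this

/-- The gradients converge strongly, by comparing the energy identities of the sequence and of the
limit. -/
theorem tendsto_gradient (h : BlowUpSeq y₀ L ρ r u J φ) (R : ℝ) :
    Tendsto (fun n => ∫ X in Metric.ball (0 : Plane) R, ‖gradient (u n) X - gradient φ X‖ ^ 2)
      atTop (𝓝 0) := by
  have hy := h.pos
  have hφ := h.lipschitz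
  obtain ⟨ζ, hζs, hζc, -, hζ01, hζ1⟩ := exists_cutoff (isCompact_closedBall (0 : Plane) R)
    isOpen_univ (subset_univ _)
  have hζ : LipTest ζ := .of_contDiff (hζs.of_le (by simp)) hζc
  have hζone : ∀ X : Plane, ‖X‖ < R → ζ X = 1 := fun X hX =>
    hζ1.self_of_nhdsSet X (by simpa using hX.le)
  obtain ⟨S, hS, hζS, hζ'S⟩ := hζ.fderiv_eq_zero
  obtain ⟨M, hM0, hM⟩ := hζ.norm_gradient_bounded
  have hgradS : ∀ X : Plane, S ≤ ‖X‖ → gradient ζ X = 0 := fun X hX => by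
    rw [gradient, hζ'S X hX, map_zero]
  have hζabs : ∀ X, |ζ X| ≤ 1 := fun X => by
    rw [abs_of_nonneg (hζ01 X).1]; exact (hζ01 X).2
  set B := Metric.ball (0 : Plane) S with hB
  have hBm : MeasurableSet B := Metric.isOpen_ball.measurableSet
  have hind : ∀ c : ℝ, Integrable (indicator B fun _ => c) := fun c =>
    (integrable_indicator_iff hBm).2 (integrableOn_const measure_ball_lt_top.ne)
  have haS := h.eventually_weight_mem S
  set a : ℕ → Plane → ℝ := fun n X => 1 / height y₀ (r n) X with ha
  have ham : ∀ n, Measurable (a n) := fun n => measurable_weight n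
  have habs : ∀ n X, 2 / (3 * y₀) ≤ a n X ∧ a n X ≤ 2 / y₀ → |a n X| ≤ 2 / y₀ := fun n X hX => by
    rw [abs_of_nonneg (le_trans (by positivity) hX.1)]; exact hX.2
  -- the boundary terms of the energy identities
  have t1 := tendsto_integral_inner_gradient (fun n => (h.pair n).lip) h.lim
    (H := fun n X => (a n X * u n X) • gradient ζ X)
    (H₀ := fun X => (1 / y₀ * φ X) • gradient ζ X)
    (g := indicator B fun _ => 2 / y₀ * (L * S) * M)
    (fun n => (((ham n).mul (h.pair n).lip.continuous.measurable).smul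
      (measurable_gradient ζ)).aestronglyMeasurable) (hind _)
    (by
      filter_upwards [haS] with n hn X
      rcases lt_or_ge ‖X‖ S with hX | hX
      · rw [indicator_of_mem (by simpa [hB] using hX), norm_smul, norm_mul]
        have h2 : ‖u n X‖ ≤ L * S := (h.abs_le n X).trans (by gcongr)
        exact mul_le_mul (mul_le_mul (habs n X (hn X hX.le)) h2 (norm_nonneg _) (by positivity))
          (hM X) (norm_nonneg _) (by positivity)
      · rw [hgradS X hX, smul_zero, norm_zero]
        exact indicator_nonneg (fun _ _ => by positivity) _)
    (fun X => ((h.tendsto_weight X).mul (h.lim X)).smul_const _)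
  have t2 := tendsto_integral_inner_gradient (fun n => (h.pair n).lip) h.lim
    (H := fun n X => (a n X * ζ X) • gradient φ X)
    (H₀ := fun X => (1 / y₀ * ζ X) • gradient φ X)
    (g := indicator B fun _ => 2 / y₀ * 1 * L)
    (fun n => (((ham n).mul hζ.continuous.measurable).smul
      (measurable_gradient φ)).aestronglyMeasurable) (hind _)
    (by
      filter_upwards [haS] with n hn X
      rcases lt_or_ge ‖X‖ S with hX | hX
      · rw [indicator_of_mem (by simpa [hB] using hX), norm_smul, norm_mul]
        exact mul_le_mul (mul_le_mul (habs n X (hn X hX.le)) (hζabs X) (norm_nonneg _)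
          (by positivity)) (norm_gradient_le hφ X) (norm_nonneg _) (by positivity)
      · rw [hζS X hX, mul_zero, zero_smul, norm_zero]
        exact indicator_nonneg (fun _ _ => by positivity) _)
    (fun X => ((h.tendsto_weight X).mul_const _).smul_const _)
  have bddI : ∀ {n} {w₁ w₂ : Plane → Plane}, (∀ X : Plane, ‖X‖ ≤ S →
      2 / (3 * y₀) ≤ a n X ∧ a n X ≤ 2 / y₀) → Measurable w₁ → Measurable w₂ →
      (∀ X, ‖w₁ X‖ ≤ L) → (∀ X, ‖w₂ X‖ ≤ L) →
      Integrable (fun X => a n X * (inner ℝ (w₁ X) (w₂ X) * ζ X)) ∧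
        ∀ X, |a n X * (inner ℝ (w₁ X) (w₂ X) * ζ X)|
          ≤ indicator B (fun _ => 2 / y₀ * (L * L * 1)) X := by
    intro n w₁ w₂ hn m₁ m₂ b₁ b₂
    have hb : ∀ X, |a n X * (inner ℝ (w₁ X) (w₂ X) * ζ X)|
        ≤ indicator B (fun _ => 2 / y₀ * (L * L * 1)) X := by
      intro X
      rcases lt_or_ge ‖X‖ S with hX | hX
      · rw [indicator_of_mem (by simpa [hB] using hX), abs_mul, abs_mul]
        have := (abs_real_inner_le_norm (w₁ X) (w₂ X)).trans
          (mul_le_mul (b₁ X) (b₂ X) (norm_nonneg _) L.2)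
        exact mul_le_mul (habs n X (hn X hX.le)) (mul_le_mul this (hζabs X) (abs_nonneg _)
          (by positivity)) (by positivity) (by positivity)
      · rw [hζS X hX, mul_zero, mul_zero, abs_zero]
        exact indicator_nonneg (fun _ _ => by positivity) _
    exact ⟨(hind _).mono' ((ham n).mul ((m₁.inner m₂).mul
      hζ.continuous.measurable)).aestronglyMeasurable (ae_of_all _ hb), hb⟩
  have t3 : Tendsto (fun n => ∫ X, a n X * (inner ℝ (gradient φ X) (gradient φ X) * ζ X)) atTop
      (𝓝 (∫ X, 1 / y₀ * (inner ℝ (gradient φ X) (gradient φ X) * ζ X))) := by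
    refine tendsto_integral_filter_of_dominated_convergence _ (Eventually.of_forall fun n =>
      ((ham n).mul (((measurable_gradient φ).inner (measurable_gradient φ)).mul
        hζ.continuous.measurable)).aestronglyMeasurable) ?_ (hind (2 / y₀ * (L * L * 1)))
      (ae_of_all _ fun X => (h.tendsto_weight X).mul_const _)
    filter_upwards [haS] with n hn
    exact ae_of_all _ (bddI hn (measurable_gradient φ) (measurable_gradient φ)
      (norm_gradient_le hφ) (norm_gradient_le hφ)).2
  -- the energy of the limit
  set D := ∫ X, inner ℝ (gradient φ X) (gradient φ X) * ζ X with hD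
  have eφ : ∫ X, inner ℝ (gradient φ X) ((1 / y₀ * φ X) • gradient ζ X) = -(1 / y₀ * D) := by
    have h0 := h.energy hζ
    have i1 : Integrable fun X => ‖gradient φ X‖ ^ 2 * ζ X :=
      ((((bdd_norm_gradient hφ S).pow 2).mul (.of_continuous hζ.continuous)).integrable (M := ℝ)
        fun X hX => by rw [hζS X hX, mul_zero])
    have i2 : Integrable fun X => φ X * inner ℝ (gradient φ X) (gradient ζ X) := by
      refine (hind ((L * S) * (L * M))).mono' (hφ.continuous.measurable.mul
        ((measurable_gradient φ).inner (measurable_gradient ζ))).aestronglyMeasurable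
        (ae_of_all _ fun X => ?_)
      rcases lt_or_ge ‖X‖ S with hX | hX
      · rw [indicator_of_mem (by simpa [hB] using hX), norm_mul]
        have h1 := hφ.dist_le_mul X 0
        rw [h.zero, dist_zero_right, dist_zero_right] at h1
        exact mul_le_mul (h1.trans (by gcongr)) ((norm_inner_le_norm _ _).trans
          (mul_le_mul (norm_gradient_le hφ X) (hM X) (norm_nonneg _) L.2)) (norm_nonneg _)
          (by positivity)
      · rw [hgradS X hX, inner_zero_right, mul_zero, norm_zero]
        exact indicator_nonneg (fun _ _ => by positivity) _
    rw [integral_add i1 i2] at h0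
    simp only [real_inner_smul_right, mul_assoc]
    rw [integral_const_mul, hD]
    simp only [real_inner_self_eq_norm_sq]
    have : ∫ X, φ X * inner ℝ (gradient φ X) (gradient ζ X)
      = -∫ X, ‖gradient φ X‖ ^ 2 * ζ X := by linarith
    rw [this]; ring
  have e2 : ∫ X, inner ℝ (gradient φ X) ((1 / y₀ * ζ X) • gradient φ X) = 1 / y₀ * D := by
    rw [hD, ← integral_const_mul]
    refine integral_congr_ae (ae_of_all _ fun X => ?_)
    simp only [real_inner_smul_right]; ring
  rw [eφ] at t1
  rw [e2] at t2
  rw [integral_const_mul, ← hD] at t3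
  -- the limits of the three parts of `∫ a |∇uₙ - ∇φ|² ζ` cancel
  have tot := (t1.neg.sub (t2.const_mul 2)).add t3
  rw [show - -(1 / y₀ * D) - 2 * (1 / y₀ * D) + 1 / y₀ * D = 0 by ring] at tot
  -- expand the square; the energy identity replaces `|∇uₙ|²` by a term in which the gradient is
  -- paired with a strongly converging factor
  have key : ∀ᶠ n in atTop, ∫ X in Metric.ball (0 : Plane) R,
      ‖gradient (u n) X - gradient φ X‖ ^ 2 ≤ 3 * y₀ / 2 *
      (-(∫ X, inner ℝ (gradient (u n) X) ((a n X * u n X) • gradient ζ X))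
        - 2 * (∫ X, inner ℝ (gradient (u n) X) ((a n X * ζ X) • gradient φ X))
        + ∫ X, a n X * (inner ℝ (gradient φ X) (gradient φ X) * ζ X)) := by
    filter_upwards [haS, h.eventually_lt_radius S] with n hn hρn
    have hun := (h.pair n).lip
    have mu := measurable_gradient (u n)
    have mφ := measurable_gradient φ
    have bu := norm_gradient_le hun
    have bφ := norm_gradient_le hφ
    have i1 := (bddI hn mu mu bu bu).1
    have i2 := (bddI hn mu mφ bu bφ).1
    have i3 := (bddI hn mφ mφ bφ bφ).1
    have hsupp : tsupport ζ ⊆ Metric.ball 0 (ρ n) := by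
      refine (closure_minimal (fun Z hZ => ?_) Metric.isClosed_closedBall).trans
        (Metric.closedBall_subset_ball hρn)
      by_contra hlt
      rw [mem_closedBall_zero_iff, not_le] at hlt
      exact hZ (hζS Z hlt.le)
    have hen := energy_identity (a := a n) (M := 2 / y₀) hun (ham n) (fun X hX => by
        have hb := (h.pair n).height_mem hX.le
        have hb0 : 0 < height y₀ (r n) X := by linarith [hb.1]
        rw [ha, abs_of_pos (by positivity), div_le_div_iff₀ hb0 hy]
        linarith [hb.1]) (h.pair n).nonneg (h.pair n).weak hζ hsupp
    have hI2 : Integrable fun X => inner ℝ (gradient (u n) X) ((a n X * u n X) • gradient ζ X) := by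
      refine (hind (L * (2 / y₀ * (L * S) * M))).mono' (mu.inner (((ham n).mul
        hun.continuous.measurable).smul (measurable_gradient ζ))).aestronglyMeasurable
        (ae_of_all _ fun X => ?_)
      rcases lt_or_ge ‖X‖ S with hX | hX
      · rw [indicator_of_mem (by simpa [hB] using hX)]
        refine (norm_inner_le_norm _ _).trans (mul_le_mul (bu X) ?_ (norm_nonneg _) L.2)
        rw [norm_smul, norm_mul]
        have h2 : ‖u n X‖ ≤ L * S := (h.abs_le n X).trans (by gcongr)
        exact mul_le_mul (mul_le_mul (habs n X (hn X hX.le)) h2 (norm_nonneg _) (by positivity))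
          (hM X) (norm_nonneg _) (by positivity)
      · rw [hgradS X hX, smul_zero, inner_zero_right, norm_zero]
        exact indicator_nonneg (fun _ _ => by positivity) _
    have hen2 : -(∫ X, inner ℝ (gradient (u n) X) ((a n X * u n X) • gradient ζ X))
        = ∫ X, a n X * (inner ℝ (gradient (u n) X) (gradient (u n) X) * ζ X) := by
      have : ∀ X, a n X * (‖gradient (u n) X‖ ^ 2 * ζ X
          + u n X * inner ℝ (gradient (u n) X) (gradient ζ X))
          = a n X * (inner ℝ (gradient (u n) X) (gradient (u n) X) * ζ X)
            + inner ℝ (gradient (u n) X) ((a n X * u n X) • gradient ζ X) := fun X => by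
        rw [real_inner_smul_right, real_inner_self_eq_norm_sq]; ring
      simp only [this] at hen
      rw [integral_add i1 hI2] at hen
      linarith
    have hmix : ∫ X, inner ℝ (gradient (u n) X) ((a n X * ζ X) • gradient φ X)
        = ∫ X, a n X * (inner ℝ (gradient (u n) X) (gradient φ X) * ζ X) :=
      integral_congr_ae (ae_of_all _ fun X => by
        simp only [real_inner_smul_right]; ring)
    have i12 : Integrable fun X => a n X * (inner ℝ (gradient (u n) X) (gradient (u n) X) * ζ X)
        - 2 * (a n X * (inner ℝ (gradient (u n) X) (gradient φ X) * ζ X)) := i1.sub (i2.const_mul 2)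
    rw [hen2, hmix, ← integral_const_mul, ← integral_sub i1 (i2.const_mul 2),
      ← integral_add i12 i3, ← integral_const_mul]
    have hpt : ∀ X, 3 * y₀ / 2 * (a n X * (inner ℝ (gradient (u n) X) (gradient (u n) X) * ζ X)
        - 2 * (a n X * (inner ℝ (gradient (u n) X) (gradient φ X) * ζ X))
        + a n X * (inner ℝ (gradient φ X) (gradient φ X) * ζ X))
        = 3 * y₀ / 2 * (a n X * (‖gradient (u n) X - gradient φ X‖ ^ 2 * ζ X)) := fun X => by
      rw [norm_sub_sq_real, real_inner_self_eq_norm_sq, real_inner_self_eq_norm_sq]; ring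
    simp only [hpt]
    have hnn : ∀ X, 0 ≤ 3 * y₀ / 2 * (a n X * (‖gradient (u n) X - gradient φ X‖ ^ 2 * ζ X)) := by
      intro X
      rcases lt_or_ge ‖X‖ S with hX | hX
      · have := (hn X hX.le).1
        have h0 : 0 ≤ a n X := le_trans (by positivity) this
        have := (hζ01 X).1
        positivity
      · rw [hζS X hX]; simp
    have hint : Integrable fun X => 3 * y₀ / 2 *
        (a n X * (‖gradient (u n) X - gradient φ X‖ ^ 2 * ζ X)) := by
      have := (i12.add i3).const_mul (3 * y₀ / 2)
      exact this.congr (ae_of_all _ hpt)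
    calc _ ≤ ∫ X in Metric.ball (0 : Plane) R, 3 * y₀ / 2 *
          (a n X * (‖gradient (u n) X - gradient φ X‖ ^ 2 * ζ X)) := by
          refine integral_mono_of_nonneg (ae_of_all _ fun X => sq_nonneg _) hint.integrableOn ?_
          filter_upwards [ae_restrict_mem Metric.isOpen_ball.measurableSet] with X hX
          have hXR : ‖X‖ < R := by simpa using hX
          have hXS : ‖X‖ < S := by
            by_contra hge
            have := hζS X (not_lt.1 hge)
            rw [hζone X hXR] at this
            exact one_ne_zero this
          rw [hζone X hXR, mul_one, ← mul_assoc]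
          have h1 := (hn X hXS.le).1
          refine le_mul_of_one_le_left (sq_nonneg _) ?_
          calc (1 : ℝ) = 3 * y₀ / 2 * (2 / (3 * y₀)) := by field_simp
            _ ≤ _ := by gcongr
      _ ≤ _ := setIntegral_le_integral hint (ae_of_all _ hnn)
  have tot2 := tot.const_mul (3 * y₀ / 2)
  rw [mul_zero] at tot2
  exact squeeze_zero' (Eventually.of_forall fun n => integral_nonneg fun X => sq_nonneg _) key tot2

/-- The limit satisfies Euler's equation for functions homogeneous of degree one. -/
theorem homDefect_eq_zero (h : BlowUpSeq y₀ L ρ r u J φ) : ∀ᵐ X, homDefect φ X = 0 := by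
  have hφ := h.lipschitz
  have hmφ := measurable_homDefect hφ
  have hball : ∀ N : ℕ, ∀ᵐ X, X ∈ Metric.ball (0 : Plane) N → homDefect φ X = 0 := by
    intro N
    set B := Metric.ball (0 : Plane) N with hB
    have hBm : MeasurableSet B := Metric.isOpen_ball.measurableSet
    -- the defect of the limit against those of the sequence and the differences
    have hlow : ∀ n X, X ∈ B → homDefect φ X ^ 2 ≤ 3 * homDefect (u n) X ^ 2
        + 3 * N ^ 2 * ‖gradient (u n) X - gradient φ X‖ ^ 2 + 3 * (u n X - φ X) ^ 2 := by
      intro n X hX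
      have hXN : ‖X‖ ≤ N := by
        have : ‖X‖ < N := by simpa [hB] using hX
        exact this.le
      set D := inner ℝ (gradient (u n) X - gradient φ X) X with hD
      have e : homDefect φ X = homDefect (u n) X - D + (u n X - φ X) := by
        rw [hD, inner_sub_left, homDefect, homDefect]; ring
      have hD2 : D ^ 2 ≤ N ^ 2 * ‖gradient (u n) X - gradient φ X‖ ^ 2 := by
        rw [← sq_abs, mul_comm, ← mul_pow]
        refine pow_le_pow_left₀ (abs_nonneg _) ((abs_real_inner_le_norm _ _).trans ?_) 2
        gcongr
      rw [e]
      nlinarith [sq_nonneg (homDefect (u n) X + D), sq_nonneg (homDefect (u n) X - (u n X - φ X)),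
        sq_nonneg (D + (u n X - φ X))]
    have tu : Tendsto (fun n => ∫ X in B, (u n X - φ X) ^ 2) atTop (𝓝 (∫ X in B, (0 : ℝ))) := by
      refine tendsto_integral_of_dominated_convergence (fun _ => (2 * (L * N)) ^ 2) (fun n =>
        (((h.pair n).lip.continuous.sub hφ.continuous).pow 2).aestronglyMeasurable)
        (integrableOn_const measure_ball_lt_top.ne) (fun n => ?_) (ae_of_all _ fun X => ?_)
      · filter_upwards [ae_restrict_mem hBm] with X hX
        have hXN : ‖X‖ ≤ N := by
          have : ‖X‖ < N := by simpa [hB] using hX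
          exact this.le
        rw [Real.norm_of_nonneg (sq_nonneg _), ← sq_abs]
        refine pow_le_pow_left₀ (abs_nonneg _) ((abs_sub _ _).trans ?_) 2
        have h1 : |u n X| ≤ L * N := (h.abs_le n X).trans (by gcongr)
        have h2 := hφ.dist_le_mul X 0
        rw [h.zero, Real.dist_eq, sub_zero, dist_zero_right] at h2
        have h3 : |φ X| ≤ L * N := h2.trans (by gcongr)
        linarith
      · have := ((h.lim X).sub_const (φ X)).pow 2
        simpa using this
    rw [integral_zero] at tu
    have tot := (((h.defect N).const_mul 3).add ((h.tendsto_gradient N).const_mul (3 * (N : ℝ) ^ 2))).add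
      (tu.const_mul 3)
    simp only [mul_zero, add_zero] at tot
    have bd : ∀ {f : Plane → ℝ}, BddOnBall N f → IntegrableOn f B := by
      rintro f ⟨hf, M, -, hM⟩
      refine Measure.integrableOn_of_bounded (M := M) measure_ball_lt_top.ne
        hf.aestronglyMeasurable ?_
      filter_upwards [ae_restrict_mem hBm] with X hX
      exact hM X (by simpa [hB] using hX)
    have hhd : ∀ {w : Plane → ℝ}, LipschitzWith L w → IntegrableOn (fun X => homDefect w X ^ 2) B :=
      fun hw => bd (((bdd_gradient_self hw N).sub (.of_continuous hw.continuous)).pow 2)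
    have hle : ∫ X in B, homDefect φ X ^ 2 ≤ 0 := by
      refine ge_of_tendsto' tot fun n => ?_
      have j1 := hhd (h.pair n).lip
      have j2 : IntegrableOn (fun X => ‖gradient (u n) X - gradient φ X‖ ^ 2) B := by
        refine bd (BddOnBall.pow (.of_abs_le (M := L + L)
          ((measurable_gradient _).sub (measurable_gradient _)).norm fun X => ?_) 2)
        rw [abs_norm]
        exact (norm_sub_le _ _).trans (add_le_add (norm_gradient_le (h.pair n).lip X)
          (norm_gradient_le hφ X))
      have j3 : IntegrableOn (fun X => (u n X - φ X) ^ 2) B :=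
        bd (.of_continuous (((h.pair n).lip.continuous.sub hφ.continuous).pow 2))
      have j12 : IntegrableOn (fun X => 3 * homDefect (u n) X ^ 2
          + 3 * (N : ℝ) ^ 2 * ‖gradient (u n) X - gradient φ X‖ ^ 2) B :=
        (j1.const_mul 3).add (j2.const_mul (3 * (N : ℝ) ^ 2))
      rw [← integral_const_mul, ← integral_const_mul, ← integral_const_mul,
        ← integral_add (j1.const_mul 3) (j2.const_mul (3 * (N : ℝ) ^ 2)),
        ← integral_add j12 (j3.const_mul 3)]
      refine integral_mono_ae (hhd hφ) (j12.add (j3.const_mul 3)) ?_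
      filter_upwards [ae_restrict_mem hBm] with X hX
      exact hlow n X hX
    have h0 := (setIntegral_eq_zero_iff_of_nonneg_ae (ae_of_all _ fun X => sq_nonneg _)
      (hhd hφ)).1 (le_antisymm hle (integral_nonneg fun X => sq_nonneg _))
    filter_upwards [(ae_restrict_iff' hBm).1 h0] with X hX hXB
    exact pow_eq_zero_iff two_ne_zero |>.1 (hX hXB)
  filter_upwards [ae_all_iff.2 hball] with X hX
  obtain ⟨N, hN⟩ := exists_nat_gt ‖X‖
  exact hX N (by simpa using hN)

end BlowUpSeq

/-! ### Homogeneous functions and their second derivatives -/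

/-- A function is homogeneous of degree one if Euler's equation holds almost everywhere: after
integration against a test function, both sides solve the same ordinary differential equation in
the dilation parameter. -/
theorem homogeneous_of_homDefect_eq_zero {φ : Plane → ℝ} {L : ℝ≥0} (hφ : LipschitzWith L φ)
    (hE : ∀ᵐ X, homDefect φ X = 0) (X : Plane) {s : ℝ} (hs : 0 < s) : φ (s • X) = s * φ X := by
  have hcont : ∀ s : ℝ, Continuous fun X => φ (s • X) := fun s =>
    hφ.continuous.comp (continuous_const_smul s)
  -- the derivative of `s ↦ ∫ φ(s X) h(X)` is its value divided by `s`
  have hder : ∀ (h : Plane → ℝ), LipTest h → ∀ s : ℝ, 0 < s →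
      HasDerivAt (fun s => ∫ X, φ (s • X) * h X) ((∫ X, φ (s • X) * h X) / s) s := by
    intro h hh s hs
    have hint : ∀ s : ℝ, Integrable fun X => φ (s • X) * h X := fun s =>
      ((hcont s).mul hh.continuous).integrable_of_hasCompactSupport hh.2.mul_left
    have h1 := hasDerivAt_integral_of_dominated_loc_of_lip (F := fun s X => φ (s • X) * h X)
      (F' := fun X => φ (s • X) * h X / s) (x₀ := s) (s := univ)
      (bound := fun X => L * ‖X‖ * |h X|) (μ := (volume : Measure Plane)) univ_mem
      (Eventually.of_forall fun s => (hint s).1) (hint s) ((hint s).div_const s).1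
      (ae_of_all _ fun X => ?_) ?_ ?_
    · simpa only [integral_div] using h1.2
    · refine LipschitzOnWith.of_dist_le_mul fun a _ b _ => ?_
      rw [Real.dist_eq, Real.dist_eq, ← sub_mul, abs_mul, Real.coe_nnabs,
        abs_of_nonneg (by positivity : (0 : ℝ) ≤ L * ‖X‖ * |h X|)]
      have := hφ.dist_le_mul (a • X) (b • X)
      rw [Real.dist_eq, dist_eq_norm, ← sub_smul, norm_smul, Real.norm_eq_abs] at this
      calc _ ≤ L * (|a - b| * ‖X‖) * |h X| := by gcongr
        _ = _ := by ring
    · refine Continuous.integrable_of_hasCompactSupport ?_ ?_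
      · have := hh.continuous
        fun_prop
      · exact (hh.2.comp_left (g := abs) abs_zero).mul_left
    · filter_upwards [ae_comp_smul hs.ne' hE, ae_comp_smul hs.ne' hφ.ae_differentiableAt]
        with X hX hd
      have h2 : HasDerivAt (fun t : ℝ => t • X) X s := by
        simpa using (hasDerivAt_id s).smul_const X
      have h3 := (hd.hasFDerivAt.comp_hasDerivAt s h2).mul_const (h X)
      refine h3.congr_deriv ?_
      rw [homDefect, inner_gradient_left, map_smul, smul_eq_mul, sub_eq_zero] at hX
      rw [← hX]
      field_simp
  -- so its quotient by `s` is constant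
  have hcst : ∀ (h : Plane → ℝ), LipTest h → ∀ s : ℝ, 0 < s →
      (∫ X, φ (s • X) * h X) / s = ∫ X, φ X * h X := by
    intro h hh s hs
    have hd : ∀ t : ℝ, 0 < t → HasDerivAt (fun s => (∫ X, φ (s • X) * h X) / s) 0 t := by
      intro t ht
      refine ((hder h hh t ht).div (hasDerivAt_id t) ht.ne').congr_deriv ?_
      simp only [id]
      field_simp
      simp
    have := isOpen_Ioi.is_const_of_deriv_eq_zero (s := Ioi (0 : ℝ)) isPreconnected_Ioi
      (f := fun s => (∫ X, φ (s • X) * h X) / s)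
      (fun t ht => (hd t ht).differentiableAt.differentiableWithinAt)
      (fun t ht => (hd t ht).deriv) (x := s) (y := 1) (mem_Ioi.2 hs)
      (mem_Ioi.2 one_pos)
    simpa using this
  have hae : ∀ᵐ X, φ (s • X) - s * φ X = 0 := by
    have hc : Continuous fun X => φ (s • X) - s * φ X :=
      (hcont s).sub (continuous_const.mul hφ.continuous)
    refine ae_eq_zero_of_integral_contDiff_smul_eq_zero hc.locallyIntegrable fun g hg hgc => ?_
    have hgt : LipTest g := .of_contDiff (hg.of_le (by simp)) hgc
    have h1 := hcst g hgt s hs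
    rw [div_eq_iff hs.ne'] at h1
    have i1 : Integrable fun X => φ (s • X) * g X :=
      ((hcont s).mul hgt.continuous).integrable_of_hasCompactSupport hgc.mul_left
    have i2 : Integrable fun X => φ X * g X :=
      (hφ.continuous.mul hgt.continuous).integrable_of_hasCompactSupport hgc.mul_left
    have : ∀ X, g X • (φ (s • X) - s * φ X) = φ (s • X) * g X - s * (φ X * g X) := fun X => by
      rw [smul_eq_mul]; ring
    simp only [this]
    rw [integral_sub i1 (i2.const_mul s), integral_const_mul, h1]
    ring
  have heq : (fun X => φ (s • X)) = fun X => s * φ X := by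
    refine (Continuous.ae_eq_iff_eq volume (hcont s) (continuous_const.mul hφ.continuous)).1 ?_
    filter_upwards [hae] with X hX using sub_eq_zero.1 hX
  exact congrFun heq X

/-- A locally integrable function whose distributional derivative vanishes on a ball is constant
there. -/
theorem ae_eq_const_of_weak_gradient_eq_zero {f : Plane → ℝ} (hf : LocallyIntegrable f)
    {X₀ : Plane} {δ : ℝ}
    (h : ∀ g : Plane → ℝ, ContDiff ℝ ∞ g → HasCompactSupport g → tsupport g ⊆ Metric.ball X₀ δ →
      ∀ v, ∫ X, f X * fderiv ℝ g X v = 0) :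
    ∃ c, ∀ᵐ X, X ∈ Metric.ball X₀ δ → f X = c := by
  rcases le_or_gt δ 0 with hδ | hδ
  · exact ⟨0, ae_of_all _ fun X hX => by simp [Metric.ball_eq_empty.2 hδ] at hX⟩
  -- mollify: the smooth approximations are constant on slightly smaller balls and converge almost
  -- everywhere
  set e : ℕ → ℝ := fun n => 1 / ((n : ℝ) + 1) with he
  have he0 : ∀ n, 0 < e n := fun n => by positivity
  have hlim : Tendsto e atTop (𝓝 0) := tendsto_one_div_add_atTop_nhds_zero_nat
  set b : ℕ → ContDiffBump (0 : Plane) := fun n => ⟨e n / 2, e n, half_pos (he0 n),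
    half_lt_self (he0 n)⟩ with hb
  have hconv := ContDiffBump.ae_convolution_tendsto_right_of_locallyIntegrable
    (μ := (volume : Measure Plane)) (φ := b) (l := atTop) (K := 2) hlim
    (Eventually.of_forall fun n => by simp only [hb]; linarith) hf
  set F : ℕ → Plane → ℝ := fun n X => ∫ t, f t * (b n).normed volume (X - t) with hF
  have hFeq : ∀ n X, (MeasureTheory.convolution ((b n).normed volume) f
      (ContinuousLinearMap.lsmul ℝ ℝ) volume) X = F n X := by
    intro n X
    rw [convolution_lsmul_swap]
    simp only [hF, smul_eq_mul, mul_comm]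
  simp only [hFeq] at hconv
  have hconst : ∀ n X, X ∈ Metric.ball X₀ (δ - e n) → F n X = F n X₀ := by
    intro n X hX
    have hδn : 0 < δ - e n := Metric.pos_of_mem_ball hX
    set ρ := (b n).normed volume with hρ
    have hρs : ContDiff ℝ ∞ ρ := (b n).contDiff_normed
    have hρc : HasCompactSupport ρ := (b n).hasCompactSupport_normed
    have hdF : ∀ Z, HasFDerivAt (F n) (MeasureTheory.convolution f (fderiv ℝ ρ)
        ((ContinuousLinearMap.mul ℝ ℝ).precompR Plane) volume Z) Z := fun Z =>
      hρc.hasFDerivAt_convolution_right (ContinuousLinearMap.mul ℝ ℝ) hf (hρs.of_le (by simp)) Z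
    have hzero : ∀ Z ∈ Metric.ball X₀ (δ - e n), MeasureTheory.convolution f (fderiv ℝ ρ)
        ((ContinuousLinearMap.mul ℝ ℝ).precompR Plane) volume Z = 0 := by
      intro Z hZ
      ext v
      have hex : Integrable fun t => (ContinuousLinearMap.mul ℝ ℝ).precompR Plane (f t)
          (fderiv ℝ ρ (Z - t)) :=
        (hρc.fderiv (𝕜 := ℝ)).convolutionExists_right _ hf (hρs.continuous_fderiv (by simp)) Z
      rw [convolution_def, ContinuousLinearMap.integral_apply hex]
      simp only [ContinuousLinearMap.precompR_apply]
      have hg := h (fun t => ρ (Z - t)) (hρs.comp (contDiff_const.sub contDiff_id)) ?_ ?_ (-v)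
      · have hd : ∀ t, fderiv ℝ (fun t => ρ (Z - t)) t (-v) = fderiv ℝ ρ (Z - t) v := by
          intro t
          have h1 : HasFDerivAt (fun t => ρ (Z - t))
              ((fderiv ℝ ρ (Z - t)).comp (-ContinuousLinearMap.id ℝ Plane)) t :=
            ((hρs.differentiable (by simp) (Z - t)).hasFDerivAt).comp t
              ((hasFDerivAt_id t).const_sub Z)
          rw [h1.fderiv]; simp
        simp only [hd] at hg
        simpa using hg
      · exact hρc.comp_homeomorph (Homeomorph.subLeft Z)
      · have : tsupport (fun t => ρ (Z - t)) = (Homeomorph.subLeft Z) ⁻¹' tsupport ρ :=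
          tsupport_comp_eq_preimage ρ (Homeomorph.subLeft Z)
        rw [this, hρ, (b n).tsupport_normed_eq]
        intro t ht
        have ht' : ‖Z - t‖ ≤ e n := by simpa using ht
        have hZ' : dist Z X₀ < δ - e n := hZ
        rw [Metric.mem_ball]
        have := dist_triangle t Z X₀
        rw [dist_comm t Z, dist_eq_norm Z t] at this
        linarith
    have := Metric.isOpen_ball.is_const_of_fderiv_eq_zero (𝕜 := ℝ)
      (convex_ball X₀ (δ - e n)).isPreconnected
      (fun Z _ => (hdF Z).differentiableAt.differentiableWithinAt)
      (fun Z hZ => (hdF Z).fderiv.trans (hzero Z hZ)) hX (Metric.mem_ball_self hδn)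
    exact this
  have hX₀ : ∀ᵐ X, X ∈ Metric.ball X₀ δ → Tendsto (fun n => F n X₀) atTop (𝓝 (f X)) := by
    filter_upwards [hconv] with X hX hXδ
    refine hX.congr' ?_
    have hpos : 0 < δ - dist X X₀ := sub_pos.2 hXδ
    filter_upwards [hlim.eventually_lt_const hpos] with n hn
    exact hconst n X (by rw [Metric.mem_ball]; linarith)
  by_cases hc : ∃ c, Tendsto (fun n => F n X₀) atTop (𝓝 c)
  · obtain ⟨c, hc⟩ := hc
    exact ⟨c, hX₀.mono fun X hX hXδ => tendsto_nhds_unique (hX hXδ) hc⟩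
  · exact ⟨0, hX₀.mono fun X hX hXδ => (hc ⟨_, hX hXδ⟩).elim⟩

section SecondDerivatives

variable {φ : Plane → ℝ} {L : ℝ≥0}

/-- The distributional second derivative `∂ᵢ∂ⱼφ`, up to the sign, as a functional of the test
function. -/
noncomputable def weakHessian (φ : Plane → ℝ) (i j : Fin 2) (g : Plane → ℝ) : ℝ :=
  ∫ X, fderiv ℝ φ X (stdVec i) * fderiv ℝ g X (stdVec j)

theorem weakHessian_symm (hφ : LipschitzWith L φ) {g : Plane → ℝ} (hg : ContDiff ℝ ∞ g)
    (hc : HasCompactSupport g) (i j : Fin 2) : weakHessian φ i j g = weakHessian φ j i g := by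
  have hdg : ∀ v, ContDiff ℝ 1 fun X => fderiv ℝ g X v := fun v =>
    ((contDiff_infty_iff_fderiv.1 hg).2.of_le (by simp)).clm_apply contDiff_const
  have ht : ∀ v, LipTest fun X => fderiv ℝ g X v := fun v =>
    .of_contDiff (hdg v) (hc.fderiv_apply (𝕜 := ℝ) v)
  have hdd : ∀ v w X, fderiv ℝ (fun Z => fderiv ℝ g Z v) X w = fderiv ℝ (fderiv ℝ g) X w v := by
    intro v w X
    have hd : DifferentiableAt ℝ (fderiv ℝ g) X :=
      (contDiff_infty_iff_fderiv.1 hg).2.differentiable (by simp) X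
    rw [fderiv_clm_apply hd (differentiableAt_const v)]
    simp
  rw [weakHessian, weakHessian, integral_fderiv_mul_eq hφ (ht _), integral_fderiv_mul_eq hφ (ht _)]
  congr 1
  refine integral_congr_ae (ae_of_all _ fun X => ?_)
  simp only [hdd]
  have hsym : IsSymmSndFDerivAt ℝ g X :=
    (hg.contDiffAt (x := X)).isSymmSndFDerivAt (by
      rw [minSmoothness_of_isRCLikeNormedField]; exact WithTop.coe_le_coe.2 le_top)
  rw [hsym.eq]

theorem weakHessian_add {i j : Fin 2} (hφ : LipschitzWith L φ) {g₁ g₂ : Plane → ℝ}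
    (h₁ : ContDiff ℝ ∞ g₁) (c₁ : HasCompactSupport g₁) (h₂ : ContDiff ℝ ∞ g₂)
    (c₂ : HasCompactSupport g₂) :
    weakHessian φ i j (fun X => g₁ X + g₂ X) = weakHessian φ i j g₁ + weakHessian φ i j g₂ := by
  have hi : ∀ {g : Plane → ℝ}, ContDiff ℝ ∞ g → HasCompactSupport g →
      Integrable fun X => fderiv ℝ φ X (stdVec i) * fderiv ℝ g X (stdVec j) := fun h c =>
    integrable_fderiv_mul hφ (((h.continuous_fderiv (by simp)).clm_apply
      continuous_const).integrable_of_hasCompactSupport (c.fderiv_apply (𝕜 := ℝ) _)) _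
  rw [weakHessian, weakHessian, weakHessian, ← integral_add (hi h₁ c₁) (hi h₂ c₂)]
  refine integral_congr_ae (ae_of_all _ fun X => ?_)
  simp only
  rw [fderiv_fun_add (h₁.differentiable (by simp) X) (h₂.differentiable (by simp) X), add_apply]
  ring

/-- The derivative of `∇φ · X = φ` in direction `j`: `X₀ ∂₀∂ⱼφ + X₁ ∂₁∂ⱼφ = 0`. -/
theorem weakHessian_euler (hφ : LipschitzWith L φ) (hE : ∀ᵐ X, homDefect φ X = 0)
    {g : Plane → ℝ} (hg : ContDiff ℝ ∞ g) (hc : HasCompactSupport g) (j : Fin 2) :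
    weakHessian φ 0 j (fun X => X 0 * g X) + weakHessian φ 1 j (fun X => X 1 * g X) = 0 := by
  have hgt : LipTest g := .of_contDiff (hg.of_le (by simp)) hc
  have hproj : ∀ k : Fin 2, ContDiff ℝ ∞ fun X : Plane => X k := fun k =>
    (EuclideanSpace.proj (𝕜 := ℝ) k : Plane →L[ℝ] ℝ).contDiff
  have hi : ∀ k, Integrable fun X =>
      fderiv ℝ φ X (stdVec k) * fderiv ℝ (fun Z => Z k * g Z) X (stdVec j) := fun k =>
    integrable_fderiv_mul hφ (((((hproj k).mul hg).continuous_fderiv (by simp)).clm_apply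
      continuous_const).integrable_of_hasCompactSupport
      ((hc.mul_left (f := fun X : Plane => X k)).fderiv_apply (𝕜 := ℝ) _)) _
  have hdk : ∀ (k : Fin 2) (X : Plane), fderiv ℝ (fun Z : Plane => Z k * g Z) X (stdVec j)
      = X k * fderiv ℝ g X (stdVec j) + g X * (stdVec j) k := by
    intro k X
    have hk : HasFDerivAt (fun Z : Plane => Z k) (EuclideanSpace.proj (𝕜 := ℝ) k : Plane →L[ℝ] ℝ) X :=
      (EuclideanSpace.proj (𝕜 := ℝ) k : Plane →L[ℝ] ℝ).hasFDerivAt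
    have hm : HasFDerivAt (fun Z : Plane => Z k * g Z) _ X :=
      hk.mul (hg.differentiable (by simp) X).hasFDerivAt
    rw [hm.fderiv]
    simp
  have hdg : Integrable fun X => fderiv ℝ g X (stdVec j) :=
    ((hg.continuous_fderiv (by simp)).clm_apply
      continuous_const).integrable_of_hasCompactSupport (hc.fderiv_apply (𝕜 := ℝ) _)
  have i1 : Integrable fun X => φ X * fderiv ℝ g X (stdVec j) :=
    (hφ.continuous.mul ((hg.continuous_fderiv (by simp)).clm_apply
      continuous_const)).integrable_of_hasCompactSupport (hc.fderiv_apply (𝕜 := ℝ) _).mul_left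
  have i2 : Integrable fun X => fderiv ℝ φ X (stdVec j) * g X :=
    integrable_fderiv_mul hφ hgt.integrable _
  have hibp := integral_fderiv_mul_eq hφ hgt (stdVec j)
  rw [weakHessian, weakHessian, ← integral_add (hi 0) (hi 1)]
  calc _ = ∫ X, (φ X * fderiv ℝ g X (stdVec j) + fderiv ℝ φ X (stdVec j) * g X) := by
        refine integral_congr_ae ?_
        filter_upwards [hE] with X hX
        rw [homDefect, inner_eq_sum, gradient_apply, gradient_apply, sub_eq_zero] at hX
        simp only [hdk]
        rw [← hX]
        fin_cases j <;> simp <;> ring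
    _ = 0 := by rw [integral_add i1 i2, hibp]; ring

/-- A positive, homogeneous, harmonic function is affine in the plane: Euler's equation expresses
all second derivatives through the Laplacian. -/
theorem weakHessian_eq_zero (hφ : LipschitzWith L φ) (h0 : φ 0 = 0)
    (hE : ∀ᵐ X, homDefect φ X = 0)
    (hharm : ∀ g, LipTest g → tsupport g ⊆ {X | 0 < φ X} →
      ∫ X, inner ℝ (gradient φ X) (gradient g X) = 0)
    {g : Plane → ℝ} (hg : ContDiff ℝ ∞ g) (hc : HasCompactSupport g)
    (hs : tsupport g ⊆ {X | 0 < φ X}) (i j : Fin 2) : weakHessian φ i j g = 0 := by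
  have hproj : ∀ k : Fin 2, ContDiff ℝ ∞ fun X : Plane => X k := fun k =>
    (EuclideanSpace.proj (𝕜 := ℝ) k : Plane →L[ℝ] ℝ).contDiff
  have hpos : ∀ X ∈ tsupport g, X ≠ 0 := by
    rintro X hX rfl
    have := hs hX
    simp [h0] at this
  -- `g = X₀² q + X₁² q`, which is legitimate as the support of `g` avoids the origin
  set q : Plane → ℝ := fun X => (‖X‖ ^ 2)⁻¹ * g X with hq
  have hqs : tsupport q ⊆ tsupport g := tsupport_mul_subset_right
  have hqc : HasCompactSupport q := hc.mul_left
  have hqd : ContDiff ℝ ∞ q := by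
    refine contDiff_iff_contDiffAt.2 fun X => ?_
    by_cases hX : X ∈ tsupport g
    · refine ContDiffAt.mul (ContDiffAt.inv (contDiff_norm_sq ℝ).contDiffAt ?_) hg.contDiffAt
      exact pow_ne_zero 2 (norm_ne_zero_iff.2 (hpos X hX))
    · have hev : q =ᶠ[𝓝 X] fun _ => 0 := by
        filter_upwards [(isClosed_tsupport g).isOpen_compl.mem_nhds hX] with Z hZ
        simp [hq, image_eq_zero_of_notMem_tsupport hZ]
      exact contDiffAt_const.congr_of_eventuallyEq hev
  have hm : ∀ (k : Fin 2) {p : Plane → ℝ}, ContDiff ℝ ∞ p ∧ HasCompactSupport p ∧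
      tsupport p ⊆ {X | 0 < φ X} → ContDiff ℝ ∞ (fun X => X k * p X) ∧
      HasCompactSupport (fun X => X k * p X) ∧ tsupport (fun X => X k * p X) ⊆ {X | 0 < φ X} :=
    fun k p hp => ⟨(hproj k).mul hp.1, hp.2.1.mul_left,
      (tsupport_mul_subset_right (f := fun X : Plane => X k) (g := p)).trans hp.2.2⟩
  have Q : ContDiff ℝ ∞ q ∧ HasCompactSupport q ∧ tsupport q ⊆ {X | 0 < φ X} :=
    ⟨hqd, hqc, hqs.trans hs⟩
  have Q00 := hm 0 (hm 0 Q)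
  have Q01 := hm 0 (hm 1 Q)
  have Q11 := hm 1 (hm 1 Q)
  have hlap : ∀ {p : Plane → ℝ}, ContDiff ℝ ∞ p ∧ HasCompactSupport p ∧
      tsupport p ⊆ {X | 0 < φ X} → weakHessian φ 0 0 p + weakHessian φ 1 1 p = 0 := by
    intro p hp
    have h1 := hharm p (.of_contDiff (hp.1.of_le (by simp)) hp.2.1) hp.2.2
    simp only [inner_eq_sum, gradient_apply] at h1
    have hi : ∀ k, Integrable fun X => fderiv ℝ φ X (stdVec k) * fderiv ℝ p X (stdVec k) :=
      fun k => integrable_fderiv_mul hφ (((hp.1.continuous_fderiv (by simp)).clm_apply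
        continuous_const).integrable_of_hasCompactSupport (hp.2.1.fderiv_apply (𝕜 := ℝ) _)) _
    rwa [integral_add (hi 0) (hi 1)] at h1
  have hcomm : (fun X : Plane => X 1 * (X 0 * q X)) = fun X => X 0 * (X 1 * q X) := by
    ext X; ring
  have hgq : g = fun X => X 0 * (X 0 * q X) + X 1 * (X 1 * q X) := by
    ext X
    by_cases hX : X ∈ tsupport g
    · have hn := pow_ne_zero 2 (norm_ne_zero_iff.2 (hpos X hX))
      simp only [hq]
      rw [show X 0 * (X 0 * ((‖X‖ ^ 2)⁻¹ * g X)) + X 1 * (X 1 * ((‖X‖ ^ 2)⁻¹ * g X))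
        = (X 0 ^ 2 + X 1 ^ 2) * (‖X‖ ^ 2)⁻¹ * g X by ring, ← norm_sq_eq, mul_inv_cancel₀ hn, one_mul]
    · simp [hq, image_eq_zero_of_notMem_tsupport hX]
  have hsplit : ∀ i j, weakHessian φ i j g
      = weakHessian φ i j (fun X => X 0 * (X 0 * q X))
        + weakHessian φ i j (fun X => X 1 * (X 1 * q X)) := by
    intro i j
    rw [← weakHessian_add hφ Q00.1 Q00.2.1 Q11.1 Q11.2.1, ← hgq]
  -- linear algebra for the three second derivatives: four Euler equations and the Laplace equation
  have E00 := weakHessian_euler hφ hE (hm 0 Q).1 (hm 0 Q).2.1 0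
  have E01 := weakHessian_euler hφ hE (hm 0 Q).1 (hm 0 Q).2.1 1
  have E10 := weakHessian_euler hφ hE (hm 1 Q).1 (hm 1 Q).2.1 0
  have E11 := weakHessian_euler hφ hE (hm 1 Q).1 (hm 1 Q).2.1 1
  rw [hcomm] at E00 E01
  have S01 := weakHessian_symm hφ Q01.1 Q01.2.1 0 1
  have S11 := weakHessian_symm hφ Q11.1 Q11.2.1 0 1
  have L00 := hlap Q00
  have L01 := hlap Q01
  have L11 := hlap Q11
  have r00 : weakHessian φ 0 0 g = 0 := by rw [hsplit]; linarith
  have r11 : weakHessian φ 1 1 g = 0 := by rw [hsplit]; linarith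
  have r01 : weakHessian φ 0 1 g = 0 := by rw [hsplit]; linarith
  have r10 : weakHessian φ 1 0 g = 0 := by rw [weakHessian_symm hφ hg hc]; exact r01
  fin_cases i <;> fin_cases j
  · exact r00
  · exact r01
  · exact r10
  · exact r11

end SecondDerivatives

/-! ### Classification by half-planes -/

variable {φ : Plane → ℝ} {L : ℝ≥0}

/-- Near its positive points, a homogeneous function that is harmonic where positive is linear. -/
theorem exists_linear_near (hφ : LipschitzWith L φ) (h0 : φ 0 = 0)
    (hE : ∀ᵐ X, homDefect φ X = 0)
    (hharm : ∀ g, LipTest g → tsupport g ⊆ {X | 0 < φ X} →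
      ∫ X, inner ℝ (gradient φ X) (gradient g X) = 0)
    {X₀ : Plane} (hX₀ : 0 < φ X₀) : ∃ c : Plane, ∀ᶠ X in 𝓝 X₀, φ X = inner ℝ c X := by
  have hU : IsOpen {X | 0 < φ X} := isOpen_lt continuous_const hφ.continuous
  obtain ⟨δ, hδ, hball⟩ := Metric.isOpen_iff.1 hU X₀ hX₀
  have hloc : ∀ i : Fin 2, LocallyIntegrable fun X => fderiv ℝ φ X (stdVec i) := fun i =>
    (memLp_top_of_bound (measurable_fderiv_apply φ (stdVec i)).aestronglyMeasurable
      (L * ‖stdVec i‖) (ae_of_all _ fun X => abs_fderiv_le hφ X _)).locallyIntegrable le_top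
  have hc : ∀ i : Fin 2, ∃ c, ∀ᵐ X, X ∈ Metric.ball X₀ δ → fderiv ℝ φ X (stdVec i) = c := by
    intro i
    refine ae_eq_const_of_weak_gradient_eq_zero (hloc i) fun g hg hgc hgs v => ?_
    have hz := fun j => weakHessian_eq_zero hφ h0 hE hharm hg hgc (hgs.trans hball) i j
    have hi : ∀ j, Integrable fun X => fderiv ℝ φ X (stdVec i) * fderiv ℝ g X (stdVec j) :=
      fun j => integrable_fderiv_mul hφ (((hg.continuous_fderiv (by simp)).clm_apply
        continuous_const).integrable_of_hasCompactSupport (hgc.fderiv_apply (𝕜 := ℝ) _)) _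
    have hpt : ∀ X, fderiv ℝ φ X (stdVec i) * fderiv ℝ g X v
        = fderiv ℝ φ X (stdVec i) * fderiv ℝ g X (stdVec 0) * v 0
          + fderiv ℝ φ X (stdVec i) * fderiv ℝ g X (stdVec 1) * v 1 := fun X => by
      rw [fderiv_eq_sum g X v]; ring
    simp only [hpt]
    rw [integral_add ((hi 0).mul_const _) ((hi 1).mul_const _), integral_mul_const,
      integral_mul_const]
    have z0 := hz 0
    have z1 := hz 1
    rw [weakHessian] at z0 z1
    rw [z0, z1]; simp
  choose c' hc' using hc
  set c : Plane := !₂[c' 0, c' 1] with hcdef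
  have hlin : LipschitzWith ‖c‖₊ fun X : Plane => inner ℝ c X := by
    have := (innerSL ℝ c).lipschitz
    rwa [show ‖innerSL ℝ c‖₊ = ‖c‖₊ from NNReal.eq (innerSL_apply_norm ℝ c)] at this
  have hf : LipschitzWith (L + ‖c‖₊) fun X => φ X - inner ℝ c X := hφ.sub hlin
  obtain ⟨d, hd⟩ := ae_eq_const_of_weak_gradient_eq_zero (X₀ := X₀) (δ := δ)
    hf.continuous.locallyIntegrable fun g hg hgc hgs v => by
      have hgt : LipTest g := .of_contDiff (hg.of_le (by simp)) hgc
      have hibp := integral_fderiv_mul_eq hf hgt v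
      rw [← neg_eq_zero, ← hibp]
      refine integral_eq_zero_of_ae ?_
      filter_upwards [hφ.ae_differentiableAt, hc' 0, hc' 1] with X hX h0 h1
      by_cases hXs : X ∈ tsupport g
      · have hXb := hgs hXs
        have hlinf : HasFDerivAt (fun X : Plane => inner ℝ c X) (innerSL ℝ c) X :=
          (innerSL ℝ c).hasFDerivAt
        have hdd : HasFDerivAt (fun X => φ X - inner ℝ c X) (fderiv ℝ φ X - innerSL ℝ c) X :=
          hX.hasFDerivAt.sub hlinf
        rw [hdd.fderiv, sub_apply, fderiv_eq_sum φ X v, h0 hXb, h1 hXb, innerSL_apply_apply,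
          inner_eq_sum]
        simp [hcdef]
      · simp [image_eq_zero_of_notMem_tsupport hXs]
  have heq : EqOn (fun X => φ X - inner ℝ c X) (fun _ => d) (Metric.ball X₀ δ) := by
    refine Measure.eqOn_open_of_ae_eq (μ := (volume : Measure Plane)) ?_ Metric.isOpen_ball
      hf.continuous.continuousOn continuousOn_const
    exact (ae_restrict_iff' Metric.isOpen_ball.measurableSet).2 hd
  -- homogeneity excludes an additive constant
  have hd0 : d = 0 := by
    set t : ℝ := δ / (2 * (‖X₀‖ + 1)) with ht
    have ht0 : 0 < t := by positivity
    have hmem : (1 + t) • X₀ ∈ Metric.ball X₀ δ := by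
      rw [Metric.mem_ball, dist_eq_norm, add_smul, one_smul, add_sub_cancel_left, norm_smul,
        Real.norm_of_nonneg ht0.le]
      calc t * ‖X₀‖ ≤ t * (‖X₀‖ + 1) := by gcongr; linarith
        _ = δ / 2 := by rw [ht]; field_simp
        _ < δ := half_lt_self hδ
    have e1 := heq (Metric.mem_ball_self hδ)
    have e2 := heq hmem
    have e3 := homogeneous_of_homDefect_eq_zero hφ hE X₀ (s := 1 + t) (by positivity)
    simp only [real_inner_smul_right] at e1 e2
    rw [e3] at e2
    have : t * d = 0 := by linear_combination e2 - (1 + t) * e1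
    exact (mul_eq_zero.1 this).resolve_left ht0.ne'
  refine ⟨c, ?_⟩
  filter_upwards [Metric.ball_mem_nhds X₀ hδ] with X hX
  have := heq hX
  simp only [hd0] at this
  linarith

theorem eq_of_inner_eq_near {c c' X : Plane} (h : ∀ᶠ Z in 𝓝 X, (inner ℝ c Z : ℝ) = inner ℝ c' Z) :
    c = c' := by
  have h1 : HasFDerivAt (fun Z : Plane => (inner ℝ c Z : ℝ)) (innerSL ℝ c) X :=
    (innerSL ℝ c).hasFDerivAt
  have h2 : HasFDerivAt (fun Z : Plane => (inner ℝ c Z : ℝ)) (innerSL ℝ c') X :=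
    (innerSL ℝ c').hasFDerivAt.congr_of_eventuallyEq h
  have h3 := h1.unique h2
  refine ext_inner_right ℝ fun v => ?_
  have := congrArg (fun l => l v) h3
  simpa using this

/-- The linear function representing `φ` near a positive point represents it on a half-plane. -/
theorem exists_linear_on_halfPlane (hφ : Continuous φ)
    (hlin : ∀ X₀, 0 < φ X₀ → ∃ c : Plane, ∀ᶠ X in 𝓝 X₀, φ X = inner ℝ c X)
    {X₀ : Plane} (hX₀ : 0 < φ X₀) :
    ∃ c : Plane, 0 < (inner ℝ c X₀ : ℝ) ∧ ∀ X, 0 ≤ (inner ℝ c X : ℝ) → φ X = inner ℝ c X := by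
  obtain ⟨c, hc⟩ := hlin X₀ hX₀
  have hpos : 0 < (inner ℝ c X₀ : ℝ) := by rw [← hc.self_of_nhds]; exact hX₀
  set H : Set Plane := {X | 0 < (inner ℝ c X : ℝ)} with hH
  have hconv : Convex ℝ H := convex_halfSpace_gt (innerSL ℝ c).isLinear 0
  set S : Set Plane := {X | ∀ᶠ Z in 𝓝 X, φ Z = inner ℝ c Z} with hS
  have hSo : IsOpen S := isOpen_iff_mem_nhds.2 fun X hX => hX.eventually_nhds
  have hlinc : Continuous fun X : Plane => (inner ℝ c X : ℝ) := by fun_prop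
  -- the set where `φ` agrees locally with this linear function is open and closed in the half-plane
  have hsub : H ⊆ S := by
    refine hconv.isPreconnected.subset_of_closure_inter_subset hSo ⟨X₀, hpos, hc⟩ ?_
    rintro X ⟨hXc, hXH⟩
    have hX : φ X = inner ℝ c X :=
      closure_minimal (t := {X | φ X = inner ℝ c X}) (fun Z (hZ : _ ∈ S) => hZ.self_of_nhds)
        (isClosed_eq hφ hlinc) hXc
    obtain ⟨c', hc'⟩ := hlin X (by rw [hX]; exact hXH)
    obtain ⟨O, hO, hOo, hXO⟩ := eventually_nhds_iff.1 hc'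
    obtain ⟨Z, hZO, hZS⟩ := mem_closure_iff.1 hXc O hOo hXO
    have : c = c' := by
      refine eq_of_inner_eq_near (X := Z) ?_
      filter_upwards [hZS, hOo.mem_nhds hZO] with W h1 h2
      rw [← h1, hO W h2]
    rw [← this] at hc'
    exact hc'
  have hc0 : c ≠ 0 := by
    rintro rfl
    simp at hpos
  refine ⟨c, hpos, fun X hX => ?_⟩
  have hcl : X ∈ closure H := by
    refine mem_closure_of_tendsto (f := fun n : ℕ => X + (1 / ((n : ℝ) + 1)) • c) (b := atTop) ?_
      (Eventually.of_forall fun n => ?_)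
    · have : Tendsto (fun n : ℕ => X + (1 / ((n : ℝ) + 1)) • c) atTop (𝓝 (X + (0 : ℝ) • c)) :=
        tendsto_const_nhds.add (tendsto_one_div_add_atTop_nhds_zero_nat.smul_const c)
      simpa using this
    · have h1 : 0 < (inner ℝ c c : ℝ) := real_inner_self_pos.2 hc0
      change 0 < (inner ℝ c (X + (1 / ((n : ℝ) + 1)) • c) : ℝ)
      rw [inner_add_right, real_inner_smul_right]
      positivity
  exact closure_minimal (t := {X | φ X = inner ℝ c X})
    (fun Z (hZ : Z ∈ H) => (hsub hZ).self_of_nhds) (isClosed_eq hφ hlinc) hcl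

/-- The planar vector orthogonal to a given one. -/
noncomputable def rot (ν : Plane) : Plane := !₂[-ν 1, ν 0]

theorem inner_rot (ν : Plane) : inner ℝ ν (rot ν) = (0 : ℝ) := by
  rw [inner_eq_sum]; simp [rot]; ring

/-- A nonnegative continuous function that is linear near each of its positive points is supported
on one half-plane or on two complementary ones, and linear on each. -/
theorem exists_two_plane (hφ : Continuous φ) (hnn : ∀ X, 0 ≤ φ X)
    (hlin : ∀ X₀, 0 < φ X₀ → ∃ c : Plane, ∀ᶠ X in 𝓝 X₀, φ X = inner ℝ c X)
    (hne : ∃ X, φ X ≠ 0) :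
    ∃ (ν : Plane) (A B : ℝ), ‖ν‖ = 1 ∧ 0 < A ∧ 0 ≤ B ∧
      ∀ X, φ X = A * max (inner ℝ X ν) 0 + B * max (-inner ℝ X ν) 0 := by
  obtain ⟨X₀, hX₀⟩ := hne
  have hX₀ : 0 < φ X₀ := lt_of_le_of_ne (hnn X₀) (Ne.symm hX₀)
  obtain ⟨c, hc, hcφ⟩ := exists_linear_on_halfPlane hφ hlin hX₀
  have hc0 : c ≠ 0 := by
    rintro rfl
    simp at hc
  have hnc : 0 < ‖c‖ := norm_pos_iff.2 hc0
  set ν : Plane := ‖c‖⁻¹ • c with hν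
  have hν1 : ‖ν‖ = 1 := by
    rw [hν, norm_smul, norm_inv, norm_norm, inv_mul_cancel₀ hnc.ne']
  have hcν : c = ‖c‖ • ν := by rw [hν, smul_smul, mul_inv_cancel₀ hnc.ne', one_smul]
  have hin : ∀ X, inner ℝ c X = ‖c‖ * inner ℝ X ν := fun X => by
    conv_lhs => rw [hcν]
    rw [real_inner_smul_left, real_inner_comm]
  have hpl : ∀ X, 0 ≤ (inner ℝ X ν : ℝ) → φ X = ‖c‖ * inner ℝ X ν := fun X hX => by
    rw [hcφ X (by rw [hin]; positivity), hin]
  by_cases hneg : ∃ X₁, (inner ℝ X₁ ν : ℝ) < 0 ∧ φ X₁ ≠ 0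
  · obtain ⟨X₁, hX₁, hφ₁⟩ := hneg
    obtain ⟨c₁, hc₁, hcφ₁⟩ := exists_linear_on_halfPlane hφ hlin
      (lt_of_le_of_ne (hnn X₁) (Ne.symm hφ₁))
    -- the two half-planes cannot overlap, so their boundary lines agree
    have hnon : ∀ τ : Plane, (inner ℝ τ ν : ℝ) = 0 → (inner ℝ c₁ τ : ℝ) ≤ 0 := by
      intro τ hτ
      by_contra hlt
      have h1 := hcφ₁ τ (not_le.1 hlt).le
      rw [hpl τ hτ.ge, hτ, mul_zero] at h1
      exact hlt h1.symm.le
    have hz : (inner ℝ c₁ (rot ν) : ℝ) = 0 := by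
      have h1 := hnon (rot ν) (by rw [real_inner_comm, inner_rot])
      have h2 := hnon (-rot ν) (by rw [inner_neg_left, real_inner_comm, inner_rot, neg_zero])
      rw [inner_neg_right] at h2
      linarith
    set b : ℝ := inner ℝ c₁ ν with hb
    have hνsq : ν 0 ^ 2 + ν 1 ^ 2 = 1 := by rw [← norm_sq_eq, hν1]; norm_num
    have hc₁X : ∀ X, (inner ℝ c₁ X : ℝ) = b * inner ℝ X ν := by
      intro X
      rw [hb, inner_eq_sum, inner_eq_sum, inner_eq_sum]
      rw [inner_eq_sum] at hz
      simp [rot] at hz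
      linear_combination (-(c₁ 0 * X 0 + c₁ 1 * X 1)) * hνsq
        + (X 1 * ν 0 - X 0 * ν 1) * hz
    have hbneg : b < 0 := by
      rw [hc₁X] at hc₁
      by_contra hge
      exact absurd hc₁ (not_lt.2 (mul_nonpos_of_nonneg_of_nonpos (not_lt.1 hge) hX₁.le))
    refine ⟨ν, ‖c‖, -b, hν1, hnc, by linarith, fun X => ?_⟩
    rcases le_total 0 (inner ℝ X ν : ℝ) with h | h
    · rw [hpl X h, max_eq_left h, max_eq_right (by linarith)]; ring
    · rw [hcφ₁ X (by rw [hc₁X]; exact mul_nonneg_of_nonpos_of_nonpos hbneg.le h), hc₁X,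
        max_eq_right h, max_eq_left (by linarith)]
      ring
  · push Not at hneg
    refine ⟨ν, ‖c‖, 0, hν1, hnc, le_rfl, fun X => ?_⟩
    rcases le_or_gt 0 (inner ℝ X ν : ℝ) with h | h
    · rw [hpl X h, max_eq_left h]; ring
    · rw [hneg X h, max_eq_right h.le]; ring

/-! ### Passing to the limit in the domain variation -/

namespace BlowUpSeq

variable {y₀ : ℝ} {L : ℝ≥0} {ρ r : ℕ → ℝ} {u J : ℕ → Plane → ℝ} {φ : Plane → ℝ}

/-- Strong convergence of the gradients gives almost everywhere convergence along a subsequence. -/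
theorem exists_subseq_ae (h : BlowUpSeq y₀ L ρ r u J φ) (R : ℝ) :
    ∃ k : ℕ → ℕ, StrictMono k ∧ ∀ᵐ X, X ∈ Metric.ball (0 : Plane) R →
      Tendsto (fun n => gradient (u (k n)) X) atTop (𝓝 (gradient φ X)) := by
  have hm : ∀ n, AEStronglyMeasurable (gradient (u n))
      (volume.restrict (Metric.ball (0 : Plane) R)) :=
    fun n => (measurable_gradient (u n)).aestronglyMeasurable
  have hm0 := (measurable_gradient φ).aestronglyMeasurable
    (μ := volume.restrict (Metric.ball (0 : Plane) R))
  have hL2 : Tendsto (fun n => eLpNorm (gradient (u n) - gradient φ) 2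
      (volume.restrict (Metric.ball (0 : Plane) R))) atTop (𝓝 0) := by
    have h1 : ∀ n, eLpNorm (gradient (u n) - gradient φ) 2
        (volume.restrict (Metric.ball (0 : Plane) R)) = ENNReal.ofReal
        (∫ X in Metric.ball (0 : Plane) R, ‖gradient (u n) X - gradient φ X‖ ^ 2) ^ (1 / 2 : ℝ) := by
      intro n
      have hb : MemLp (gradient (u n) - gradient φ) 2
          (volume.restrict (Metric.ball (0 : Plane) R)) := by
        have : IsFiniteMeasure (volume.restrict (Metric.ball (0 : Plane) R)) :=
          ⟨by rw [Measure.restrict_apply_univ]; exact measure_ball_lt_top⟩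
        refine MemLp.of_bound ((hm n).sub hm0) (L + L) (ae_of_all _ fun X => ?_)
        exact (norm_sub_le _ _).trans (add_le_add (norm_gradient_le (h.pair n).lip X)
          (norm_gradient_le h.lipschitz X))
      rw [hb.eLpNorm_eq_integral_rpow_norm (by simp) (by simp),
        ENNReal.ofReal_rpow_of_nonneg (integral_nonneg fun X => sq_nonneg _) (by norm_num)]
      norm_num
    simp only [h1]
    have h2 := (ENNReal.tendsto_ofReal (h.tendsto_gradient R)).ennrpow_const (1 / 2 : ℝ)
    simpa using h2
  obtain ⟨k, hk, hae⟩ := (tendstoInMeasure_of_tendsto_eLpNorm (by simp) hm hm0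
    hL2).exists_seq_tendsto_ae
  exact ⟨k, hk, (ae_restrict_iff' Metric.isOpen_ball.measurableSet).1 hae⟩

/-- The integrand of the limiting inner variation, which still contains the densities `Jₙ`. -/
noncomputable def limitIntegrand (y₀ : ℝ) (φ J : Plane → ℝ) (η : Plane → Plane) (X : Plane) : ℝ :=
  ((1 / y₀) * ‖gradient φ X‖ ^ 2 + y₀ * J X) * divergence η X
    - (2 / y₀) * inner ℝ (gradient φ X) (fderiv ℝ η X (gradient φ X))

/-- A bound for the integrand of the inner variation: `a` is the weight, `b` the height, `N =
|∇u|²`, `d` the divergence of the field, `I` the quadratic form of its derivative, `e` its second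
component. -/
theorem abs_variation_le {a b N J d I r e α β Λ M : ℝ} (ha : |a| ≤ α) (hb : |b| ≤ β)
    (hN0 : 0 ≤ N) (hN : N ≤ Λ) (hJ : |J| ≤ 1) (hd : |d| ≤ M) (hI : |I| ≤ Λ * M) (hr : |r| ≤ 1)
    (he : |e| ≤ M) :
    |(a * N + b * J) * d - 2 * a * I - r * e * (a ^ 2 * N - J)|
      ≤ (α * Λ + β) * M + 2 * α * (Λ * M) + M * (α ^ 2 * Λ + 1) := by
  have hα : 0 ≤ α := (abs_nonneg a).trans ha
  have hβ : 0 ≤ β := (abs_nonneg b).trans hb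
  have hM : 0 ≤ M := (abs_nonneg d).trans hd
  have hΛ : 0 ≤ Λ := hN0.trans hN
  have hN' : |N| ≤ Λ := by rwa [abs_of_nonneg hN0]
  have t1 : |(a * N + b * J) * d| ≤ (α * Λ + β) * M := by
    rw [abs_mul]
    refine mul_le_mul ((abs_add_le _ _).trans (add_le_add ?_ ?_)) hd (abs_nonneg _) (by positivity)
    · rw [abs_mul]; exact mul_le_mul ha hN' (abs_nonneg _) hα
    · rw [abs_mul]
      calc |b| * |J| ≤ β * 1 := mul_le_mul hb hJ (abs_nonneg _) hβ
        _ = β := mul_one β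
  have t2 : |2 * a * I| ≤ 2 * α * (Λ * M) := by
    rw [abs_mul, abs_mul, abs_two]
    exact mul_le_mul (by linarith) hI (abs_nonneg _) (by positivity)
  have t3 : |r * e * (a ^ 2 * N - J)| ≤ M * (α ^ 2 * Λ + 1) := by
    rw [abs_mul, abs_mul]
    refine mul_le_mul ?_ ?_ (abs_nonneg _) hM
    · calc |r| * |e| ≤ 1 * M := mul_le_mul hr he (abs_nonneg _) zero_le_one
        _ = M := one_mul M
    · refine (abs_sub _ _).trans (add_le_add ?_ hJ)
      rw [abs_mul, abs_pow]
      exact mul_le_mul (pow_le_pow_left₀ (abs_nonneg _) ha 2) hN' (abs_nonneg _) (by positivity)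
  exact (abs_sub _ _).trans (add_le_add ((abs_sub _ _).trans (add_le_add t1 t2)) t3)

theorem variationIntegrand_eq (y₀ r : ℝ) (u J : Plane → ℝ) (η : Plane → Plane) (X : Plane) :
    variationIntegrand y₀ r u J η X
      = ((1 / height y₀ r X) * ‖gradient u X‖ ^ 2 + height y₀ r X * J X) * divergence η X
        - 2 * (1 / height y₀ r X) * inner ℝ (gradient u X) (fderiv ℝ η X (gradient u X))
        - r * η X 1 * ((1 / height y₀ r X) ^ 2 * ‖gradient u X‖ ^ 2 - J X) := by
  rw [variationIntegrand, one_div_pow]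
  ring

/-- A bound for a compactly supported `C¹` field and its derivative. -/
theorem exists_field_bounds {η : Plane → Plane} (hη : ContDiff ℝ 1 η) (hc : HasCompactSupport η) :
    ∃ R M, 0 < R ∧ 0 ≤ M ∧ (∀ X, R ≤ ‖X‖ → X ∉ tsupport η) ∧ (∀ X, |η X 1| ≤ M) ∧
      (∀ X, |divergence η X| ≤ M) ∧ ∀ X V : Plane, |inner ℝ V (fderiv ℝ η X V)| ≤ ‖V‖ ^ 2 * M := by
  obtain ⟨R, hR, hsub⟩ := hc.isCompact.isBounded.subset_ball_lt 0 0
  obtain ⟨M₁, hM₁⟩ := hc.exists_bound_of_continuous hη.continuous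
  obtain ⟨M₂, hM₂⟩ := (hc.fderiv (𝕜 := ℝ)).exists_bound_of_continuous
    (hη.continuous_fderiv (by simp))
  have h₁ : 0 ≤ M₁ := (norm_nonneg _).trans (hM₁ 0)
  have h₂ : 0 ≤ M₂ := (norm_nonneg _).trans (hM₂ 0)
  have hv : ∀ i : Fin 2, ∀ X, |fderiv ℝ η X (stdVec i) i| ≤ M₂ := fun i X => by
    refine (abs_coord_le _ i).trans (((fderiv ℝ η X).le_opNorm _).trans ?_)
    simpa using hM₂ X
  refine ⟨R, M₁ + 2 * M₂, hR, by positivity, fun X hX hmem => ?_, fun X => ?_, fun X => ?_,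
    fun X V => ?_⟩
  · have := hsub hmem
    rw [mem_ball_zero_iff] at this
    linarith
  · have := (abs_coord_le (η X) 1).trans (hM₁ X)
    linarith
  · rw [divergence_eq]
    have := abs_add_le (fderiv ℝ η X (stdVec 0) 0) (fderiv ℝ η X (stdVec 1) 1)
    linarith [hv 0 X, hv 1 X]
  · calc |inner ℝ V (fderiv ℝ η X V)| ≤ ‖V‖ * ‖fderiv ℝ η X V‖ := abs_real_inner_le_norm _ _
      _ ≤ ‖V‖ * (M₂ * ‖V‖) := by
          gcongr
          exact ((fderiv ℝ η X).le_opNorm V).trans (by gcongr; exact hM₂ X)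
      _ = ‖V‖ ^ 2 * M₂ := by ring
      _ ≤ _ := by gcongr; linarith

theorem measurable_divergence {η : Plane → Plane} (hη : ContDiff ℝ 1 η) :
    Measurable (divergence η) := by
  have hdη : Continuous (fderiv ℝ η) := hη.continuous_fderiv (by simp)
  have : Continuous (divergence η) := by
    unfold divergence
    fun_prop
  exact this.measurable

theorem measurable_inner_fderiv {η : Plane → Plane} (hη : ContDiff ℝ 1 η) {G : Plane → Plane}
    (hG : Measurable G) : Measurable fun X => (inner ℝ (G X) (fderiv ℝ η X (G X)) : ℝ) := by
  have hdη : Continuous (fderiv ℝ η) := hη.continuous_fderiv (by simp)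
  have h1 : Continuous fun p : Plane × Plane => (inner ℝ p.2 (fderiv ℝ η p.1 p.2) : ℝ) := by
    fun_prop
  exact h1.measurable.comp (measurable_id.prodMk hG)

theorem measurable_variationIntegrand {η : Plane → Plane} (hη : ContDiff ℝ 1 η) {u J : Plane → ℝ}
    (hJ : Measurable J) (y₀ r : ℝ) : Measurable (variationIntegrand y₀ r u J η) := by
  have h1 := measurable_divergence hη
  have h2 := measurable_inner_fderiv hη (measurable_gradient u)
  have h3 := (continuous_height y₀ r).measurable
  have h4 := (measurable_gradient u).norm
  have h5 : Measurable fun X => η X 1 := by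
    have := hη.continuous
    exact Continuous.measurable (by fun_prop)
  unfold variationIntegrand
  exact ((((measurable_const.div h3).mul (h4.pow_const 2)).add (h3.mul hJ)).mul h1).sub
    ((measurable_const.div h3).mul h2) |>.sub ((measurable_const.mul h5).mul
    (((measurable_const.div (h3.pow_const 2)).mul (h4.pow_const 2)).sub hJ))

theorem measurable_limitIntegrand {η : Plane → Plane} (hη : ContDiff ℝ 1 η) {φ J : Plane → ℝ}
    (hJ : Measurable J) (y₀ : ℝ) : Measurable (limitIntegrand y₀ φ J η) := by
  have h1 := measurable_divergence hη
  have h2 := measurable_inner_fderiv hη (measurable_gradient φ)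
  have h4 := (measurable_gradient φ).norm
  unfold limitIntegrand
  exact (((measurable_const.mul (h4.pow_const 2)).add (measurable_const.mul hJ)).mul h1).sub
    (measurable_const.mul h2)

/-- Stationarity passes to the limit, by strong convergence of the gradients. -/
theorem tendsto_limitIntegrand (h : BlowUpSeq y₀ L ρ r u J φ) {η : Plane → Plane}
    (hη : ContDiff ℝ 1 η) (hc : HasCompactSupport η) :
    Tendsto (fun n => ∫ X, limitIntegrand y₀ φ (J n) η X) atTop (𝓝 0) := by
  have hy := h.pos
  obtain ⟨R, M, hR, hM0, hout, hη1, hdiv, hin⟩ := exists_field_bounds hη hc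
  -- pass to a subsequence along which the gradients converge almost everywhere
  refine tendsto_of_subseq_tendsto fun ns hns => ?_
  have h' := h.comp hns
  obtain ⟨k, hk, hae⟩ := h'.exists_subseq_ae R
  have h2 := h'.comp hk.tendsto_atTop
  refine ⟨k, ?_⟩
  set ms : ℕ → ℕ := fun n => ns (k n) with hms
  have h3 : BlowUpSeq y₀ L (fun n => ρ (ms n)) (fun n => r (ms n)) (fun n => u (ms n))
    (fun n => J (ms n)) φ := h2
  set B := Metric.ball (0 : Plane) R with hB
  have hBm : MeasurableSet B := Metric.isOpen_ball.measurableSet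
  have hdivz : ∀ X, X ∉ tsupport η → divergence η X = 0 := fun X hX => by
    have : fderiv ℝ η X = 0 :=
      image_eq_zero_of_notMem_tsupport fun h' => hX (tsupport_fderiv_subset ℝ h')
    simp [divergence, this]
  have hzE : ∀ (n) (X : Plane), R ≤ ‖X‖ → limitIntegrand y₀ φ (J n) η X = 0 := fun n X hX => by
    have : fderiv ℝ η X = 0 :=
      image_eq_zero_of_notMem_tsupport fun h' => hout X hX (tsupport_fderiv_subset ℝ h')
    simp [limitIntegrand, hdivz X (hout X hX), this]
  have hNL : ∀ {w : Plane → ℝ}, LipschitzWith L w → ∀ X, ‖gradient w X‖ ^ 2 ≤ (L : ℝ) ^ 2 :=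
    fun hw X => pow_le_pow_left₀ (norm_nonneg _) (norm_gradient_le hw X) 2
  have hinL : ∀ {w : Plane → ℝ}, LipschitzWith L w → ∀ X,
      |inner ℝ (gradient w X) (fderiv ℝ η X (gradient w X))| ≤ (L : ℝ) ^ 2 * M := fun hw X =>
    (hin X _).trans (mul_le_mul_of_nonneg_right (hNL hw X) hM0)
  set K := (2 / y₀ * (L : ℝ) ^ 2 + 3 * y₀ / 2) * M + 2 * (2 / y₀) * ((L : ℝ) ^ 2 * M)
    + M * ((2 / y₀) ^ 2 * (L : ℝ) ^ 2 + 1) with hK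
  have hK0 : 0 ≤ K := by positivity
  have hEb : ∀ n X, |limitIntegrand y₀ φ (J n) η X| ≤ K := by
    intro n X
    have := abs_variation_le (a := 1 / y₀) (b := y₀) (r := 0) (e := 0) (α := 2 / y₀)
      (β := 3 * y₀ / 2) (by rw [abs_of_pos (by positivity)]; gcongr; norm_num)
      (by rw [abs_of_pos hy]; linarith) (sq_nonneg _)
      (hNL h.lipschitz X) ((h.pair n).abs_density_le X) (hdiv X) (hinL h.lipschitz X)
      (by simp) (by simpa using hM0)
    rw [limitIntegrand]
    convert this using 2
    ring
  have hVb : ∀ᶠ n in atTop, ∀ X, |variationIntegrand y₀ (r (ms n)) (u (ms n)) (J (ms n)) η X| ≤ K := by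
    filter_upwards [h3.eventually_weight_mem R, h3.eventually_lt_radius R,
      h3.scale.eventually (eventually_abs_sub_lt 0 one_pos)] with n hw hρ hr1 X
    rcases lt_or_ge ‖X‖ R with hX | hX
    · have hb := (h3.pair n).height_mem (hX.le.trans hρ.le)
      have ha := hw X hX.le
      rw [variationIntegrand_eq]
      refine abs_variation_le ?_ ?_ (sq_nonneg _)
        (hNL (h3.pair n).lip X) ((h3.pair n).abs_density_le X) (hdiv X) (hinL (h3.pair n).lip X)
        (by simpa using hr1.le) (hη1 X)
      · rw [abs_of_nonneg (le_trans (by positivity) ha.1)]; exact ha.2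
      · rw [abs_of_nonneg (by linarith [hb.1])]; exact hb.2
    · rw [variationIntegrand_eq_zero (hout X hX)]; simpa using hK0
  have hVz : ∀ᶠ n in atTop, ∫ X, variationIntegrand y₀ (r (ms n)) (u (ms n)) (J (ms n)) η X = 0 := by
    filter_upwards [h3.eventually_lt_radius R] with n hρ
    refine (h3.pair n).stationary η hη hc fun X hX => ?_
    by_contra hlt
    rw [mem_ball_zero_iff, not_lt] at hlt
    exact hout X (hρ.le.trans hlt) hX
  have hmV : ∀ n, Measurable (variationIntegrand y₀ (r (ms n)) (u (ms n)) (J (ms n)) η) :=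
    fun n => measurable_variationIntegrand hη (h3.pair n).measurable _ _
  have hmE : ∀ n, Measurable (limitIntegrand y₀ φ (J n) η) :=
    fun n => measurable_limitIntegrand hη (h.pair n).measurable _
  have hdiff : Tendsto (fun n => ∫ X, (limitIntegrand y₀ φ (J (ms n)) η X
      - variationIntegrand y₀ (r (ms n)) (u (ms n)) (J (ms n)) η X)) atTop
      (𝓝 (∫ X : Plane, (0 : ℝ))) := by
    refine tendsto_integral_filter_of_dominated_convergence (indicator B fun _ => K + K)
      (Eventually.of_forall fun n => ((hmE _).sub (hmV n)).aestronglyMeasurable) ?_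
      ((integrable_indicator_iff hBm).2 (integrableOn_const measure_ball_lt_top.ne)) ?_
    · filter_upwards [hVb] with n hn
      refine ae_of_all _ fun X => ?_
      rcases lt_or_ge ‖X‖ R with hX | hX
      · rw [indicator_of_mem (by simpa [hB] using hX)]
        exact (abs_sub _ _).trans (add_le_add (hEb _ X) (hn X))
      · rw [hzE _ X hX, variationIntegrand_eq_zero (hout X hX), sub_zero, norm_zero]
        exact indicator_nonneg (fun _ _ => by positivity) _
    · filter_upwards [hae] with X hX
      rcases lt_or_ge ‖X‖ R with hXR | hXR
      · have hg : Tendsto (fun n => gradient (u (ms n)) X) atTop (𝓝 (gradient φ X)) :=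
          hX (by simpa [hB] using hXR)
        have hw := h3.tendsto_weight X
        have hb := h3.tendsto_height X
        have hbd : ∀ n, |J (ms n) X| ≤ 1 := fun n => (h3.pair n).abs_density_le X
        have hin2 : Tendsto (fun n => (inner ℝ (gradient (u (ms n)) X)
            (fderiv ℝ η X (gradient (u (ms n)) X)) : ℝ)) atTop
            (𝓝 (inner ℝ (gradient φ X) (fderiv ℝ η X (gradient φ X)))) :=
          hg.inner (((fderiv ℝ η X).continuous.tendsto _).comp hg)
        have hN2 := (hg.norm).pow 2
        -- the terms without density converge, those with density differ by a null sequence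
        have s1 : Tendsto (fun n => (1 / height y₀ (r (ms n)) X * ‖gradient (u (ms n)) X‖ ^ 2)
            * divergence η X) atTop (𝓝 (1 / y₀ * ‖gradient φ X‖ ^ 2 * divergence η X)) :=
          (hw.mul hN2).mul_const _
        have s2 : Tendsto (fun n => 2 * (1 / height y₀ (r (ms n)) X) *
            (inner ℝ (gradient (u (ms n)) X) (fderiv ℝ η X (gradient (u (ms n)) X)) : ℝ)) atTop
            (𝓝 (2 * (1 / y₀) * inner ℝ (gradient φ X) (fderiv ℝ η X (gradient φ X)))) :=
          (hw.const_mul 2).mul hin2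
        have s3 : Tendsto (fun n => r (ms n) * η X 1 * ((1 / height y₀ (r (ms n)) X) ^ 2
            * ‖gradient (u (ms n)) X‖ ^ 2)) atTop
            (𝓝 (0 * η X 1 * ((1 / y₀) ^ 2 * ‖gradient φ X‖ ^ 2))) :=
          (h3.scale.mul_const _).mul ((hw.pow 2).mul hN2)
        have s4 : Tendsto (fun n => ((y₀ - height y₀ (r (ms n)) X) * divergence η X
            - r (ms n) * η X 1) * J (ms n) X) atTop (𝓝 0) := by
          have z : Tendsto (fun n => (y₀ - height y₀ (r (ms n)) X) * divergence η X
              - r (ms n) * η X 1) atTop (𝓝 0) := by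
            have := ((hb.const_sub y₀).mul_const (divergence η X)).sub
              (h3.scale.mul_const (η X 1))
            simpa using this
          refine squeeze_zero_norm (fun n => ?_) (tendsto_zero_iff_norm_tendsto_zero.1 z)
          rw [norm_mul]
          exact mul_le_of_le_one_right (norm_nonneg _) (hbd n)
        have tot := ((((s1.const_sub (1 / y₀ * ‖gradient φ X‖ ^ 2 * divergence η X)).add
          (s2.sub_const (2 * (1 / y₀) * inner ℝ (gradient φ X)
            (fderiv ℝ η X (gradient φ X))))).add s3).add s4)
        simp only [sub_self, zero_mul, add_zero] at tot
        refine tot.congr fun n => ?_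
        rw [variationIntegrand_eq, limitIntegrand]
        ring
      · simp only [hzE _ X hXR, variationIntegrand_eq_zero (hout X hXR), sub_zero]
        exact tendsto_const_nhds
  rw [integral_zero] at hdiff
  refine hdiff.congr' ?_
  filter_upwards [hVb, hVz] with n hn hz
  have iE : Integrable (limitIntegrand y₀ φ (J (ms n)) η) :=
    integrable_of_bound (R := R) (hmE _).aestronglyMeasurable (ae_of_all _ (hEb _)) (hzE _)
  have iV : Integrable (variationIntegrand y₀ (r (ms n)) (u (ms n)) (J (ms n)) η) :=
    integrable_of_bound (R := R) (hmV n).aestronglyMeasurable (ae_of_all _ hn)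
      fun X hX => variationIntegrand_eq_zero (hout X hX)
  rw [integral_sub iE iV, hz, sub_zero]

/-- Where the limit is positive, the densities are eventually equal to one. -/
theorem eventually_density (h : BlowUpSeq y₀ L ρ r u J φ) :
    ∀ᵐ X, 0 < φ X → ∀ᶠ n in atTop, J n X = 1 := by
  filter_upwards [ae_all_iff.2 fun n => (h.pair n).one] with X hX hpos
  filter_upwards [h.eventually_lt_radius ‖X‖, (h.lim X).eventually_const_lt hpos] with n hn hu
  exact hX n (by simpa using hn) hu

end BlowUpSeq

/-! ### Densities below the interface and equality of two slopes -/

/-- Integration along the direction `ν` of a function against translates of `∂_ν G`. -/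
theorem integral_shift {K G : Plane → ℝ} {M : ℝ} (hK : Measurable K) (hKM : ∀ X, |K X| ≤ M)
    (hG : ContDiff ℝ 1 G) (hc : HasCompactSupport G) (ν : Plane) {T : ℝ} (hT : 0 ≤ T) :
    Integrable (fun s => ∫ X, K X * fderiv ℝ G (X - s • ν) ν) (volume.restrict (Ioc 0 T)) ∧
    ∫ s in Ioc 0 T, (∫ X, K X * fderiv ℝ G (X - s • ν) ν)
      = ∫ X, K X * (G X - G (X - T • ν)) := by
  have hM : 0 ≤ M := (abs_nonneg _).trans (hKM 0)
  have hdG : Continuous fun X => fderiv ℝ G X ν :=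
    (hG.continuous_fderiv (by simp)).clm_apply continuous_const
  have hdc : HasCompactSupport fun X => fderiv ℝ G X ν := hc.fderiv_apply (𝕜 := ℝ) ν
  obtain ⟨N, hN⟩ := hdc.exists_bound_of_continuous hdG
  have hN0 : 0 ≤ N := (norm_nonneg _).trans (hN 0)
  obtain ⟨R, hR, hsub⟩ := hdc.isCompact.isBounded.subset_ball_lt 0 0
  set S := R + T * ‖ν‖ with hS
  set f : ℝ → Plane → ℝ := fun s X => K X * fderiv ℝ G (X - s • ν) ν with hf
  have hfm : Measurable (Function.uncurry f) := by
    have h1 : Continuous fun p : ℝ × Plane => fderiv ℝ G (p.2 - p.1 • ν) ν :=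
      hdG.comp (by fun_prop)
    exact (hK.comp measurable_snd).mul h1.measurable
  have hi : Integrable (Function.uncurry f) ((volume.restrict (Ioc 0 T)).prod volume) := by
    have hb1 : Integrable (fun _ : ℝ => M * N) (volume.restrict (Ioc 0 T)) :=
      integrableOn_const (by simp)
    have hb2 : Integrable (indicator (Metric.ball (0 : Plane) S) fun _ => (1 : ℝ)) :=
      (integrable_indicator_iff Metric.isOpen_ball.measurableSet).2
        (integrableOn_const measure_ball_lt_top.ne)
    refine (hb1.mul_prod hb2).mono' hfm.aestronglyMeasurable ?_
    have hmem : ∀ᵐ p : ℝ × Plane ∂((volume.restrict (Ioc 0 T)).prod volume), p.1 ∈ Ioc 0 T :=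
      Measure.quasiMeasurePreserving_fst.ae (ae_restrict_mem measurableSet_Ioc)
    filter_upwards [hmem] with p hp
    simp only [Function.uncurry, hf]
    rcases lt_or_ge ‖p.2‖ S with h | h
    · rw [indicator_of_mem (by simpa using h), mul_one, norm_mul]
      exact mul_le_mul (hKM _) (hN _) (norm_nonneg _) hM
    · have hz : fderiv ℝ G (p.2 - p.1 • ν) ν = 0 := by
        by_contra hne
        have h1 := hsub (subset_tsupport _ hne)
        rw [mem_ball_zero_iff] at h1
        have h2 : ‖p.2‖ ≤ ‖p.2 - p.1 • ν‖ + ‖p.1 • ν‖ := by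
          simpa using norm_add_le (p.2 - p.1 • ν) (p.1 • ν)
        have h3 : ‖p.1 • ν‖ ≤ T * ‖ν‖ := by
          rw [norm_smul, Real.norm_of_nonneg hp.1.le]
          exact mul_le_mul_of_nonneg_right hp.2 (norm_nonneg _)
        linarith
      rw [hz, mul_zero, norm_zero]
      exact mul_nonneg (mul_nonneg hM hN0) (indicator_nonneg (fun _ _ => zero_le_one) _)
  refine ⟨hi.integral_prod_left, ?_⟩
  rw [integral_integral_swap hi]
  refine integral_congr_ae (ae_of_all _ fun X => ?_)
  simp only
  rw [integral_const_mul]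
  congr 1
  rw [← intervalIntegral.integral_of_le hT]
  have hder : ∀ s ∈ uIcc 0 T, HasDerivAt (fun s => - G (X - s • ν)) (fderiv ℝ G (X - s • ν) ν) s := by
    intro s _
    have h1 : HasDerivAt (fun s : ℝ => X - s • ν) (-ν) s := by
      simpa using ((hasDerivAt_id s).smul_const ν).const_sub X
    have h2 := ((hG.differentiable (by simp) (X - s • ν)).hasFDerivAt.comp_hasDerivAt s h1).neg
    refine h2.congr_deriv ?_
    rw [map_neg, neg_neg]
  rw [intervalIntegral.integral_eq_sub_of_hasDerivAt hder
    ((hdG.comp (by fun_prop : Continuous fun s : ℝ => X - s • ν)).intervalIntegrable _ _)]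
  simp only [zero_smul, sub_zero]
  ring

namespace BlowUpSeq

variable {y₀ : ℝ} {L : ℝ≥0} {ρ r : ℕ → ℝ} {u J : ℕ → Plane → ℝ} {φ : Plane → ℝ}
  {ν : Plane} {A B : ℝ}

/-- The gradient of a two-plane function off the interface. -/
theorem gradient_two_plane (hφ : ∀ X, φ X = A * max (inner ℝ X ν) 0 + B * max (-inner ℝ X ν) 0)
    (X : Plane) : (0 < (inner ℝ X ν : ℝ) → gradient φ X = A • ν) ∧
      ((inner ℝ X ν : ℝ) < 0 → gradient φ X = (-B) • ν) := by
  have hcont : Continuous fun Z : Plane => (inner ℝ Z ν : ℝ) := by fun_prop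
  have hg : ∀ c : ℝ, gradient (fun Z : Plane => c * inner ℝ Z ν) X = c • ν := by
    intro c
    have h1 : HasFDerivAt (fun Z : Plane => c * (inner ℝ Z ν : ℝ)) (c • innerSL ℝ ν) X := by
      have := (innerSL ℝ ν).hasFDerivAt (x := X) |>.const_mul c
      simpa [real_inner_comm] using this
    rw [gradient, h1.fderiv, LinearIsometryEquiv.symm_apply_eq]
    ext v
    simp
  constructor
  · intro hX
    rw [← hg A]
    refine Filter.EventuallyEq.gradient_eq ?_
    filter_upwards [hcont.continuousAt.eventually_const_lt hX] with Z hZ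
    rw [hφ, max_eq_left hZ.le, max_eq_right (by linarith)]; ring
  · intro hX
    rw [← hg (-B)]
    refine Filter.EventuallyEq.gradient_eq ?_
    filter_upwards [hcont.continuousAt.eventually_lt_const hX] with Z hZ
    rw [hφ, max_eq_right hZ.le, max_eq_left (by linarith)]; ring

/-- For fields parallel to `ν` and a gradient parallel to `ν`, the limiting variation contains only
the derivative of the field along `ν`. -/
theorem limitIntegrand_smul {g : Plane → ℝ} (hg : ContDiff ℝ 1 g) (hν : ‖ν‖ = 1)
    {J : Plane → ℝ} {X : Plane} {c : ℝ} (hX : gradient φ X = c • ν) :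
    limitIntegrand y₀ φ J (fun Z => g Z • ν) X
      = (y₀ * J X - c ^ 2 / y₀) * fderiv ℝ g X ν := by
  have hd := hg.differentiable (by simp) X
  have hdiv : divergence (fun Z => g Z • ν) X = fderiv ℝ g X ν := by
    rw [divergence_eq, fderiv_smul_const_apply hd, fderiv_smul_const_apply hd, fderiv_eq_sum g X ν]
    simp
  rw [limitIntegrand, hdiv, hX, fderiv_smul_const_apply hd, map_smul, norm_smul, hν,
    real_inner_smul_left, real_inner_smul_right, real_inner_self_eq_norm_sq, hν, mul_one,
    Real.norm_eq_abs, sq_abs, smul_eq_mul]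
  ring

/-- On the side `X · ν < 0` of a two-plane limit, the densities converge weakly to a constant: test
stationarity with fields parallel to `ν`, and integrate along `ν`. -/
theorem tendsto_density_lower (h : BlowUpSeq y₀ L ρ r u J φ) (hν : ‖ν‖ = 1) (hA : 0 < A)
    (hφ : ∀ X, φ X = A * max (inner ℝ X ν) 0 + B * max (-inner ℝ X ν) 0)
    {G : Plane → ℝ} (hG : ContDiff ℝ 1 G) (hc : HasCompactSupport G)
    (hs : tsupport G ⊆ {X | (inner ℝ X ν : ℝ) < 0}) :
    Tendsto (fun n => ∫ X, (y₀ * (J n X - 1) + (A ^ 2 - B ^ 2) / y₀) * G X) atTop (𝓝 0) := by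
  have hy := h.pos
  have hν0 : ν ≠ 0 := by rintro rfl; simp at hν
  have hcont : Continuous fun Z : Plane => (inner ℝ Z ν : ℝ) := by fun_prop
  set P : Set Plane := {X | 0 ≤ (inner ℝ X ν : ℝ)} with hP
  set N : Set Plane := {X | (inner ℝ X ν : ℝ) < 0} with hN
  have hNm : MeasurableSet N := (isOpen_lt hcont continuous_const).measurableSet
  have hPm : MeasurableSet P := (isClosed_le continuous_const hcont).measurableSet
  set K : ℕ → Plane → ℝ := fun n => indicator N fun X => y₀ * (J n X - 1) + (A ^ 2 - B ^ 2) / y₀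
    with hK
  have hKm : ∀ n, Measurable (K n) := fun n =>
    ((measurable_const.mul ((h.pair n).measurable.sub_const 1)).add_const _).indicator hNm
  set M : ℝ := y₀ * 2 + |(A ^ 2 - B ^ 2) / y₀| with hM
  have hM0 : 0 ≤ M := by positivity
  have hJ2 : ∀ n X, |J n X - 1| ≤ 2 := fun n X =>
    (abs_sub _ _).trans (by have := (h.pair n).abs_density_le X; rw [abs_one]; linarith)
  have hKM : ∀ n X, |K n X| ≤ M := by
    intro n X
    by_cases hX : X ∈ N
    · rw [hK]
      simp only [indicator_of_mem hX]
      refine (abs_add_le _ _).trans (add_le_add ?_ le_rfl)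
      rw [abs_mul, abs_of_pos hy]
      exact mul_le_mul_of_nonneg_left (hJ2 n X) hy.le
    · rw [hK]
      simp only [indicator_of_notMem hX, abs_zero]
      exact hM0
  -- stationarity in direction `ν`, rewritten as a statement about the lower side
  have hstat : ∀ g : Plane → ℝ, ContDiff ℝ 1 g → HasCompactSupport g →
      Tendsto (fun n => ∫ X, K n X * fderiv ℝ g X ν) atTop (𝓝 0) := by
    intro g hg hgc
    have hgt : LipTest g := .of_contDiff hg hgc
    have hdg : Continuous fun X => fderiv ℝ g X ν :=
      (hg.continuous_fderiv (by simp)).clm_apply continuous_const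
    have hdc : HasCompactSupport fun X => fderiv ℝ g X ν := hgc.fderiv_apply (𝕜 := ℝ) ν
    have hdi : Integrable fun X => fderiv ℝ g X ν := hdg.integrable_of_hasCompactSupport hdc
    have hη : ContDiff ℝ 1 fun Z => g Z • ν := hg.smul contDiff_const
    have hηc : HasCompactSupport fun Z => g Z • ν := hgc.smul_right
    have t1 := h.tendsto_limitIntegrand hη hηc
    have hint0 := integral_fderiv_eq_zero hgt ν
    set p : ℝ := y₀ - A ^ 2 / y₀ with hp
    have t2 : Tendsto (fun n => ∫ X, indicator P (fun X => y₀ * (J n X - 1)) X * fderiv ℝ g X ν)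
        atTop (𝓝 (∫ X : Plane, (0 : ℝ))) := by
      refine tendsto_integral_of_dominated_convergence (fun X => y₀ * 2 * |fderiv ℝ g X ν|)
        (fun n => ((((measurable_const.mul ((h.pair n).measurable.sub_const 1))).indicator
          hPm).mul hdg.measurable).aestronglyMeasurable) (hdi.abs.const_mul _) (fun n => ?_) ?_
      · refine ae_of_all _ fun X => ?_
        rw [norm_mul]
        refine mul_le_mul_of_nonneg_right ?_ (norm_nonneg _)
        by_cases hX : X ∈ P
        · rw [indicator_of_mem hX, norm_mul, Real.norm_of_nonneg hy.le]
          exact mul_le_mul_of_nonneg_left (hJ2 n X) hy.le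
        · rw [indicator_of_notMem hX, norm_zero]; positivity
      · filter_upwards [h.eventually_density, ae_inner_ne_zero hν0] with X hX hXν
        by_cases hXP : X ∈ P
        · have hpos : 0 < (inner ℝ X ν : ℝ) := lt_of_le_of_ne hXP (Ne.symm hXν)
          have : 0 < φ X := by
            rw [hφ, max_eq_left hpos.le, max_eq_right (by linarith)]
            simp only [mul_zero, add_zero]; positivity
          refine tendsto_const_nhds.congr' ?_
          filter_upwards [hX this] with n hn
          rw [indicator_of_mem hXP, hn]; ring
        · simp only [indicator_of_notMem hXP, zero_mul]
          exact tendsto_const_nhds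
    rw [integral_zero] at t2
    have t3 := t1.sub t2
    rw [sub_zero] at t3
    refine t3.congr fun n => ?_
    have hae : ∀ᵐ X, limitIntegrand y₀ φ (J n) (fun Z => g Z • ν) X
        = K n X * fderiv ℝ g X ν
          + indicator P (fun X => y₀ * (J n X - 1)) X * fderiv ℝ g X ν
          + p * fderiv ℝ g X ν := by
      filter_upwards [ae_inner_ne_zero hν0] with X hX
      rcases lt_or_gt_of_ne hX with hlt | hgt
      · rw [limitIntegrand_smul hg hν ((gradient_two_plane hφ X).2 hlt), hK]
        have h1 : X ∈ N := hlt
        have h2 : X ∉ P := not_le.2 hlt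
        simp only [indicator_of_mem h1, indicator_of_notMem h2, hp]
        ring
      · rw [limitIntegrand_smul hg hν ((gradient_two_plane hφ X).1 hgt), hK]
        have h1 : X ∉ N := not_lt.2 (le_of_lt hgt)
        have h2 : X ∈ P := le_of_lt hgt
        simp only [indicator_of_mem h2, indicator_of_notMem h1, hp]
        ring
    have i1 : Integrable fun X => K n X * fderiv ℝ g X ν :=
      hdi.bdd_mul (c := M) (hKm n).aestronglyMeasurable (ae_of_all _ (hKM n))
    have i2 : Integrable fun X => indicator P (fun X => y₀ * (J n X - 1)) X * fderiv ℝ g X ν := by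
      refine hdi.bdd_mul (c := y₀ * 2) ((measurable_const.mul
        ((h.pair n).measurable.sub_const 1)).indicator hPm).aestronglyMeasurable
        (ae_of_all _ fun X => ?_)
      by_cases hX : X ∈ P
      · rw [indicator_of_mem hX, norm_mul, Real.norm_of_nonneg hy.le]
        exact mul_le_mul_of_nonneg_left (hJ2 n X) hy.le
      · rw [indicator_of_notMem hX, norm_zero]; positivity
    have i12 : Integrable fun X => K n X * fderiv ℝ g X ν
          + indicator P (fun X => y₀ * (J n X - 1)) X * fderiv ℝ g X ν := i1.add i2
    rw [integral_congr_ae hae, integral_add i12 (hdi.const_mul p), integral_add i1 i2,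
      integral_const_mul, hint0]
    ring
  -- translate the support of `G` out of the lower side
  obtain ⟨R, hR, hsub⟩ := hc.isCompact.isBounded.subset_ball_lt 0 0
  have hdG : Continuous fun X => fderiv ℝ G X ν :=
    (hG.continuous_fderiv (by simp)).clm_apply continuous_const
  have hdGi : Integrable fun X => fderiv ℝ G X ν :=
    hdG.integrable_of_hasCompactSupport (hc.fderiv_apply (𝕜 := ℝ) ν)
  have hshift : ∀ n, ∫ s in Ioc 0 R, (∫ X, K n X * fderiv ℝ G (X - s • ν) ν)
      = ∫ X, (y₀ * (J n X - 1) + (A ^ 2 - B ^ 2) / y₀) * G X := by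
    intro n
    rw [(integral_shift (hKm n) (hKM n) hG hc ν hR.le).2]
    refine integral_congr_ae (ae_of_all _ fun X => ?_)
    by_cases hX : X ∈ N
    · have hz : G (X - R • ν) = 0 := by
        by_contra hne
        have h1 := hsub (subset_tsupport _ hne)
        rw [mem_ball_zero_iff] at h1
        have h2 := (_root_.abs_le.1 (abs_real_inner_le_norm (X - R • ν) ν)).1
        rw [hν, mul_one, inner_sub_left, real_inner_smul_left, real_inner_self_eq_norm_sq, hν] at h2
        have h3 : (inner ℝ X ν : ℝ) < 0 := hX
        linarith
      simp only [hK, indicator_of_mem hX, hz, sub_zero]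
    · have hz : G X = 0 := image_eq_zero_of_notMem_tsupport fun h => hX (hs h)
      simp only [hK, indicator_of_notMem hX, hz, zero_mul, mul_zero]
  have hlim : Tendsto (fun n => ∫ s in Ioc 0 R, (∫ X, K n X * fderiv ℝ G (X - s • ν) ν)) atTop
      (𝓝 (∫ s in Ioc 0 R, (0 : ℝ))) := by
    refine tendsto_integral_of_dominated_convergence (fun _ => M * ∫ X, |fderiv ℝ G X ν|)
      (fun n => (integral_shift (hKm n) (hKM n) hG hc ν hR.le).1.1)
      (integrableOn_const (by simp)) (fun n => ae_of_all _ fun s => ?_) (ae_of_all _ fun s => ?_)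
    · have hsi : Integrable fun X => fderiv ℝ G (X - s • ν) ν := hdGi.comp_sub_right (s • ν)
      rw [← integral_sub_right_eq_self (fun X => |fderiv ℝ G X ν|) (s • ν), ← integral_const_mul]
      refine norm_integral_le_of_norm_le (hsi.abs.const_mul M) (ae_of_all _ fun X => ?_)
      rw [norm_mul]
      exact mul_le_mul_of_nonneg_right (hKM n X) (norm_nonneg _)
    · have h1 := hstat (fun X => G (X - s • ν)) (hG.comp (contDiff_id.sub contDiff_const))
        (hc.comp_homeomorph (Homeomorph.subRight (s • ν)))
      refine h1.congr fun n => integral_congr_ae (ae_of_all _ fun X => ?_)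
      simp only [sub_eq_add_neg, fderiv_comp_add_right]
  rw [integral_zero] at hlim
  exact hlim.congr hshift

/-- In the two-phase case both slopes agree. -/
theorem slopes_eq (h : BlowUpSeq y₀ L ρ r u J φ) (hν : ‖ν‖ = 1) (hA : 0 < A) (hB : 0 < B)
    (hφ : ∀ X, φ X = A * max (inner ℝ X ν) 0 + B * max (-inner ℝ X ν) 0) : A = B := by
  have hy := h.pos
  have hcont : Continuous fun Z : Plane => (inner ℝ Z ν : ℝ) := by fun_prop
  have hN : IsOpen {X : Plane | (inner ℝ X ν : ℝ) < 0} := isOpen_lt hcont continuous_const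
  have hmem : -ν ∈ {X : Plane | (inner ℝ X ν : ℝ) < 0} := by
    change (inner ℝ (-ν) ν : ℝ) < 0
    rw [inner_neg_left, real_inner_self_eq_norm_sq, hν]; norm_num
  obtain ⟨G, hG, hc, hs, hG01, hG1⟩ := exists_cutoff (isCompact_singleton (x := -ν)) hN
    (singleton_subset_iff.2 hmem)
  have hGi : Integrable G := hG.continuous.integrable_of_hasCompactSupport hc
  have t1 := h.tendsto_density_lower hν hA hφ (hG.of_le (by simp)) hc hs
  -- below the interface `φ` is positive too, so the densities tend to one there
  have t2 : Tendsto (fun n => ∫ X, (y₀ * (J n X - 1) + (A ^ 2 - B ^ 2) / y₀) * G X) atTop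
      (𝓝 (∫ X, (A ^ 2 - B ^ 2) / y₀ * G X)) := by
    refine tendsto_integral_of_dominated_convergence
      (fun X => (y₀ * 2 + |(A ^ 2 - B ^ 2) / y₀|) * |G X|)
      (fun n => (((measurable_const.mul ((h.pair n).measurable.sub_const 1)).add_const _).mul
        hG.continuous.measurable).aestronglyMeasurable) (hGi.abs.const_mul _) (fun n => ?_) ?_
    · refine ae_of_all _ fun X => ?_
      rw [norm_mul]
      refine mul_le_mul_of_nonneg_right ((abs_add_le _ _).trans (add_le_add ?_ le_rfl))
        (norm_nonneg _)
      rw [abs_mul, abs_of_pos hy]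
      refine mul_le_mul_of_nonneg_left ((abs_sub _ _).trans ?_) hy.le
      have := (h.pair n).abs_density_le X
      rw [abs_one]; linarith
    · filter_upwards [h.eventually_density] with X hX
      by_cases hXs : X ∈ tsupport G
      · have hlt : (inner ℝ X ν : ℝ) < 0 := hs hXs
        have hpos : 0 < φ X := by
          rw [hφ, max_eq_right hlt.le, max_eq_left (by linarith)]
          have : 0 < -(inner ℝ X ν : ℝ) := by linarith
          simp only [mul_zero, zero_add]; positivity
        refine tendsto_const_nhds.congr' ?_
        filter_upwards [hX hpos] with n hn
        rw [hn]; ring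
      · simp [image_eq_zero_of_notMem_tsupport hXs]
  have h0 := tendsto_nhds_unique t1 t2
  rw [integral_const_mul] at h0
  have hpos : 0 < ∫ X, G X :=
    hG.continuous.integral_pos_of_hasCompactSupport_nonneg_nonzero hc (fun X => (hG01 X).1)
      (x := -ν) (by rw [hG1.self_of_nhdsSet _ (mem_singleton _)]; exact one_ne_zero)
  have h1 := (mul_eq_zero.1 h0.symm).resolve_right hpos.ne'
  rw [div_eq_zero_iff] at h1
  have h2 := h1.resolve_right hy.ne'
  have h3 : (A - B) * (A + B) = 0 := by linear_combination h2
  have h4 := (mul_eq_zero.1 h3).resolve_right (by positivity)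
  linarith

end BlowUpSeq

/-! ### The resolvent of the Laplacian -/

open scoped FourierTransform LineDeriv SchwartzMap

theorem hasTemperateGrowth_inv_one_add_norm_sq :
    (fun ξ : Plane => (1 + ‖ξ‖ ^ 2)⁻¹).HasTemperateGrowth := by
  have := Function.hasTemperateGrowth_one_add_norm_sq_rpow Plane (-1)
  simpa only [Real.rpow_neg_one] using this

theorem fourier_lineDeriv_apply (V : 𝓢(Plane, ℂ)) (v ξ : Plane) :
    𝓕 (∂_{v} V) ξ = (2 * Real.pi * Complex.I) * ((inner ℝ ξ v : ℝ) * 𝓕 V ξ) := by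
  have h : (fun X : Plane => (inner ℝ X v : ℝ)).HasTemperateGrowth := by fun_prop
  rw [SchwartzMap.fourier_lineDerivOp_eq]
  simp [SchwartzMap.smulLeftCLM_apply_apply h]

/-- The equation `V - (4π²)⁻¹ ΔV = f` has a solution in the Schwartz class, with Fourier transform
`(1 + |ξ|²)⁻¹ 𝓕 f`. -/
theorem exists_resolvent (f : 𝓢(Plane, ℂ)) :
    ∃ V : 𝓢(Plane, ℂ),
      V - ((4 * Real.pi ^ 2)⁻¹ : ℂ) • (∂_{stdVec 0} (∂_{stdVec 0} V)
        + ∂_{stdVec 1} (∂_{stdVec 1} V)) = f ∧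
      ∀ ξ, 𝓕 V ξ = ((1 + ‖ξ‖ ^ 2)⁻¹ : ℝ) * 𝓕 f ξ := by
  have hm := hasTemperateGrowth_inv_one_add_norm_sq
  set V : 𝓢(Plane, ℂ) := 𝓕⁻ (SchwartzMap.smulLeftCLM ℂ
    (fun ξ : Plane => (1 + ‖ξ‖ ^ 2)⁻¹) (𝓕 f)) with hV
  have hF : ∀ ξ, 𝓕 V ξ = ((1 + ‖ξ‖ ^ 2)⁻¹ : ℝ) * 𝓕 f ξ := by
    intro ξ
    rw [hV, FourierTransform.fourier_fourierInv_eq, SchwartzMap.smulLeftCLM_apply_apply hm]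
    simp
  refine ⟨V, ?_, hF⟩
  have hinj : Function.Injective (fun g : 𝓢(Plane, ℂ) => 𝓕 g) := by
    intro a b hab
    have := congrArg (fun g : 𝓢(Plane, ℂ) => 𝓕⁻ g) hab
    simpa [FourierTransform.fourierInv_fourier_eq] using this
  apply hinj
  ext ξ
  have hn : (‖ξ‖ ^ 2 : ℝ) = ξ 0 ^ 2 + ξ 1 ^ 2 := by
    rw [EuclideanSpace.norm_sq_eq, Fin.sum_univ_two]; simp
  have h1 : (1 + ‖ξ‖ ^ 2 : ℝ) ≠ 0 := by positivity
  have hpi : (Real.pi : ℂ) ≠ 0 := by exact_mod_cast Real.pi_ne_zero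
  simp only [sub_eq_add_neg, FourierTransform.fourier_add, FourierTransform.fourier_neg,
    FourierTransform.fourier_smul, add_apply, neg_apply,
    smul_apply, fourier_lineDeriv_apply, hF, smul_eq_mul]
  have e0 : (inner ℝ ξ (stdVec 0) : ℝ) = ξ 0 := by simp [inner_eq_sum, stdVec]
  have e1 : (inner ℝ ξ (stdVec 1) : ℝ) = ξ 1 := by simp [inner_eq_sum, stdVec]
  rw [e0, e1]
  have key : (((1 + ‖ξ‖ ^ 2)⁻¹ : ℝ) : ℂ) * (1 + (ξ 0) ^ 2 + (ξ 1) ^ 2) = 1 := by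
    rw [hn]
    rw [hn] at h1
    norm_cast
    rw [← add_assoc] at h1 ⊢
    exact inv_mul_cancel₀ h1
  have hk : ((4 * Real.pi ^ 2)⁻¹ : ℂ) * (2 * Real.pi * Complex.I) ^ 2 = -1 := by
    rw [mul_pow, Complex.I_sq]
    field_simp
    norm_num
  linear_combination (𝓕 f ξ) * key
    - (((1 + ‖ξ‖ ^ 2)⁻¹ : ℝ) : ℂ) * 𝓕 f ξ * (ξ 0 ^ 2 + ξ 1 ^ 2) * hk

theorem integrable_norm_sq_schwartz (f : 𝓢(Plane, ℂ)) : Integrable fun X => ‖f X‖ ^ 2 := by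
  simpa using (f.memLp 2 volume).integrable_norm_pow (by norm_num)

theorem integrable_weight_fourier (f : 𝓢(Plane, ℂ)) (k : ℕ) :
    Integrable fun ξ : Plane => ((1 + ‖ξ‖ ^ 2)⁻¹) ^ k * ‖𝓕 f ξ‖ ^ 2 := by
  refine (integrable_norm_sq_schwartz (𝓕 f)).mono' ?_ (.of_forall fun ξ => ?_)
  · refine Continuous.aestronglyMeasurable ?_
    have : ∀ ξ : Plane, 1 + ‖ξ‖ ^ 2 ≠ 0 := fun ξ => by positivity
    have := (𝓕 f).continuous
    fun_prop (disch := assumption)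
  · have h0 : (0 : ℝ) ≤ (1 + ‖ξ‖ ^ 2)⁻¹ := by positivity
    have h1 : (1 + ‖ξ‖ ^ 2)⁻¹ ≤ 1 := inv_le_one_of_one_le₀ (by nlinarith [norm_nonneg ξ])
    rw [Real.norm_of_nonneg (by positivity)]
    exact mul_le_of_le_one_left (by positivity) (pow_le_one₀ h0 h1)

/-- Bound of the resolvent by the norm of `f` with the weight `(1 + |ξ|²)⁻¹`, which is that of
`W^{-1,2}`. -/
theorem integral_norm_sq_resolvent_le {f V : 𝓢(Plane, ℂ)}
    (hV : ∀ ξ, 𝓕 V ξ = ((1 + ‖ξ‖ ^ 2)⁻¹ : ℝ) * 𝓕 f ξ) :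
    ∫ X, ‖V X‖ ^ 2 ≤ ∫ ξ : Plane, (1 + ‖ξ‖ ^ 2)⁻¹ * ‖𝓕 f ξ‖ ^ 2 := by
  rw [← SchwartzMap.integral_norm_sq_fourier]
  have hi := integrable_weight_fourier f 1
  simp only [pow_one] at hi
  refine integral_mono (integrable_norm_sq_schwartz _) hi fun ξ => ?_
  have h0 : (0 : ℝ) ≤ (1 + ‖ξ‖ ^ 2)⁻¹ := by positivity
  have h1 : (1 + ‖ξ‖ ^ 2)⁻¹ ≤ 1 := inv_le_one_of_one_le₀ (by nlinarith [norm_nonneg ξ])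
  simp only [hV, norm_mul, Complex.norm_real, Real.norm_of_nonneg h0, mul_pow]
  gcongr
  nlinarith

/-- First derivatives of the resolvent are bounded by the same weighted norm. -/
theorem integral_norm_sq_lineDeriv_resolvent_le {f V : 𝓢(Plane, ℂ)}
    (hV : ∀ ξ, 𝓕 V ξ = ((1 + ‖ξ‖ ^ 2)⁻¹ : ℝ) * 𝓕 f ξ)
    {v : Plane} (hv : ‖v‖ = 1) :
    ∫ X, ‖(∂_{v} V) X‖ ^ 2 ≤
      (2 * Real.pi) ^ 2 * ∫ ξ : Plane, (1 + ‖ξ‖ ^ 2)⁻¹ * ‖𝓕 f ξ‖ ^ 2 := by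
  rw [← SchwartzMap.integral_norm_sq_fourier, ← integral_const_mul]
  have hi := integrable_weight_fourier f 1
  simp only [pow_one] at hi
  refine integral_mono (integrable_norm_sq_schwartz _) (hi.const_mul _) fun ξ => ?_
  have hp : 0 < 1 + ‖ξ‖ ^ 2 := by positivity
  have h0 : (0 : ℝ) ≤ (1 + ‖ξ‖ ^ 2)⁻¹ := by positivity
  have h1 : |inner ℝ ξ v| ≤ ‖ξ‖ := by simpa [hv] using abs_real_inner_le_norm ξ v
  simp only [fourier_lineDeriv_apply, hV, norm_mul, Complex.norm_real, Real.norm_of_nonneg h0,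
    Complex.norm_I, mul_pow, Real.norm_of_nonneg Real.pi_pos.le, Real.norm_eq_abs,
    Complex.norm_ofNat, mul_one]
  have h2 : |inner ℝ ξ v| ^ 2 * ((1 + ‖ξ‖ ^ 2)⁻¹) ^ 2 ≤ (1 + ‖ξ‖ ^ 2)⁻¹ := by
    calc |inner ℝ ξ v| ^ 2 * ((1 + ‖ξ‖ ^ 2)⁻¹) ^ 2
        ≤ (1 + ‖ξ‖ ^ 2) * ((1 + ‖ξ‖ ^ 2)⁻¹) ^ 2 := by
          gcongr
          nlinarith [abs_nonneg (inner ℝ ξ v)]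
      _ = (1 + ‖ξ‖ ^ 2)⁻¹ := by field_simp
  have h3 := mul_le_mul_of_nonneg_right h2 (show 0 ≤ 2 ^ 2 * Real.pi ^ 2 * ‖𝓕 f ξ‖ ^ 2 by positivity)
  linarith

/-- Second derivatives of the resolvent are bounded in `L²`. -/
theorem integral_norm_sq_lineDeriv_lineDeriv_resolvent_le {f V : 𝓢(Plane, ℂ)}
    (hV : ∀ ξ, 𝓕 V ξ = ((1 + ‖ξ‖ ^ 2)⁻¹ : ℝ) * 𝓕 f ξ)
    {v w : Plane} (hv : ‖v‖ = 1)
    (hw : ‖w‖ = 1) :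
    ∫ X, ‖(∂_{w} (∂_{v} V)) X‖ ^ 2 ≤ (2 * Real.pi) ^ 4 * ∫ X, ‖f X‖ ^ 2 := by
  rw [← SchwartzMap.integral_norm_sq_fourier, ← SchwartzMap.integral_norm_sq_fourier f,
    ← integral_const_mul]
  refine integral_mono (integrable_norm_sq_schwartz _)
    ((integrable_norm_sq_schwartz (𝓕 f)).const_mul _) fun ξ => ?_
  have hp : 0 < 1 + ‖ξ‖ ^ 2 := by positivity
  have h0 : (0 : ℝ) ≤ (1 + ‖ξ‖ ^ 2)⁻¹ := by positivity
  have h1 : |inner ℝ ξ v| ≤ ‖ξ‖ := by simpa [hv] using abs_real_inner_le_norm ξ v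
  have h1' : |inner ℝ ξ w| ≤ ‖ξ‖ := by simpa [hw] using abs_real_inner_le_norm ξ w
  simp only [fourier_lineDeriv_apply, hV, norm_mul, Complex.norm_real, Real.norm_of_nonneg h0,
    Complex.norm_I, mul_pow, Real.norm_of_nonneg Real.pi_pos.le, Real.norm_eq_abs,
    Complex.norm_ofNat, mul_one]
  have h2 : |inner ℝ ξ w| * |inner ℝ ξ v| * (1 + ‖ξ‖ ^ 2)⁻¹ ≤ 1 := by
    calc |inner ℝ ξ w| * |inner ℝ ξ v| * (1 + ‖ξ‖ ^ 2)⁻¹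
        ≤ (1 + ‖ξ‖ ^ 2) * (1 + ‖ξ‖ ^ 2)⁻¹ := by
          gcongr
          nlinarith [abs_nonneg (inner ℝ ξ v), abs_nonneg (inner ℝ ξ w)]
      _ = 1 := by field_simp
  have h2' : (|inner ℝ ξ w| * |inner ℝ ξ v| * (1 + ‖ξ‖ ^ 2)⁻¹) ^ 2 ≤ 1 :=
    pow_le_one₀ (by positivity) h2
  have h3 := mul_le_mul_of_nonneg_right h2'
    (show 0 ≤ 2 ^ 4 * Real.pi ^ 4 * ‖𝓕 f ξ‖ ^ 2 by positivity)
  nlinarith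

/-- Interpolation between weighted norms, from `m ≤ ε + ε⁻¹ m²` for `m = (1 + |ξ|²)⁻¹`. The weight
`m²` is integrable in the plane, which `m` is not. -/
theorem integral_weight_fourier_le (f : 𝓢(Plane, ℂ)) {ε : ℝ} (hε : 0 < ε) :
    ∫ ξ : Plane, (1 + ‖ξ‖ ^ 2)⁻¹ * ‖𝓕 f ξ‖ ^ 2 ≤
      ε * (∫ X, ‖f X‖ ^ 2) + ε⁻¹ * ∫ ξ : Plane, ((1 + ‖ξ‖ ^ 2)⁻¹) ^ 2 * ‖𝓕 f ξ‖ ^ 2 := by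
  have hi := integrable_weight_fourier f 1
  have hi2 := integrable_weight_fourier f 2
  have hi0 := integrable_norm_sq_schwartz (𝓕 f)
  simp only [pow_one] at hi
  rw [← SchwartzMap.integral_norm_sq_fourier f, ← integral_const_mul, ← integral_const_mul,
    ← integral_add (hi0.const_mul _) (hi2.const_mul _)]
  refine integral_mono hi ((hi0.const_mul _).add (hi2.const_mul _)) fun ξ => ?_
  set m : ℝ := (1 + ‖ξ‖ ^ 2)⁻¹ with hm
  have hm0 : 0 ≤ m := by positivity
  have h : m ≤ ε + ε⁻¹ * m ^ 2 := by
    rw [← sub_nonneg]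
    have : ε + ε⁻¹ * m ^ 2 - m = ε⁻¹ * ((ε - m) ^ 2 + ε * m) := by field_simp; ring
    rw [this]; positivity
  have h3 := mul_le_mul_of_nonneg_right h (sq_nonneg ‖𝓕 f ξ‖)
  linarith

/-! ### Weakly null sequences and the resolvent -/

/-- Bounded functions supported in a fixed ball are approximated by Schwartz functions in `L²` and
in `L¹`. -/
theorem exists_schwartz_approx {g : Plane → ℝ} {M R : ℝ} (hm : Measurable g)
    (hM : ∀ X, |g X| ≤ M) (hR : ∀ X, R ≤ ‖X‖ → g X = 0) {ε : ℝ} (hε : 0 < ε) :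
    ∃ f : 𝓢(Plane, ℂ), (∫ X, ‖f X - g X‖ ^ 2) ≤ ε ^ 2 ∧
      (Integrable fun X => ‖f X - g X‖ ^ 2) ∧
      (∫ X, ‖f X - g X‖) ≤ ε * (volume.real (Metric.ball (0 : Plane) (R + 1)) + 1) := by
  obtain ⟨χ, hχ, hχc, hχs, hχI, hχ1⟩ := exists_cutoff (K := Metric.closedBall (0 : Plane) R)
    (D := Metric.ball (0 : Plane) (R + 1)) (isCompact_closedBall 0 R) Metric.isOpen_ball
    (Metric.closedBall_subset_ball (by linarith))
  have hχ1' : ∀ X : Plane, ‖X‖ ≤ R → χ X = 1 := fun X hX =>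
    hχ1.self_of_nhdsSet X (by simpa using hX)
  have hmc : Measurable fun X => (g X : ℂ) := Complex.measurable_ofReal.comp hm
  have hg2 : MemLp (fun X => (g X : ℂ)) 2 volume := by
    have hb : MemLp (fun X => (g X : ℂ)) 2 (volume.restrict (Metric.ball 0 (R + 1))) := by
      have : IsFiniteMeasure (volume.restrict (Metric.ball (0 : Plane) (R + 1))) :=
        ⟨by
          rw [Measure.restrict_apply_univ]
          exact measure_ball_lt_top⟩
      exact MemLp.of_bound hmc.aestronglyMeasurable M (.of_forall fun X => by simpa using hM X)
    rw [← memLp_indicator_iff_restrict measurableSet_ball] at hb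
    convert hb using 1
    ext X
    by_cases hX : X ∈ Metric.ball (0 : Plane) (R + 1)
    · simp [hX]
    · rw [indicator_of_notMem hX, hR X (by
        have : R + 1 ≤ ‖X‖ := by simpa using hX
        linarith), Complex.ofReal_zero]
  obtain ⟨G, hGc, hG, hGε⟩ := hg2.exist_eLpNorm_sub_le (by norm_num) (by norm_num) hε
  have hsm : ContDiff ℝ ∞ fun X => (χ X : ℂ) * G X :=
    (Complex.ofRealCLM.contDiff.comp hχ).mul hG
  have hcs : HasCompactSupport fun X => (χ X : ℂ) * G X := hGc.mul_left
  refine ⟨hcs.toSchwartzMap hsm, ?_⟩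
  have hval : ∀ X, hcs.toSchwartzMap hsm X = (χ X : ℂ) * G X := fun X => rfl
  simp only [hval]
  have hptw : ∀ X, ‖(χ X : ℂ) * G X - g X‖ ≤ ‖(g X : ℂ) - G X‖ := by
    intro X
    have : (χ X : ℂ) * G X - g X = (χ X : ℂ) * (G X - g X) := by
      rcases le_total ‖X‖ R with h | h
      · rw [hχ1' X h]; simp
      · rw [hR X h]; simp
    rw [this, norm_mul, Complex.norm_real, Real.norm_of_nonneg (hχI X).1, norm_sub_rev]
    exact mul_le_of_le_one_left (norm_nonneg _) (hχI X).2
  have hmem : MemLp (fun X => (g X : ℂ) - G X) 2 volume :=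
    hg2.sub (hG.continuous.memLp_of_hasCompactSupport hGc)
  have hi1 : Integrable fun X => ‖(g X : ℂ) - G X‖ ^ 2 := by
    simpa using hmem.integrable_norm_pow (by norm_num)
  have hmeas : AEStronglyMeasurable (fun X => (χ X : ℂ) * G X - g X) volume :=
    hsm.continuous.aestronglyMeasurable.sub hmc.aestronglyMeasurable
  have hi : Integrable fun X => ‖(χ X : ℂ) * G X - g X‖ ^ 2 := by
    refine hi1.mono' (hmeas.norm.pow 2) (.of_forall fun X => ?_)
    rw [Real.norm_of_nonneg (by positivity)]
    gcongr
    exact hptw X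
  have h2 : (∫ X, ‖(χ X : ℂ) * G X - g X‖ ^ 2) ≤ ε ^ 2 := by
    refine (integral_mono hi hi1 fun X => ?_).trans ?_
    · have := hptw X
      dsimp only
      gcongr
    · have h := hmem.eLpNorm_eq_integral_rpow_norm (by norm_num) (by norm_num)
      have h' := hGε
      rw [show ((fun X => (g X : ℂ)) - G) = fun X => (g X : ℂ) - G X from rfl, h] at h'
      rw [ENNReal.ofReal_le_ofReal_iff hε.le] at h'
      simp only [ENNReal.toReal_ofNat, Real.rpow_ofNat] at h'
      have h0 : (0:ℝ) ≤ ∫ X, ‖(g X : ℂ) - G X‖ ^ 2 := integral_nonneg fun X => by positivity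
      rw [← one_div, ← Real.sqrt_eq_rpow] at h'
      exact (Real.sqrt_le_left hε.le).1 h'
  refine ⟨h2, hi, ?_⟩
  have hB : Integrable ((Metric.ball (0 : Plane) (R + 1)).indicator fun _ => ε) :=
    (integrable_indicator_iff measurableSet_ball).2 (integrableOn_const measure_ball_lt_top.ne)
  calc (∫ X, ‖(χ X : ℂ) * G X - g X‖)
      ≤ ∫ X, ((Metric.ball (0 : Plane) (R + 1)).indicator (fun _ => ε) X
          + ε⁻¹ * ‖(χ X : ℂ) * G X - g X‖ ^ 2) := by
        refine integral_mono_of_nonneg (.of_forall fun X => norm_nonneg _)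
          (hB.add (hi.const_mul _)) (.of_forall fun X => ?_)
        dsimp only
        by_cases hX : X ∈ Metric.ball (0 : Plane) (R + 1)
        · rw [indicator_of_mem hX]
          set t := ‖(χ X : ℂ) * G X - g X‖
          have ht : 0 ≤ t := norm_nonneg _
          rw [← sub_nonneg]
          have : ε + ε⁻¹ * t ^ 2 - t = ε⁻¹ * ((ε - t) ^ 2 + ε * t) := by field_simp; ring
          rw [this]; positivity
        · have h1 : χ X = 0 := image_eq_zero_of_notMem_tsupport fun h => hX (hχs h)
          have h3 : g X = 0 := hR X (by
            have : R + 1 ≤ ‖X‖ := by simpa using hX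
            linarith)
          rw [indicator_of_notMem hX]
          simp [h1, h3]
    _ = ε * volume.real (Metric.ball (0 : Plane) (R + 1))
          + ε⁻¹ * ∫ X, ‖(χ X : ℂ) * G X - g X‖ ^ 2 := by
        rw [integral_add hB (hi.const_mul _), integral_const_mul,
          integral_indicator measurableSet_ball, setIntegral_const, smul_eq_mul, mul_comm ε]
    _ ≤ ε * volume.real (Metric.ball (0 : Plane) (R + 1)) + ε⁻¹ * ε ^ 2 := by gcongr
    _ = _ := by field_simp

theorem norm_fourier_le {f : 𝓢(Plane, ℂ)} (ξ : Plane) : ‖𝓕 f ξ‖ ≤ ∫ X, ‖f X‖ := by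
  simpa [SchwartzMap.norm_toLp_one] using f.norm_fourier_apply_le_toLp_one ξ

/-- If bounded functions with support in a fixed ball tend to zero weakly, then the Fourier
transforms of close Schwartz functions tend to zero pointwise. -/
theorem tendsto_fourier_zero {g : ℕ → Plane → ℝ} {R : ℝ}
    (hi : ∀ n, Integrable (g n)) (hR : ∀ n X, R ≤ ‖X‖ → g n X = 0)
    (hg : ∀ G : Plane → ℝ, ContDiff ℝ ∞ G → HasCompactSupport G →
      Tendsto (fun n => ∫ X, g n X * G X) atTop (𝓝 0))
    {f : ℕ → 𝓢(Plane, ℂ)} (hf : Tendsto (fun n => ∫ X, ‖f n X - g n X‖) atTop (𝓝 0))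
    (ξ : Plane) : Tendsto (fun n => 𝓕 (f n) ξ) atTop (𝓝 0) := by
  obtain ⟨χ, hχ, hχc, -, -, hχ1⟩ := exists_cutoff (K := Metric.closedBall (0 : Plane) R)
    (D := Metric.ball (0 : Plane) (R + 1)) (isCompact_closedBall 0 R) Metric.isOpen_ball
    (Metric.closedBall_subset_ball (by linarith))
  have hχ1' : ∀ X : Plane, ‖X‖ ≤ R → χ X = 1 := fun X hX =>
    hχ1.self_of_nhdsSet X (by simpa using hX)
  set e : Plane → ℂ := fun X => Complex.exp (((-2 * Real.pi * inner ℝ X ξ : ℝ) : ℂ) * Complex.I)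
    with he
  have heq : ∀ n, 𝓕 (f n) ξ = ∫ X, e X * f n X := by
    intro n
    rw [SchwartzMap.fourier_coe, Real.fourier_eq']
    simp [he]
  have hes : ContDiff ℝ ∞ e := by
    refine ContDiff.cexp ((Complex.ofRealCLM.contDiff.comp ?_).mul contDiff_const)
    exact contDiff_const.mul (contDiff_id.inner ℝ contDiff_const)
  have hec : Continuous e := hes.continuous
  have hen : ∀ X, ‖e X‖ = 1 := fun X => Complex.norm_exp_ofReal_mul_I _
  have hgC : ∀ n, Integrable fun X => (g n X : ℂ) := fun n => (hi n).ofReal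
  have heI : ∀ {h : Plane → ℂ}, Integrable h → Integrable fun X => e X * h X := fun hh =>
    hh.bdd_mul hec.aestronglyMeasurable (.of_forall fun X => (hen X).le)
  have h1 : Tendsto (fun n => ∫ X, e X * (f n X - g n X)) atTop (𝓝 0) := by
    refine squeeze_zero_norm (fun n => ?_) hf
    refine (norm_integral_le_integral_norm _).trans (le_of_eq ?_)
    simp [hen]
  have h2 : Tendsto (fun n => ∫ X, e X * (g n X : ℂ)) atTop (𝓝 0) := by
    have hre := hg (fun X => χ X * (e X).re) (hχ.mul (Complex.reCLM.contDiff.comp hes)) hχc.mul_right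
    have him := hg (fun X => χ X * (e X).im) (hχ.mul (Complex.imCLM.contDiff.comp hes)) hχc.mul_right
    have hsum := ((Complex.continuous_ofReal.tendsto _).comp hre).add
      (((Complex.continuous_ofReal.tendsto _).comp him).mul_const Complex.I)
    simp only [Complex.ofReal_zero, zero_mul, add_zero, Function.comp_def] at hsum
    refine hsum.congr fun n => ?_
    rw [← integral_re_add_im (heI (hgC n))]
    congr 1
    · congr 1
      refine integral_congr_ae (.of_forall fun X => ?_)
      rcases le_total ‖X‖ R with h | h
      · simp [hχ1' X h, mul_comm]
      · simp [hR n X h]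
    · congr 2
      refine integral_congr_ae (.of_forall fun X => ?_)
      rcases le_total ‖X‖ R with h | h
      · simp [hχ1' X h, mul_comm]
      · simp [hR n X h]
  have h := h1.add h2
  rw [add_zero] at h
  refine h.congr fun n => ?_
  have h3 : Integrable fun X => e X * (f n X - g n X) := heI ((f n).integrable.sub (hgC n))
  rw [heq, ← integral_add h3 (heI (hgC n))]
  refine integral_congr_ae (.of_forall fun X => ?_)
  dsimp only
  ring

/-- Bounded functions `gₙ` with support in a fixed ball that tend to zero weakly are, up to errors
tending to zero in `L²`, of the form `Wₙ - c ΔWₙ` with smooth `Wₙ` that tend to zero in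
`W^{1,2}` and are bounded in `W^{2,2}`. This is the compactness of the resolvent of the Laplacian on
functions with support in a fixed ball. -/
theorem exists_elliptic_corrector {g : ℕ → Plane → ℝ} {M R : ℝ} (hm : ∀ n, Measurable (g n))
    (hM : ∀ n X, |g n X| ≤ M) (hR : ∀ n X, R ≤ ‖X‖ → g n X = 0)
    (hg : ∀ G : Plane → ℝ, ContDiff ℝ ∞ G → HasCompactSupport G →
      Tendsto (fun n => ∫ X, g n X * G X) atTop (𝓝 0)) :
    ∃ (W : ℕ → Plane → ℝ) (c C : ℝ), (∀ n, ContDiff ℝ ∞ (W n)) ∧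
      (∀ n, Integrable fun X => W n X ^ 2) ∧
      (∀ n i, Integrable fun X => fderiv ℝ (W n) X (stdVec i) ^ 2) ∧
      (∀ n i j, Integrable fun X =>
        fderiv ℝ (fun Y => fderiv ℝ (W n) Y (stdVec i)) X (stdVec j) ^ 2) ∧
      Tendsto (fun n => ∫ X, W n X ^ 2) atTop (𝓝 0) ∧
      (∀ i, Tendsto (fun n => ∫ X, fderiv ℝ (W n) X (stdVec i) ^ 2) atTop (𝓝 0)) ∧
      (∀ n i j, ∫ X, fderiv ℝ (fun Y => fderiv ℝ (W n) Y (stdVec i)) X (stdVec j) ^ 2 ≤ C) ∧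
      (∀ n, Integrable fun X => (W n X - c * (∑ i,
        fderiv ℝ (fun Y => fderiv ℝ (W n) Y (stdVec i)) X (stdVec i)) - g n X) ^ 2) ∧
      Tendsto (fun n => ∫ X, (W n X - c * (∑ i,
        fderiv ℝ (fun Y => fderiv ℝ (W n) Y (stdVec i)) X (stdVec i)) - g n X) ^ 2)
        atTop (𝓝 0) := by
  have hM0 : 0 ≤ M := (abs_nonneg _).trans (hM 0 0)
  have hε : ∀ n : ℕ, (0 : ℝ) < 1 / ((n : ℝ) + 1) := fun n => Nat.one_div_pos_of_nat
  choose f hf2 hfi hf1 using fun n => exists_schwartz_approx (hm n) (hM n) (hR n) (hε n)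
  choose V hVeq hV using fun n => exists_resolvent (f n)
  have hlim : Tendsto (fun n : ℕ => 1 / ((n : ℝ) + 1)) atTop (𝓝 0) :=
    tendsto_one_div_add_atTop_nhds_zero_nat
  set B := volume.real (Metric.ball (0 : Plane) (R + 1))
  have hi : ∀ n, Integrable (g n) := fun n => integrable_of_bound (R := R)
    (hm n).aestronglyMeasurable (.of_forall (hM n)) (hR n)
  have hb : ∀ n, ∫ X, |g n X| ≤ M * B := by
    intro n
    have h1 : ∫ X, |g n X| = ∫ X in Metric.ball 0 (R + 1), |g n X| := by
      rw [setIntegral_eq_integral_of_forall_compl_eq_zero]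
      intro X hX
      have : R + 1 ≤ ‖X‖ := by simpa using hX
      rw [hR n X (by linarith), abs_zero]
    have h2 := norm_setIntegral_le_of_norm_le_const (μ := volume)
      (s := Metric.ball (0 : Plane) (R + 1)) (f := fun X => |g n X|) (C := M)
      measure_ball_lt_top (fun X _ => by simpa using hM n X)
    rw [h1]
    exact (le_abs_self _).trans h2
  have hδ1 : Tendsto (fun n => ∫ X, ‖f n X - g n X‖) atTop (𝓝 0) := by
    refine squeeze_zero (fun n => integral_nonneg fun X => norm_nonneg _) hf1 ?_
    simpa using hlim.mul_const (B + 1)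
  have hδ2 : Tendsto (fun n => ∫ X, ‖f n X - g n X‖ ^ 2) atTop (𝓝 0) := by
    refine squeeze_zero (fun n => integral_nonneg fun X => by positivity) hf2 ?_
    simpa using hlim.pow 2
  have hε1 : ∀ n : ℕ, 1 / ((n : ℝ) + 1) ≤ 1 := fun n => by
    rw [div_le_one (by positivity)]; linarith [n.cast_nonneg (α := ℝ)]
  have hB0 : 0 ≤ B := measureReal_nonneg
  -- uniform bounds in `L¹` and `L²`
  have hL1 : ∀ n, ∫ X, ‖f n X‖ ≤ M * B + (B + 1) := by
    intro n
    have hi1 : Integrable fun X => ‖f n X - g n X‖ := ((f n).integrable.sub (hi n).ofReal).norm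
    calc ∫ X, ‖f n X‖ ≤ ∫ X, (|g n X| + ‖f n X - g n X‖) := by
          refine integral_mono (f n).integrable.norm ((hi n).abs.add hi1) fun X => ?_
          have := norm_add_le (g n X : ℂ) (f n X - g n X)
          simpa using this
      _ = (∫ X, |g n X|) + ∫ X, ‖f n X - g n X‖ := integral_add (hi n).abs hi1
      _ ≤ _ := by
          refine add_le_add (hb n) ((hf1 n).trans ?_)
          exact mul_le_of_le_one_left (by positivity) (hε1 n)
  have hL2 : ∀ n, ∫ X, ‖f n X‖ ^ 2 ≤ 2 * (M * (M * B)) + 2 := by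
    intro n
    have hi2 : Integrable fun X => 2 * (M * |g n X|) := ((hi n).abs.const_mul _).const_mul _
    calc ∫ X, ‖f n X‖ ^ 2 ≤ ∫ X, (2 * (M * |g n X|) + 2 * ‖f n X - g n X‖ ^ 2) := by
          refine integral_mono (integrable_norm_sq_schwartz _) (hi2.add ((hfi n).const_mul _))
            fun X => ?_
          have h1 := norm_add_le (g n X : ℂ) (f n X - g n X)
          rw [add_sub_cancel, Complex.norm_real, Real.norm_eq_abs] at h1
          have h2 := mul_le_mul_of_nonneg_right (hM n X) (abs_nonneg (g n X))
          have h3 := norm_nonneg (f n X)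
          dsimp only
          nlinarith [sq_nonneg (|g n X| - ‖f n X - g n X‖), mul_self_le_mul_self h3 h1]
      _ = 2 * (M * ∫ X, |g n X|) + 2 * ∫ X, ‖f n X - g n X‖ ^ 2 := by
          rw [integral_add hi2 ((hfi n).const_mul _), integral_const_mul, integral_const_mul,
            integral_const_mul]
      _ ≤ _ := by
          have h1 := hf2 n
          have h2 : (1 / ((n : ℝ) + 1)) ^ 2 ≤ 1 := pow_le_one₀ (hε n).le (hε1 n)
          have h3 := mul_le_mul_of_nonneg_left (hb n) hM0
          linarith
  set C₂ := 2 * (M * (M * B)) + 2 with hC₂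
  have hC₂0 : 0 < C₂ := by positivity
  -- the weighted norms of the Fourier transforms tend to zero by dominated convergence
  have hw2 : Tendsto (fun n => ∫ ξ : Plane, ((1 + ‖ξ‖ ^ 2)⁻¹) ^ 2 * ‖𝓕 (f n) ξ‖ ^ 2) atTop
      (𝓝 0) := by
    have hint : Integrable fun ξ : Plane => ((1 + ‖ξ‖ ^ 2)⁻¹) ^ 2 := by
      have := integrable_rpow_neg_one_add_norm_sq (E := Plane) (μ := volume) (r := 4)
        (by simp; norm_num)
      refine this.congr (.of_forall fun ξ => ?_)
      dsimp only
      rw [show (-4 / 2 : ℝ) = -(2 : ℕ) by norm_num, Real.rpow_neg (by positivity),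
        Real.rpow_natCast, inv_pow]
    have := tendsto_integral_of_dominated_convergence (F := fun n (ξ : Plane) =>
        ((1 + ‖ξ‖ ^ 2)⁻¹) ^ 2 * ‖𝓕 (f n) ξ‖ ^ 2) (f := fun _ => 0)
      (fun ξ : Plane => ((1 + ‖ξ‖ ^ 2)⁻¹) ^ 2 * (M * B + (B + 1)) ^ 2)
      (fun n => (integrable_weight_fourier (f n) 2).aestronglyMeasurable)
      (hint.mul_const _) (fun n => .of_forall fun ξ => ?_) (.of_forall fun ξ => ?_)
    · simpa using this
    · rw [Real.norm_of_nonneg (by positivity)]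
      have := (norm_fourier_le (f := f n) ξ).trans (hL1 n)
      gcongr
    · have := (tendsto_fourier_zero hi hR hg hδ1 ξ).norm
      simpa [-inv_pow] using (this.pow 2).const_mul (((1 + ‖ξ‖ ^ 2)⁻¹) ^ 2)
  have hw1 : Tendsto (fun n => ∫ ξ : Plane, (1 + ‖ξ‖ ^ 2)⁻¹ * ‖𝓕 (f n) ξ‖ ^ 2) atTop
      (𝓝 0) := by
    rw [Metric.tendsto_atTop]
    intro ε hε
    have h1 := hw2.const_mul (ε / (2 * C₂))⁻¹
    rw [mul_zero] at h1
    obtain ⟨N, hN⟩ := (Metric.tendsto_atTop.1 h1) (ε / 2) (by positivity)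
    refine ⟨N, fun n hn => ?_⟩
    have h2 := integral_weight_fourier_le (f n) (ε := ε / (2 * C₂)) (by positivity)
    have h3 := (le_abs_self _).trans_lt (by simpa only [Real.dist_eq, sub_zero] using hN n hn)
    have h4 : ε / (2 * C₂) * (∫ X, ‖f n X‖ ^ 2) ≤ ε / (2 * C₂) * C₂ := by
      gcongr
      exact hL2 n
    have h5 : ε / (2 * C₂) * C₂ = ε / 2 := by field_simp
    rw [Real.dist_eq, sub_zero, abs_of_nonneg (integral_nonneg fun ξ => by positivity)]
    linarith
  -- pass to real parts
  have hre : ∀ (U : 𝓢(Plane, ℂ)) X v,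
      fderiv ℝ (fun Y => (U Y).re) X v = ((∂_{v} U) X).re := by
    intro U X v
    have h := (Complex.reCLM.hasFDerivAt.comp X (U.differentiableAt (x := X)).hasFDerivAt).fderiv
    rw [show (fun Y => (U Y).re) = Complex.reCLM ∘ U from rfl, h]
    rfl
  have hre2 : ∀ (U : 𝓢(Plane, ℂ)) X v w,
      fderiv ℝ (fun Y => fderiv ℝ (fun Z => (U Z).re) Y v) X w = ((∂_{w} (∂_{v} U)) X).re := by
    intro U X v w
    simp only [hre]
  have hsq : ∀ U : 𝓢(Plane, ℂ), (Integrable fun X => (U X).re ^ 2) ∧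
      ∫ X, (U X).re ^ 2 ≤ ∫ X, ‖U X‖ ^ 2 := by
    intro U
    have hle : ∀ X, (U X).re ^ 2 ≤ ‖U X‖ ^ 2 := fun X =>
      sq_le_sq.2 (by simpa using Complex.abs_re_le_norm (U X))
    have hi : Integrable fun X => (U X).re ^ 2 := by
      refine (integrable_norm_sq_schwartz U).mono'
        ((Complex.continuous_re.comp U.continuous).pow 2).aestronglyMeasurable
        (.of_forall fun X => ?_)
      rw [Real.norm_of_nonneg (by positivity)]
      exact hle X
    exact ⟨hi, integral_mono hi (integrable_norm_sq_schwartz U) hle⟩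
  have hv : ∀ i, ‖stdVec i‖ = 1 := fun i => by simp [stdVec]
  have heq : ∀ n X, (V n X).re - (4 * Real.pi ^ 2)⁻¹ * (∑ i,
      fderiv ℝ (fun Y => fderiv ℝ (fun Z => (V n Z).re) Y (stdVec i)) X (stdVec i)) - g n X
      = (f n X - g n X).re := by
    intro n X
    have h := congrArg (fun U : 𝓢(Plane, ℂ) => (U X).re) (hVeq n)
    have hc : ((4 * Real.pi ^ 2)⁻¹ : ℂ) = (((4 * Real.pi ^ 2)⁻¹ : ℝ) : ℂ) := by push_cast; rfl
    simp only [hc, sub_apply, smul_apply, add_apply, smul_eq_mul, Complex.sub_re,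
      Complex.re_ofReal_mul, Complex.add_re] at h
    simp only [hre2, Fin.sum_univ_two, Complex.sub_re, Complex.ofReal_re]
    linarith
  have hgi : ∀ n, Integrable fun X => (f n X - g n X).re ^ 2 := by
    intro n
    refine (hfi n).mono' ?_ (.of_forall fun X => ?_)
    · exact ((Complex.measurable_re.comp ((f n).continuous.measurable.sub
        (Complex.measurable_ofReal.comp (hm n)))).pow_const 2).aestronglyMeasurable
    · rw [Real.norm_of_nonneg (by positivity)]
      exact sq_le_sq.2 (by simpa using Complex.abs_re_le_norm (f n X - g n X))
  refine ⟨fun n X => (V n X).re, (4 * Real.pi ^ 2)⁻¹, (2 * Real.pi) ^ 4 * C₂,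
    fun n => Complex.reCLM.contDiff.comp (V n).smooth', fun n => (hsq _).1, fun n i => ?_,
    fun n i j => ?_, ?_, fun i => ?_, fun n i j => ?_, fun n => ?_, ?_⟩
  · simp only [hre]
    exact (hsq _).1
  · simp only [hre2]
    exact (hsq _).1
  · exact squeeze_zero (fun n => integral_nonneg fun X => by positivity)
      (fun n => (hsq _).2.trans (integral_norm_sq_resolvent_le (hV n))) hw1
  · simp only [hre]
    refine squeeze_zero (fun n => integral_nonneg fun X => by positivity)
      (fun n => (hsq _).2.trans (integral_norm_sq_lineDeriv_resolvent_le (hV n) (hv i))) ?_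
    simpa using hw1.const_mul ((2 * Real.pi) ^ 2)
  · simp only [hre2]
    refine (hsq _).2.trans
      ((integral_norm_sq_lineDeriv_lineDeriv_resolvent_le (hV n) (hv i) (hv j)).trans ?_)
    gcongr
    exact hL2 n
  · simp only [heq]
    exact hgi n
  · simp only [heq]
    refine squeeze_zero (fun n => integral_nonneg fun X => by positivity) (fun n => ?_) hδ2
    exact integral_mono (hgi n) (hfi n) fun X =>
      sq_le_sq.2 (by simpa using Complex.abs_re_le_norm (f n X - g n X))

/-! ### Domain variations along fields depending on the index -/

/-- A sequence tends to zero if it is bounded, for each `δ > 0`, by a null sequence up to an error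
proportional to `δ`. -/
theorem tendsto_zero_of_forall_abs_le {x : ℕ → ℝ} {a : ℝ} (ha : 0 ≤ a)
    (h : ∀ δ > 0, ∃ y : ℕ → ℝ, Tendsto y atTop (𝓝 0) ∧ ∀ᶠ n in atTop, |x n| ≤ δ * a + y n) :
    Tendsto x atTop (𝓝 0) := by
  rw [Metric.tendsto_nhds]
  intro ε hε
  obtain ⟨y, hy, hxy⟩ := h (ε / (2 * (a + 1))) (by positivity)
  filter_upwards [hxy, hy.eventually (gt_mem_nhds (half_pos hε))] with n h1 h2
  rw [Real.dist_eq, sub_zero]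
  have h3 : ε / (2 * (a + 1)) * a ≤ ε / 2 := by
    rw [div_mul_eq_mul_div, div_le_div_iff₀ (by positivity) (by positivity)]
    nlinarith
  linarith

/-- Null sequences in `L²`, paired with bounded functions supported in a fixed ball, have integrals
tending to zero. -/
theorem tendsto_integral_mul_of_sq {K F : ℕ → Plane → ℝ} {M R : ℝ} (hK : ∀ n, Measurable (K n))
    (hM : ∀ n X, |K n X| ≤ M) (hR : ∀ n X, R ≤ ‖X‖ → K n X = 0)
    (hF : ∀ n, AEStronglyMeasurable (F n)) (hF2 : ∀ n, Integrable fun X => F n X ^ 2)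
    (hlim : Tendsto (fun n => ∫ X, F n X ^ 2) atTop (𝓝 0)) :
    (∀ n, Integrable fun X => K n X * F n X) ∧
      Tendsto (fun n => ∫ X, K n X * F n X) atTop (𝓝 0) := by
  have hM0 : 0 ≤ M := (abs_nonneg _).trans (hM 0 0)
  set B := Metric.ball (0 : Plane) R with hB
  have hBi : ∀ δ : ℝ, Integrable (B.indicator fun _ => δ) := fun δ =>
    (integrable_indicator_iff measurableSet_ball).2 (integrableOn_const measure_ball_lt_top.ne)
  have hpt : ∀ δ > 0, ∀ n X,
      |K n X * F n X| ≤ B.indicator (fun _ => M * δ) X + M * δ⁻¹ * F n X ^ 2 := by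
    intro δ hδ n X
    by_cases hX : X ∈ B
    · rw [indicator_of_mem hX, abs_mul]
      have h1 : |F n X| ≤ δ + δ⁻¹ * F n X ^ 2 := by
        rw [← sub_nonneg, ← sq_abs (F n X)]
        have : δ + δ⁻¹ * |F n X| ^ 2 - |F n X| = δ⁻¹ * ((δ - |F n X|) ^ 2 + δ * |F n X|) := by
          field_simp; ring
        rw [this]; positivity
      calc |K n X| * |F n X| ≤ M * (δ + δ⁻¹ * F n X ^ 2) := by gcongr; exact hM n X
        _ = _ := by ring
    · rw [indicator_of_notMem hX, hR n X (by simpa [hB] using hX), zero_mul, abs_zero, zero_add]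
      positivity
  have hint : ∀ n, Integrable fun X => K n X * F n X := fun n =>
    ((hBi (M * 1)).add ((hF2 n).const_mul (M * 1⁻¹))).mono'
      ((hK n).aestronglyMeasurable.mul (hF n)) (.of_forall fun X => hpt 1 one_pos n X)
  refine ⟨hint, tendsto_zero_of_forall_abs_le (a := M * volume.real B) (by positivity)
    fun δ hδ => ⟨fun n => M * δ⁻¹ * ∫ X, F n X ^ 2, by simpa using hlim.const_mul _,
      .of_forall fun n => ?_⟩⟩
  have hi : Integrable fun X => B.indicator (fun _ => M * δ) X + M * δ⁻¹ * F n X ^ 2 :=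
    (hBi (M * δ)).add ((hF2 n).const_mul (M * δ⁻¹))
  have h := norm_integral_le_of_norm_le hi
    (ae_of_all _ fun X => (Real.norm_eq_abs (K n X * F n X)).trans_le (hpt δ hδ n X))
  refine h.trans (le_of_eq ?_)
  rw [integral_add (hBi _) ((hF2 n).const_mul _), integral_const_mul,
    integral_indicator measurableSet_ball, setIntegral_const, smul_eq_mul]
  ring

theorem abs_divergence_le (η : Plane → Plane) (X : Plane) :
    |divergence η X| ≤ 2 * ‖fderiv ℝ η X‖ := by
  have hv : ∀ i : Fin 2, |fderiv ℝ η X (stdVec i) i| ≤ ‖fderiv ℝ η X‖ := fun i => by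
    refine (abs_coord_le _ i).trans (((fderiv ℝ η X).le_opNorm _).trans ?_)
    simp
  rw [divergence_eq]
  exact (abs_add_le _ _).trans (by linarith [hv 0, hv 1])

theorem fderiv_coord {η : Plane → Plane} (hη : ContDiff ℝ 1 η) (i : Fin 2) (X v : Plane) :
    fderiv ℝ η X v i = fderiv ℝ (fun Y => η Y i) X v := by
  have h := ((EuclideanSpace.proj (𝕜 := ℝ) i).hasFDerivAt.comp X
    (hη.differentiable (by simp) X).hasFDerivAt).fderiv
  rw [show (fun Y => η Y i) = (EuclideanSpace.proj (𝕜 := ℝ) i) ∘ η from rfl, h]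
  rfl

theorem integral_divergence_eq_zero {η : Plane → Plane} (hη : ContDiff ℝ 1 η)
    (hc : HasCompactSupport η) : ∫ X, divergence η X = 0 := by
  have hL : ∀ i : Fin 2, LipTest fun Y => η Y i := fun i =>
    .of_contDiff ((EuclideanSpace.proj (𝕜 := ℝ) i).contDiff.comp hη)
      (hc.comp_left (g := fun V : Plane => V i) rfl)
  have hi : ∀ i : Fin 2, Integrable fun X => fderiv ℝ (fun Y => η Y i) X (stdVec i) := fun i =>
    ((((EuclideanSpace.proj (𝕜 := ℝ) i).contDiff.comp hη).continuous_fderiv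
      (by simp)).clm_apply continuous_const).integrable_of_hasCompactSupport
      ((hc.comp_left (g := fun V : Plane => V i) rfl).fderiv_apply (𝕜 := ℝ) _)
  simp only [divergence_eq, fderiv_coord hη]
  rw [integral_add (hi 0) (hi 1), integral_fderiv_eq_zero (hL 0), integral_fderiv_eq_zero (hL 1),
    add_zero]

namespace BlowUpSeq

variable {y₀ : ℝ} {L : ℝ≥0} {ρ r : ℕ → ℝ} {u J : ℕ → Plane → ℝ} {φ : Plane → ℝ}

/-- Where the gradient of the limit vanishes, the densities annihilate divergences of fields that
are bounded in `W^{1,2}`, asymptotically. The fields may depend on `n`. -/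
theorem tendsto_density_divergence (h : BlowUpSeq y₀ L ρ r u J φ) {Q : Set Plane} {R : ℝ}
    (hQR : Q ⊆ Metric.ball 0 R) (hQ : ∀ X ∈ Q, gradient φ X = 0) {η : ℕ → Plane → Plane}
    {D : ℕ → Plane → ℝ} {C : ℝ} (hη : ∀ n, ContDiff ℝ 1 (η n))
    (hc : ∀ n, HasCompactSupport (η n)) (hs : ∀ n, tsupport (η n) ⊆ Q)
    (h0 : ∀ n X, ‖η n X‖ ≤ D n X) (h1 : ∀ n X, ‖fderiv ℝ (η n) X‖ ≤ D n X)
    (hD : ∀ n, Integrable fun X => D n X ^ 2) (hC : ∀ n, ∫ X, D n X ^ 2 ≤ C) :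
    Tendsto (fun n => ∫ X, J n X * divergence (η n) X) atTop (𝓝 0) := by
  have hy := h.pos
  set B := Metric.ball (0 : Plane) R with hB
  have hBi : ∀ δ : ℝ, Integrable (B.indicator fun _ => δ) := fun δ =>
    (integrable_indicator_iff measurableSet_ball).2 (integrableOn_const measure_ball_lt_top.ne)
  set a : ℝ := 2 / y₀ with ha
  have ha0 : 0 < a := by positivity
  set K : ℝ := 2 * |R| + (a ^ 2 * (L : ℝ) ^ 2 + 1) with hKdef
  have hK0 : 0 ≤ K := by positivity
  have hC0 : 0 ≤ C := (integral_nonneg fun X => sq_nonneg _).trans (hC 0)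
  have hp : ∀ n, IntegrableOn (fun X => ‖gradient (u n) X - gradient φ X‖ ^ 2) B := by
    intro n
    refine Measure.integrableOn_of_bounded (M := (2 * (L : ℝ)) ^ 2) measure_ball_lt_top.ne
      (((measurable_gradient (u n)).sub (measurable_gradient φ)).norm.pow_const
        2).aestronglyMeasurable (.of_forall fun X => ?_)
    rw [Real.norm_of_nonneg (by positivity)]
    have := norm_sub_le (gradient (u n) X) (gradient φ X)
    have h2 := norm_gradient_le (h.pair n).lip X
    have h3 := norm_gradient_le h.lipschitz X
    gcongr
    linarith
  set P : ℕ → Plane → ℝ := fun n => B.indicator fun X => ‖gradient (u n) X - gradient φ X‖ ^ 2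
    with hP
  have hPi : ∀ n, Integrable (P n) := fun n => (integrable_indicator_iff measurableSet_ball).2 (hp n)
  have key : Tendsto (fun n => y₀ * ∫ X, J n X * divergence (η n) X) atTop (𝓝 0) := by
    refine tendsto_zero_of_forall_abs_le (a := 4 * a * L * C) (by positivity) fun δ hδ =>
      ⟨fun n => 4 * a * L * δ⁻¹ * (∫ X in B, ‖gradient (u n) X - gradient φ X‖ ^ 2)
        + |r n| * (K * (volume.real B + C)), ?_, ?_⟩
    · simpa using ((h.tendsto_gradient R).const_mul (4 * a * L * δ⁻¹)).add
        (h.scale.abs.mul_const (K * (volume.real B + C)))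
    · filter_upwards [h.eventually_weight_mem R, h.eventually_lt_radius R] with n hw hρ
      have hst := (h.pair n).stationary (η n) (hη n) (hc n)
        ((hs n).trans (hQR.trans (Metric.ball_subset_ball hρ.le)))
      -- the density term against the rest of the variation
      have hpt : ∀ X, |y₀ * (J n X * divergence (η n) X)
          - variationIntegrand y₀ (r n) (u n) (J n) (η n) X|
          ≤ 4 * a * L * (δ * D n X ^ 2) + 4 * a * L * δ⁻¹ * P n X
            + |r n| * K * (B.indicator (fun _ => (1 : ℝ)) X + D n X ^ 2) := by
        intro X
        have hD0 : 0 ≤ D n X := (norm_nonneg _).trans (h0 n X)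
        have hP0 : 0 ≤ P n X := indicator_nonneg (fun _ _ => by positivity) _
        have hI0 : 0 ≤ B.indicator (fun _ => (1 : ℝ)) X := indicator_nonneg (fun _ _ => by simp) _
        by_cases hX : X ∈ tsupport (η n)
        · have hXQ := hs n hX
          have hXB : X ∈ B := hQR hXQ
          have hXR : ‖X‖ < R := by simpa [hB] using hXB
          set G := gradient (u n) X with hG
          set d := divergence (η n) X
          set q : ℝ := inner ℝ G (fderiv ℝ (η n) X G)
          set e := η n X 1
          set α := 1 / height y₀ (r n) X with hα
          have hα0 : 0 ≤ α := le_trans (by positivity) (hw X hXR.le).1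
          have hαa : α ≤ a := (hw X hXR.le).2
          have hPX : P n X = ‖G‖ ^ 2 := by
            rw [hP]; simp only [indicator_of_mem hXB, hQ X hXQ, sub_zero, hG]
          have hGL : ‖G‖ ≤ L := norm_gradient_le (h.pair n).lip X
          have hJ := (h.pair n).abs_density_le X
          have hd : |d| ≤ 2 * D n X :=
            (abs_divergence_le _ _).trans (by linarith [h1 n X])
          have hq : |q| ≤ ‖G‖ ^ 2 * D n X := by
            calc |q| ≤ ‖G‖ * ‖fderiv ℝ (η n) X G‖ := abs_real_inner_le_norm _ _
              _ ≤ ‖G‖ * (D n X * ‖G‖) := by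
                  gcongr
                  exact ((fderiv ℝ (η n) X).le_opNorm _).trans (by gcongr; exact h1 n X)
              _ = _ := by ring
          have he : |e| ≤ D n X := (abs_coord_le _ 1).trans (h0 n X)
          have hN : ‖G‖ ^ 2 * D n X ≤ L * (‖G‖ * D n X) := by
            rw [sq, mul_assoc]; gcongr
          have hyo : ‖G‖ * D n X ≤ δ * D n X ^ 2 + δ⁻¹ * ‖G‖ ^ 2 := by
            rw [← sub_nonneg]
            have : δ * D n X ^ 2 + δ⁻¹ * ‖G‖ ^ 2 - ‖G‖ * D n X
                = δ⁻¹ * ((δ * D n X - ‖G‖) ^ 2 + δ * (D n X * ‖G‖)) := by field_simp; ring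
            rw [this]; positivity
          have hform : y₀ * (J n X * d) - variationIntegrand y₀ (r n) (u n) (J n) (η n) X
              = -(α * (‖G‖ ^ 2 * d)) + 2 * (α * q) - r n * (X 1 * (J n X * d))
                + r n * (e * (α ^ 2 * ‖G‖ ^ 2 - J n X)) := by
            rw [variationIntegrand_eq, ← hα]
            simp only [height]
            ring
          have t1 : |α * (‖G‖ ^ 2 * d)| ≤ a * (2 * (‖G‖ ^ 2 * D n X)) := by
            rw [abs_mul, abs_mul, abs_of_nonneg hα0, abs_of_nonneg (sq_nonneg _)]
            calc α * (‖G‖ ^ 2 * |d|) ≤ a * (‖G‖ ^ 2 * (2 * D n X)) := by gcongr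
              _ = _ := by ring
          have t2 : |α * q| ≤ a * (‖G‖ ^ 2 * D n X) := by
            rw [abs_mul, abs_of_nonneg hα0]
            gcongr
          have t3 : |r n * (X 1 * (J n X * d))| ≤ |r n| * (2 * |R| * D n X) := by
            rw [abs_mul, abs_mul, abs_mul]
            have hX1 : |X 1| ≤ |R| := (abs_coord_le X 1).trans (hXR.le.trans (le_abs_self R))
            calc |r n| * (|X 1| * (|J n X| * |d|)) ≤ |r n| * (|R| * (1 * (2 * D n X))) := by gcongr
              _ = _ := by ring
          have t4 : |r n * (e * (α ^ 2 * ‖G‖ ^ 2 - J n X))|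
              ≤ |r n| * ((a ^ 2 * (L : ℝ) ^ 2 + 1) * D n X) := by
            rw [abs_mul, abs_mul]
            have hb : |α ^ 2 * ‖G‖ ^ 2 - J n X| ≤ a ^ 2 * (L : ℝ) ^ 2 + 1 := by
              refine (abs_sub _ _).trans (add_le_add ?_ hJ)
              rw [abs_of_nonneg (by positivity)]
              gcongr
            calc |r n| * (|e| * |α ^ 2 * ‖G‖ ^ 2 - J n X|)
                ≤ |r n| * (D n X * (a ^ 2 * (L : ℝ) ^ 2 + 1)) := by gcongr
              _ = _ := by ring
          have hD1 : D n X ≤ 1 + D n X ^ 2 := by nlinarith [sq_nonneg (D n X - 1)]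
          rw [hform, indicator_of_mem hXB, hPX]
          have s1 : |-(α * (‖G‖ ^ 2 * d)) + 2 * (α * q) - r n * (X 1 * (J n X * d))
                + r n * (e * (α ^ 2 * ‖G‖ ^ 2 - J n X))|
              ≤ |α * (‖G‖ ^ 2 * d)| + 2 * |α * q| + |r n * (X 1 * (J n X * d))|
                + |r n * (e * (α ^ 2 * ‖G‖ ^ 2 - J n X))| := by
            refine (abs_add_le _ _).trans (add_le_add ((abs_sub _ _).trans (add_le_add
              ((abs_add_le _ _).trans ?_) le_rfl)) le_rfl)
            rw [abs_neg, abs_mul 2, abs_two]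
          have s2 : a * (‖G‖ ^ 2 * D n X) ≤ a * (L * (δ * D n X ^ 2 + δ⁻¹ * ‖G‖ ^ 2)) := by
            exact mul_le_mul_of_nonneg_left
              (hN.trans (mul_le_mul_of_nonneg_left hyo L.coe_nonneg)) ha0.le
          have s3 : |r n| * (K * D n X) ≤ |r n| * (K * (1 + D n X ^ 2)) := by gcongr
          have s4 : |r n| * (2 * |R| * D n X) + |r n| * ((a ^ 2 * (L : ℝ) ^ 2 + 1) * D n X)
              = |r n| * (K * D n X) := by rw [hKdef]; ring
          linarith
        · have hd : divergence (η n) X = 0 := by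
            have : fderiv ℝ (η n) X = 0 :=
              image_eq_zero_of_notMem_tsupport fun h' => hX (tsupport_fderiv_subset ℝ h')
            simp [divergence, this]
          rw [hd, variationIntegrand_eq_zero hX]
          simp only [mul_zero, sub_zero, abs_zero]
          positivity
      have hdi : Integrable fun X => y₀ * (J n X * divergence (η n) X) := by
        have hdc : Continuous (divergence (η n)) := by
          have := (hη n).continuous_fderiv (by simp)
          unfold divergence
          fun_prop
        have hds : HasCompactSupport (divergence (η n)) := (hc n).mono' fun X hX => by
          by_contra hX'
          have : fderiv ℝ (η n) X = 0 :=
            image_eq_zero_of_notMem_tsupport fun h' => hX' (tsupport_fderiv_subset ℝ h')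
          exact hX (by simp [divergence, this])
        exact ((hdc.integrable_of_hasCompactSupport hds).bdd_mul
          (h.pair n).measurable.aestronglyMeasurable
          (.of_forall fun X => (h.pair n).abs_density_le X)).const_mul _
      have i1 : Integrable fun X => 4 * a * L * (δ * D n X ^ 2) :=
        ((hD n).const_mul _).const_mul _
      have i2 : Integrable fun X => 4 * a * L * δ⁻¹ * P n X := (hPi n).const_mul _
      have i3 : Integrable fun X =>
          |r n| * K * (B.indicator (fun _ => (1 : ℝ)) X + D n X ^ 2) :=
        ((hBi 1).add (hD n)).const_mul _
      have i12 : Integrable fun X => 4 * a * L * (δ * D n X ^ 2) + 4 * a * L * δ⁻¹ * P n X :=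
        i1.add i2
      have i123 : Integrable fun X => 4 * a * L * (δ * D n X ^ 2) + 4 * a * L * δ⁻¹ * P n X
          + |r n| * K * (B.indicator (fun _ => (1 : ℝ)) X + D n X ^ 2) := i12.add i3
      have hvm := measurable_variationIntegrand (hη n) (u := u n) (h.pair n).measurable y₀ (r n)
      have hdiff : Integrable fun X => y₀ * (J n X * divergence (η n) X)
          - variationIntegrand y₀ (r n) (u n) (J n) (η n) X :=
        i123.mono' (hdi.aestronglyMeasurable.sub hvm.aestronglyMeasurable) (.of_forall hpt)
      have hvi : Integrable (variationIntegrand y₀ (r n) (u n) (J n) (η n)) := by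
        refine (hdi.sub hdiff).congr (.of_forall fun X => ?_)
        simp only [Pi.sub_apply, sub_sub_cancel]
      have heq : y₀ * ∫ X, J n X * divergence (η n) X
          = ∫ X, (y₀ * (J n X * divergence (η n) X)
            - variationIntegrand y₀ (r n) (u n) (J n) (η n) X) := by
        rw [integral_sub hdi hvi, hst, sub_zero, integral_const_mul]
      rw [heq]
      refine (norm_integral_le_of_norm_le i123
        (ae_of_all _ fun X => (Real.norm_eq_abs _).trans_le (hpt X))).trans ?_
      have i4 : Integrable fun X => B.indicator (fun _ => (1 : ℝ)) X + D n X ^ 2 :=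
        (hBi 1).add (hD n)
      rw [integral_add i12 i3, integral_add i1 i2, integral_const_mul, integral_const_mul,
        integral_const_mul, integral_const_mul, integral_add (hBi 1) (hD n), hP,
        integral_indicator measurableSet_ball, integral_indicator measurableSet_ball,
        setIntegral_const, smul_eq_mul, mul_one]
      have hCn := hC n
      have e1 : 4 * a * L * (δ * ∫ X, D n X ^ 2) ≤ 4 * a * L * (δ * C) := by gcongr
      have e2 : |r n| * K * (volume.real B + ∫ X, D n X ^ 2) ≤ |r n| * K * (volume.real B + C) := by
        gcongr
      linarith
  have := key.const_mul y₀⁻¹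
  rw [mul_zero] at this
  refine this.congr fun n => ?_
  rw [inv_mul_cancel_left₀ hy.ne']

end BlowUpSeq

/-! ### The slope in the one-phase case -/

theorem norm_le_sum_abs (V : Plane) : ‖V‖ ≤ ∑ i, |V i| := by
  have h := norm_sq_eq V
  rw [Fin.sum_univ_two]
  refine le_of_sq_le_sq ?_ (by positivity)
  rw [h]
  nlinarith [abs_nonneg (V 0), abs_nonneg (V 1), sq_abs (V 0), sq_abs (V 1),
    mul_nonneg (abs_nonneg (V 0)) (abs_nonneg (V 1))]

theorem norm_fderiv_le_sum {η : Plane → Plane} (hη : ContDiff ℝ 1 η) (X : Plane) :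
    ‖fderiv ℝ η X‖ ≤ ∑ i, ∑ j, |fderiv ℝ (fun Y => η Y i) X (stdVec j)| := by
  refine ContinuousLinearMap.opNorm_le_bound _ (by positivity) fun V => ?_
  refine (norm_le_sum_abs _).trans ?_
  rw [Finset.sum_mul]
  refine Finset.sum_le_sum fun i _ => ?_
  rw [fderiv_coord hη, fderiv_eq_sum, Fin.sum_univ_two, add_mul]
  refine (abs_add_le _ _).trans (add_le_add ?_ ?_)
  all_goals
    rw [abs_mul]
    exact mul_le_mul_of_nonneg_left (abs_coord_le _ _) (abs_nonneg _)

/-- The field `ζ ∇W`. -/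
noncomputable def cutoffGradient (ζ W : Plane → ℝ) (X : Plane) : Plane :=
  ζ X • WithLp.toLp 2 fun i => fderiv ℝ W X (stdVec i)

section CutoffGradient

variable {ζ W : Plane → ℝ}

theorem contDiff_cutoffGradient (hζ : ContDiff ℝ ∞ ζ) (hW : ContDiff ℝ ∞ W) :
    ContDiff ℝ 1 (cutoffGradient ζ W) := by
  refine (hζ.of_le (by simp)).smul (contDiff_euclidean.2 fun i => ?_)
  exact ((contDiff_infty_iff_fderiv.1 hW).2.clm_apply contDiff_const).of_le (by simp)

theorem fderiv_cutoffGradient (hζ : ContDiff ℝ ∞ ζ) (hW : ContDiff ℝ ∞ W) (i j : Fin 2)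
    (X : Plane) :
    fderiv ℝ (fun Y => cutoffGradient ζ W Y i) X (stdVec j)
      = fderiv ℝ ζ X (stdVec j) * fderiv ℝ W X (stdVec i)
        + ζ X * fderiv ℝ (fun Y => fderiv ℝ W Y (stdVec i)) X (stdVec j) := by
  have h1 : DifferentiableAt ℝ ζ X := hζ.differentiable (by simp) X
  have h2 : DifferentiableAt ℝ (fun Y => fderiv ℝ W Y (stdVec i)) X :=
    ((contDiff_infty_iff_fderiv.1 hW).2.clm_apply contDiff_const).differentiable (by simp) X
  have : (fun Y => cutoffGradient ζ W Y i) = fun Y => ζ Y * fderiv ℝ W Y (stdVec i) := by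
    ext Y; simp [cutoffGradient]
  rw [this, fderiv_fun_mul h1 h2]
  simp only [add_apply, smul_apply, smul_eq_mul]
  ring

theorem divergence_cutoffGradient (hζ : ContDiff ℝ ∞ ζ) (hW : ContDiff ℝ ∞ W) (X : Plane) :
    divergence (cutoffGradient ζ W) X
      = (∑ i, fderiv ℝ ζ X (stdVec i) * fderiv ℝ W X (stdVec i))
        + ζ X * ∑ i, fderiv ℝ (fun Y => fderiv ℝ W Y (stdVec i)) X (stdVec i) := by
  have h := contDiff_cutoffGradient hζ hW
  rw [divergence_eq, fderiv_coord h, fderiv_coord h, fderiv_cutoffGradient hζ hW,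
    fderiv_cutoffGradient hζ hW, Fin.sum_univ_two, Fin.sum_univ_two]
  ring

/-- A common bound for `ζ ∇W` and its derivative, if `|ζ| ≤ 1` and `M` bounds the partial
derivatives of `ζ`. -/
noncomputable def cutoffGradientBound (M : ℝ) (W : Plane → ℝ) (X : Plane) : ℝ :=
  ∑ i, ∑ j, ((1 + M) * |fderiv ℝ W X (stdVec i)|
    + |fderiv ℝ (fun Y => fderiv ℝ W Y (stdVec i)) X (stdVec j)|)

theorem norm_cutoffGradient_le {M : ℝ} (hM : 0 ≤ M) (hζ1 : ∀ X, |ζ X| ≤ 1) (X : Plane) :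
    ‖cutoffGradient ζ W X‖ ≤ cutoffGradientBound M W X := by
  refine (norm_le_sum_abs _).trans (Finset.sum_le_sum fun i _ => ?_)
  have h : |cutoffGradient ζ W X i| ≤ |fderiv ℝ W X (stdVec i)| := by
    simp only [cutoffGradient, PiLp.smul_apply, smul_eq_mul, abs_mul]
    exact mul_le_of_le_one_left (abs_nonneg _) (hζ1 X)
  rw [Fin.sum_univ_two]
  have h2 := abs_nonneg (fderiv ℝ (fun Y => fderiv ℝ W Y (stdVec i)) X (stdVec 0))
  have h3 := abs_nonneg (fderiv ℝ (fun Y => fderiv ℝ W Y (stdVec i)) X (stdVec 1))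
  have h4 := mul_nonneg hM (abs_nonneg (fderiv ℝ W X (stdVec i)))
  have h5 := abs_nonneg (fderiv ℝ W X (stdVec i))
  linarith

theorem norm_fderiv_cutoffGradient_le (hζ : ContDiff ℝ ∞ ζ) (hW : ContDiff ℝ ∞ W) {M : ℝ}
    (hζ1 : ∀ X, |ζ X| ≤ 1) (hM : ∀ X i, |fderiv ℝ ζ X (stdVec i)| ≤ M) (X : Plane) :
    ‖fderiv ℝ (cutoffGradient ζ W) X‖ ≤ cutoffGradientBound M W X := by
  refine (norm_fderiv_le_sum (contDiff_cutoffGradient hζ hW) X).trans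
    (Finset.sum_le_sum fun i _ => Finset.sum_le_sum fun j _ => ?_)
  rw [fderiv_cutoffGradient hζ hW]
  refine (abs_add_le _ _).trans ?_
  rw [abs_mul, abs_mul]
  refine add_le_add (mul_le_mul_of_nonneg_right ?_ (abs_nonneg _))
    (mul_le_of_le_one_left (abs_nonneg _) (hζ1 X))
  linarith [hM X j]

theorem cutoffGradientBound_sq_le (M : ℝ) (W : Plane → ℝ) (X : Plane) :
    cutoffGradientBound M W X ^ 2 ≤ ∑ i, ∑ j, (8 * (1 + M) ^ 2 * fderiv ℝ W X (stdVec i) ^ 2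
      + 8 * fderiv ℝ (fun Y => fderiv ℝ W Y (stdVec i)) X (stdVec j) ^ 2) := by
  rw [cutoffGradientBound, ← Finset.sum_product', ← Finset.sum_product']
  refine sq_sum_le_card_mul_sum_sq.trans ?_
  rw [Finset.mul_sum]
  refine Finset.sum_le_sum fun p _ => ?_
  have h1 := sq_abs (fderiv ℝ W X (stdVec p.1))
  have h2 := sq_abs (fderiv ℝ (fun Y => fderiv ℝ W Y (stdVec p.1)) X (stdVec p.2))
  simp only [Finset.card_product, Finset.card_univ, Fintype.card_fin]
  push_cast
  nlinarith [sq_nonneg ((1 + M) * |fderiv ℝ W X (stdVec p.1)|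
    - |fderiv ℝ (fun Y => fderiv ℝ W Y (stdVec p.1)) X (stdVec p.2)|)]

theorem integral_cutoffGradientBound_sq_le (hW : ContDiff ℝ ∞ W) {M C₁ C₂ : ℝ}
    (h1 : ∀ i, Integrable fun X => fderiv ℝ W X (stdVec i) ^ 2)
    (h2 : ∀ i j, Integrable fun X =>
      fderiv ℝ (fun Y => fderiv ℝ W Y (stdVec i)) X (stdVec j) ^ 2)
    (hC₁ : ∀ i, ∫ X, fderiv ℝ W X (stdVec i) ^ 2 ≤ C₁)
    (hC₂ : ∀ i j, ∫ X, fderiv ℝ (fun Y => fderiv ℝ W Y (stdVec i)) X (stdVec j) ^ 2 ≤ C₂) :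
    (Integrable fun X => cutoffGradientBound M W X ^ 2) ∧
      ∫ X, cutoffGradientBound M W X ^ 2 ≤ 4 * (8 * (1 + M) ^ 2 * C₁ + 8 * C₂) := by
  have hdW : ∀ i, ContDiff ℝ ∞ fun Y => fderiv ℝ W Y (stdVec i) := fun i =>
    (contDiff_infty_iff_fderiv.1 hW).2.clm_apply contDiff_const
  have hddW : ∀ i j, Continuous fun X =>
      fderiv ℝ (fun Y => fderiv ℝ W Y (stdVec i)) X (stdVec j) := fun i j =>
    ((contDiff_infty_iff_fderiv.1 (hdW i)).2.clm_apply contDiff_const).continuous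
  have hij : ∀ i j, Integrable fun X => 8 * (1 + M) ^ 2 * fderiv ℝ W X (stdVec i) ^ 2
      + 8 * fderiv ℝ (fun Y => fderiv ℝ W Y (stdVec i)) X (stdVec j) ^ 2 := fun i j =>
    ((h1 i).const_mul _).add ((h2 i j).const_mul _)
  have hsum : Integrable fun X => ∑ i, ∑ j, (8 * (1 + M) ^ 2 * fderiv ℝ W X (stdVec i) ^ 2
      + 8 * fderiv ℝ (fun Y => fderiv ℝ W Y (stdVec i)) X (stdVec j) ^ 2) :=
    integrable_finsetSum _ fun i _ => integrable_finsetSum _ fun j _ => hij i j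
  have hc : Continuous (cutoffGradientBound M W) := by
    unfold cutoffGradientBound
    exact continuous_finsetSum _ fun i _ => continuous_finsetSum _ fun j _ =>
      ((hdW i).continuous.abs.const_mul (1 + M)).add (hddW i j).abs
  have hi : Integrable fun X => cutoffGradientBound M W X ^ 2 := by
    refine hsum.mono' (hc.pow 2).aestronglyMeasurable (.of_forall fun X => ?_)
    rw [Real.norm_of_nonneg (sq_nonneg _)]
    exact cutoffGradientBound_sq_le M W X
  refine ⟨hi, (integral_mono hi hsum fun X => cutoffGradientBound_sq_le M W X).trans ?_⟩
  rw [integral_finsetSum _ fun i _ => integrable_finsetSum _ fun j _ => hij i j]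
  have hle : ∀ i j, ∫ X, (8 * (1 + M) ^ 2 * fderiv ℝ W X (stdVec i) ^ 2
      + 8 * fderiv ℝ (fun Y => fderiv ℝ W Y (stdVec i)) X (stdVec j) ^ 2)
      ≤ 8 * (1 + M) ^ 2 * C₁ + 8 * C₂ := by
    intro i j
    rw [integral_add ((h1 i).const_mul _) ((h2 i j).const_mul _), integral_const_mul,
      integral_const_mul]
    have := hC₁ i
    have := hC₂ i j
    gcongr
  calc _ ≤ ∑ i : Fin 2, ∑ j : Fin 2, (8 * (1 + M) ^ 2 * C₁ + 8 * C₂) := by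
        refine Finset.sum_le_sum fun i _ => ?_
        rw [integral_finsetSum _ fun j _ => hij i j]
        exact Finset.sum_le_sum fun j _ => hle i j
    _ = _ := by simp; ring

end CutoffGradient

namespace BlowUpSeq

variable {y₀ : ℝ} {L : ℝ≥0} {ρ r : ℕ → ℝ} {u J : ℕ → Plane → ℝ} {φ : Plane → ℝ}

/-- In the one-phase case the weak limit of the densities below the interface is the constant
`1 - A² / y₀²`, and the convergence is strong by elliptic regularity; as the densities take
the values `0` and `1` only, so does their limit. -/
theorem slope_eq_of_one_phase {ν : Plane} {A : ℝ} (h : BlowUpSeq y₀ L ρ r u J φ) (hν : ‖ν‖ = 1)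
    (hA : 0 < A) (hφ : ∀ X, φ X = A * max (inner ℝ X ν) 0) : A = y₀ := by
  have hy := h.pos
  have hφ' : ∀ X, φ X = A * max (inner ℝ X ν) 0 + 0 * max (-inner ℝ X ν) 0 := fun X => by
    rw [hφ, zero_mul, add_zero]
  have hcont : Continuous fun Z : Plane => (inner ℝ Z ν : ℝ) := by fun_prop
  set Q : Set Plane := {X | (inner ℝ X ν : ℝ) < 0} ∩ Metric.ball 0 2 with hQdef
  have hQo : IsOpen Q := (isOpen_lt hcont continuous_const).inter Metric.isOpen_ball
  have hνQ : -ν ∈ Q := ⟨by simp [hν], by simp [hν]⟩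
  obtain ⟨ζ, hζ, hζc, hζs, hζI, hζ1⟩ := exists_cutoff isCompact_singleton hQo
    (singleton_subset_iff.2 hνQ)
  have hζa : ∀ X, |ζ X| ≤ 1 := fun X => by rw [abs_of_nonneg (hζI X).1]; exact (hζI X).2
  have hζt : LipTest ζ := .of_contDiff (hζ.of_le (by simp)) hζc
  obtain ⟨M, hM⟩ : ∃ M, ∀ X, ‖fderiv ℝ ζ X‖ ≤ M :=
    (hζc.fderiv (𝕜 := ℝ)).exists_bound_of_continuous (hζ.continuous_fderiv (by simp))
  have hM0 : 0 ≤ M := (norm_nonneg _).trans (hM 0)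
  have hMi : ∀ X i, |fderiv ℝ ζ X (stdVec i)| ≤ M := fun X i =>
    ((fderiv ℝ ζ X).le_opNorm _).trans (by simpa using hM X)
  have hζ0 : ∀ X : Plane, 2 ≤ ‖X‖ → X ∉ tsupport ζ := fun X hX hmem => by
    have := (hζs hmem).2
    rw [mem_ball_zero_iff] at this
    linarith
  set m : ℝ := 1 - A ^ 2 / y₀ ^ 2 with hm
  set k : ℕ → Plane → ℝ := fun n X => J n X - m with hk
  have hkm : ∀ n, Measurable (k n) := fun n => (h.pair n).measurable.sub_const m
  have hkb : ∀ n X, |k n X| ≤ 1 + |m| := fun n X =>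
    (abs_sub _ _).trans (add_le_add ((h.pair n).abs_density_le X) le_rfl)
  have hm1 : 0 ≤ 1 + |m| := by positivity
  set g : ℕ → Plane → ℝ := fun n X => k n X * ζ X with hg
  have hgm : ∀ n, Measurable (g n) := fun n => (hkm n).mul hζ.continuous.measurable
  have hgb : ∀ n X, |g n X| ≤ 1 + |m| := fun n X => by
    rw [hg, abs_mul]
    exact (mul_le_of_le_one_right (abs_nonneg _) (hζa X)).trans (hkb n X)
  have hg0 : ∀ n X, 2 ≤ ‖X‖ → g n X = 0 := fun n X hX => by
    rw [hg]; simp only [image_eq_zero_of_notMem_tsupport (hζ0 X hX), mul_zero]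
  have hgw : ∀ G : Plane → ℝ, ContDiff ℝ ∞ G → HasCompactSupport G →
      Tendsto (fun n => ∫ X, g n X * G X) atTop (𝓝 0) := by
    intro G hG hGc
    have t := h.tendsto_density_lower hν hA hφ' (G := fun X => ζ X * G X)
      ((hζ.mul hG).of_le (by simp)) hζc.mul_right
      ((tsupport_mul_subset_left).trans (hζs.trans inter_subset_left))
    have t2 := t.const_mul y₀⁻¹
    rw [mul_zero] at t2
    refine t2.congr fun n => ?_
    rw [← integral_const_mul]
    refine integral_congr_ae (ae_of_all _ fun X => ?_)
    simp only [hg, hk, hm]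
    field_simp
    ring
  obtain ⟨W, c, C, hW, iW, iW1, iW2, tW, tW1, hC, if0, tf⟩ :=
    exists_elliptic_corrector hgm hgb hg0 hgw
  obtain ⟨C₁, hC₁⟩ : ∃ C₁, ∀ n i, ∫ X, fderiv ℝ (W n) X (stdVec i) ^ 2 ≤ C₁ := by
    obtain ⟨a, ha⟩ := (tW1 0).bddAbove_range
    obtain ⟨b, hb⟩ := (tW1 1).bddAbove_range
    refine ⟨max a b, fun n i => ?_⟩
    fin_cases i
    · exact (ha ⟨n, rfl⟩).trans (le_max_left _ _)
    · exact (hb ⟨n, rfl⟩).trans (le_max_right _ _)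
  set D : ℕ → Plane → ℝ := fun n => cutoffGradientBound M (W n) with hD
  have hDi := fun n => integral_cutoffGradientBound_sq_le (M := M) (hW n) (iW1 n) (iW2 n)
    (hC₁ n) (hC n)
  have hηc : ∀ n, ContDiff ℝ 1 (cutoffGradient ζ (W n)) := fun n =>
    contDiff_cutoffGradient hζ (hW n)
  have hηs : ∀ n, HasCompactSupport (cutoffGradient ζ (W n)) := fun n => hζc.smul_right
  have hdiv := h.tendsto_density_divergence (Q := Q) inter_subset_right
    (fun X hX => by rw [(gradient_two_plane hφ' X).2 hX.1]; simp) hηc hηs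
    (fun n => (tsupport_smul_subset_left ζ _).trans hζs)
    (fun n X => norm_cutoffGradient_le hM0 hζa X)
    (fun n X => norm_fderiv_cutoffGradient_le hζ (hW n) hζa hMi X)
    (fun n => (hDi n).1) (fun n => (hDi n).2)
  have hdW : ∀ n i, AEStronglyMeasurable fun X => fderiv ℝ (W n) X (stdVec i) := fun n i =>
    ((contDiff_infty_iff_fderiv.1 (hW n)).2.clm_apply
      contDiff_const).continuous.aestronglyMeasurable
  have hdζ : ∀ i, Continuous fun X => fderiv ℝ ζ X (stdVec i) := fun i =>
    ((contDiff_infty_iff_fderiv.1 hζ).2.clm_apply contDiff_const).continuous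
  set F : ℕ → Plane → ℝ := fun n X => W n X - c * (∑ i,
        fderiv ℝ (fun Y => fderiv ℝ (W n) Y (stdVec i)) X (stdVec i)) - g n X with hF
  have hFm : ∀ n, AEStronglyMeasurable (F n) := by
    intro n
    refine (AEStronglyMeasurable.sub (hW n).continuous.aestronglyMeasurable ?_).sub
      (hgm n).aestronglyMeasurable
    refine Continuous.aestronglyMeasurable (continuous_const.mul
      (continuous_finsetSum _ fun i _ => ?_))
    have h1 : ContDiff ℝ ∞ fun Y => fderiv ℝ (W n) Y (stdVec i) :=
      (contDiff_infty_iff_fderiv.1 (hW n)).2.clm_apply contDiff_const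
    exact ((contDiff_infty_iff_fderiv.1 h1).2.clm_apply contDiff_const).continuous
  obtain ⟨i1, t1⟩ := tendsto_integral_mul_of_sq hgm hgb hg0
    (fun n => (hW n).continuous.aestronglyMeasurable) iW tW
  have hd : ∀ i, (∀ n, Integrable fun X => (k n X * fderiv ℝ ζ X (stdVec i))
        * fderiv ℝ (W n) X (stdVec i)) ∧
      Tendsto (fun n => ∫ X, (k n X * fderiv ℝ ζ X (stdVec i))
        * fderiv ℝ (W n) X (stdVec i)) atTop (𝓝 0) := by
    intro i
    refine tendsto_integral_mul_of_sq (M := (1 + |m|) * M) (R := 2)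
      (fun n => (hkm n).mul (hdζ i).measurable) (fun n X => ?_) (fun n X hX => ?_)
      (fun n => hdW n i) (fun n => iW1 n i) (tW1 i)
    · rw [abs_mul]
      exact mul_le_mul (hkb n X) (hMi X i) (abs_nonneg _) hm1
    · have : fderiv ℝ ζ X = 0 := image_eq_zero_of_notMem_tsupport fun h' =>
        hζ0 X hX (tsupport_fderiv_subset ℝ h')
      simp [this]
  obtain ⟨i3, t3⟩ := tendsto_integral_mul_of_sq hgm hgb hg0 hFm if0 tf
  have hdivi : ∀ n, Integrable (divergence (cutoffGradient ζ (W n))) := by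
    intro n
    have hdc : Continuous (divergence (cutoffGradient ζ (W n))) := by
      have := (hηc n).continuous_fderiv (by simp)
      unfold divergence
      fun_prop
    refine hdc.integrable_of_hasCompactSupport ((hηs n).mono' fun X hX => ?_)
    by_contra hX'
    have : fderiv ℝ (cutoffGradient ζ (W n)) X = 0 :=
      image_eq_zero_of_notMem_tsupport fun h' => hX' (tsupport_fderiv_subset ℝ h')
    exact hX (by simp [divergence, this])
  have hkdiv : ∀ n, Integrable fun X => k n X * divergence (cutoffGradient ζ (W n)) X := fun n =>
    (hdivi n).bdd_mul (hkm n).aestronglyMeasurable (ae_of_all _ (hkb n))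
  have hJdiv : ∀ n, Integrable fun X => J n X * divergence (cutoffGradient ζ (W n)) X := fun n =>
    (hdivi n).bdd_mul (h.pair n).measurable.aestronglyMeasurable
      (ae_of_all _ (h.pair n).abs_density_le)
  have hkd : Tendsto (fun n => ∫ X, k n X * divergence (cutoffGradient ζ (W n)) X) atTop
      (𝓝 0) := by
    refine hdiv.congr fun n => ?_
    have : ∀ X, k n X * divergence (cutoffGradient ζ (W n)) X
        = J n X * divergence (cutoffGradient ζ (W n)) X
          - m * divergence (cutoffGradient ζ (W n)) X := fun X => by simp only [hk]; ring
    simp only [this]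
    rw [integral_sub (hJdiv n) ((hdivi n).const_mul m), integral_const_mul,
      integral_divergence_eq_zero (hηc n) (hηs n), mul_zero, sub_zero]
  -- `g² = g (W - c ΔW) - g F`, and `ζ ΔW` is the divergence of `ζ ∇W` up to lower order
  have hsq : ∀ n X, g n X * g n X = g n X * W n X
      + c * ((k n X * fderiv ℝ ζ X (stdVec 0)) * fderiv ℝ (W n) X (stdVec 0))
      + c * ((k n X * fderiv ℝ ζ X (stdVec 1)) * fderiv ℝ (W n) X (stdVec 1))
      - c * (k n X * divergence (cutoffGradient ζ (W n)) X) - g n X * F n X := by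
    intro n X
    rw [divergence_cutoffGradient hζ (hW n)]
    simp only [hF, hg, Fin.sum_univ_two]
    ring
  have hlim : Tendsto (fun n => ∫ X, g n X * g n X) atTop (𝓝 0) := by
    have t := (((t1.add ((hd 0).2.const_mul c)).add ((hd 1).2.const_mul c)).sub
      (hkd.const_mul c)).sub t3
    simp only [mul_zero, add_zero, sub_zero] at t
    refine t.congr fun n => ?_
    simp only [hsq]
    have j1 := ((hd 0).1 n).const_mul c
    have j2 := ((hd 1).1 n).const_mul c
    have j3 := (hkdiv n).const_mul c
    have e1 : Integrable fun X => g n X * W n X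
      + c * ((k n X * fderiv ℝ ζ X (stdVec 0)) * fderiv ℝ (W n) X (stdVec 0)) := (i1 n).add j1
    have e2 : Integrable fun X => g n X * W n X
      + c * ((k n X * fderiv ℝ ζ X (stdVec 0)) * fderiv ℝ (W n) X (stdVec 0))
      + c * ((k n X * fderiv ℝ ζ X (stdVec 1)) * fderiv ℝ (W n) X (stdVec 1)) := e1.add j2
    have e3 : Integrable fun X => g n X * W n X
      + c * ((k n X * fderiv ℝ ζ X (stdVec 0)) * fderiv ℝ (W n) X (stdVec 0))
      + c * ((k n X * fderiv ℝ ζ X (stdVec 1)) * fderiv ℝ (W n) X (stdVec 1))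
      - c * (k n X * divergence (cutoffGradient ζ (W n)) X) := e2.sub j3
    rw [integral_sub e3 (i3 n), integral_sub e2 j3, integral_add e1 j2, integral_add (i1 n) j1,
      integral_const_mul, integral_const_mul, integral_const_mul]
  -- `(J - m)²` is bounded below, as `J` is `0` or `1`
  set κ : ℝ := min (m ^ 2) ((1 - m) ^ 2) with hκ
  have hκ0 : 0 ≤ κ := le_min (sq_nonneg _) (sq_nonneg _)
  have hζ2i : Integrable fun X => ζ X * ζ X :=
    (hζ.continuous.mul hζ.continuous).integrable_of_hasCompactSupport hζc.mul_right
  have hle : ∀ n, κ * ∫ X, ζ X * ζ X ≤ ∫ X, g n X * g n X := by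
    intro n
    rw [← integral_const_mul]
    refine integral_mono_of_nonneg
      (ae_of_all _ fun X => mul_nonneg hκ0 (mul_self_nonneg _)) ?_ (ae_of_all _ fun X => ?_)
    · have hgi : Integrable (g n) := integrable_of_bound (R := 2) (hgm n).aestronglyMeasurable
        (ae_of_all _ (hgb n)) (hg0 n)
      exact hgi.bdd_mul (hgm n).aestronglyMeasurable (ae_of_all _ (hgb n))
    · have hκJ : κ ≤ k n X ^ 2 := by
        rcases (h.pair n).values X with hJ | hJ
        · simp only [hk, hJ, zero_sub, neg_sq]; exact min_le_left _ _
        · simp only [hk, hJ]; exact min_le_right _ _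
      calc κ * (ζ X * ζ X) ≤ k n X ^ 2 * (ζ X * ζ X) :=
            mul_le_mul_of_nonneg_right hκJ (mul_self_nonneg _)
        _ = g n X * g n X := by simp only [hg]; ring
  have hζpos : 0 < ∫ X, ζ X * ζ X :=
    (hζ.continuous.mul hζ.continuous).integral_pos_of_hasCompactSupport_nonneg_nonzero
      hζc.mul_right (fun X => mul_self_nonneg _)
      (x := -ν) (by simp [hζ1.self_of_nhdsSet _ (mem_singleton _)])
  have hκz : κ = 0 := by
    have h1 : κ * ∫ X, ζ X * ζ X ≤ 0 := ge_of_tendsto' hlim hle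
    exact le_antisymm (nonpos_of_mul_nonpos_left h1 hζpos) hκ0
  have hA2 : 0 < A ^ 2 / y₀ ^ 2 := by positivity
  have hm0 : m = 0 := by
    rcases min_choice (m ^ 2) ((1 - m) ^ 2) with h1 | h1
    · rw [← hκ, hκz] at h1
      exact pow_eq_zero_iff (two_ne_zero) |>.1 h1.symm
    · rw [← hκ, hκz] at h1
      have := pow_eq_zero_iff (two_ne_zero) |>.1 h1.symm
      linarith
  have h1 : A ^ 2 / y₀ ^ 2 = 1 := by linarith
  rw [div_eq_one_iff_eq (by positivity)] at h1
  exact (pow_left_inj₀ hA.le hy.le two_ne_zero).1 h1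

end BlowUpSeq

/-! ### Blow-up limits of variational solutions -/

theorem memLp_of_memL2 {F : Type*} [NormedAddCommGroup F] {c : ℝ} (hc : 0 < c) {K : Set Plane}
    {g : Plane → F} (h : MemL2 (fun _ => c) K g) : MemLp g 2 (volume.restrict K) := by
  refine ⟨h.1, ?_⟩
  rw [eLpNorm_lt_top_iff_lintegral_rpow_enorm_lt_top (by norm_num) (by norm_num)]
  have h2 := h.2
  rw [lintegral_const_mul' _ _ ENNReal.ofReal_ne_top] at h2
  have h3 := ENNReal.lt_top_of_mul_ne_top_right h2.ne (ENNReal.ofReal_pos.2 hc).ne'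
  simpa using h3

theorem memL2_of_memLp {F : Type*} [NormedAddCommGroup F] {c : ℝ} {K : Set Plane}
    {g : Plane → F} (h : MemLp g 2 (volume.restrict K)) : MemL2 (fun _ => c) K g := by
  refine ⟨h.1, ?_⟩
  rw [lintegral_const_mul' _ _ ENNReal.ofReal_ne_top]
  refine ENNReal.mul_lt_top ENNReal.ofReal_lt_top ?_
  have h2 := (eLpNorm_lt_top_iff_lintegral_rpow_enorm_lt_top (by norm_num) (by norm_num)).1 h.2
  simpa using h2

theorem tendsto_lintegral_of_integral {F : Type*} [NormedAddCommGroup F] {c : ℝ}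
    {K B : Set Plane} (hKB : K ⊆ B) {f g : ℕ → Plane → F}
    (hfg : ∀ᶠ n in atTop, ∀ᵐ X, X ∈ K → f n X = g n X)
    (hK : MeasurableSet K)
    (hi : ∀ n, IntegrableOn (fun X => ‖g n X‖ ^ 2) B)
    (hlim : Tendsto (fun n => ∫ X in B, ‖g n X‖ ^ 2) atTop (𝓝 0)) :
    Tendsto (fun n => ∫⁻ X in K, ENNReal.ofReal c * ‖f n X‖ₑ ^ 2) atTop (𝓝 0) := by
  have h1 : Tendsto (fun n => ENNReal.ofReal c * ENNReal.ofReal (∫ X in B, ‖g n X‖ ^ 2)) atTop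
      (𝓝 0) := by
    have := ENNReal.Tendsto.const_mul (a := ENNReal.ofReal c) (ENNReal.tendsto_ofReal hlim)
      (Or.inr ENNReal.ofReal_ne_top)
    simpa using this
  refine tendsto_of_tendsto_of_tendsto_of_le_of_le' tendsto_const_nhds h1
    (.of_forall fun n => zero_le) ?_
  filter_upwards [hfg] with n hn
  rw [lintegral_const_mul' _ _ ENNReal.ofReal_ne_top]
  gcongr
  rw [ofReal_integral_eq_lintegral_ofReal (hi n) (ae_of_all _ fun X => by positivity)]
  calc ∫⁻ X in K, ‖f n X‖ₑ ^ 2 = ∫⁻ X in K, ENNReal.ofReal (‖g n X‖ ^ 2) := by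
        refine lintegral_congr_ae ?_
        rw [EventuallyEq, ae_restrict_iff' hK]
        filter_upwards [hn] with X hX hXK
        rw [hX hXK, ← ofReal_norm, ENNReal.ofReal_pow (norm_nonneg _)]
    _ ≤ _ := lintegral_mono_set hKB

/-- The functions `g n`, defined on `U n`, agree with the globally Lipschitz functions `v n` on balls
whose radii tend to infinity, together with the weak gradients. -/
def LocallyAgree (U : ℕ → Set Plane) (g v : ℕ → Plane → ℝ) : Prop :=
  ∀ R : ℝ, ∀ᶠ n in atTop, Metric.ball (0 : Plane) R ⊆ U n ∧
    EqOn (g n) (v n) (Metric.ball 0 R) ∧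
    ∀ᵐ X, X ∈ Metric.ball (0 : Plane) R → wgrad (U n) (g n) X = gradient (v n) X

theorem LocallyAgree.comp {U : ℕ → Set Plane} {g v : ℕ → Plane → ℝ} (h : LocallyAgree U g v)
    {k : ℕ → ℕ} (hk : Tendsto k atTop atTop) :
    LocallyAgree (fun n => U (k n)) (fun n => g (k n)) (fun n => v (k n)) :=
  fun R => hk.eventually (h R)

theorem WeakConvLoc.comp {w : Plane → ℝ} {U : ℕ → Set Plane} {g : ℕ → Plane → ℝ} {g₀ : Plane → ℝ}
    (h : WeakConvLoc w U g g₀) {k : ℕ → ℕ} (hk : Tendsto k atTop atTop) :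
    WeakConvLoc w (fun n => U (k n)) (fun n => g (k n)) g₀ := fun K hK =>
  ⟨hk.eventually (h K hK).1, fun f hf => ((h K hK).2.1 f hf).comp hk,
    fun H hH => ((h K hK).2.2 H hH).comp hk⟩

/-- The chosen weak gradient of a function with a Lipschitz representative is the gradient of the
representative. -/
theorem ae_wgrad_eq_gradient {ψ₀ φ : Plane → ℝ} {L : ℝ≥0} (hφ : LipschitzWith L φ)
    (hψ₀ : ∃ G, IsWeakGrad univ ψ₀ G) (heq : ψ₀ =ᵐ[volume] φ) :
    ∀ᵐ X, wgrad univ ψ₀ X = gradient φ X := by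
  obtain ⟨-, h2, h3⟩ := isWeakGrad_wgrad hψ₀
  have h : IsWeakGrad univ φ (wgrad univ ψ₀) := by
    refine ⟨hφ.continuous.locallyIntegrable.locallyIntegrableOn _, h2, fun f hf hc hs i => ?_⟩
    rw [← h3 f hf hc hs i]
    refine integral_congr_ae ?_
    filter_upwards [heq] with X hX
    rw [hX]
  filter_upwards [h.ae_eq_gradient isOpen_univ (by simp) hφ (eqOn_refl _ _)] with X hX
  exact hX (mem_univ X)

theorem memW12Loc_of_lipschitz {φ : Plane → ℝ} {L : ℝ≥0} (hφ : LipschitzWith L φ) (c : ℝ) :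
    MemW12Loc (fun _ => c) univ φ := by
  have hw : ∃ G, IsWeakGrad univ φ G := ⟨_, isWeakGrad_gradient hφ univ⟩
  refine ⟨hw, fun K hK _ => ?_⟩
  have : IsFiniteMeasure (volume.restrict K) :=
    ⟨by rw [Measure.restrict_apply_univ]; exact hK.measure_lt_top⟩
  constructor
  · obtain ⟨M, hM⟩ := hK.exists_bound_of_continuousOn hφ.continuous.continuousOn
    refine memL2_of_memLp (MemLp.of_bound hφ.continuous.aestronglyMeasurable M ?_)
    rw [ae_restrict_iff' hK.measurableSet]
    exact ae_of_all _ hM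
  · refine memL2_of_memLp (MemLp.ae_eq (f := gradient φ) ?_ (MemLp.of_bound
      (measurable_gradient φ).aestronglyMeasurable L (ae_of_all _ (norm_gradient_le hφ))))
    filter_upwards [ae_restrict_of_ae (ae_wgrad_eq_gradient hφ hw ae_eq_rfl)] with X hX
    exact hX.symm

section Convergence

variable {U : ℕ → Set Plane} {g v : ℕ → Plane → ℝ} {φ ψ₀ : Plane → ℝ} {L : ℝ≥0} {c : ℝ}

theorem abs_le_of_lipschitz {w : Plane → ℝ} (hw : LipschitzWith L w) (h0 : w 0 = 0) (X : Plane) :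
    |w X| ≤ L * ‖X‖ := by
  have := hw.dist_le_mul X 0
  rwa [h0, Real.dist_eq, sub_zero, dist_zero_right] at this

/-- Pointwise convergence of uniformly Lipschitz functions implies weak convergence in `W^{1,2}`. -/
theorem weakConvLoc_of_tendsto (hloc : LocallyAgree U g v) (hv : ∀ n, LipschitzWith L (v n))
    (hv0 : ∀ n, v n 0 = 0) (hlim : ∀ X, Tendsto (fun n => v n X) atTop (𝓝 (φ X))) (hc : 0 < c) :
    WeakConvLoc (fun _ => c) U g φ := by
  intro K hK
  have hφ := lipschitzWith_of_tendsto hv hlim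
  have hgφ := ae_wgrad_eq_gradient hφ ⟨_, isWeakGrad_gradient hφ univ⟩ ae_eq_rfl
  obtain ⟨R, hR, hKR⟩ := hK.isBounded.subset_ball_lt 0 0
  have hfin : IsFiniteMeasure (volume.restrict K) :=
    ⟨by rw [Measure.restrict_apply_univ]; exact hK.measure_lt_top⟩
  refine ⟨(hloc R).mono fun n hn => hKR.trans hn.1, fun f hf => ?_, fun H hH => ?_⟩
  · have hfi : IntegrableOn f K := (memLp_of_memL2 hc hf).integrable (by norm_num)
    have h1 : Tendsto (fun n => ∫ X in K, c * (v n X * f X)) atTop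
        (𝓝 (∫ X in K, c * (φ X * f X))) := by
      refine tendsto_integral_of_dominated_convergence (fun X => c * (L * R * |f X|))
        (fun n => ((hv n).continuous.aestronglyMeasurable.mul hf.1).const_mul c)
        ((hfi.abs.const_mul _).const_mul _) (fun n => ?_)
        (ae_of_all _ fun X => ((hlim X).mul_const _).const_mul _)
      rw [ae_restrict_iff' hK.measurableSet]
      refine ae_of_all _ fun X hX => ?_
      rw [norm_mul, norm_mul, Real.norm_of_nonneg hc.le, Real.norm_eq_abs, Real.norm_eq_abs]
      have h2 := abs_le_of_lipschitz (hv n) (hv0 n) X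
      have h3 : ‖X‖ ≤ R := (mem_ball_zero_iff.1 (hKR hX)).le
      gcongr
      exact h2.trans (by gcongr)
    refine h1.congr' ?_
    filter_upwards [hloc R] with n hn
    refine setIntegral_congr_fun hK.measurableSet fun X hX => ?_
    simp only [hn.2.1 (hKR hX)]
  · have hHi : IntegrableOn H K := (memLp_of_memL2 hc hH).integrable (by norm_num)
    have hH1 : Integrable (K.indicator H) := (integrable_indicator_iff hK.measurableSet).2 hHi
    have h1 := tendsto_integral_inner_gradient hv hlim (H := fun _ => K.indicator H)
      (H₀ := K.indicator H) (g := fun X => ‖K.indicator H X‖)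
      (fun _ => hH1.aestronglyMeasurable) hH1.norm (.of_forall fun _ X => le_rfl)
      (fun X => tendsto_const_nhds)
    have hind : ∀ (G G' : Plane → Plane), (∀ᵐ X, X ∈ K → G X = G' X) →
        ∫ X in K, c * inner ℝ (G X) (H X) = c * ∫ X, inner ℝ (G' X) (K.indicator H X) := by
      intro G G' hG
      rw [← integral_const_mul, ← integral_indicator hK.measurableSet]
      refine integral_congr_ae ?_
      filter_upwards [hG] with X hX
      by_cases hXK : X ∈ K
      · rw [indicator_of_mem hXK, indicator_of_mem hXK, hX hXK]
      · rw [indicator_of_notMem hXK, indicator_of_notMem hXK, inner_zero_right, mul_zero]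
    have h2 := h1.const_mul c
    dsimp only
    rw [hind _ (gradient φ) (hgφ.mono fun X hX _ => hX)]
    refine h2.congr' ?_
    filter_upwards [hloc R] with n hn
    exact (hind _ _ (hn.2.2.mono fun X hX hXK => hX (hKR hXK))).symm

/-- A weak limit agrees with any pointwise limit. -/
theorem ae_eq_of_weakConvLoc (hψ₀ : MemW12Loc (fun _ => c) univ ψ₀)
    (hw : WeakConvLoc (fun _ => c) U g ψ₀)
    (hloc : LocallyAgree U g v) (hv : ∀ n, LipschitzWith L (v n))
    (hv0 : ∀ n, v n 0 = 0) (hlim : ∀ X, Tendsto (fun n => v n X) atTop (𝓝 (φ X))) (hc : 0 < c) :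
    ψ₀ =ᵐ[volume] φ := by
  have hφ := lipschitzWith_of_tendsto hv hlim
  have hw' := weakConvLoc_of_tendsto hloc hv hv0 hlim hc
  have hK : ∀ N : ℕ, ∀ᵐ X, X ∈ Metric.closedBall (0 : Plane) N → ψ₀ X = φ X := by
    intro N
    have hKc := isCompact_closedBall (0 : Plane) (N : ℝ)
    set K := Metric.closedBall (0 : Plane) (N : ℝ) with hKdef
    have m1 : MemLp ψ₀ 2 (volume.restrict K) :=
      memLp_of_memL2 hc (hψ₀.2 K hKc (subset_univ _)).1
    have m2 : MemLp φ 2 (volume.restrict K) :=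
      memLp_of_memL2 hc ((memW12Loc_of_lipschitz hφ c).2 K hKc (subset_univ _)).1
    have m3 : MemLp (fun X => ψ₀ X - φ X) 2 (volume.restrict K) := m1.sub m2
    have h := tendsto_nhds_unique ((hw K hKc).2.1 _ (memL2_of_memLp m3))
      ((hw' K hKc).2.1 _ (memL2_of_memLp m3))
    have i1 : IntegrableOn (fun X => ψ₀ X * (ψ₀ X - φ X)) K := m1.integrable_mul m3
    have i2 : IntegrableOn (fun X => φ X * (ψ₀ X - φ X)) K := m2.integrable_mul m3
    rw [integral_const_mul, integral_const_mul] at h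
    have h0 : ∫ X in K, (ψ₀ X - φ X) ^ 2 = 0 := by
      have : ∀ X, (ψ₀ X - φ X) ^ 2 = ψ₀ X * (ψ₀ X - φ X) - φ X * (ψ₀ X - φ X) := fun X => by ring
      simp only [this]
      rw [integral_sub i1 i2, mul_left_cancel₀ hc.ne' h, sub_self]
    rw [integral_eq_zero_iff_of_nonneg (fun X => sq_nonneg _) m3.integrable_sq,
      EventuallyEq, ae_restrict_iff' hKc.measurableSet] at h0
    filter_upwards [h0] with X hX hXK
    have := hX hXK
    simp only [Pi.zero_apply] at this
    exact sub_eq_zero.1 (pow_eq_zero_iff two_ne_zero |>.1 this)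
  filter_upwards [ae_all_iff.2 hK] with X hX
  obtain ⟨N, hN⟩ := exists_nat_ge ‖X‖
  exact hX N (by simpa using hN)

/-- Pointwise convergence of the functions and `L²` convergence of the gradients imply strong
convergence in `W^{1,2}`. -/
theorem strongConvLoc_of_tendsto (hψ₀ : ∃ G, IsWeakGrad univ ψ₀ G) (heq : ψ₀ =ᵐ[volume] φ)
    (hloc : LocallyAgree U g v) (hv : ∀ n, LipschitzWith L (v n))
    (hv0 : ∀ n, v n 0 = 0) (hlim : ∀ X, Tendsto (fun n => v n X) atTop (𝓝 (φ X)))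
    (hgrad : ∀ R, Tendsto (fun n => ∫ X in Metric.ball (0 : Plane) R,
      ‖gradient (v n) X - gradient φ X‖ ^ 2) atTop (𝓝 0)) :
    StrongConvLoc (fun _ => c) U g ψ₀ := by
  intro K hK
  have hφ := lipschitzWith_of_tendsto hv hlim
  have hφ0 : φ 0 = 0 := tendsto_nhds_unique (hlim 0) (by simp only [hv0, tendsto_const_nhds])
  have hgφ := ae_wgrad_eq_gradient hφ hψ₀ heq
  obtain ⟨R, hR, hKR⟩ := hK.isBounded.subset_ball_lt 0 0
  set B := Metric.ball (0 : Plane) R with hB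
  have hfin : IsFiniteMeasure (volume.restrict B) :=
    ⟨by rw [Measure.restrict_apply_univ]; exact measure_ball_lt_top⟩
  refine ⟨(hloc R).mono fun n hn => hKR.trans hn.1, ?_, ?_⟩
  · have hb : ∀ n, ∀ X ∈ B, ‖‖v n X - φ X‖ ^ 2‖ ≤ (2 * (L * R)) ^ 2 := by
      intro n X hX
      have h1 := abs_le_of_lipschitz (hv n) (hv0 n) X
      have h2 := abs_le_of_lipschitz hφ hφ0 X
      have h3 : (L : ℝ) * ‖X‖ ≤ L * R := by
        have : ‖X‖ ≤ R := (mem_ball_zero_iff.1 hX).le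
        gcongr
      rw [Real.norm_of_nonneg (by positivity)]
      refine pow_le_pow_left₀ (norm_nonneg _) ?_ 2
      exact (norm_sub_le _ _).trans (by simp only [Real.norm_eq_abs]; linarith)
    have hb' : ∀ n, ∀ᵐ X ∂(volume.restrict B), ‖‖v n X - φ X‖ ^ 2‖ ≤ (2 * (L * R)) ^ 2 := fun n => by
      rw [ae_restrict_iff' measurableSet_ball]
      exact ae_of_all _ (hb n)
    have hm : ∀ n, AEStronglyMeasurable (fun X => ‖v n X - φ X‖ ^ 2) (volume.restrict B) :=
      fun n => (((hv n).continuous.sub hφ.continuous).norm.pow 2).aestronglyMeasurable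
    refine tendsto_lintegral_of_integral hKR (g := fun n X => v n X - φ X) ?_ hK.measurableSet
      (fun n => (integrable_const _).mono' (hm n) (hb' n)) ?_
    · filter_upwards [hloc R] with n hn
      filter_upwards [heq] with X hX hXK
      rw [hn.2.1 (hKR hXK), hX]
    · have := tendsto_integral_of_dominated_convergence (μ := volume.restrict B)
        (F := fun n X => ‖v n X - φ X‖ ^ 2) (f := fun _ => 0)
        (fun _ => (2 * ((L : ℝ) * R)) ^ 2) hm (integrable_const _) hb'
        (ae_of_all _ fun X => by simpa using (((hlim X).sub_const (φ X)).norm.pow 2))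
      simpa using this
  · refine tendsto_lintegral_of_integral hKR (g := fun n X => gradient (v n) X - gradient φ X)
      ?_ hK.measurableSet (fun n => ?_) (hgrad R)
    · filter_upwards [hloc R] with n hn
      filter_upwards [hgφ, hn.2.2] with X hX hX2 hXK
      rw [hX2 (hKR hXK), hX]
    · refine (integrable_const ((2 * (L : ℝ)) ^ 2)).mono' (((measurable_gradient (v n)).sub
        (measurable_gradient φ)).norm.pow_const 2).aestronglyMeasurable (ae_of_all _ fun X => ?_)
      rw [Real.norm_of_nonneg (by positivity)]
      have h1 := norm_sub_le (gradient (v n) X) (gradient φ X)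
      have h2 := norm_gradient_le (hv n) X
      have h3 := norm_gradient_le hφ X
      gcongr
      linarith

end Convergence

/-- Near a non-degenerate point the rescalings of `ψ` agree with those of its Lipschitz
extension `u`. -/
theorem locallyAgree_rescale {Ω : Set Plane} {ψ u : Plane → ℝ} {X₀ : Plane} {ρ : ℝ} {L : ℝ≥0}
    (hψ : ∃ G, IsWeakGrad Ω ψ G) (hρ : 0 < ρ) (hball : Metric.ball X₀ ρ ⊆ interior Ω)
    (hu : ∀ X ∈ Metric.ball (0 : Plane) ρ, ψ (X₀ + X) = u X) (hL : LipschitzWith L u)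
    {s : ℕ → ℝ} (hs : ∀ n, 0 < s n) (hs0 : Tendsto s atTop (𝓝 0)) :
    LocallyAgree (fun n => rescaledDomain Ω X₀ (s n)) (fun n => rescale ψ X₀ (s n))
      (fun n X => u (s n • X) / s n) := by
  intro R
  have h1 : Tendsto (fun n => s n * R) atTop (𝓝 0) := by simpa using hs0.mul_const R
  filter_upwards [h1.eventually (gt_mem_nhds hρ)] with n hn
  have hmem : ∀ X ∈ Metric.ball (0 : Plane) R, s n • X ∈ Metric.ball (0 : Plane) ρ := by
    intro X hX
    rw [mem_ball_zero_iff] at hX ⊢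
    rw [norm_smul, Real.norm_of_nonneg (hs n).le]
    exact (mul_le_mul_of_nonneg_left hX.le (hs n).le).trans_lt hn
  have hint : ∀ X ∈ Metric.ball (0 : Plane) R, X₀ + s n • X ∈ interior Ω := fun X hX =>
    hball (by simpa using hmem X hX)
  have heq : EqOn (rescale ψ X₀ (s n)) (fun X => u (s n • X) / s n) (Metric.ball 0 R) :=
    fun X hX => by simp only [rescale, hu _ (hmem X hX)]
  refine ⟨fun X hX => (interior_subset (hint X hX) : X₀ + s n • X ∈ Ω), heq, ?_⟩
  obtain ⟨G, hG⟩ := hψ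
  refine (isWeakGrad_wgrad ⟨_, hG.rescale X₀ (hs n)⟩).ae_eq_gradient Metric.isOpen_ball ?_
    (lipschitzWith_dilate hL (hs n)) heq
  rw [interior_rescaledDomain _ _ (hs n).ne']
  exact hint

end AxiFlow

open AxiFlow in
theorem proposition10p1 (C : ℝ) (Ω : Set Plane) (ψ I : Plane → ℝ)
    (hψ : IsVariationalSolution C Ω ψ I) (X₀ : Plane) (hX₀ : X₀ ∈ nonDegeneratePoints Ω ψ) :
    -- blow-up limits exist along a subsequence of every sequence
    (∀ r : ℕ → ℝ, (∀ n, 0 < r n) → Tendsto r atTop (𝓝 0) →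
      ∃ k : ℕ → ℕ, StrictMono k ∧ ∃ ψ₀ : Plane → ℝ, IsBlowUpLimit Ω ψ X₀ (r ∘ k) ψ₀) ∧
    ∀ (r : ℕ → ℝ) (ψ₀ : Plane → ℝ), IsBlowUpLimit Ω ψ X₀ r ψ₀ →
      -- strong convergence
      StrongConvLoc (blowUpWeight X₀) (fun n => rescaledDomain Ω X₀ (r n))
        (fun n => rescale ψ X₀ (r n)) ψ₀ ∧
      -- the limit, as a Sobolev function, has a continuous representative
      ∃ φ : Plane → ℝ, Continuous φ ∧ φ =ᵐ[volume] ψ₀ ∧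
        -- homogeneity of degree one
        (∀ (X : Plane) (s : ℝ), 0 < s → φ (s • X) = s * φ X) ∧
        -- classification of the limits that do not vanish identically
        ((∃ X, φ X ≠ 0) →
          (∃ ν : Plane, ‖ν‖ = 1 ∧ ∀ X, φ X = X₀ 1 * max (inner ℝ X ν) 0) ∨
          (∃ (ν : Plane) (A : ℝ), ‖ν‖ = 1 ∧ 0 < A ∧ ∀ X, φ X = A * |inner ℝ X ν|)) := by
  obtain ⟨L, ρ, u, J, hpair, hball, hu⟩ := hψ.exists_statPair hX₀
  have hc : 0 < 1 / X₀ 1 := one_div_pos.2 hpair.pos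
  have hagree := fun (s : ℕ → ℝ) (hs : ∀ n, 0 < s n) (hs0 : Tendsto s atTop (𝓝 0)) =>
    locallyAgree_rescale hψ.memW12Loc.1 hpair.radius_pos hball hu hpair.lip hs hs0
  have hlip : ∀ {s : ℝ}, 0 < s → LipschitzWith L fun X => u (s • X) / s := fun hs =>
    lipschitzWith_dilate hpair.lip hs
  have hzero : ∀ s : ℝ, u (s • (0 : Plane)) / s = 0 := fun s => by
    rw [smul_zero, hpair.zero, zero_div]
  refine ⟨fun r hr hr0 => ?_, fun r ψ₀ hlim => ?_⟩
  · obtain ⟨k, hk, φ, hφ⟩ := exists_subseq_tendsto_of_lipschitz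
      (u := fun n X => u (r n • X) / r n) (fun n => hlip (hr n)) (fun n => hzero _)
    have hk0 := hr0.comp hk.tendsto_atTop
    refine ⟨k, hk, φ, fun n => hr _, hk0, ?_, ?_⟩
    · exact memW12Loc_of_lipschitz (lipschitzWith_of_tendsto (fun n => hlip (hr (k n))) hφ) _
    · exact weakConvLoc_of_tendsto (hagree _ (fun n => hr (k n)) hk0) (fun n => hlip (hr (k n)))
        (fun n => hzero _) hφ hc
  · obtain ⟨hr, hr0, hW, hweak⟩ := hlim
    have hag := hagree r hr hr0
    -- every subsequence has a further subsequence with a pointwise limit, which represents `ψ₀`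
    have hsub : ∀ ns : ℕ → ℕ, Tendsto ns atTop atTop → ∃ k : ℕ → ℕ, ∃ φ : Plane → ℝ,
        LipschitzWith L φ ∧ ψ₀ =ᵐ[volume] φ ∧
        ∀ X, Tendsto (fun n => u (r (ns (k n)) • X) / r (ns (k n))) atTop (𝓝 (φ X)) := by
      intro ns hns
      obtain ⟨k, hk, φ, hφ⟩ := exists_subseq_tendsto_of_lipschitz
        (u := fun n X => u (r (ns n) • X) / r (ns n)) (fun n => hlip (hr _)) (fun n => hzero _)
      have hnk := hns.comp hk.tendsto_atTop
      exact ⟨k, φ, lipschitzWith_of_tendsto (fun n => hlip (hr (ns (k n)))) hφ,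
        ae_eq_of_weakConvLoc hW (hweak.comp hnk) (hag.comp hnk) (fun n => hlip (hr (ns (k n))))
          (fun n => hzero _) hφ hc, hφ⟩
    obtain ⟨-, φ, hφL, hφψ, -⟩ := hsub id tendsto_id
    have hptw : ∀ X, Tendsto (fun n => u (r n • X) / r n) atTop (𝓝 (φ X)) := by
      intro X
      refine tendsto_of_subseq_tendsto fun ns hns => ?_
      obtain ⟨k, φ', hφ'L, hφ'ψ, hk⟩ := hsub ns hns
      have : φ' = φ :=
        (Continuous.ae_eq_iff_eq volume hφ'L.continuous hφL.continuous).1 (hφ'ψ.symm.trans hφψ)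
      exact ⟨k, this ▸ hk X⟩
    have h := BlowUpSeq.of_dilate hpair hr hr0 hptw
    have hdef := h.homDefect_eq_zero
    refine ⟨strongConvLoc_of_tendsto hW.1 hφψ hag (fun n => hlip (hr n)) (fun n => hzero _) hptw
      h.tendsto_gradient, φ, hφL.continuous, hφψ.symm,
      fun X s hs => homogeneous_of_homDefect_eq_zero hφL hdef X hs, fun hne => ?_⟩
    obtain ⟨ν, A, B, hν, hA, hB, hform⟩ := exists_two_plane hφL.continuous h.nonneg
      (fun X hX => exists_linear_near hφL h.zero hdef (fun g hg hs => h.weak hg hs) hX) hne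
    rcases hB.eq_or_lt with rfl | hB
    · left
      have hform' : ∀ X, φ X = A * max (inner ℝ X ν) 0 := fun X => by
        rw [hform, zero_mul, add_zero]
      obtain rfl := h.slope_eq_of_one_phase hν hA hform'
      exact ⟨ν, hν, hform'⟩
    · right
      obtain rfl := h.slopes_eq hν hA hB hform
      refine ⟨ν, A, hν, hA, fun X => ?_⟩
      rw [hform, ← mul_add]
      rcases le_total 0 (inner ℝ X ν : ℝ) with hX | hX
      · rw [max_eq_left hX, max_eq_right (by linarith), add_zero, abs_of_nonneg hX]
      · rw [max_eq_right hX, max_eq_left (by linarith), zero_add, abs_of_nonpos hX]
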